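/- **Setting.** Let $(\Omega,\mathcal F,\mathbb P)$ be a probability space, $S>0$ a (jointly measurable) price process, $0=\tau_0<\tau_1<\tau_2<\cdots$ random trading dates, $Z_k=(S_{\tau_k}-S_{\tau_{k-1}})/S_{\tau_{k-1}}$ for $k\ge1$, and $Z_0$ a constant. Put $\mathcal G_t=\sigma\{(\tau_k,Z_k):\tau_k\le t\}$. A control policy is a pair $(\alpha,c)$, where $\alpha_{k+1}$ is real-valued and $\mathcal G_{\tau_k}$-measurable for all $k\ge 0$, and $c=(c_t)_{t\ge0}$ is nonnegative and $(\mathcal G_t)$-predictable. Its wealth is $X_k^x=x-\int_0^{\tau_k}c_t\,dt+\sum_{i=1}^k\alpha_iZ_i$, $X^x_0=x$; the policy is admissible, $(\alpha,c)\in\mathcal A(x)$, if for all $k\ge1$ almost surely $\int_0^{\tau_k}c_t\,dt<\infty$ and $X^x_k\ge0$. The value function is $$v(x)=\sup_{(\alpha,c)\in\mathcal A(x)}\mathbb E\int_0^\infty e^{-\rho t}U(c_t)\,dt,\qquad x\ge0 .$$ **Assumptions.** (H) (a) $(\tau_k)_{k\ge1}$ are the jump times of a Poisson process of intensity $\lambda>0$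 relative to the observations: for every $k\ge0$, $\tau_{k+1}-\tau_k$ is exponential with parameter $\lambda$ and independent of $(\tau_i,Z_i)_{i\le k}$. (b) For $k\ge1$, conditionally on $\tau_k-\tau_{k-1}=t$, $Z_k$ is independent of $(\tau_i,Z_i)_{i<k}$ and has law $p(t,dz)$. There are $\underline z\in(0,1]$ and $\bar z\in(0,+\infty]$ such that for every $t\ge0$ the support of $p(t,dz)$ either is an interval with interior $(-\underline z,\bar z)$, or is finite with minimum $-\underline z$ and maximum $\bar z<\infty$. (c) For all $t\ge0$, $p(t,dz)$ has a finite first moment, $\int z\,p(t,dz)\ge0$, and $\int(1+z)\,p(t,dz)\le ke^{bt}$, for constants $k,b\ge0$. (d) $t\mapsto\int w(z)\,p(t,dz)$ is continuous on $[0,\infty)$ for every measurable $w$ of linear growth. (U) $U:[0,\infty)\to\mathbb R$ is strictly increasing and strictly concave, $C^1$ on $(0,\infty)$, $U(0)=0$, $U'(0^+)=+\infty$, $U'(+\infty)=0$, and $U(x)\le K_1x^\gamma$ for some $K_1>0$, $\gamma\in(0,1)$. Moreover $\rho>0$ and $\rho>b\gamma+\lambda\left(k^\gamma/\underline z^\gamma-1\right)$.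 Let $A=\mathbb R$ if $\bar z<\infty$ and $A=[0,\infty)$ if $\bar z=\infty$; let $l(a)=\max(a\underline z,-a\bar z)$, read as $a\underline z$ if $\bar z=\infty$. (SC) For every $a\in A\setminus\{0\}$ and every continuous $w:\mathbb R\to\mathbb R$ of linear growth, $(t,x)\mapsto\lambda\int w(x+az)\,p(t,dz)$ is locally semiconcave on $(0,\infty)\times(l(a),\infty)$, i.e. semiconcave on each compact subset $K$: for some nondecreasing upper semicontinuous $m:[0,\infty)\to[0,\infty)$ with $m(0^+)=0$, the function $u$ satisfies $\eta u(P)+(1-\eta)u(Q)-u(\eta P+(1-\eta)Q)\le\eta(1-\eta)|P-Q|\,m(|P-Q|)$ for all $\eta\in[0,1]$ and all segments $[P,Q]\subset K$. **Auxiliary problem.** For $t\ge0$, $a\in A$, $x\ge l(a)$ let $$\hat v(t,x,a)=\sup_{c}\int_t^\infty e^{-(\rho+\lambda)(s-t)}\Big[U(c_s)+\lambda\int v\big(Y_s+az\big)\,p(s,dz)\Big]ds,\qquad Y_s=x-\int_t^sc_u\,du,$$ the supremum being over deterministic measurable $c\ge0$ on $[t,\infty)$ with $\int_t^sc_u\,du\le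 x-l(a)$ for all $s\ge t$. Set $\hat c(t,x,a)=(U')^{-1}\big(\partial_x\hat v(t,x,a)\big)$ for $x>l(a)$, and $\hat c(t,x,a)=0$ for $x\le l(a)$. **Theorem.** Under (H), (U) and (SC), $v$ and $\hat v$ are finite, $\hat v(t,\cdot,a)$ is differentiable on $(l(a),\infty)$ with $\partial_x\hat v>0$ and $\partial_x\hat v(t,l(a)^+,a)=+\infty$ for all $t\ge0$, $a\in A$ (so that $\hat c$ is well defined), and for every $x\ge0$ there is an optimal policy $(\alpha^*,c^*)\in\mathcal A(x)$, i.e. $\mathbb E\int_0^\infty e^{-\rho t}U(c^*_t)\,dt=v(x)$, such that, with $X^x_k$ its wealth at $\tau_k$, almost surely for all $k\ge0$: 1. $\alpha^*_{k+1}$ belongs to $[-X^x_k/\bar z,\,X^x_k/\underline z]$ (lower bound $0$ if $\bar z=\infty$) and maximises $a\mapsto\hat v(0,X_k^x,a)$ over this interval; 2. the problem $Y'_s=-\hat c(s-\tau_k,Y_s,\alpha^*_{k+1})$ for $\tau_k<s\le\tau_{k+1}$, $Y_{\tau_k}=X^x_k$, has a unique solution $Y^{(k)}$ on $[\tau_k,\tau_{k+1}]$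 (continuous on this interval, the derivative at $\tau_{k+1}$ being the left one); 3. $c^*_t=\hat c\big(t-\tau_k,Y^{(k)}_t,\alpha^*_{k+1}\big)$ for $\tau_k<t\le\tau_{k+1}$. -/

import Mathlib

open MeasureTheory ProbabilityTheory Set Filter Topology
open scoped NNReal ENNReal

namespace IlliquidConsumption

/-- The data of an illiquid market on `Ω` together with an investor: the positive price process `S`,
the trading dates `0 = τ 0 < τ 1 < ⋯`, the intensity `lam`, the laws `p t` of the return given the
waiting time `t ≥ 0`, the bounds `-zlow` and `zbar` (possibly `⊤`) of the returns, the discount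
rate `rho` and the utility function `U` (used on `[0, ∞)`). -/
structure Market (Ω : Type*) [MeasurableSpace Ω] where
  S : ℝ≥0 → Ω → ℝ
  measurable_S : Measurable (Function.uncurry S)
  S_pos : ∀ t ω, 0 < S t ω
  τ : ℕ → Ω → ℝ≥0
  measurable_τ : ∀ k, Measurable (τ k)
  τ_zero : ∀ ω, τ 0 ω = 0
  τ_strictMono : ∀ ω, StrictMono fun k => τ k ω
  lam : ℝ
  rho : ℝ
  p : ℝ → Measure ℝ
  zlow : ℝ
  zbar : EReal
  U : ℝ → ℝ

namespace Market

variable {Ω : Type*} [mΩ : MeasurableSpace Ω] (M : Market Ω)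

/-- The observed returns: `Z (k+1) = (S_{τ (k+1)} - S_{τ k}) / S_{τ k}`; by convention `Z 0 = 0`. -/
noncomputable def Z : ℕ → Ω → ℝ
  | 0, _ => 0
  | k + 1, ω => (M.S (M.τ (k + 1) ω) ω - M.S (M.τ k ω) ω) / M.S (M.τ k ω) ω

theorem measurable_Z (k : ℕ) : Measurable (M.Z k) := by
  have h : ∀ j, Measurable fun ω => M.S (M.τ j ω) ω := fun j =>
    M.measurable_S.comp ((M.measurable_τ j).prodMk measurable_id)
  cases k with
  | zero => exact measurable_const
  | succ k => exact ((h (k + 1)).sub (h k)).div (h k)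

/-- The waiting time `τ (k+1) - τ k`. -/
noncomputable def wait (k : ℕ) (ω : Ω) : ℝ := (M.τ (k + 1) ω : ℝ) - M.τ k ω

/-- The `σ`-algebra generated by `(τ i, Z i)` for `i ≤ k`. -/
@[reducible]
noncomputable def hist (k : ℕ) : MeasurableSpace Ω :=
  ⨆ i : ℕ, ⨆ _ : i ≤ k,
    (MeasurableSpace.comap (M.τ i) inferInstance ⊔ MeasurableSpace.comap (M.Z i) inferInstance)

/-- The continuous observation filtration: `𝒢 t` is generated by the pairs `(τ k, Z k)` with
`τ k ≤ t`, that is, by the events `{τ k ≤ s, Z k ∈ B}` for `s ≤ t` and `B` Borel. -/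
noncomputable def obs : Filtration ℝ≥0 mΩ where
  seq t := MeasurableSpace.generateFrom
    {A | ∃ (k : ℕ) (s : ℝ≥0) (B : Set ℝ), s ≤ t ∧ MeasurableSet B ∧
      A = {ω | M.τ k ω ≤ s ∧ M.Z k ω ∈ B}}
  mono' := by
    intro t t' h
    apply MeasurableSpace.generateFrom_mono
    rintro A ⟨k, s, B, hs, hB, rfl⟩
    exact ⟨k, s, B, hs.trans h, hB, rfl⟩
  le' := by
    intro t
    apply MeasurableSpace.generateFrom_le
    rintro A ⟨k, s, B, -, hB, rfl⟩
    exact (measurableSet_le (M.measurable_τ k) measurable_const).inter (M.measurable_Z k hB)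

theorem isStoppingTime_τ (k : ℕ) :
    IsStoppingTime M.obs fun ω => ((M.τ k ω : ℝ≥0) : WithTop ℝ≥0) := by
  intro t
  apply MeasurableSpace.measurableSet_generateFrom
  exact ⟨k, t, univ, le_rfl, MeasurableSet.univ, by
    ext ω
    exact ⟨fun h => ⟨WithTop.coe_le_coe.1 h, trivial⟩, fun h => WithTop.coe_le_coe.2 h.1⟩⟩

/-- `(α, c)` is a control policy: `α (k+1)` is `𝒢_{τ k}`-measurable, and `c` is nonnegative and
predictable with respect to `(𝒢 t)`. (The value `α 0` plays no role.) -/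
structure IsPolicy (α : ℕ → Ω → ℝ) (c : ℝ≥0 → Ω → ℝ) : Prop where
  measurable_α : ∀ k, Measurable[(M.isStoppingTime_τ k).measurableSpace] (α (k + 1))
  predictable_c : IsStronglyPredictable M.obs c
  nonneg_c : ∀ t ω, 0 ≤ c t ω

/-- The wealth at the trading date `τ k`. -/
noncomputable def wealth (x : ℝ) (α : ℕ → Ω → ℝ) (c : ℝ≥0 → Ω → ℝ) (k : ℕ) (ω : Ω) : ℝ :=
  x - (∫ t in (0 : ℝ)..(M.τ k ω), c t.toNNReal ω) + ∑ i ∈ Finset.Icc 1 k, α i ω * M.Z i ω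

/-- Admissible policies: consumption up to each trading date is finite and the wealth at each
trading date is nonnegative, almost surely. -/
structure Admissible (μ : Measure Ω) (x : ℝ) (α : ℕ → Ω → ℝ) (c : ℝ≥0 → Ω → ℝ) : Prop where
  isPolicy : M.IsPolicy α c
  nonneg_wealth : ∀ k, 1 ≤ k → ∀ᵐ ω ∂μ,
    IntervalIntegrable (fun t : ℝ => c t.toNNReal ω) volume 0 (M.τ k ω) ∧
      0 ≤ M.wealth x α c k ω

/-- The expected discounted utility `E ∫₀^∞ e^{-ρt} U(c_t) dt` of a consumption process (the
integrand is nonnegative under the assumptions on `U`). -/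
noncomputable def gain (μ : Measure Ω) (c : ℝ≥0 → Ω → ℝ) : ℝ≥0∞ :=
  ∫⁻ ω, (∫⁻ t in Ioi (0 : ℝ),
    ENNReal.ofReal (Real.exp (-M.rho * t) * M.U (c t.toNNReal ω))) ∂μ

/-- The value function `v`. -/
noncomputable def value (μ : Measure Ω) (x : ℝ) : ℝ≥0∞ :=
  ⨆ (α : ℕ → Ω → ℝ) (c : ℝ≥0 → Ω → ℝ) (_ : M.Admissible μ x α c), M.gain μ c

/-- The set `A` of investments: `ℝ` if `zbar < ∞`, and `[0, ∞)` if `zbar = ∞`. -/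
def investSet : Set ℝ := {a | M.zbar = ⊤ → 0 ≤ a}

/-- `l(a) = max (a zlow, -a zbar)`, which is `a zlow` by convention if `zbar = ∞`. -/
noncomputable def l (a : ℝ) : ℝ :=
  open Classical in
  if M.zbar = ⊤ then a * M.zlow else max (a * M.zlow) (-a * M.zbar.toReal)

/-- The interval `[-x / zbar, x / zlow]`, where `x / ∞ = 0`. -/
noncomputable def investInterval (x : ℝ) : Set ℝ :=
  open Classical in
  Icc (if M.zbar = ⊤ then 0 else -x / M.zbar.toReal) (x / M.zlow)

/-- `g(t, x, a) = λ ∫ v(x + a z) p(t, dz)`. -/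
noncomputable def g (μ : Measure Ω) (t x a : ℝ) : ℝ≥0∞ :=
  ENNReal.ofReal M.lam * ∫⁻ z, M.value μ (x + a * z) ∂(M.p t)

/-- The deterministic consumption rates `(c_s)_{s ≥ t}` that are admissible at `(t, x)`
for the investment `a`. -/
def detControls (t x a : ℝ) : Set (ℝ → ℝ) :=
  {c | Measurable c ∧ (∀ s, t ≤ s → 0 ≤ c s) ∧
    ∀ s, t ≤ s → IntervalIntegrable c volume t s ∧ ∫ u in t..s, c u ≤ x - M.l a}

/-- The auxiliary value function, with values in `[0, ∞]`. -/
noncomputable def vHatENN (μ : Measure Ω) (t x a : ℝ) : ℝ≥0∞ :=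
  ⨆ c ∈ M.detControls t x a, ∫⁻ s in Ioi t,
    ENNReal.ofReal (Real.exp (-(M.rho + M.lam) * (s - t))) *
      (ENNReal.ofReal (M.U (c s)) + M.g μ s (x - ∫ u in t..s, c u) a)

/-- The auxiliary value function `v̂` as a real function. -/
noncomputable def vHat (μ : Measure Ω) (t x a : ℝ) : ℝ := (M.vHatENN μ t x a).toReal

/-- The inverse `I = (U')⁻¹ : (0, ∞) → (0, ∞)` of the marginal utility. -/
noncomputable def invMarginal (y : ℝ) : ℝ := Function.invFunOn (deriv M.U) (Ioi 0) y

/-- The feedback map `ĉ(t, x, a) = (U')⁻¹ (∂ₓ v̂(t, x, a))` for `x > l(a)`. On the boundary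
`x = l(a)`, where `∂ₓ v̂ = +∞`, it is `0`, and it is extended by `0` to `x < l(a)`. -/
noncomputable def cHat (μ : Measure Ω) (t x a : ℝ) : ℝ :=
  open Classical in
  if M.l a < x then M.invMarginal (deriv (fun y => M.vHat μ t y a) x) else 0

/-- `Y` is a solution on `[t₀, t₁]` of `Y' s = -ĉ(s - t₀, Y s, a)`, `t₀ < s ≤ t₁`, `Y t₀ = x`. -/
structure SolvesFeedback (μ : Measure Ω) (t₀ t₁ x a : ℝ) (Y : ℝ → ℝ) : Prop where
  initial : Y t₀ = x
  continuousOn : ContinuousOn Y (Icc t₀ t₁)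
  hasDeriv : ∀ s ∈ Ioc t₀ t₁,
    HasDerivWithinAt Y (-M.cHat μ (s - t₀) (Y s) a) (Icc t₀ t₁) s

/-- The standing assumptions on the trading dates and the returns, with constants `k` and `b`. -/
structure ReturnAssumption (μ : Measure Ω) (k b : ℝ) : Prop where
  lam_pos : 0 < M.lam
  /-- the dates are the jumps of a Poisson process of intensity `lam`, with respect to the
  information generated by the trading dates and the returns -/
  wait_law : ∀ n, μ.map (M.wait n) = expMeasure M.lam
  wait_indep : ∀ n, Indep (M.hist n) (MeasurableSpace.comap (M.wait n) inferInstance) μ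
  /-- given the waiting time `t` before it, the return is independent of the past, with law `p t` -/
  return_law : ∀ n, ∀ B : Set ℝ, MeasurableSet B →
    μ[(M.Z (n + 1) ⁻¹' B).indicator (fun _ => (1 : ℝ)) |
        M.hist n ⊔ MeasurableSpace.comap (M.wait n) inferInstance]
      =ᵐ[μ] fun ω => (M.p (M.wait n ω)).real B
  isProb : ∀ t, 0 ≤ t → IsProbabilityMeasure (M.p t)
  zlow_mem : M.zlow ∈ Ioc (0 : ℝ) 1
  zbar_pos : 0 < M.zbar
  support : ∀ t, 0 ≤ t →
    ((M.p t).support.OrdConnected ∧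
      interior (M.p t).support = {z : ℝ | -M.zlow < z ∧ (z : EReal) < M.zbar}) ∨
    (M.zbar ≠ ⊤ ∧ (M.p t).support.Finite ∧ IsLeast (M.p t).support (-M.zlow) ∧
      IsGreatest (M.p t).support M.zbar.toReal)
  k_nonneg : 0 ≤ k
  b_nonneg : 0 ≤ b
  integrable : ∀ t, 0 ≤ t → Integrable (fun z : ℝ => z) (M.p t)
  mean_nonneg : ∀ t, 0 ≤ t → 0 ≤ ∫ z, z ∂(M.p t)
  mean_le : ∀ t, 0 ≤ t → ∫ z, (1 + z) ∂(M.p t) ≤ k * Real.exp (b * t)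
  continuity : ∀ w : ℝ → ℝ, Measurable w → (∃ C, ∀ z, |w z| ≤ C * (1 + |z|)) →
    ∀ t₀, 0 ≤ t₀ →
      Tendsto (fun t => ∫ z, w z ∂(M.p t)) (𝓝[Ici 0] t₀) (𝓝 (∫ z, w z ∂(M.p t₀)))

/-- The standing assumptions on the utility function and the discount rate. -/
structure UtilityAssumption (k b γ K₁ : ℝ) : Prop where
  strictMono : StrictMonoOn M.U (Ici 0)
  strictConcave : StrictConcaveOn ℝ (Ici 0) M.U
  contDiff : ContDiffOn ℝ 1 M.U (Ioi 0)
  zero : M.U 0 = 0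
  inada_zero : Tendsto (deriv M.U) (𝓝[>] 0) atTop
  inada_top : Tendsto (deriv M.U) atTop (𝓝 0)
  γ_mem : γ ∈ Ioo (0 : ℝ) 1
  K₁_pos : 0 < K₁
  growth : ∀ x, 0 ≤ x → M.U x ≤ K₁ * x ^ γ
  rho_pos : 0 < M.rho
  rho_gt : b * γ + M.lam * (k ^ γ / M.zlow ^ γ - 1) < M.rho

end Market

/-- Semiconcavity on a subset of the Euclidean plane. -/
def IsSemiconcaveOn (D : Set (ℝ × ℝ)) (u : ℝ × ℝ → ℝ) : Prop :=
  ∃ m : ℝ → ℝ, MonotoneOn m (Ici 0) ∧ UpperSemicontinuousOn m (Ici 0) ∧ (∀ r, 0 ≤ r → 0 ≤ m r) ∧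
    Tendsto m (𝓝[>] 0) (𝓝 0) ∧
    ∀ P Q : ℝ × ℝ, segment ℝ P Q ⊆ D → ∀ η ∈ Icc (0 : ℝ) 1,
      η * u P + (1 - η) * u Q - u (η • P + (1 - η) • Q) ≤
        η * (1 - η) * ‖WithLp.toLp 2 (P - Q)‖ * m ‖WithLp.toLp 2 (P - Q)‖

/-- Local semiconcavity: semiconcavity on every compact subset. -/
def IsLocallySemiconcaveOn (D : Set (ℝ × ℝ)) (u : ℝ × ℝ → ℝ) : Prop :=
  ∀ K ⊆ D, IsCompact K → IsSemiconcaveOn K u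

namespace Market

variable {Ω : Type*} [mΩ : MeasurableSpace Ω] (M : Market Ω)

/-- For `a ≠ 0` and `w` continuous of linear growth, `(t, x) ↦ λ ∫ w(x + a z) p(t, dz)` is locally
semiconcave on `(0, ∞) × (l(a), ∞)`. -/
def SemiconcavityAssumption : Prop :=
  ∀ a ∈ M.investSet, a ≠ 0 → ∀ w : ℝ → ℝ, Continuous w →
    (∃ C, ∀ y, |w y| ≤ C * (1 + |y|)) →
    IsLocallySemiconcaveOn (Ioi 0 ×ˢ Ioi (M.l a))
      fun q => M.lam * ∫ z, w (q.2 + a * z) ∂(M.p q.1)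

end Market

end IlliquidConsumption

/-! Dynamic programming over one trading period reduces the problem to a deterministic consumption
problem and a fixed point equation.

Reduction. Between two dates a predictable rate depends only on time and on the past
(`exists_past_of_predictable`), and the waiting time is an exponential clock independent of the
past. Hence the expected utility of a period plus the discounted value w of the wealth at its end is
the payoff of a deterministic rate with discount β = ρ + λ, budget x - l(a) and running reward λ ∫
w(l(a) + y + a z) p(s, dz) at residual budget y (`oneStep_eq`). The exponential density is positive
and the support of the return reaches both of its bounds, so nonnegative wealth at the next date
forces a to be allowed and the rate to have total mass at most x - l(a) (`ae_isCtrl`).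

Fixed point. The operator `step` sends w to the maximum over a of the deterministic value. It
preserves concavity and a bound w(y) ≤ K y^γ: Jensen's inequality gives the factor λ (k/z)^γ / (ρ +
λ - bγ), with z the lower return bound, and the condition on ρ says that this factor is below 1. The
iterates from 0 increase to a fixed point V (`step_fixedPt`).

Deterministic problem. It is concave, and an optimal rate exists (`exists_optimal`). Spending a
little more where the optimal rate c is low, or a little less where it is high, shows that every
supergradient q of the value at b satisfies e^{-βε} U'(c_s) ≤ q ≤ U'(c_s) + O(ε) for almost every s
≤ ε (`ae_supergradient_bounds`). So the supergradient is unique and the value is differentiable.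
Tails of optimal rates are optimal, so the same squeeze at every later time identifies c_s with
(U')⁻¹ of the marginal value at the residual budget (`ae_eq_fbRate`). This feedback is jointly
continuous, so the optimal path is a classical solution of the feedback equation; it is
nondecreasing in the budget, so the solution is unique and depends continuously on the data, hence
measurably.

Verification. For every admissible policy, the expected gain up to τ_n plus E e^{-ρτ_n} V(X_n) is at
most V(x) (`gain_le`). A measurable maximising investment with feedback consumption gives equality,
and then the remainder is at most a constant times q^n x^γ with q < 1 the factor above
(`gain_optPast`). Therefore v = V on [0, ∞), and v̂ is the deterministic value with running reward
built from V. -/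

namespace IlliquidConsumption

/-! ### Utility functions. -/

/-- The standing assumptions on a utility function. -/
structure IsUtility (U : ℝ → ℝ) (K γ : ℝ) : Prop where
  strictMono : StrictMonoOn U (Ici 0)
  strictConcave : StrictConcaveOn ℝ (Ici 0) U
  contDiff : ContDiffOn ℝ 1 U (Ioi 0)
  zero : U 0 = 0
  inada_zero : Tendsto (deriv U) (𝓝[>] 0) atTop
  inada_top : Tendsto (deriv U) atTop (𝓝 0)
  γ_mem : γ ∈ Ioo (0 : ℝ) 1
  K_pos : 0 < K
  growth : ∀ x, 0 ≤ x → U x ≤ K * x ^ γ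

/-- The scale `m` is free: after integration one takes `m` of the order of the mean of `x`, and the
bound becomes a multiple of `m ^ γ`. This keeps the growth exponent γ through integrals. -/
theorem rpow_le_mul_one_add_div {x m γ : ℝ} (hx : 0 ≤ x) (hm : 0 < m) (h0 : 0 ≤ γ) (h1 : γ ≤ 1) :
    x ^ γ ≤ m ^ γ * (1 + x / m) := by
  have hxm : 0 ≤ x / m := div_nonneg hx hm.le
  have h : x ^ γ = m ^ γ * (x / m) ^ γ := by
    rw [← Real.mul_rpow hm.le hxm, mul_div_cancel₀ _ hm.ne']
  rw [h]
  refine mul_le_mul_of_nonneg_left ?_ (Real.rpow_nonneg hm.le _)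
  rcases le_total (x / m) 1 with h2 | h2
  · exact (Real.rpow_le_one hxm h2 h0).trans (by linarith)
  · calc (x / m) ^ γ ≤ (x / m) ^ (1 : ℝ) := Real.rpow_le_rpow_of_exponent_le h2 h1
      _ ≤ 1 + x / m := by rw [Real.rpow_one]; linarith

namespace IsUtility

variable {U : ℝ → ℝ} {K γ : ℝ} (hU : IsUtility U K γ)
include hU

theorem mono : MonotoneOn U (Ici 0) := hU.strictMono.monotoneOn

theorem concave : ConcaveOn ℝ (Ici 0) U := hU.strictConcave.concaveOn

theorem nonneg {x : ℝ} (hx : 0 ≤ x) : 0 ≤ U x := by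
  rw [← hU.zero]; exact hU.mono self_mem_Ici hx hx

theorem differentiableAt {x : ℝ} (hx : 0 < x) : DifferentiableAt ℝ U x :=
  (hU.contDiff.differentiableOn (by norm_num)).differentiableAt (Ioi_mem_nhds hx)

theorem continuousOn_deriv : ContinuousOn (deriv U) (Ioi 0) :=
  hU.contDiff.continuousOn_deriv_of_isOpen isOpen_Ioi le_rfl

theorem tendsto_zero : Tendsto U (𝓝[≥] 0) (𝓝 0) := by
  have h : Tendsto (fun x : ℝ => K * x ^ γ) (𝓝[≥] 0) (𝓝 0) := by
    have := ((Real.continuous_rpow_const hU.γ_mem.1.le).const_mul K).tendsto 0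
    rw [Real.zero_rpow hU.γ_mem.1.ne', mul_zero] at this
    exact this.mono_left nhdsWithin_le_nhds
  refine tendsto_of_tendsto_of_tendsto_of_le_of_le' tendsto_const_nhds h ?_ ?_
  · filter_upwards [self_mem_nhdsWithin] with x hx using hU.nonneg hx
  · filter_upwards [self_mem_nhdsWithin] with x hx using hU.growth x hx

theorem continuousOn : ContinuousOn U (Ici 0) := by
  intro x hx
  rcases eq_or_lt_of_le (show (0 : ℝ) ≤ x from hx) with rfl | h
  · rw [ContinuousWithinAt, hU.zero]; exact hU.tendsto_zero
  · exact (hU.differentiableAt h).continuousAt.continuousWithinAt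

/-- Nothing is known of `U` on the negative axis, so measurability and limits pass through the
truncation at 0. -/
theorem continuous_comp_max : Continuous fun x => U (max x 0) :=
  hU.continuousOn.comp_continuous (continuous_id.max continuous_const) fun _ => mem_Ici.2 (le_max_right _ _)

theorem measurable_comp {α : Type*} [MeasurableSpace α] {c : α → ℝ} (hc : Measurable c)
    (h0 : ∀ s, 0 ≤ c s) : Measurable fun s => U (c s) := by
  have := hU.continuous_comp_max.measurable.comp hc
  simpa [Function.comp_def, max_eq_left, h0] using this

theorem deriv_le_slope {x y : ℝ} (hx : 0 ≤ x) (hxy : x < y) :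
    deriv U y * (y - x) ≤ U y - U x := by
  have h := hU.concave.le_slope_of_hasDerivAt (x := x) (y := y) hx (hx.trans hxy.le) hxy
    (hU.differentiableAt (hx.trans_lt hxy)).hasDerivAt
  rw [slope_def_field, le_div_iff₀ (by linarith)] at h
  exact h

theorem slope_le_deriv {x y : ℝ} (hx : 0 < x) (hxy : x < y) :
    U y - U x ≤ deriv U x * (y - x) := by
  have h := hU.concave.slope_le_of_hasDerivAt (x := x) (y := y) hx.le (hx.le.trans hxy.le) hxy
    (hU.differentiableAt hx).hasDerivAt
  rw [slope_def_field, div_le_iff₀ (by linarith)] at h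
  exact h

theorem strictAntiOn_deriv : StrictAntiOn (deriv U) (Ioi 0) := by
  intro x hx y hy hxy
  have hc := hU.strictConcave
  have h1 := hc.slope_lt_of_hasDerivAt (x := x) (y := y) (mem_Ici.2 (le_of_lt hx))
    (mem_Ici.2 (le_of_lt hy)) hxy
    (hU.differentiableAt hx).hasDerivAt
  have h2 := hc.lt_slope_of_hasDerivAt (x := x) (y := y) (mem_Ici.2 (le_of_lt hx))
    (mem_Ici.2 (le_of_lt hy)) hxy
    (hU.differentiableAt hy).hasDerivAt
  exact h2.trans h1

theorem deriv_pos {x : ℝ} (hx : 0 < x) : 0 < deriv U x := by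
  have h := hU.slope_le_deriv hx (lt_add_one x)
  have h' := hU.strictMono (mem_Ici.2 hx.le) (mem_Ici.2 (by linarith : (0:ℝ) ≤ x + 1)) (lt_add_one x)
  have e : x + 1 - x = 1 := by ring
  rw [e, mul_one] at h
  linarith

/-- Both `y` and `x + d` are convex combinations of `x` and `y + d`, with exchanged weights; the two
concavity inequalities add up to the claim. -/
theorem increment_anti {x y d : ℝ} (hx : 0 ≤ x) (hxy : x ≤ y) (hd : 0 ≤ d) :
    U (y + d) - U y ≤ U (x + d) - U x := by
  rcases eq_or_lt_of_le hd with rfl | hd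
  · simp
  rcases eq_or_lt_of_le hxy with rfl | hxy
  · simp
  have hL : 0 < y + d - x := by linarith
  have ha : 0 ≤ d / (y + d - x) := by positivity
  have hb : 0 ≤ (y - x) / (y + d - x) := div_nonneg (by linarith) hL.le
  have hx' : x ∈ Ici (0 : ℝ) := hx
  have hy' : y + d ∈ Ici (0 : ℝ) := mem_Ici.2 (by linarith)
  have h1 := hU.concave.2 hx' hy' ha hb (by field_simp; ring)
  have h2 := hU.concave.2 hx' hy' hb ha (by field_simp; ring)
  simp only [smul_eq_mul] at h1 h2
  have e1 : d / (y + d - x) * x + (y - x) / (y + d - x) * (y + d) = y := by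
    field_simp; ring
  have e2 : (y - x) / (y + d - x) * x + d / (y + d - x) * (y + d) = x + d := by
    field_simp; ring
  rw [e1] at h1
  rw [e2] at h2
  have e3 : d / (y + d - x) + (y - x) / (y + d - x) = 1 := by field_simp; ring
  rw [eq_sub_of_add_eq' e3] at h1 h2
  linarith

theorem add_le {x y : ℝ} (hx : 0 ≤ x) (hy : 0 ≤ y) : U (x + y) ≤ U x + U y := by
  have := hU.increment_anti le_rfl hx hy
  rw [zero_add, hU.zero] at this
  linarith

theorem mul_le {x η : ℝ} (hx : 0 ≤ x) (h0 : 0 ≤ η) (h1 : η ≤ 1) : U x ≤ U (η * x) + U ((1 - η) * x) := by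
  have := hU.add_le (mul_nonneg h0 hx) (mul_nonneg (sub_nonneg.2 h1) hx)
  rwa [← add_mul, add_sub_cancel, one_mul] at this

theorem le_linear {x m : ℝ} (hx : 0 ≤ x) (hm : 0 < m) : U x ≤ K * m ^ γ * (1 + x / m) := by
  rw [mul_assoc]
  exact (hU.growth x hx).trans (mul_le_mul_of_nonneg_left
    (rpow_le_mul_one_add_div hx hm hU.γ_mem.1.le hU.γ_mem.2.le) hU.K_pos.le)

/-- Above the level `R` each unit consumed yields at most `K * R ^ (γ - 1)`. Since the total
consumed is bounded by the budget, truncating utility at `R` costs little, uniformly over all rates;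
this stands in for uniform integrability. -/
theorem le_min_add {x R : ℝ} (hx : 0 ≤ x) (hR : 0 < R) :
    U x ≤ U (min x R) + K * R ^ (γ - 1) * x := by
  have hK := hU.K_pos
  rcases le_total x R with h | h
  · rw [min_eq_left h]
    have : 0 ≤ K * R ^ (γ - 1) * x := by positivity
    linarith
  · rw [min_eq_right h]
    have hx' : 0 < x := hR.trans_le h
    have h1 : U x ≤ K * (x ^ (γ - 1) * x) := by
      rw [← Real.rpow_add_one hx'.ne', sub_add_cancel]; exact hU.growth x hx
    have h2 : x ^ (γ - 1) ≤ R ^ (γ - 1) :=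
      Real.rpow_le_rpow_of_nonpos hR h (by linarith [hU.γ_mem.2])
    have h3 : K * (x ^ (γ - 1) * x) ≤ K * R ^ (γ - 1) * x := by
      rw [← mul_assoc]; gcongr
    linarith [hU.nonneg hR.le]

theorem exists_deriv_eq {q : ℝ} (hq : 0 < q) : ∃ x, 0 < x ∧ deriv U x = q := by
  obtain ⟨a, ha, ha0⟩ := ((hU.inada_zero.eventually (eventually_gt_atTop q)).and
    self_mem_nhdsWithin).exists
  obtain ⟨b, hb, hb0⟩ := ((hU.inada_top.eventually (gt_mem_nhds hq)).and
    (eventually_gt_atTop a)).exists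
  have ha0' : (0 : ℝ) < a := ha0
  have hsub : Icc a b ⊆ Ioi 0 := fun x hx => ha0'.trans_le hx.1
  obtain ⟨x, hx, hxq⟩ := intermediate_value_Icc' hb0.le (hU.continuousOn_deriv.mono hsub)
    ⟨hb.le, ha.le⟩
  exact ⟨x, hsub hx, hxq⟩

theorem inv_pos {q : ℝ} (hq : 0 < q) : 0 < Function.invFunOn (deriv U) (Ioi 0) q :=
  Function.invFunOn_mem (hU.exists_deriv_eq hq)

theorem deriv_inv {q : ℝ} (hq : 0 < q) : deriv U (Function.invFunOn (deriv U) (Ioi 0) q) = q :=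
  Function.invFunOn_eq (hU.exists_deriv_eq hq)

theorem inv_deriv {x : ℝ} (hx : 0 < x) : Function.invFunOn (deriv U) (Ioi 0) (deriv U x) = x :=
  hU.strictAntiOn_deriv.injOn (hU.inv_pos (hU.deriv_pos hx)) hx (hU.deriv_inv (hU.deriv_pos hx))

theorem inv_le_of_deriv_le {q x : ℝ} (hx : 0 < x) (h : deriv U x ≤ q) :
    Function.invFunOn (deriv U) (Ioi 0) q ≤ x := by
  have hq := (hU.deriv_pos hx).trans_le h
  rw [← hU.deriv_inv hq] at h
  exact (hU.strictAntiOn_deriv.le_iff_ge hx (hU.inv_pos hq)).1 h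

theorem le_inv_of_le_deriv {q x : ℝ} (hx : 0 < x) (hq : 0 < q) (h : q ≤ deriv U x) :
    x ≤ Function.invFunOn (deriv U) (Ioi 0) q := by
  rw [← hU.deriv_inv hq] at h
  exact (hU.strictAntiOn_deriv.le_iff_ge (hU.inv_pos hq) hx).1 h

theorem inv_anti {p q : ℝ} (hp : 0 < p) (h : p ≤ q) : Function.invFunOn (deriv U) (Ioi 0) q ≤
    Function.invFunOn (deriv U) (Ioi 0) p :=
  hU.inv_le_of_deriv_le (hU.inv_pos hp) (by rwa [hU.deriv_inv hp])

theorem continuousAt_inv {q : ℝ} (hq : 0 < q) :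
    ContinuousAt (Function.invFunOn (deriv U) (Ioi 0)) q := by
  set I := Function.invFunOn (deriv U) (Ioi 0)
  have h0 : 0 < I q := hU.inv_pos hq
  rw [ContinuousAt, tendsto_order]
  constructor
  · intro a ha
    obtain ⟨x, hx1, hx2⟩ := exists_between (max_lt ha h0)
    have hx0 : 0 < x := (le_max_right _ _).trans_lt hx1
    have : q < deriv U x := by
      have := hU.strictAntiOn_deriv hx0 h0 hx2
      rwa [hU.deriv_inv hq] at this
    filter_upwards [lt_mem_nhds hq, gt_mem_nhds this] with p hp hp'
    exact ((le_max_left _ _).trans_lt hx1).trans_le (hU.le_inv_of_le_deriv hx0 hp hp'.le)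
  · intro a ha
    obtain ⟨x, hx1, hx2⟩ := exists_between ha
    have hx0 : 0 < x := h0.trans hx1
    have : deriv U x < q := by
      have := hU.strictAntiOn_deriv h0 hx0 hx1
      rwa [hU.deriv_inv hq] at this
    filter_upwards [lt_mem_nhds this] with p hp
    exact (hU.inv_le_of_deriv_le hx0 hp.le).trans_lt hx2

end IsUtility

end IlliquidConsumption


/-! ### The deterministic consumption problem: rates, payoff, integrability, concavity. -/

namespace IlliquidConsumption

/-- Consumption rates on `(0, ∞)` with total consumption at most `b`. -/
structure IsCtrl (b : ℝ) (c : ℝ → ℝ) : Prop where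
  measurable : Measurable c
  nonneg : ∀ s, 0 ≤ c s
  integrable : IntegrableOn c (Ioi 0)
  total_le : ∫ s in Ioi 0, c s ≤ b

/-- Running rewards `g s y` at time `s` and residual budget `y`. -/
structure IsRunning (β : ℝ) (g : ℝ → ℝ → ℝ) : Prop where
  cont : Continuous fun q : ℝ × ℝ => g q.1 q.2
  nonneg : ∀ s y, 0 ≤ g s y
  mono : ∀ s, Monotone (g s)
  concave : ∀ s, ConcaveOn ℝ (Ici 0) (g s)
  bound : ∃ r, 0 ≤ r ∧ r < β ∧ ∀ R, ∃ B, 0 ≤ B ∧ ∀ s y, 0 ≤ s → y ≤ R → g s y ≤ B * Real.exp (r * s)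

/-- The payoff of a consumption rate. -/
noncomputable def payoff (U : ℝ → ℝ) (β : ℝ) (g : ℝ → ℝ → ℝ) (b : ℝ) (c : ℝ → ℝ) : ℝ :=
  ∫ s in Ioi (0 : ℝ), Real.exp (-β * s) * (U (c s) + g s (b - ∫ u in (0 : ℝ)..s, c u))

/-- The value of the deterministic consumption problem. -/
noncomputable def val (U : ℝ → ℝ) (β : ℝ) (g : ℝ → ℝ → ℝ) (b : ℝ) : ℝ :=
  sSup (payoff U β g b '' {c | IsCtrl b c})

theorem integrableOn_exp_neg_mul {β : ℝ} (hβ : 0 < β) :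
    IntegrableOn (fun s => Real.exp (-β * s)) (Ioi 0) :=
  exp_neg_integrableOn_Ioi 0 hβ

theorem integral_exp_neg_mul {β : ℝ} (hβ : 0 < β) :
    ∫ s in Ioi (0 : ℝ), Real.exp (-β * s) = 1 / β := by
  rw [integral_exp_mul_Ioi (by linarith) 0]
  simp

namespace IsCtrl

variable {b : ℝ} {c : ℝ → ℝ}

theorem intervalIntegrable (hc : IsCtrl b c) {s t : ℝ} (hs : 0 ≤ s) (ht : 0 ≤ t) :
    IntervalIntegrable c volume s t := by
  rw [intervalIntegrable_iff]
  refine hc.integrable.mono_set fun x hx => ?_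
  exact (le_min hs ht).trans_lt hx.1

theorem integral_nonneg (hc : IsCtrl b c) {s t : ℝ} (hst : s ≤ t) : 0 ≤ ∫ u in s..t, c u :=
  intervalIntegral.integral_nonneg hst fun u _ => hc.nonneg u

theorem integral_le (hc : IsCtrl b c) {s : ℝ} (hs : 0 ≤ s) : ∫ u in (0 : ℝ)..s, c u ≤ b := by
  rw [intervalIntegral.integral_of_le hs]
  exact (setIntegral_mono_set hc.integrable (Eventually.of_forall hc.nonneg)
    (Eventually.of_forall Ioc_subset_Ioi_self)).trans hc.total_le

theorem nonneg_budget (hc : IsCtrl b c) : 0 ≤ b := by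
  simpa using hc.integral_le le_rfl

theorem continuousOn_integral (hc : IsCtrl b c) :
    ContinuousOn (fun s => ∫ u in (0 : ℝ)..s, c u) (Ici 0) := by
  have h : ∀ T : ℝ, 0 ≤ T → ContinuousOn (fun s => ∫ u in (0 : ℝ)..s, c u) (Icc 0 T) := by
    intro T hT
    exact intervalIntegral.continuousOn_primitive_interval'
      (hc.intervalIntegrable le_rfl hT) left_mem_uIcc |>.mono Icc_subset_uIcc
  intro s hs
  have hs0 : (0 : ℝ) ≤ s := hs
  refine (h (s + 1) (by linarith) s ⟨hs, by linarith⟩).mono_of_mem_nhdsWithin ?_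
  exact mem_nhdsWithin.2 ⟨Iio (s + 1), isOpen_Iio, by simp, fun x hx => ⟨hx.2, hx.1.le⟩⟩

theorem monotoneOn_integral (hc : IsCtrl b c) :
    MonotoneOn (fun s => ∫ u in (0 : ℝ)..s, c u) (Ici 0) := by
  intro s hs t ht hst
  have := intervalIntegral.integral_add_adjacent_intervals
    (hc.intervalIntegrable le_rfl hs) (hc.intervalIntegrable hs ht)
  have h2 := hc.integral_nonneg hst
  simp only
  linarith

theorem mono (hc : IsCtrl b c) {b' : ℝ} (h : b ≤ b') : IsCtrl b' c :=
  ⟨hc.measurable, hc.nonneg, hc.integrable, hc.total_le.trans h⟩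

theorem zero_mem (hb : 0 ≤ b) : IsCtrl b fun _ => 0 :=
  ⟨measurable_const, fun _ => le_rfl, integrableOn_zero, by simpa using hb⟩

theorem smul_mem (hc : IsCtrl b c) {η : ℝ} (hη : 0 ≤ η) : IsCtrl (η * b) fun s => η * c s := by
  refine ⟨hc.measurable.const_mul η, fun s => mul_nonneg hη (hc.nonneg s), hc.integrable.const_mul η, ?_⟩
  rw [integral_const_mul]
  exact mul_le_mul_of_nonneg_left hc.total_le hη

theorem add_mem (hc : IsCtrl b c) {c' : ℝ → ℝ} {b' : ℝ} (hc' : IsCtrl b' c') :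
    IsCtrl (b + b') fun s => c s + c' s := by
  refine ⟨hc.measurable.add hc'.measurable, fun s => add_nonneg (hc.nonneg s) (hc'.nonneg s), hc.integrable.add hc'.integrable, ?_⟩
  rw [integral_add hc.integrable hc'.integrable]
  exact add_le_add hc.total_le hc'.total_le

theorem measurable_residual (hc : IsCtrl b c) {g : ℝ → ℝ → ℝ}
    (hg : Continuous fun q : ℝ × ℝ => g q.1 q.2) (b' : ℝ) :
    AEStronglyMeasurable (fun s => g s (b' - ∫ u in (0 : ℝ)..s, c u))
      (volume.restrict (Ioi 0)) := by
  refine ContinuousOn.aestronglyMeasurable ?_ measurableSet_Ioi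
  exact hg.comp_continuousOn (continuousOn_id.prodMk
    (continuousOn_const.sub (hc.continuousOn_integral.mono Ioi_subset_Ici_self)))

end IsCtrl

section Payoff

variable {U : ℝ → ℝ} {K γ β : ℝ} {g : ℝ → ℝ → ℝ} {b : ℝ} {c : ℝ → ℝ}

theorem IsRunning.pos (hg : IsRunning β g) : 0 < β := by
  obtain ⟨r, h0, h1, -⟩ := hg.bound; linarith

/-- An integrable majorant of the discounted running reward. -/
theorem IsRunning.exists_bound (hg : IsRunning β g) (R : ℝ) :
    ∃ F : ℝ → ℝ, IntegrableOn F (Ioi 0) ∧ ∀ s y, 0 ≤ s → y ≤ R →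
      ‖Real.exp (-β * s) * g s y‖ ≤ F s := by
  obtain ⟨r, h0, h1, h⟩ := hg.bound
  obtain ⟨B, hB0, hB⟩ := h R
  refine ⟨fun s => B * Real.exp (-(β - r) * s),
    (integrableOn_exp_neg_mul (by linarith)).const_mul B, fun s y hs hy => ?_⟩
  rw [Real.norm_of_nonneg (mul_nonneg (Real.exp_nonneg _) (hg.nonneg s y))]
  calc Real.exp (-β * s) * g s y ≤ Real.exp (-β * s) * (B * Real.exp (r * s)) := by
        gcongr; exact hB s y hs hy
    _ = B * (Real.exp (-β * s) * Real.exp (r * s)) := by ring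
    _ = _ := by rw [← Real.exp_add]; ring_nf

theorem IsRunning.integrableOn (hg : IsRunning β g) (hc : IsCtrl b c) (b' : ℝ) :
    IntegrableOn (fun s => Real.exp (-β * s) * g s (b' - ∫ u in (0 : ℝ)..s, c u)) (Ioi 0) := by
  obtain ⟨F, hF, h⟩ := hg.exists_bound b'
  refine Integrable.mono' hF ((by fun_prop : Measurable fun s : ℝ => Real.exp (-β * s))
    |>.aestronglyMeasurable.mul (hc.measurable_residual hg.cont b')) ?_
  filter_upwards [ae_restrict_mem measurableSet_Ioi] with s hs
  have hs' : (0 : ℝ) ≤ s := le_of_lt hs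
  exact h s _ hs' (by linarith [hc.integral_nonneg hs'])

theorem exp_neg_mul_le_one (hβ : 0 < β) {s : ℝ} (hs : 0 < s) : Real.exp (-β * s) ≤ 1 :=
  Real.exp_le_one_iff.2 (by nlinarith)

theorem IsUtility.integrableOn (hU : IsUtility U K γ) (hβ : 0 < β) (hc : IsCtrl b c) :
    IntegrableOn (fun s => Real.exp (-β * s) * U (c s)) (Ioi 0) := by
  have hint : IntegrableOn (fun s => K * (Real.exp (-β * s) + c s)) (Ioi 0) :=
    ((integrableOn_exp_neg_mul hβ).add hc.integrable).const_mul K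
  refine Integrable.mono' hint ((by fun_prop : Measurable fun s : ℝ => Real.exp (-β * s))
    |>.mul (hU.measurable_comp hc.measurable hc.nonneg)).aestronglyMeasurable ?_
  filter_upwards [ae_restrict_mem measurableSet_Ioi] with s hs
  rw [Real.norm_of_nonneg (mul_nonneg (Real.exp_nonneg _) (hU.nonneg (hc.nonneg s)))]
  have h1 := hU.le_linear (hc.nonneg s) one_pos
  rw [Real.one_rpow, mul_one, div_one] at h1
  have h2 := exp_neg_mul_le_one hβ hs
  have h3 := hc.nonneg s
  have h4 := hU.K_pos
  calc Real.exp (-β * s) * U (c s) ≤ Real.exp (-β * s) * (K * (1 + c s)) := by gcongr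
    _ = K * (Real.exp (-β * s) + Real.exp (-β * s) * c s) := by ring
    _ ≤ K * (Real.exp (-β * s) + 1 * c s) := by gcongr
    _ = _ := by ring

/-- Discounted utility of consumption is controlled by the budget. -/
theorem IsUtility.integral_le (hU : IsUtility U K γ) (hβ : 0 < β) (hc : IsCtrl b c) :
    ∫ s in Ioi (0 : ℝ), Real.exp (-β * s) * U (c s) ≤ K * (1 / β + 1) * b ^ γ := by
  have hb := hc.nonneg_budget
  -- The natural scale is the budget `b`, but `b` may be 0, so the estimate is made at positive
  -- scales `m ≥ b` and then `m` decreases to `b`.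
  have key : ∀ m, 0 < m → b ≤ m →
      ∫ s in Ioi (0 : ℝ), Real.exp (-β * s) * U (c s) ≤ K * (1 / β + 1) * m ^ γ := by
    intro m hm hbm
    have hm' := Real.rpow_nonneg hm.le γ
    have hint : IntegrableOn (fun s => K * m ^ γ * (Real.exp (-β * s) + c s / m)) (Ioi 0) :=
      ((integrableOn_exp_neg_mul hβ).add (hc.integrable.div_const m)).const_mul _
    have h1 : ∫ s in Ioi (0 : ℝ), Real.exp (-β * s) * U (c s) ≤
        ∫ s in Ioi (0 : ℝ), K * m ^ γ * (Real.exp (-β * s) + c s / m) := by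
      refine setIntegral_mono_on (hU.integrableOn hβ hc) hint measurableSet_Ioi fun s hs => ?_
      have h1 := hU.le_linear (hc.nonneg s) hm
      have h2 := exp_neg_mul_le_one hβ hs
      have h3 := div_nonneg (hc.nonneg s) hm.le
      have h4 := hU.K_pos
      calc Real.exp (-β * s) * U (c s) ≤ Real.exp (-β * s) * (K * m ^ γ * (1 + c s / m)) := by gcongr
        _ = K * m ^ γ * (Real.exp (-β * s) + Real.exp (-β * s) * (c s / m)) := by ring
        _ ≤ K * m ^ γ * (Real.exp (-β * s) + 1 * (c s / m)) := by gcongr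
        _ = _ := by ring
    refine h1.trans ?_
    rw [integral_const_mul, integral_add (integrableOn_exp_neg_mul hβ) (hc.integrable.div_const m),
      integral_exp_neg_mul hβ, integral_div]
    have h2 : (∫ s in Ioi (0 : ℝ), c s) / m ≤ 1 := (div_le_one hm).2 (hc.total_le.trans hbm)
    have h4 := hU.K_pos
    calc K * m ^ γ * (1 / β + (∫ s in Ioi (0 : ℝ), c s) / m) ≤ K * m ^ γ * (1 / β + 1) := by gcongr
      _ = _ := by ring
  have hlim : Tendsto (fun m : ℝ => K * (1 / β + 1) * m ^ γ) (𝓝[>] b)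
      (𝓝 (K * (1 / β + 1) * b ^ γ)) :=
    (((Real.continuous_rpow_const hU.γ_mem.1.le).const_mul _).tendsto b).mono_left
      nhdsWithin_le_nhds
  refine ge_of_tendsto hlim ?_
  filter_upwards [self_mem_nhdsWithin] with m hm
  have hm' : b < m := hm
  exact key m (hb.trans_lt hm') hm'.le

theorem payoff_eq_add (hU : IsUtility U K γ) (hg : IsRunning β g) (hc : IsCtrl b c) (b' : ℝ) :
    payoff U β g b' c = (∫ s in Ioi (0 : ℝ), Real.exp (-β * s) * U (c s)) +
      ∫ s in Ioi (0 : ℝ), Real.exp (-β * s) * g s (b' - ∫ u in (0 : ℝ)..s, c u) := by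
  rw [← integral_add (hU.integrableOn hg.pos hc) (hg.integrableOn hc b')]
  simp only [payoff, mul_add]

theorem integrableOn_payoff (hU : IsUtility U K γ) (hg : IsRunning β g) (hc : IsCtrl b c) (b' : ℝ) :
    IntegrableOn (fun s => Real.exp (-β * s) * (U (c s) + g s (b' - ∫ u in (0 : ℝ)..s, c u)))
      (Ioi 0) := by
  simp only [mul_add]
  exact (hU.integrableOn hg.pos hc).add (hg.integrableOn hc b')

theorem exists_payoff_le (hU : IsUtility U K γ) (hg : IsRunning β g) (b : ℝ) :
    ∃ C, ∀ c, IsCtrl b c → payoff U β g b c ≤ C := by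
  obtain ⟨F, hF, h⟩ := hg.exists_bound b
  refine ⟨K * (1 / β + 1) * b ^ γ + ∫ s in Ioi (0 : ℝ), F s, fun c hc => ?_⟩
  rw [payoff_eq_add hU hg hc]
  refine add_le_add (hU.integral_le hg.pos hc) ?_
  refine setIntegral_mono_on (hg.integrableOn hc b) hF measurableSet_Ioi fun s hs => ?_
  have hs' : (0 : ℝ) ≤ s := le_of_lt hs
  exact (Real.le_norm_self _).trans (h s _ hs' (by linarith [hc.integral_nonneg hs']))

theorem bddAbove_payoff (hU : IsUtility U K γ) (hg : IsRunning β g) (b : ℝ) :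
    BddAbove (payoff U β g b '' {c | IsCtrl b c}) := by
  obtain ⟨C, hC⟩ := exists_payoff_le hU hg b
  exact ⟨C, by rintro _ ⟨c, hc, rfl⟩; exact hC c hc⟩

theorem payoff_le_val (hU : IsUtility U K γ) (hg : IsRunning β g) (hc : IsCtrl b c) :
    payoff U β g b c ≤ val U β g b :=
  le_csSup (bddAbove_payoff hU hg b) ⟨c, hc, rfl⟩

theorem payoff_nonneg (hU : IsUtility U K γ) (hg : IsRunning β g) (hc : IsCtrl b c) (b' : ℝ) :
    0 ≤ payoff U β g b' c :=
  setIntegral_nonneg measurableSet_Ioi fun s _ => mul_nonneg (Real.exp_nonneg _)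
    (add_nonneg (hU.nonneg (hc.nonneg s)) (hg.nonneg _ _))

theorem val_nonneg (hU : IsUtility U K γ) (hg : IsRunning β g) : 0 ≤ val U β g b := by
  refine Real.sSup_nonneg ?_
  rintro _ ⟨c, hc, rfl⟩
  exact payoff_nonneg hU hg hc b

/-- Payoffs with jointly concave rewards are jointly concave. -/
theorem payoff_concave_of (hU : IsUtility U K γ) {g' g'' : ℝ → ℝ → ℝ} (hg : IsRunning β g)
    (hg' : IsRunning β g') (hg'' : IsRunning β g'') {b' b'' : ℝ} {c' : ℝ → ℝ}
    (hc : IsCtrl b c) (hc' : IsCtrl b' c') {η η' : ℝ} (hη : 0 ≤ η) (hη' : 0 ≤ η')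
    (h1 : η + η' = 1) (hb : η * b + η' * b' ≤ b'')
    (hgc : ∀ s y y', 0 ≤ y → 0 ≤ y' → η * g s y + η' * g' s y' ≤
      g'' s (b'' - (η * (b - y) + η' * (b' - y')))) :
    η * payoff U β g b c + η' * payoff U β g' b' c' ≤
      payoff U β g'' b'' fun s => η * c s + η' * c' s := by
  have hmem := ((hc.smul_mem hη).add_mem (hc'.smul_mem hη')).mono hb
  unfold payoff
  rw [← integral_const_mul, ← integral_const_mul, ← integral_add
    ((integrableOn_payoff hU hg hc b).const_mul η)
    ((integrableOn_payoff hU hg' hc' b').const_mul η')]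
  refine setIntegral_mono_on (((integrableOn_payoff hU hg hc b).const_mul η).add
    ((integrableOn_payoff hU hg' hc' b').const_mul η')) (integrableOn_payoff hU hg'' hmem _)
    measurableSet_Ioi fun s hs => ?_
  have hs' : (0 : ℝ) ≤ s := le_of_lt hs
  have hUc := hU.concave.2 (mem_Ici.2 (hc.nonneg s)) (mem_Ici.2 (hc'.nonneg s)) hη hη' h1
  have hGc := hgc s _ _ (sub_nonneg.2 (hc.integral_le hs')) (sub_nonneg.2 (hc'.integral_le hs'))
  simp only [smul_eq_mul] at hUc
  rw [sub_sub_cancel, sub_sub_cancel] at hGc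
  rw [intervalIntegral.integral_add ((hc.intervalIntegrable le_rfl hs').const_mul η)
    ((hc'.intervalIntegrable le_rfl hs').const_mul η'), intervalIntegral.integral_const_mul,
    intervalIntegral.integral_const_mul]
  calc _ = Real.exp (-β * s) * ((η * U (c s) + η' * U (c' s)) +
        (η * g s (b - ∫ u in (0 : ℝ)..s, c u) + η' * g' s (b' - ∫ u in (0 : ℝ)..s, c' u))) := by ring
    _ ≤ _ := mul_le_mul_of_nonneg_left (add_le_add hUc hGc) (Real.exp_nonneg _)

/-- The payoff is jointly concave in the budget and the consumption rate. -/
theorem payoff_concave (hU : IsUtility U K γ) (hg : IsRunning β g) {b' : ℝ} {c' : ℝ → ℝ}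
    (hc : IsCtrl b c) (hc' : IsCtrl b' c') {η η' : ℝ} (hη : 0 ≤ η) (hη' : 0 ≤ η')
    (h1 : η + η' = 1) :
    η * payoff U β g b c + η' * payoff U β g b' c' ≤
      payoff U β g (η * b + η' * b') fun s => η * c s + η' * c' s := by
  refine payoff_concave_of hU hg hg hg hc hc' hη hη' h1 le_rfl fun s y y' hy hy' => ?_
  have h := (hg.concave s).2 (mem_Ici.2 hy) (mem_Ici.2 hy') hη hη' h1
  simp only [smul_eq_mul] at h
  rwa [show η * b + η' * b' - (η * (b - y) + η' * (b' - y')) = η * y + η' * y' by ring]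

end Payoff

end IlliquidConsumption


/-! ### Existence of an optimal rate. -/

namespace IlliquidConsumption

section Existence

variable {U : ℝ → ℝ} {K γ β : ℝ} {g : ℝ → ℝ → ℝ} {b : ℝ} {c : ℝ → ℝ}

theorem IsCtrl.of_le {d : ℝ → ℝ} (hc : IsCtrl b c) (hd : Measurable d) (h0 : ∀ s, 0 ≤ d s)
    (h : ∀ s, d s ≤ c s) : IsCtrl b d := by
  have hint : IntegrableOn d (Ioi 0) := Integrable.mono' hc.integrable hd.aestronglyMeasurable
    (Eventually.of_forall fun s => by rw [Real.norm_of_nonneg (h0 s)]; exact h s)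
  exact ⟨hd, h0, hint, (integral_mono hint hc.integrable h).trans hc.total_le⟩

/-- Upper semicontinuity of the payoff along almost everywhere convergent consumption rates. -/
theorem le_payoff_of_tendsto (hU : IsUtility U K γ) (hg : IsRunning β g) {f : ℕ → ℝ → ℝ} {v : ℝ}
    (hf : ∀ n, IsCtrl b (f n)) (hc : IsCtrl b c)
    (hlim : ∀ᵐ s ∂volume.restrict (Ioi (0 : ℝ)), Tendsto (fun n => f n s) atTop (𝓝 (c s)))
    (hv : ∀ ε > 0, ∀ᶠ n in atTop, v - ε ≤ payoff U β g b (f n)) : v ≤ payoff U β g b c := by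
  have hb := hc.nonneg_budget
  have hβ := hg.pos
  -- Utility is truncated at level `R`, at a cost `K * R ^ (γ - 1) * b` uniform in `n`. The
  -- truncated part passes to the limit by domination, and the cost vanishes as `R → ∞` because γ <
  -- 1.
  have key : ∀ R : ℝ, 0 < R → v ≤ payoff U β g b c + K * R ^ (γ - 1) * b := by
    intro R hR
    -- The mass of `f n` may concentrate, so its primitive need not converge to that of `c`.
    -- Replacing `f n` by `min (f n) c` inside the running reward only increases the reward, and the
    -- minimum is dominated by `c`, so its primitive does converge.
    set d : ℕ → ℝ → ℝ := fun n s => min (f n s) (c s) with hd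
    have hdc : ∀ n, IsCtrl b (d n) := fun n => (hf n).of_le ((hf n).measurable.min hc.measurable)
      (fun s => le_min ((hf n).nonneg s) (hc.nonneg s)) fun s => min_le_left _ _
    have hmR : ∀ {e : ℝ → ℝ}, IsCtrl b e → IsCtrl b fun s => min (e s) R := fun he =>
      he.of_le (he.measurable.min measurable_const) (fun s => le_min (he.nonneg s) hR.le)
        fun s => min_le_left _ _
    have hI : ∀ {e e' : ℝ → ℝ}, IsCtrl b e → IsCtrl b e' → IntegrableOn (fun s =>
        Real.exp (-β * s) * (U (min (e s) R) + g s (b - ∫ u in (0 : ℝ)..s, e' u))) (Ioi 0) := by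
      intro e e' he he'
      simp only [mul_add]
      exact (hU.integrableOn hβ (hmR he)).add (hg.integrableOn he' b)
    have hle : ∀ n, payoff U β g b (f n) ≤ (∫ s in Ioi (0 : ℝ), Real.exp (-β * s) *
        (U (min (f n s) R) + g s (b - ∫ u in (0 : ℝ)..s, d n u))) + K * R ^ (γ - 1) * b := by
      intro n
      have hK : 0 ≤ K * R ^ (γ - 1) := mul_nonneg hU.K_pos.le (Real.rpow_nonneg hR.le _)
      have h1 : payoff U β g b (f n) ≤ ∫ s in Ioi (0 : ℝ), (Real.exp (-β * s) *
          (U (min (f n s) R) + g s (b - ∫ u in (0 : ℝ)..s, d n u)) + K * R ^ (γ - 1) * f n s) := by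
        refine setIntegral_mono_on (integrableOn_payoff hU hg (hf n) b)
          ((hI (hf n) (hdc n)).add ((hf n).integrable.const_mul _)) measurableSet_Ioi fun s hs => ?_
        have hs' : (0 : ℝ) ≤ s := le_of_lt hs
        have a1 := hU.le_min_add ((hf n).nonneg s) hR
        have a2 : g s (b - ∫ u in (0 : ℝ)..s, f n u) ≤ g s (b - ∫ u in (0 : ℝ)..s, d n u) := by
          refine hg.mono s (sub_le_sub_left ?_ _)
          exact intervalIntegral.integral_mono_on hs' ((hdc n).intervalIntegrable le_rfl hs')
            ((hf n).intervalIntegrable le_rfl hs') fun u _ => min_le_left _ _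
        have a3 := exp_neg_mul_le_one hβ hs
        have a4 := mul_nonneg hK ((hf n).nonneg s)
        calc _ ≤ Real.exp (-β * s) * ((U (min (f n s) R) + K * R ^ (γ - 1) * f n s) +
              g s (b - ∫ u in (0 : ℝ)..s, d n u)) := by gcongr
          _ = Real.exp (-β * s) * (U (min (f n s) R) + g s (b - ∫ u in (0 : ℝ)..s, d n u)) +
              Real.exp (-β * s) * (K * R ^ (γ - 1) * f n s) := by ring
          _ ≤ Real.exp (-β * s) * (U (min (f n s) R) + g s (b - ∫ u in (0 : ℝ)..s, d n u)) +
              1 * (K * R ^ (γ - 1) * f n s) := by gcongr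
          _ = _ := by rw [one_mul]
      rw [integral_add (hI (hf n) (hdc n)) ((hf n).integrable.const_mul _), integral_const_mul] at h1
      exact h1.trans (add_le_add le_rfl (mul_le_mul_of_nonneg_left (hf n).total_le hK))
    have hconv : Tendsto (fun n => ∫ s in Ioi (0 : ℝ), Real.exp (-β * s) *
        (U (min (f n s) R) + g s (b - ∫ u in (0 : ℝ)..s, d n u))) atTop
        (𝓝 (∫ s in Ioi (0 : ℝ), Real.exp (-β * s) *
          (U (min (c s) R) + g s (b - ∫ u in (0 : ℝ)..s, c u)))) := by
      obtain ⟨F, hF, hFb⟩ := hg.exists_bound b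
      refine tendsto_integral_of_dominated_convergence
        (fun s => Real.exp (-β * s) * U R + F s) (fun n => (hI (hf n) (hdc n)).aestronglyMeasurable)
        (((integrableOn_exp_neg_mul hβ).mul_const _).add hF) ?_ ?_
      · intro n
        filter_upwards [ae_restrict_mem measurableSet_Ioi] with s hs
        have hs' : (0 : ℝ) ≤ s := le_of_lt hs
        rw [mul_add]
        refine (norm_add_le _ _).trans (add_le_add ?_ (hFb s _ hs' ?_))
        · rw [Real.norm_of_nonneg (mul_nonneg (Real.exp_nonneg _)
            (hU.nonneg (le_min ((hf n).nonneg s) hR.le)))]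
          gcongr
          exact hU.mono (le_min ((hf n).nonneg s) hR.le) (mem_Ici.2 hR.le) (min_le_right _ _)
        · linarith [(hdc n).integral_nonneg hs']
      · filter_upwards [hlim, ae_restrict_mem measurableSet_Ioi] with s hs hs0
        have hs' : (0 : ℝ) ≤ s := le_of_lt hs0
        refine Tendsto.const_mul _ (Tendsto.add ?_ ?_)
        · have h2 : Tendsto (fun n => U (max (min (f n s) R) 0)) atTop (𝓝 (U (max (min (c s) R) 0))) :=
            (hU.continuous_comp_max.tendsto _).comp (hs.min tendsto_const_nhds)
          rw [max_eq_left (le_min (hc.nonneg s) hR.le)] at h2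
          refine h2.congr fun n => ?_
          rw [max_eq_left (le_min ((hf n).nonneg s) hR.le)]
        · refine ((hg.cont.comp (Continuous.prodMk_right s)).tendsto _).comp
            (Tendsto.sub tendsto_const_nhds ?_)
          refine intervalIntegral.tendsto_integral_filter_of_dominated_convergence c
            (Eventually.of_forall fun n => (hdc n).measurable.aestronglyMeasurable) ?_
            (hc.intervalIntegrable le_rfl hs') ?_
          · refine Eventually.of_forall fun n => Eventually.of_forall fun u _ => ?_
            rw [Real.norm_of_nonneg ((hdc n).nonneg u)]
            exact min_le_right _ _
          · rw [ae_restrict_iff' measurableSet_Ioi] at hlim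
            filter_upwards [hlim] with u hu huI
            rw [uIoc_of_le hs'] at huI
            simpa using (hu huI.1).min (tendsto_const_nhds (x := c u))
    have hfin : (∫ s in Ioi (0 : ℝ), Real.exp (-β * s) *
        (U (min (c s) R) + g s (b - ∫ u in (0 : ℝ)..s, c u))) ≤ payoff U β g b c := by
      refine setIntegral_mono_on (hI hc hc) (integrableOn_payoff hU hg hc b) measurableSet_Ioi
        fun s hs => ?_
      gcongr
      exact hU.mono (le_min (hc.nonneg s) hR.le) (mem_Ici.2 (hc.nonneg s)) (min_le_left _ _)
    refine le_of_forall_pos_le_add fun ε hε => ?_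
    have h4 : v - ε ≤ (∫ s in Ioi (0 : ℝ), Real.exp (-β * s) *
        (U (min (c s) R) + g s (b - ∫ u in (0 : ℝ)..s, c u))) + K * R ^ (γ - 1) * b := by
      refine ge_of_tendsto (hconv.add_const _) ?_
      filter_upwards [hv ε hε] with n hn
      exact hn.trans (hle n)
    linarith
  have hlim0 : Tendsto (fun R : ℝ => payoff U β g b c + K * R ^ (γ - 1) * b) atTop
      (𝓝 (payoff U β g b c + K * 0 * b)) := by
    refine Tendsto.const_add _ (Tendsto.mul_const _ (Tendsto.const_mul _ ?_))
    have := tendsto_rpow_neg_atTop (y := 1 - γ) (by linarith [hU.γ_mem.2])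
    simpa using this
  rw [mul_zero, zero_mul, add_zero] at hlim0
  refine ge_of_tendsto hlim0 ?_
  filter_upwards [eventually_gt_atTop 0] with R hR using key R hR

/-- Completeness: rates whose transforms `exp (-c / 2)` are Cauchy in a weighted `L²` have a
subsequence converging almost everywhere to a rate with the same budget. -/
theorem exists_subseq_tendsto (hβ : 0 < β) {f : ℕ → ℝ → ℝ} (hf : ∀ n, IsCtrl b (f n))
    (hcau : ∀ ε > 0, ∃ N, ∀ n m, N ≤ n → N ≤ m → ∫ s in Ioi (0 : ℝ), Real.exp (-β * s) *
      (Real.exp (-f n s / 2) - Real.exp (-f m s / 2)) ^ 2 < ε) :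
    ∃ (c : ℝ → ℝ) (φ : ℕ → ℕ), IsCtrl b c ∧ StrictMono φ ∧
      ∀ᵐ s ∂volume.restrict (Ioi (0 : ℝ)), Tendsto (fun n => f (φ n) s) atTop (𝓝 (c s)) := by
  have hb := (hf 0).nonneg_budget
  -- The subsequence is chosen with consecutive weighted L² distances below `2 ^ (-k)`, which are
  -- summable; this yields convergence almost everywhere.
  have hev : ∀ k : ℕ, ∃ N, ∀ n ≥ N, ∀ n' m', n ≤ n' → n ≤ m' → ∫ s in Ioi (0 : ℝ), Real.exp (-β * s) *
      (Real.exp (-f n' s / 2) - Real.exp (-f m' s / 2)) ^ 2 < ((1 / 2 : ℝ) ^ k) ^ 2 := by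
    intro k
    obtain ⟨N, hN⟩ := hcau (((1 / 2 : ℝ) ^ k) ^ 2) (by positivity)
    exact ⟨N, fun n hn n' m' h1 h2 => hN n' m' (hn.trans h1) (hn.trans h2)⟩
  obtain ⟨φ, hφ, hφ'⟩ := extraction_forall_of_eventually' hev
  set F : ℕ → ℝ → ℝ := fun k s => Real.exp (-β * s / 2) * Real.exp (-f (φ k) s / 2) with hF
  have hFm : ∀ k, Measurable (F k) := fun k => by
    have := (hf (φ k)).measurable
    fun_prop
  have hlimF : ∀ᵐ s ∂volume.restrict (Ioi (0 : ℝ)), ∃ l : ℝ,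
      Tendsto (fun n => F n s) atTop (𝓝 l) := by
    refine Lp.ae_tendsto_of_cauchy_eLpNorm' (p := 2)
      (fun k => (hFm k).aestronglyMeasurable) (by norm_num) (B := fun k => ENNReal.ofReal ((1 / 2) ^ k))
      ?_ ?_
    · rw [← ENNReal.ofReal_tsum_of_nonneg (fun k => by positivity) summable_geometric_two]
      exact ENNReal.ofReal_ne_top
    · intro N n m hn hm
      have hlt := hφ' N (φ n) (φ m) (hφ.monotone hn) (hφ.monotone hm)
      rw [eLpNorm'_eq_lintegral_enorm]
      have e : ∀ s, ‖(F n - F m) s‖ₑ ^ (2 : ℝ) = ENNReal.ofReal (Real.exp (-β * s) *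
          (Real.exp (-f (φ n) s / 2) - Real.exp (-f (φ m) s / 2)) ^ 2) := by
        intro s
        rw [Real.enorm_eq_ofReal_abs, ENNReal.ofReal_rpow_of_nonneg (abs_nonneg _) (by norm_num)]
        congr 1
        rw [Real.rpow_two, sq_abs]
        have : Real.exp (-β * s) = Real.exp (-β * s / 2) ^ 2 := by
          rw [← Real.exp_nat_mul]; congr 1; push_cast; ring
        simp only [hF, Pi.sub_apply]
        rw [this]; ring
      simp only [e]
      rw [← ofReal_integral_eq_lintegral_ofReal, ENNReal.ofReal_rpow_of_nonneg
        (integral_nonneg fun s => by positivity) (by norm_num)]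
      · rw [ENNReal.ofReal_lt_ofReal_iff (by positivity)]
        rw [← Real.sqrt_eq_rpow, Real.sqrt_lt' (by positivity)]
        exact hlt
      · refine Integrable.mono' (integrableOn_exp_neg_mul hβ) ?_ (Eventually.of_forall fun s => ?_)
        · have h1 := (hf (φ n)).measurable
          have h2 := (hf (φ m)).measurable
          exact Measurable.aestronglyMeasurable (by fun_prop)
        · have a1 : Real.exp (-f (φ n) s / 2) ≤ 1 := Real.exp_le_one_iff.2 (by
            linarith [(hf (φ n)).nonneg s])
          have a2 : Real.exp (-f (φ m) s / 2) ≤ 1 := Real.exp_le_one_iff.2 (by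
            linarith [(hf (φ m)).nonneg s])
          have a3 := Real.exp_pos (-f (φ n) s / 2)
          have a4 := Real.exp_pos (-f (φ m) s / 2)
          rw [Real.norm_of_nonneg (by positivity)]
          have : (Real.exp (-f (φ n) s / 2) - Real.exp (-f (φ m) s / 2)) ^ 2 ≤ 1 := by
            rw [sq_le_one_iff_abs_le_one, abs_le]; constructor <;> linarith
          nlinarith [Real.exp_pos (-β * s)]
      · exact Eventually.of_forall fun s => by positivity
  -- By Fatou's lemma this lower limit has integral at most the budget; it is therefore finite
  -- almost everywhere, and its real version is the limiting rate.
  set L : ℝ → ℝ≥0∞ := fun s => liminf (fun n => ENNReal.ofReal (f (φ n) s)) atTop with hL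
  have hLm : Measurable L := Measurable.liminf fun n => (hf (φ n)).measurable.ennreal_ofReal
  have hLint : ∫⁻ s in Ioi (0 : ℝ), L s ≤ ENNReal.ofReal b := by
    refine (lintegral_liminf_le fun n => (hf (φ n)).measurable.ennreal_ofReal).trans ?_
    refine liminf_le_of_frequently_le' (Frequently.of_forall fun n => ?_)
    rw [← ofReal_integral_eq_lintegral_ofReal (hf (φ n)).integrable
      (Eventually.of_forall (hf (φ n)).nonneg)]
    exact ENNReal.ofReal_le_ofReal (hf (φ n)).total_le
  have hLtop : ∀ᵐ s ∂volume.restrict (Ioi (0 : ℝ)), L s < ⊤ :=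
    ae_lt_top hLm (hLint.trans_lt ENNReal.ofReal_lt_top).ne
  refine ⟨fun s => (L s).toReal, φ, ⟨hLm.ennreal_toReal, fun s => ENNReal.toReal_nonneg,
    integrable_toReal_of_lintegral_ne_top hLm.aemeasurable
      (hLint.trans_lt ENNReal.ofReal_lt_top).ne, ?_⟩, hφ, ?_⟩
  · rw [integral_toReal hLm.aemeasurable hLtop]
    exact ENNReal.toReal_le_of_le_ofReal hb hLint
  · filter_upwards [hlimF, hLtop] with s hs hs'
    obtain ⟨l, hl⟩ := hs
    have hl' : Tendsto (fun n => Real.exp (-f (φ n) s / 2)) atTop (𝓝 (l / Real.exp (-β * s / 2))) := by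
      refine (hl.div_const (Real.exp (-β * s / 2))).congr fun n => ?_
      simp only [hF]
      field_simp
    set l' := l / Real.exp (-β * s / 2)
    have hl0 : 0 ≤ l' := ge_of_tendsto' hl' fun n => (Real.exp_pos _).le
    -- A zero limit of `exp (-f / 2)` would mean that the rates tend to infinity at `s`, against the
    -- finiteness of `L s`. A positive limit can be undone by the logarithm.
    rcases eq_or_lt_of_le hl0 with h0 | h0
    · exfalso
      have : Tendsto (fun n => f (φ n) s) atTop atTop := by
        have h1 : Tendsto (fun n => Real.exp (-f (φ n) s / 2)) atTop (𝓝[>] 0) :=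
          tendsto_nhdsWithin_iff.2 ⟨by rwa [← h0] at hl', Eventually.of_forall fun n => Real.exp_pos _⟩
        have h2 := Real.tendsto_log_nhdsGT_zero.comp h1
        have h3 : Tendsto (fun n => -2 * (Real.log ∘ fun n => Real.exp (-f (φ n) s / 2)) n)
            atTop atTop := h2.const_mul_atBot_of_neg (by norm_num)
        refine h3.congr fun n => ?_
        simp only [Function.comp_apply, Real.log_exp]; ring
      have h4 := (ENNReal.tendsto_ofReal_atTop.comp this).liminf_eq
      exact hs'.ne h4
    · have h2 : Tendsto (fun n => f (φ n) s) atTop (𝓝 (-2 * Real.log l')) := by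
        refine ((hl'.log h0.ne').const_mul (-2)).congr fun n => ?_
        rw [Real.log_exp]; ring
      have h4 : L s = ENNReal.ofReal (-2 * Real.log l') :=
        (ENNReal.tendsto_ofReal h2).liminf_eq
      have h5 : 0 ≤ -2 * Real.log l' := ge_of_tendsto' h2 fun n => (hf (φ n)).nonneg s
      rw [h4, ENNReal.toReal_ofReal h5]
      exact h2

/-- An optimal consumption rate exists. -/
theorem exists_optimal (hU : IsUtility U K γ) (hg : IsRunning β g) (hb : 0 ≤ b) :
    ∃ c, IsCtrl b c ∧ payoff U β g b c = val U β g b := by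
  have hβ := hg.pos
  set v := val U β g b with hv
  set A : ℕ → Set (ℝ → ℝ) := fun n => {c | IsCtrl b c ∧ v - 1 / (n + 1 : ℝ) ≤ payoff U β g b c} with hA
  -- An auxiliary strictly convex functional replaces weak compactness: among the rates that are
  -- optimal up to `1 / (n + 1)`, those nearly minimising Φ form a Cauchy sequence, because these
  -- sets are convex and decrease with `n`.
  set Φ : (ℝ → ℝ) → ℝ := fun c => ∫ s in Ioi (0 : ℝ), Real.exp (-β * s) * Real.exp (-c s) with hΦ
  have hexpint : ∀ c : ℝ → ℝ, IsCtrl b c →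
      IntegrableOn (fun s => Real.exp (-β * s) * Real.exp (-c s)) (Ioi 0) := by
    intro c hc
    refine Integrable.mono' (integrableOn_exp_neg_mul hβ) ?_ (Eventually.of_forall fun s => ?_)
    · have := hc.measurable
      exact Measurable.aestronglyMeasurable (by fun_prop)
    · rw [Real.norm_of_nonneg (by positivity)]
      have : Real.exp (-c s) ≤ 1 := Real.exp_le_one_iff.2 (by linarith [hc.nonneg s])
      nlinarith [Real.exp_pos (-β * s)]
  have hΦ0 : ∀ c, 0 ≤ Φ c := fun c => integral_nonneg fun s => by positivity
  have hΦ1 : ∀ c, IsCtrl b c → Φ c ≤ 1 / β := by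
    intro c hc
    rw [← integral_exp_neg_mul hβ]
    refine integral_mono (hexpint c hc) (integrableOn_exp_neg_mul hβ) fun s => ?_
    have : Real.exp (-c s) ≤ 1 := Real.exp_le_one_iff.2 (by linarith [hc.nonneg s])
    exact mul_le_of_le_one_right (Real.exp_nonneg _) this
  have hAne : ∀ n, (A n).Nonempty := by
    intro n
    have hne : (payoff U β g b '' {c | IsCtrl b c}).Nonempty := ⟨_, _, IsCtrl.zero_mem hb, rfl⟩
    obtain ⟨_, ⟨c, hc, rfl⟩, h⟩ := exists_lt_of_lt_csSup hne
      (show v - 1 / (n + 1 : ℝ) < sSup (payoff U β g b '' {c | IsCtrl b c}) by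
        have : 0 < 1 / (n + 1 : ℝ) := by positivity
        change v - 1 / (n + 1 : ℝ) < v
        linarith)
    exact ⟨c, hc, h.le⟩
  have hAanti : ∀ n m, n ≤ m → A m ⊆ A n := by
    rintro n m h c ⟨hc, hp⟩
    refine ⟨hc, le_trans ?_ hp⟩
    have : 1 / (m + 1 : ℝ) ≤ 1 / (n + 1 : ℝ) := by gcongr
    linarith
  have hbdd : ∀ n, BddBelow (Φ '' A n) := fun n => ⟨0, by rintro _ ⟨c, -, rfl⟩; exact hΦ0 c⟩
  set I : ℕ → ℝ := fun n => sInf (Φ '' A n) with hI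
  have hImono : Monotone I := fun n m h =>
    csInf_le_csInf (hbdd n) ((hAne m).image Φ) (image_mono (hAanti n m h))
  have hIbdd : BddAbove (range I) := by
    refine ⟨1 / β, ?_⟩
    rintro _ ⟨n, rfl⟩
    obtain ⟨c, hc⟩ := hAne n
    exact (csInf_le (hbdd n) ⟨c, hc, rfl⟩).trans (hΦ1 c hc.1)
  have hIlim := tendsto_atTop_ciSup hImono hIbdd
  have hIle : ∀ n, I n ≤ ⨆ n, I n := fun n => le_ciSup hIbdd n
  have hch : ∀ n : ℕ, ∃ c ∈ A n, Φ c < I n + 1 / (n + 1 : ℝ) := by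
    intro n
    obtain ⟨_, ⟨c, hc, rfl⟩, h⟩ := exists_lt_of_csInf_lt ((hAne n).image Φ)
      (show sInf (Φ '' A n) < I n + 1 / (n + 1 : ℝ) by
        have : 0 < 1 / (n + 1 : ℝ) := by positivity
        change I n < _
        linarith)
    exact ⟨c, hc, h⟩
  choose f hfA hfΦ using hch
  have hmid : ∀ N n m, N ≤ n → N ≤ m → ∫ s in Ioi (0 : ℝ), Real.exp (-β * s) *
      (Real.exp (-f n s / 2) - Real.exp (-f m s / 2)) ^ 2 ≤
      2 * ((⨆ n, I n) - I N) + 2 * (1 / (N + 1 : ℝ)) := by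
    intro N n m hn hm
    have hcn := (hfA n).1
    have hcm := (hfA m).1
    have hmidc : IsCtrl b fun s => 1 / 2 * f n s + 1 / 2 * f m s := by
      have := (hcn.smul_mem (η := 1 / 2) (by norm_num)).add_mem (hcm.smul_mem (η := 1 / 2) (by norm_num))
      convert! this using 1
      ring
    have hmidA : (fun s => 1 / 2 * f n s + 1 / 2 * f m s) ∈ A N := by
      refine ⟨hmidc, ?_⟩
      have h1 := payoff_concave hU hg hcn hcm (η := 1 / 2) (η' := 1 / 2) (by norm_num) (by norm_num)
        (by norm_num)
      have h2 := (hAanti N n hn (hfA n)).2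
      have h3 := (hAanti N m hm (hfA m)).2
      rw [show 1 / 2 * b + 1 / 2 * b = b by ring] at h1
      linarith
    have hI1 : I N ≤ Φ (fun s => 1 / 2 * f n s + 1 / 2 * f m s) := csInf_le (hbdd N) ⟨_, hmidA, rfl⟩
    -- With `u = exp (-f n / 2)` and `w = exp (-f m / 2)`, the midpoint of the two rates contributes
    -- exactly `u * w` to Φ. The convexity gap is thus the squared weighted distance `(u - w) ^ 2`.
    have e : ∫ s in Ioi (0 : ℝ), Real.exp (-β * s) *
        (Real.exp (-f n s / 2) - Real.exp (-f m s / 2)) ^ 2 =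
        Φ (f n) + Φ (f m) - 2 * Φ (fun s => 1 / 2 * f n s + 1 / 2 * f m s) := by
      have hadd : IntegrableOn (fun s => Real.exp (-β * s) * Real.exp (-f n s) +
          Real.exp (-β * s) * Real.exp (-f m s)) (Ioi 0) := (hexpint _ hcn).add (hexpint _ hcm)
      simp only [hΦ]
      rw [← integral_const_mul, ← integral_add (hexpint _ hcn) (hexpint _ hcm), ← integral_sub
        hadd ((hexpint _ hmidc).const_mul 2)]
      congr 1
      funext s
      have e1 : Real.exp (-f n s) = Real.exp (-f n s / 2) ^ 2 := by
        rw [← Real.exp_nat_mul]; congr 1; push_cast; ring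
      have e2 : Real.exp (-f m s) = Real.exp (-f m s / 2) ^ 2 := by
        rw [← Real.exp_nat_mul]; congr 1; push_cast; ring
      have e3 : Real.exp (-(1 / 2 * f n s + 1 / 2 * f m s)) =
          Real.exp (-f n s / 2) * Real.exp (-f m s / 2) := by
        rw [← Real.exp_add]; congr 1; ring
      rw [e1, e2, e3]; ring
    have h1 : ∀ k, N ≤ k → Φ (f k) ≤ (⨆ n, I n) + 1 / (N + 1 : ℝ) := by
      intro k hk
      have : 1 / (k + 1 : ℝ) ≤ 1 / (N + 1 : ℝ) := by gcongr
      linarith [hfΦ k, hIle k]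
    rw [e]
    linarith [h1 n hn, h1 m hm]
  have hcau : ∀ ε > 0, ∃ N, ∀ n m, N ≤ n → N ≤ m → ∫ s in Ioi (0 : ℝ), Real.exp (-β * s) *
      (Real.exp (-f n s / 2) - Real.exp (-f m s / 2)) ^ 2 < ε := by
    intro ε hε
    have hlim : Tendsto (fun N : ℕ => 2 * ((⨆ n, I n) - I N) + 2 * (1 / (N + 1 : ℝ))) atTop
        (𝓝 (2 * ((⨆ n, I n) - ⨆ n, I n) + 2 * 0)) :=
      ((hIlim.const_sub _).const_mul 2).add (tendsto_one_div_add_atTop_nhds_zero_nat.const_mul 2)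
    rw [sub_self, mul_zero, add_zero] at hlim
    obtain ⟨N, hN⟩ := (hlim.eventually (gt_mem_nhds hε)).exists
    exact ⟨N, fun n m hn hm => (hmid N n m hn hm).trans_lt hN⟩
  obtain ⟨c, φ, hc, hφ, hlim⟩ := exists_subseq_tendsto hβ (fun n => (hfA n).1) hcau
  refine ⟨c, hc, le_antisymm (payoff_le_val hU hg hc) ?_⟩
  refine le_payoff_of_tendsto hU hg (fun n => (hfA (φ n)).1) hc hlim fun ε hε => ?_
  have h1 := (tendsto_one_div_add_atTop_nhds_zero_nat (𝕜 := ℝ)).comp hφ.tendsto_atTop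
  filter_upwards [h1.eventually (gt_mem_nhds hε)] with n hn
  have h2 := (hfA (φ n)).2
  simp only [Function.comp_apply] at hn
  linarith

end Existence

end IlliquidConsumption


/-! ### Time splitting and optimality of tails. -/

namespace IlliquidConsumption

section Dynamic

variable {U : ℝ → ℝ} {K γ β : ℝ} {g : ℝ → ℝ → ℝ} {b : ℝ} {c : ℝ → ℝ}

theorem val_concaveOn (hU : IsUtility U K γ) (hg : IsRunning β g) :
    ConcaveOn ℝ (Ici 0) (val U β g) := by
  refine ⟨convex_Ici 0, fun x hx y hy η η' hη hη' h1 => ?_⟩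
  obtain ⟨c, hc, hcv⟩ := exists_optimal hU hg hx
  obtain ⟨d, hd, hdv⟩ := exists_optimal hU hg hy
  simp only [smul_eq_mul]
  rw [← hcv, ← hdv]
  exact (payoff_concave hU hg hc hd hη hη' h1).trans
    (payoff_le_val hU hg ((hc.smul_mem hη).add_mem (hd.smul_mem hη')))

theorem payoff_mono_budget (hU : IsUtility U K γ) (hg : IsRunning β g) (hc : IsCtrl b c)
    {x y : ℝ} (hxy : x ≤ y) : payoff U β g x c ≤ payoff U β g y c := by
  refine setIntegral_mono_on (integrableOn_payoff hU hg hc x) (integrableOn_payoff hU hg hc y)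
    measurableSet_Ioi fun s _ => ?_
  gcongr
  exact hg.mono s (by linarith)

theorem integral_congr_of_ae_Ioi {c c' : ℝ → ℝ} (h : c =ᵐ[volume.restrict (Ioi 0)] c') {s : ℝ}
    (hs : 0 ≤ s) : ∫ u in (0 : ℝ)..s, c u = ∫ u in (0 : ℝ)..s, c' u := by
  refine intervalIntegral.integral_congr_ae ?_
  filter_upwards [(ae_restrict_iff' measurableSet_Ioi).1 h] with u hu huI
  rw [uIoc_of_le hs] at huI
  exact hu huI.1

theorem payoff_congr_ae {c c' : ℝ → ℝ} (h : c =ᵐ[volume.restrict (Ioi 0)] c') :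
    payoff U β g b c = payoff U β g b c' := by
  refine integral_congr_ae ?_
  filter_upwards [h, ae_restrict_mem measurableSet_Ioi] with s hs hs0
  rw [hs, integral_congr_of_ae_Ioi h (le_of_lt hs0)]

theorem IsRunning.shift (hg : IsRunning β g) {s : ℝ} (hs : 0 ≤ s) :
    IsRunning β fun u => g (s + u) := by
  refine ⟨hg.cont.comp (f := fun q : ℝ × ℝ => (s + q.1, q.2)) (by fun_prop),
    fun u => hg.nonneg _, fun u => hg.mono _, fun u => hg.concave _, ?_⟩
  obtain ⟨r, h0, h1, h⟩ := hg.bound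
  refine ⟨r, h0, h1, fun R => ?_⟩
  obtain ⟨B, hB0, hB⟩ := h R
  refine ⟨B * Real.exp (r * s), by positivity, fun u y hu hy => ?_⟩
  refine (hB _ y (add_nonneg hs hu) hy).trans (le_of_eq ?_)
  rw [mul_assoc, ← Real.exp_add, mul_add]

theorem integral_Ioi_shift (f : ℝ → ℝ) (s : ℝ) :
    ∫ u in Ioi s, f u = ∫ u in Ioi (0 : ℝ), f (s + u) := by
  have := (measurePreserving_add_left volume s).setIntegral_preimage_emb
    (measurableEmbedding_addLeft s) f (Ioi s)
  rw [← this]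
  simp

theorem IsCtrl.tail (hc : IsCtrl b c) {s : ℝ} (hs : 0 ≤ s) :
    IsCtrl (b - ∫ u in (0 : ℝ)..s, c u) fun u => c (s + u) := by
  refine ⟨hc.measurable.comp (measurable_const_add s), fun u => hc.nonneg _, ?_, ?_⟩
  · have := (measurePreserving_add_left volume s).integrableOn_comp_preimage
      (measurableEmbedding_addLeft s) (f := c) (s := Ioi s)
    simp only [preimage_const_add_Ioi, sub_self] at this
    exact this.2 (hc.integrable.mono_set (Ioi_subset_Ioi hs))
  · rw [← integral_Ioi_shift]
    have h := setIntegral_union (μ := volume) (f := c) (Ioc_disjoint_Ioi le_rfl : Disjoint (Ioc 0 s) (Ioi s))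
      measurableSet_Ioi (hc.integrable.mono_set Ioc_subset_Ioi_self)
      (hc.integrable.mono_set (Ioi_subset_Ioi hs))
    rw [Ioc_union_Ioi_eq_Ioi hs, ← intervalIntegral.integral_of_le hs] at h
    linarith [hc.total_le]

theorem IsCtrl.integral_add (hc : IsCtrl b c) {s u : ℝ} (hs : 0 ≤ s) (hu : 0 ≤ u) :
    ∫ v in (0 : ℝ)..(s + u), c v = (∫ v in (0 : ℝ)..s, c v) + ∫ v in (0 : ℝ)..u, c (s + v) := by
  rw [← intervalIntegral.integral_add_adjacent_intervals (hc.intervalIntegrable le_rfl hs)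
    (hc.intervalIntegrable hs (add_nonneg hs hu)), intervalIntegral.integral_comp_add_left]
  simp

/-- The payoff splits at time `s`. -/
theorem payoff_split (hU : IsUtility U K γ) (hg : IsRunning β g) (hc : IsCtrl b c) {s : ℝ}
    (hs : 0 ≤ s) : payoff U β g b c =
      (∫ u in Ioc (0 : ℝ) s, Real.exp (-β * u) * (U (c u) + g u (b - ∫ v in (0 : ℝ)..u, c v))) +
      Real.exp (-β * s) * payoff U β (fun u => g (s + u)) (b - ∫ u in (0 : ℝ)..s, c u)
        fun u => c (s + u) := by
  have hint := integrableOn_payoff hU hg hc b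
  have h := setIntegral_union (Ioc_disjoint_Ioi (le_refl s) : Disjoint (Ioc 0 s) (Ioi s))
    measurableSet_Ioi (hint.mono_set Ioc_subset_Ioi_self) (hint.mono_set (Ioi_subset_Ioi hs))
  rw [Ioc_union_Ioi_eq_Ioi hs, integral_Ioi_shift _ s] at h
  rw [payoff, h, payoff, ← integral_const_mul]
  congr 1
  refine setIntegral_congr_fun measurableSet_Ioi fun u hu => ?_
  have hu' : (0 : ℝ) ≤ u := le_of_lt hu
  rw [hc.integral_add hs hu', ← mul_assoc, ← Real.exp_add, mul_add (-β), sub_sub]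

/-- Continuing optimally is optimal: the tail of an optimal rate is optimal. -/
theorem payoff_tail_eq_val (hU : IsUtility U K γ) (hg : IsRunning β g) (hc : IsCtrl b c)
    (hopt : payoff U β g b c = val U β g b) {s : ℝ} (hs : 0 ≤ s) :
    payoff U β (fun u => g (s + u)) (b - ∫ u in (0 : ℝ)..s, c u) (fun u => c (s + u)) =
      val U β (fun u => g (s + u)) (b - ∫ u in (0 : ℝ)..s, c u) := by
  have hg' := hg.shift hs
  have hct := hc.tail hs
  refine le_antisymm (payoff_le_val hU hg' hct) ?_
  obtain ⟨d, hd, hdv⟩ := exists_optimal hU hg' hct.nonneg_budget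
  rw [← hdv]
  set e : ℝ → ℝ := fun u => if u ≤ s then c u else d (u - s) with he
  have hem : Measurable e := Measurable.ite measurableSet_Iic hc.measurable
    (hd.measurable.comp (measurable_id.sub_const s))
  have he0 : ∀ u, 0 ≤ e u := fun u => by
    simp only [he]; split_ifs
    · exact hc.nonneg u
    · exact hd.nonneg _
  have heq1 : ∀ u ∈ Ioc (0 : ℝ) s, e u = c u := fun u hu => if_pos hu.2
  have heq2 : ∀ u ∈ Ioi (0 : ℝ), e (s + u) = d u := fun u hu => by
    have : ¬ s + u ≤ s := by have : 0 < u := hu; linarith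
    simp [he, this]
  have hae : (fun u => e (s + u)) =ᵐ[volume.restrict (Ioi 0)] d := by
    filter_upwards [ae_restrict_mem measurableSet_Ioi] with u hu using heq2 u hu
  have hi1 : IntegrableOn e (Ioc 0 s) :=
    (hc.integrable.mono_set Ioc_subset_Ioi_self).congr_fun (fun u hu => (heq1 u hu).symm)
      measurableSet_Ioc
  have hi2 : IntegrableOn e (Ioi s) := by
    have := (measurePreserving_add_left volume s).integrableOn_comp_preimage
      (measurableEmbedding_addLeft s) (f := e) (s := Ioi s)
    simp only [preimage_const_add_Ioi, sub_self] at this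
    exact this.1 (hd.integrable.congr hae.symm)
  have hcum : ∀ u, 0 ≤ u → u ≤ s → ∫ v in (0 : ℝ)..u, e v = ∫ v in (0 : ℝ)..u, c v := by
    intro u hu hus
    refine intervalIntegral.integral_congr_ae (Eventually.of_forall fun v hv => ?_)
    rw [uIoc_of_le hu] at hv
    exact heq1 v ⟨hv.1, hv.2.trans hus⟩
  have hec : IsCtrl b e := by
    refine ⟨hem, he0, ?_, ?_⟩
    · rw [← Ioc_union_Ioi_eq_Ioi hs]; exact hi1.union hi2
    · rw [← Ioc_union_Ioi_eq_Ioi hs, setIntegral_union (Ioc_disjoint_Ioi le_rfl) measurableSet_Ioi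
        hi1 hi2, integral_Ioi_shift, integral_congr_ae hae, ← intervalIntegral.integral_of_le hs,
        hcum s hs le_rfl]
      linarith [hd.total_le]
  have h1 := payoff_split hU hg hc hs
  have h2 := payoff_split hU hg hec hs
  have h3 := payoff_le_val hU hg hec
  rw [← hopt, h1, h2, hcum s hs le_rfl, payoff_congr_ae hae] at h3
  have h4 : (∫ u in Ioc (0 : ℝ) s, Real.exp (-β * u) * (U (e u) + g u (b - ∫ v in (0 : ℝ)..u, e v))) =
      ∫ u in Ioc (0 : ℝ) s, Real.exp (-β * u) * (U (c u) + g u (b - ∫ v in (0 : ℝ)..u, c v)) := by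
    refine setIntegral_congr_fun measurableSet_Ioc fun u hu => ?_
    simp only [heq1 u hu, hcum u hu.1.le hu.2]
  rw [h4] at h3
  exact le_of_mul_le_mul_left (by linarith) (Real.exp_pos (-β * s))

end Dynamic

/-! ### Stability of the value under perturbation of reward and budget. -/

section Stability

variable {U : ℝ → ℝ} {K γ β : ℝ}

/-- Stability of the value under perturbations of the running reward and the budget. -/
theorem eventually_val_le (hU : IsUtility U K γ) (hβ : 0 < β) {g h : ℕ → ℝ → ℝ → ℝ} {b b' : ℕ → ℝ}
    {R : ℝ} {F : ℝ → ℝ} (hg : ∀ n, IsRunning β (g n)) (hh : ∀ n, IsRunning β (h n))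
    (hb : ∀ n, b n ∈ Icc 0 R) (hb' : ∀ n, b' n ∈ Icc 0 R)
    (hbb : Tendsto (fun n => b n - b' n) atTop (𝓝 0)) (hF : IntegrableOn F (Ioi 0))
    (hgF : ∀ᶠ n in atTop, ∀ s y, 0 ≤ s → y ≤ R → ‖Real.exp (-β * s) * g n s y‖ ≤ F s)
    (hhF : ∀ᶠ n in atTop, ∀ s y, 0 ≤ s → y ≤ R → ‖Real.exp (-β * s) * h n s y‖ ≤ F s)
    (hlim : ∀ s, 0 < s → ∀ y y' : ℕ → ℝ, (∀ n, y n ∈ Icc 0 R) → (∀ n, y' n ∈ Icc 0 R) →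
      Tendsto (fun n => y n - y' n) atTop (𝓝 0) →
      Tendsto (fun n => g n s (y n) - h n s (y' n)) atTop (𝓝 0)) {ε : ℝ} (hε : 0 < ε) :
    ∀ᶠ n in atTop, val U β (g n) (b n) ≤ val U β (h n) (b' n) + ε := by
  choose c hc hcv using fun n => exists_optimal hU (hg n) (hb n).1
  -- The optimal rate for `b n` is scaled down just enough to fit into `b' n`. Subadditivity of `U`
  -- bounds the lost utility by that of the removed fraction, which has budget at most `|b n - b'
  -- n|` and so is worth `O(|b n - b' n| ^ γ)`.
  set η : ℕ → ℝ := fun n => if b n ≤ b' n then 1 else b' n / b n with hη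
  have hη0 : ∀ n, 0 ≤ η n := fun n => by
    simp only [hη]; split_ifs
    · norm_num
    · exact div_nonneg (hb' n).1 (hb n).1
  have hη1 : ∀ n, η n ≤ 1 := fun n => by
    simp only [hη]; split_ifs with h
    · norm_num
    · exact div_le_one_of_le₀ (not_le.1 h).le (hb n).1
  have hηb : ∀ n, η n * b n ≤ b' n := fun n => by
    simp only [hη]; split_ifs with h
    · rwa [one_mul]
    · rw [div_mul_cancel₀]; exact ((hb' n).1.trans_lt (not_le.1 h)).ne'
  have hηb' : ∀ n, (1 - η n) * b n ≤ |b n - b' n| := fun n => by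
    simp only [hη]; split_ifs with h
    · rw [sub_self, zero_mul]; exact abs_nonneg _
    · rw [sub_mul, div_mul_cancel₀ _ ((hb' n).1.trans_lt (not_le.1 h)).ne', one_mul]
      exact le_abs_self _
  have hcη : ∀ n, IsCtrl (b' n) fun s => η n * c n s := fun n =>
    ((hc n).smul_mem (hη0 n)).mono (hηb n)
  have hcη' : ∀ n, IsCtrl ((1 - η n) * b n) fun s => (1 - η n) * c n s := fun n =>
    (hc n).smul_mem (sub_nonneg.2 (hη1 n))
  set Y : ℕ → ℝ → ℝ := fun n s => b n - ∫ u in (0 : ℝ)..s, c n u with hY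
  set Y' : ℕ → ℝ → ℝ := fun n s => b' n - ∫ u in (0 : ℝ)..s, η n * c n u with hY'
  have hYR : ∀ n s, 0 ≤ s → Y n s ∈ Icc 0 R := fun n s hs =>
    ⟨sub_nonneg.2 ((hc n).integral_le hs), by
      have := (hc n).integral_nonneg hs; have := (hb n).2; simp only [hY]; linarith⟩
  have hYR' : ∀ n s, 0 ≤ s → Y' n s ∈ Icc 0 R := fun n s hs =>
    ⟨sub_nonneg.2 ((hcη n).integral_le hs), by
      have := (hcη n).integral_nonneg hs; have := (hb' n).2; simp only [hY']; linarith⟩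
  have hYY : ∀ n s, 0 ≤ s → |Y n s - Y' n s| ≤ |b n - b' n| := by
    intro n s hs
    have i0 := (hc n).integral_nonneg hs
    have i1 := (hc n).integral_le hs
    simp only [hY, hY', intervalIntegral.integral_const_mul]
    by_cases h : b n ≤ b' n
    · have : η n = 1 := if_pos h
      rw [this, one_mul]
      refine le_of_eq ?_
      congr 1
      ring
    · have h' := not_le.1 h
      have a1 : 0 ≤ (1 - η n) * ∫ u in (0 : ℝ)..s, c n u := mul_nonneg (sub_nonneg.2 (hη1 n)) i0
      have a2 : (1 - η n) * ∫ u in (0 : ℝ)..s, c n u ≤ (1 - η n) * b n :=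
        mul_le_mul_of_nonneg_left i1 (sub_nonneg.2 (hη1 n))
      have a3 := hηb' n
      rw [abs_of_pos (sub_pos.2 h')] at a3 ⊢
      rw [abs_le]
      constructor <;> nlinarith
  set E : ℕ → ℝ := fun n => ∫ s in Ioi (0 : ℝ),
    (Real.exp (-β * s) * g n s (Y n s) - Real.exp (-β * s) * h n s (Y' n s)) with hE
  have hElim : Tendsto E atTop (𝓝 0) := by
    have : Tendsto E atTop (𝓝 (∫ s in Ioi (0 : ℝ), (0 : ℝ))) := by
      refine tendsto_integral_filter_of_dominated_convergence (fun s => F s + F s)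
        (Eventually.of_forall fun n => (((hg n).integrableOn (hc n) (b n)).sub
          ((hh n).integrableOn (hcη n) (b' n))).aestronglyMeasurable) ?_ (hF.add hF) ?_
      · filter_upwards [hgF, hhF] with n hgF hhF
        filter_upwards [ae_restrict_mem measurableSet_Ioi] with s hs
        have hs' : (0 : ℝ) ≤ s := le_of_lt hs
        exact (norm_sub_le _ _).trans (add_le_add (hgF s _ hs' (hYR n s hs').2)
          (hhF s _ hs' (hYR' n s hs').2))
      · filter_upwards [ae_restrict_mem measurableSet_Ioi] with s hs
        have hs' : (0 : ℝ) ≤ s := le_of_lt hs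
        have h1 := hlim s hs (fun n => Y n s) (fun n => Y' n s) (fun n => hYR n s hs')
          (fun n => hYR' n s hs') (squeeze_zero_norm (fun n => hYY n s hs') (by simpa using hbb.abs))
        simpa [mul_sub] using h1.const_mul (Real.exp (-β * s))
    simpa using this
  have hmain : ∀ n, val U β (g n) (b n) ≤ val U β (h n) (b' n) +
      (K * (1 / β + 1) * |b n - b' n| ^ γ + E n) := by
    intro n
    have p1 := payoff_eq_add hU (hg n) (hc n) (b n)
    have p2 := payoff_eq_add hU (hh n) (hcη n) (b' n)
    have p3 := payoff_le_val hU (hh n) (hcη n)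
    have p4 : E n = (∫ s in Ioi (0 : ℝ), Real.exp (-β * s) * g n s (Y n s)) -
        ∫ s in Ioi (0 : ℝ), Real.exp (-β * s) * h n s (Y' n s) :=
      integral_sub ((hg n).integrableOn (hc n) (b n)) ((hh n).integrableOn (hcη n) (b' n))
    have p5 : ∫ s in Ioi (0 : ℝ), Real.exp (-β * s) * U (c n s) ≤
        (∫ s in Ioi (0 : ℝ), Real.exp (-β * s) * U (η n * c n s)) +
        ∫ s in Ioi (0 : ℝ), Real.exp (-β * s) * U ((1 - η n) * c n s) := by
      have i1 := hU.integrableOn hβ (hcη n)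
      have i2 := hU.integrableOn hβ (hcη' n)
      rw [← integral_add i1 i2]
      refine setIntegral_mono_on (hU.integrableOn hβ (hc n)) (i1.add i2) measurableSet_Ioi
        fun s _ => ?_
      rw [← mul_add]
      gcongr
      exact hU.mul_le ((hc n).nonneg s) (hη0 n) (hη1 n)
    have p6 := hU.integral_le hβ (hcη' n)
    have p7 : ((1 - η n) * b n) ^ γ ≤ |b n - b' n| ^ γ :=
      Real.rpow_le_rpow (mul_nonneg (sub_nonneg.2 (hη1 n)) (hb n).1) (hηb' n) hU.γ_mem.1.le
    have p8 : K * (1 / β + 1) * ((1 - η n) * b n) ^ γ ≤ K * (1 / β + 1) * |b n - b' n| ^ γ :=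
      mul_le_mul_of_nonneg_left p7 (mul_nonneg hU.K_pos.le (by positivity))
    have := hcv n
    simp only [hY, hY'] at p4
    linarith
  have hlim0 : Tendsto (fun n => K * (1 / β + 1) * |b n - b' n| ^ γ + E n) atTop (𝓝 0) := by
    have h1 : Tendsto (fun n => |b n - b' n| ^ γ) atTop (𝓝 (|(0 : ℝ)| ^ γ)) :=
      (hbb.abs).rpow_const (Or.inr hU.γ_mem.1.le)
    rw [abs_zero, Real.zero_rpow hU.γ_mem.1.ne'] at h1
    simpa using (h1.const_mul (K * (1 / β + 1))).add hElim
  filter_upwards [hlim0.eventually (gt_mem_nhds hε)] with n hn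
  linarith [hmain n]

end Stability

end IlliquidConsumption


/-! ### Perturbing an optimal rate at small times. -/

namespace IlliquidConsumption

section Perturbation

variable {U : ℝ → ℝ} {K γ β : ℝ} {g : ℝ → ℝ → ℝ} {b : ℝ} {c : ℝ → ℝ}

theorem exp_neg_mul_ge (hβ : 0 < β) {s ε : ℝ} (hs : s ≤ ε) :
    Real.exp (-β * ε) ≤ Real.exp (-β * s) := Real.exp_le_exp.2 (by nlinarith)

/-- The rate with total mass `h` uniformly spread over `E`. -/
theorem isCtrl_indicator {E : Set ℝ} (hE : MeasurableSet E) {ε h : ℝ} (hEε : E ⊆ Ioc 0 ε)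
    (hpos : 0 < volume.real E) (hh : 0 ≤ h) :
    IsCtrl h (E.indicator fun _ => h / volume.real E) ∧
      ∫ u in (0 : ℝ)..ε, E.indicator (fun _ => h / volume.real E) u = h := by
  have hfin : volume E ≠ ⊤ := ((measure_mono hEε).trans_lt measure_Ioc_lt_top).ne
  have hint : Integrable (E.indicator fun _ => h / volume.real E) volume :=
    (integrable_indicator_iff hE).2 (integrableOn_const hfin)
  have htot : ∀ A : Set ℝ, MeasurableSet A → E ⊆ A →
      ∫ u in A, E.indicator (fun _ => h / volume.real E) u = h := by
    intro A hA hEA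
    rw [setIntegral_indicator hE, inter_eq_self_of_subset_right hEA, setIntegral_const, smul_eq_mul]
    field_simp
  refine ⟨⟨measurable_const.indicator hE, fun s => indicator_nonneg
    (fun _ _ => div_nonneg hh hpos.le) s, hint.integrableOn,
    (htot _ measurableSet_Ioi fun x hx => (hEε hx).1).le⟩, ?_⟩
  have hε : 0 ≤ ε := by
    by_contra hcon
    have : E = ∅ := by
      rw [Ioc_eq_empty (by linarith)] at hEε; exact subset_empty_iff.1 hEε
    simp [this] at hpos
  rw [intervalIntegral.integral_of_le hε]
  exact htot _ measurableSet_Ioc hEε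

/-- Extra budget spent on a set where consumption is at most `κ`. -/
theorem val_add_ge (hU : IsUtility U K γ) (hg : IsRunning β g) (hc : IsCtrl b c)
    (hopt : payoff U β g b c = val U β g b) {E : Set ℝ} (hE : MeasurableSet E) {ε h κ : ℝ}
    (hEε : E ⊆ Ioc 0 ε) (hpos : 0 < volume.real E) (hh : 0 ≤ h) (hκ : ∀ s ∈ E, c s ≤ κ) :
    volume.real E * (Real.exp (-β * ε) * (U (κ + h / volume.real E) - U κ)) ≤
      val U β g (b + h) - val U β g b := by
  obtain ⟨hi, -⟩ := isCtrl_indicator hE hEε hpos hh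
  set m := volume.real E with hm
  set d : ℝ → ℝ := E.indicator fun _ => h / m with hd
  have hm0 : 0 ≤ h / m := div_nonneg hh hpos.le
  have hcd := hc.add_mem hi
  have h1 := payoff_le_val hU hg hcd
  have hfin : volume E ≠ ⊤ := ((measure_mono hEε).trans_lt measure_Ioc_lt_top).ne
  have hEI : E ⊆ Ioi 0 := fun x hx => (hEε hx).1
  have hsub : payoff U β g b c + ∫ s in Ioi (0 : ℝ), E.indicator (fun _ => Real.exp (-β * ε) *
      (U (κ + h / m) - U κ)) s ≤ payoff U β g (b + h) fun s => c s + d s := by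
    have hint : IntegrableOn (E.indicator fun _ => Real.exp (-β * ε) *
      (U (κ + h / m) - U κ)) (Ioi 0) := ((integrable_indicator_iff hE).2
        (integrableOn_const hfin)).integrableOn
    unfold payoff
    rw [← integral_add (integrableOn_payoff hU hg hc b) hint]
    refine setIntegral_mono_on ((integrableOn_payoff hU hg hc b).add hint)
      (integrableOn_payoff hU hg hcd _) measurableSet_Ioi fun s hs => ?_
    have hs' : (0 : ℝ) ≤ s := le_of_lt hs
    -- The added consumption up to any time is at most the added budget `h`, so the residual budget
    -- never falls.
    have hG : g s (b - ∫ u in (0 : ℝ)..s, c u) ≤ g s (b + h - ∫ u in (0 : ℝ)..s, (c u + d u)) := by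
      refine hg.mono s ?_
      rw [intervalIntegral.integral_add (hc.intervalIntegrable le_rfl hs')
        (hi.intervalIntegrable le_rfl hs')]
      linarith [hi.integral_le hs']
    by_cases hsE : s ∈ E
    · have hds : d s = h / m := indicator_of_mem hsE _
      rw [indicator_of_mem hsE]
      have hinc := hU.increment_anti (hc.nonneg s) (hκ s hsE) hm0
      have hκ0 : 0 ≤ κ := (hc.nonneg s).trans (hκ s hsE)
      have hpos' : 0 ≤ U (κ + h / m) - U κ :=
        sub_nonneg.2 (hU.mono (mem_Ici.2 hκ0) (mem_Ici.2 (add_nonneg hκ0 hm0)) (by linarith))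
      have he := exp_neg_mul_ge hg.pos (hEε hsE).2
      have he0 := Real.exp_pos (-β * s)
      have k1 : Real.exp (-β * ε) * (U (κ + h / m) - U κ) ≤
          Real.exp (-β * s) * (U (c s + h / m) - U (c s)) := by gcongr
      have k2 := mul_le_mul_of_nonneg_left hG he0.le
      simp only [hds] at *
      linarith
    · have hds : d s = 0 := indicator_of_notMem hsE _
      simp only [indicator_of_notMem hsE, hds, add_zero]
      gcongr
  rw [setIntegral_indicator hE, inter_eq_self_of_subset_right hEI,
    setIntegral_const, smul_eq_mul, hopt] at hsub
  linarith

/-- Concave nonnegative functions are Lipschitz away from the boundary. -/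
theorem IsRunning.sub_le (hg : IsRunning β g) {s y h r : ℝ} (hr : 0 < r) (hh : 0 ≤ h)
    (hy : r + h ≤ y) : g s y - g s (y - h) ≤ h * (g s y / r) := by
  rcases eq_or_lt_of_le hh with rfl | hh
  · simp
  have hyh : 0 < y - h := by linarith
  have h1 := (hg.concave s).slope_anti_adjacent (x := 0) (y := y - h) (z := y) self_mem_Ici
    (mem_Ici.2 (by linarith)) hyh (by linarith)
  rw [sub_sub_cancel, sub_zero, div_le_div_iff₀ hh hyh] at h1
  have h2 := hg.nonneg s 0
  have h3 := hg.mono s (show y - h ≤ y by linarith)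
  have h4 := hg.nonneg s y
  have h5 : (g s y - g s (y - h)) * r ≤ (g s y - g s (y - h)) * (y - h) :=
    mul_le_mul_of_nonneg_left (by linarith) (by linarith)
  rw [mul_div_assoc', le_div_iff₀ hr]
  nlinarith

/-- Budget saved on a set where consumption is at least `κ`. -/
theorem val_sub_le (hU : IsUtility U K γ) (hg : IsRunning β g) (hc : IsCtrl b c)
    (hopt : payoff U β g b c = val U β g b) {E : Set ℝ} (hE : MeasurableSet E) {ε h κ r D : ℝ}
    (hEε : E ⊆ Ioc 0 ε) (hpos : 0 < volume.real E) (hh : 0 ≤ h) (hκ : ∀ s ∈ E, κ ≤ c s)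
    (hhκ : h / volume.real E ≤ κ) (hr : 0 < r) (hres : r + h ≤ b - ∫ u in (0 : ℝ)..ε, c u)
    (hD : ∀ s ∈ Ioc 0 ε, g s b ≤ D) :
    val U β g b - val U β g (b - h) ≤
      volume.real E * (U κ - U (κ - h / volume.real E)) + ε * (h * (D / r)) := by
  obtain ⟨hi, hitot⟩ := isCtrl_indicator hE hEε hpos hh
  set m := volume.real E with hm
  set d : ℝ → ℝ := E.indicator fun _ => h / m with hd
  have hm0 : 0 ≤ h / m := div_nonneg hh hpos.le
  have hβ := hg.pos
  have hε : 0 < ε := by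
    obtain ⟨x, hx⟩ : E.Nonempty := by
      by_contra hcon
      rw [not_nonempty_iff_eq_empty.1 hcon] at hm
      simp [hm] at hpos
    exact (hEε hx).1.trans_le (hEε hx).2
  have hfin : volume E ≠ ⊤ := ((measure_mono hEε).trans_lt measure_Ioc_lt_top).ne
  have hEI : E ⊆ Ioi 0 := fun x hx => (hEε hx).1
  have hdle : ∀ s, d s ≤ c s := fun s => by
    by_cases hsE : s ∈ E
    · rw [hd, indicator_of_mem hsE]; exact hhκ.trans (hκ s hsE)
    · rw [hd, indicator_of_notMem hsE]; exact hc.nonneg s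
  have hcd : IsCtrl (b - h) fun s => c s - d s := by
    refine ⟨hc.measurable.sub hi.measurable, fun s => sub_nonneg.2 (hdle s),
      hc.integrable.sub hi.integrable, ?_⟩
    rw [integral_sub hc.integrable hi.integrable, hd, setIntegral_indicator hE,
      inter_eq_self_of_subset_right hEI, setIntegral_const, smul_eq_mul,
      ← hm, mul_div_cancel₀ _ hpos.ne']
    linarith [hc.total_le]
  have h1 := payoff_le_val hU hg hcd
  have hI1 : IntegrableOn (E.indicator fun _ => U κ - U (κ - h / m)) (Ioi 0) :=
    ((integrable_indicator_iff hE).2 (integrableOn_const hfin)).integrableOn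
  have hI2 : IntegrableOn ((Ioc 0 ε).indicator fun _ => h * (D / r)) (Ioi 0) :=
    ((integrable_indicator_iff measurableSet_Ioc).2
      (integrableOn_const measure_Ioc_lt_top.ne)).integrableOn
  have hI12 : IntegrableOn (fun s => E.indicator (fun _ => U κ - U (κ - h / m)) s +
      (Ioc 0 ε).indicator (fun _ => h * (D / r)) s) (Ioi 0) := hI1.add hI2
  have hsub : payoff U β g b c ≤ payoff U β g (b - h) (fun s => c s - d s) +
      ∫ s in Ioi (0 : ℝ), (E.indicator (fun _ => U κ - U (κ - h / m)) s +
        (Ioc 0 ε).indicator (fun _ => h * (D / r)) s) := by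
    unfold payoff
    rw [← integral_add (integrableOn_payoff hU hg hcd _) hI12]
    refine setIntegral_mono_on (integrableOn_payoff hU hg hc b)
      ((integrableOn_payoff hU hg hcd _).add hI12) measurableSet_Ioi fun s hs => ?_
    have hs' : (0 : ℝ) ≤ s := le_of_lt hs
    have he1 := exp_neg_mul_le_one hβ hs
    have he0 := Real.exp_pos (-β * s)
    have hcum : ∫ u in (0 : ℝ)..s, (c u - d u) = (∫ u in (0 : ℝ)..s, c u) - ∫ u in (0 : ℝ)..s, d u :=
      intervalIntegral.integral_sub (hc.intervalIntegrable le_rfl hs')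
        (hi.intervalIntegrable le_rfl hs')
    have hUpart : Real.exp (-β * s) * U (c s) ≤ Real.exp (-β * s) * U (c s - d s) +
        E.indicator (fun _ => U κ - U (κ - h / m)) s := by
      by_cases hsE : s ∈ E
      · have hds : d s = h / m := indicator_of_mem hsE _
        rw [indicator_of_mem hsE, hds]
        have hinc := hU.increment_anti (x := κ - h / m) (y := c s - h / m) (sub_nonneg.2 hhκ)
          (by linarith [hκ s hsE]) hm0
        rw [sub_add_cancel, sub_add_cancel] at hinc
        have hge : 0 ≤ U (c s) - U (c s - h / m) := by
          have := hU.mono (mem_Ici.2 (show 0 ≤ c s - h / m by linarith [hκ s hsE]))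
            (mem_Ici.2 (hc.nonneg s)) (by linarith)
          linarith
        nlinarith
      · have hds : d s = 0 := indicator_of_notMem hsE _
        rw [indicator_of_notMem hsE, hds, sub_zero, add_zero]
    have hGpart : Real.exp (-β * s) * g s (b - ∫ u in (0 : ℝ)..s, c u) ≤
        Real.exp (-β * s) * g s (b - h - ∫ u in (0 : ℝ)..s, (c u - d u)) +
        (Ioc 0 ε).indicator (fun _ => h * (D / r)) s := by
      rw [hcum]
      -- After ε the whole amount `h` has been saved, and the residual budget agrees with that of
      -- the original problem. Before ε it is lower by at most `h`, which costs at most the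
      -- Lipschitz bound on the reward.
      by_cases hsE : s ∈ Ioc 0 ε
      · rw [indicator_of_mem hsE]
        have hmn : ∫ u in (0 : ℝ)..s, c u ≤ ∫ u in (0 : ℝ)..ε, c u :=
          hc.monotoneOn_integral (mem_Ici.2 hs') (mem_Ici.2 hε.le) hsE.2
        have hi0 := hi.integral_nonneg hs'
        have hlip := hg.sub_le (s := s) (y := b - ∫ u in (0 : ℝ)..s, c u) hr hh (by linarith)
        have hmono : g s (b - (∫ u in (0 : ℝ)..s, c u) - h) ≤
            g s (b - h - ((∫ u in (0 : ℝ)..s, c u) - ∫ u in (0 : ℝ)..s, d u)) :=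
          hg.mono s (by linarith)
        have hgD : g s (b - ∫ u in (0 : ℝ)..s, c u) ≤ D :=
          (hg.mono s (by linarith [hc.integral_nonneg hs'])).trans (hD s hsE)
        have hgD' : h * (g s (b - ∫ u in (0 : ℝ)..s, c u) / r) ≤ h * (D / r) := by gcongr
        have hD0 : 0 ≤ h * (D / r) := mul_nonneg hh (div_nonneg ((hg.nonneg s _).trans hgD) hr.le)
        have k : g s (b - ∫ u in (0 : ℝ)..s, c u) ≤
            g s (b - h - ((∫ u in (0 : ℝ)..s, c u) - ∫ u in (0 : ℝ)..s, d u)) + h * (D / r) := by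
          linarith
        have k2 := mul_le_mul_of_nonneg_left k he0.le
        nlinarith
      · have hsε : ε ≤ s := by
          by_contra hcon; exact hsE ⟨hs, (not_le.1 hcon).le⟩
        rw [indicator_of_notMem hsE, add_zero]
        have hdt : ∫ u in (0 : ℝ)..s, d u = h := by
          rw [← hitot]
          refine le_antisymm ?_ (hi.monotoneOn_integral (mem_Ici.2 hε.le) (mem_Ici.2 hs') hsε)
          rw [hitot]; exact hi.integral_le hs'
        rw [hdt]
        refine le_of_eq ?_
        congr 2
        ring
    linarith
  rw [integral_add hI1 hI2, setIntegral_indicator hE,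
    inter_eq_self_of_subset_right hEI, setIntegral_const, smul_eq_mul,
    setIntegral_indicator measurableSet_Ioc, inter_eq_self_of_subset_right Ioc_subset_Ioi_self,
    setIntegral_const, smul_eq_mul, hopt, Real.volume_real_Ioc_of_le hε.le, sub_zero] at hsub
  linarith

/-- Supergradients of the value are squeezed by the marginal utility of optimal consumption. -/
theorem ae_supergradient_bounds (hU : IsUtility U K γ) (hg : IsRunning β g) (hc : IsCtrl b c)
    (hopt : payoff U β g b c = val U β g b) {ε r D q : ℝ} (hr : 0 < r)
    (hres : 2 * r ≤ b - ∫ u in (0 : ℝ)..ε, c u) (hε : 0 ≤ ε)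
    (hD : ∀ s ∈ Ioc 0 ε, g s b ≤ D)
    (hq : ∀ y, 0 ≤ y → val U β g y ≤ val U β g b + q * (y - b)) :
    ∀ᵐ s, s ∈ Ioc 0 ε → 0 < c s ∧ Real.exp (-β * ε) * deriv U (c s) ≤ q ∧
      q ≤ deriv U (c s) + ε * (D / r) := by
  have hb := hc.nonneg_budget
  -- If consumption is at most κ on a set of positive measure, the extra budget is chosen as that
  -- measure times `κ' - κ`, so that spreading it there lifts the reference level exactly from κ to
  -- κ'.
  have hup : ∀ κ κ' : ℝ, 0 ≤ κ → κ < κ' → ∀ᵐ s, s ∈ Ioc 0 ε → c s ≤ κ →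
      Real.exp (-β * ε) * deriv U κ' ≤ q := by
    intro κ κ' hκ hκκ'
    set E := Ioc 0 ε ∩ c ⁻¹' Iic κ with hE
    have hEm : MeasurableSet E := measurableSet_Ioc.inter (hc.measurable measurableSet_Iic)
    by_cases h0 : volume E = 0
    · filter_upwards [measure_eq_zero_iff_ae_notMem.1 h0] with s hs h1 h2
      exact absurd ⟨h1, h2⟩ hs
    · refine Eventually.of_forall fun _ _ _ => ?_
      have hpos : 0 < volume.real E := ENNReal.toReal_pos h0
        ((measure_mono inter_subset_left).trans_lt measure_Ioc_lt_top).ne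
      have hh : 0 ≤ volume.real E * (κ' - κ) := mul_nonneg hpos.le (by linarith)
      have h1 := val_add_ge hU hg hc hopt hEm inter_subset_left hpos hh fun s hs => hs.2
      have h2 := hq (b + volume.real E * (κ' - κ)) (by linarith)
      rw [mul_div_cancel_left₀ _ hpos.ne', add_sub_cancel] at h1
      have h3 := hU.deriv_le_slope hκ hκκ'
      rw [add_sub_cancel_left] at h2
      have h4 : volume.real E * (Real.exp (-β * ε) * (deriv U κ' * (κ' - κ))) ≤
          q * (volume.real E * (κ' - κ)) := by
        refine le_trans ?_ (h1.trans (by linarith))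
        gcongr
      have h5 : 0 < volume.real E * (κ' - κ) := mul_pos hpos (by linarith)
      refine le_of_mul_le_mul_right (le_trans (le_of_eq ?_) h4) h5
      ring
  have hdown : ∀ κ κ' : ℝ, 0 < κ' → κ' < κ → ∀ᵐ s, s ∈ Ioc 0 ε → κ ≤ c s →
      q ≤ deriv U κ' + ε * (D / r) := by
    intro κ κ' hκ' hκκ'
    set E := Ioc 0 ε ∩ c ⁻¹' Ici κ with hE
    have hEm : MeasurableSet E := measurableSet_Ioc.inter (hc.measurable measurableSet_Ici)
    by_cases h0 : volume E = 0
    · filter_upwards [measure_eq_zero_iff_ae_notMem.1 h0] with s hs h1 h2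
      exact absurd ⟨h1, h2⟩ hs
    · refine Eventually.of_forall fun _ _ _ => ?_
      have hpos : 0 < volume.real E := ENNReal.toReal_pos h0
        ((measure_mono inter_subset_left).trans_lt measure_Ioc_lt_top).ne
      -- The first bound keeps the reduced rate above `κ'`; the second keeps the total saving below
      -- `r`, so that the residual budget stays away from 0 where the reward is Lipschitz.
      set δ := min (κ - κ') (r / volume.real E) with hδ
      have hδ0 : 0 < δ := lt_min (by linarith) (div_pos hr hpos)
      have hh : 0 ≤ volume.real E * δ := mul_nonneg hpos.le hδ0.le
      have hhr : volume.real E * δ ≤ r := by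
        rw [mul_comm, ← le_div_iff₀ hpos]; exact min_le_right _ _
      have hdiv : volume.real E * δ / volume.real E = δ := mul_div_cancel_left₀ _ hpos.ne'
      have hδκ : δ ≤ κ - κ' := min_le_left _ _
      have h1 := val_sub_le hU hg hc hopt hEm inter_subset_left hpos hh (fun s hs => hs.2)
        (by rw [hdiv]; linarith) hr (by linarith) hD
      have hbr : r ≤ b := by linarith [hc.integral_nonneg hε]
      have h2 := hq (b - volume.real E * δ) (by linarith)
      rw [hdiv] at h1
      have h3 := hU.slope_le_deriv (x := κ - δ) (y := κ) (by linarith) (by linarith)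
      have h3' : deriv U (κ - δ) ≤ deriv U κ' :=
        hU.strictAntiOn_deriv.antitoneOn hκ' (mem_Ioi.2 (by linarith)) (by linarith)
      have h6 : U κ - U (κ - δ) ≤ deriv U κ' * δ := by
        rw [sub_sub_cancel] at h3
        exact h3.trans (mul_le_mul_of_nonneg_right h3' hδ0.le)
      have h4 : q * (volume.real E * δ) ≤ (deriv U κ' + ε * (D / r)) * (volume.real E * δ) := by
        have := mul_le_mul_of_nonneg_left h6 hpos.le
        nlinarith
      exact le_of_mul_le_mul_right h4 (mul_pos hpos hδ0)
  -- Only rational levels are used, so that a single null set serves all of them; real levels are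
  -- recovered below by monotonicity of `U'`.
  have hall1 : ∀ᵐ s, ∀ κ κ' : ℚ, (0 : ℝ) ≤ κ → (κ : ℝ) < κ' → s ∈ Ioc 0 ε → c s ≤ κ →
      Real.exp (-β * ε) * deriv U κ' ≤ q := by
    rw [ae_all_iff]; intro κ
    rw [ae_all_iff]; intro κ'
    by_cases h : (0 : ℝ) ≤ κ ∧ (κ : ℝ) < κ'
    · filter_upwards [hup κ κ' h.1 h.2] with s hs _ _ using hs
    · exact Eventually.of_forall fun s h1 h2 => absurd ⟨h1, h2⟩ h
  have hall2 : ∀ᵐ s, ∀ κ κ' : ℚ, (0 : ℝ) < κ' → (κ' : ℝ) < κ → s ∈ Ioc 0 ε → κ ≤ c s →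
      q ≤ deriv U κ' + ε * (D / r) := by
    rw [ae_all_iff]; intro κ
    rw [ae_all_iff]; intro κ'
    by_cases h : (0 : ℝ) < κ' ∧ (κ' : ℝ) < κ
    · filter_upwards [hdown κ κ' h.1 h.2] with s hs _ _ using hs
    · exact Eventually.of_forall fun s h1 h2 => absurd ⟨h1, h2⟩ h
  filter_upwards [hall1, hall2] with s hs1 hs2 hsε
  have hup' : ∀ x, c s < x → Real.exp (-β * ε) * deriv U x ≤ q := by
    intro x hx
    obtain ⟨κ, hκ1, hκ2⟩ := exists_rat_btwn hx
    obtain ⟨κ', hκ1', hκ2'⟩ := exists_rat_btwn hκ2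
    have hκ0 : (0 : ℝ) ≤ κ := (hc.nonneg s).trans hκ1.le
    have hκ0' : (0 : ℝ) < κ' := hκ0.trans_lt hκ1'
    refine le_trans ?_ (hs1 κ κ' hκ0 hκ1' hsε hκ1.le)
    gcongr
    exact hU.strictAntiOn_deriv.antitoneOn hκ0' (mem_Ioi.2 (hκ0'.trans hκ2')) hκ2'.le
  have hdown' : ∀ x, 0 < x → x < c s → q ≤ deriv U x + ε * (D / r) := by
    intro x hx0 hx
    obtain ⟨κ', hκ1', hκ2'⟩ := exists_rat_btwn hx
    obtain ⟨κ, hκ1, hκ2⟩ := exists_rat_btwn hκ2'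
    refine (hs2 κ κ' (hx0.trans hκ1') hκ1 hsε hκ2.le).trans ?_
    gcongr
    exact hU.strictAntiOn_deriv.antitoneOn hx0 (mem_Ioi.2 (hx0.trans hκ1')) hκ1'.le
  -- At a point of zero consumption the upper estimate would bound `U'` near 0 by a multiple of `q`,
  -- against `U'(0+) = ∞`.
  have hcs : 0 < c s := by
    refine lt_of_le_of_ne (hc.nonneg s) fun h0 => ?_
    obtain ⟨x, hx, hx0⟩ := ((hU.inada_zero.eventually
      (eventually_gt_atTop (q / Real.exp (-β * ε)))).and self_mem_nhdsWithin).exists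
    have := hup' x (by rw [← h0]; exact hx0)
    rw [div_lt_iff₀ (Real.exp_pos _)] at hx
    linarith
  have hcont : ContinuousAt (deriv U) (c s) :=
    (hU.continuousOn_deriv).continuousAt (Ioi_mem_nhds hcs)
  refine ⟨hcs, ?_, ?_⟩
  · have h1 : Tendsto (fun x => Real.exp (-β * ε) * deriv U x) (𝓝[>] (c s))
        (𝓝 (Real.exp (-β * ε) * deriv U (c s))) :=
      (hcont.tendsto.mono_left nhdsWithin_le_nhds).const_mul _
    refine le_of_tendsto h1 ?_
    filter_upwards [self_mem_nhdsWithin] with x hx using hup' x hx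
  · have h1 : Tendsto (fun x => deriv U x + ε * (D / r)) (𝓝[<] (c s))
        (𝓝 (deriv U (c s) + ε * (D / r))) :=
      (hcont.tendsto.mono_left nhdsWithin_le_nhds).add_const _
    refine ge_of_tendsto h1 ?_
    filter_upwards [Ioo_mem_nhdsLT hcs] with x hx using hdown' x hx.1 hx.2

end Perturbation

end IlliquidConsumption


/-! ### Differentiability of the value in the budget. -/

namespace IlliquidConsumption

section Differentiability

variable {U : ℝ → ℝ} {K γ β : ℝ} {g : ℝ → ℝ → ℝ} {b : ℝ} {c : ℝ → ℝ}

/-- A supergradient on the half line. -/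
def IsSupergradient (f : ℝ → ℝ) (b q : ℝ) : Prop := ∀ y, 0 ≤ y → f y ≤ f b + q * (y - b)

theorem IsRunning.exists_le_on_Icc (hg : IsRunning β g) (T b : ℝ) :
    ∃ D, 0 ≤ D ∧ ∀ s ∈ Icc 0 T, g s b ≤ D := by
  have hc : Continuous fun s => g s b := hg.cont.comp (f := fun s => (s, b)) (by fun_prop)
  obtain ⟨D, hD⟩ := (isCompact_Icc (a := (0 : ℝ)) (b := T)).bddAbove_image hc.continuousOn
  exact ⟨max D 0, le_max_right _ _, fun s hs => (hD ⟨s, hs, rfl⟩).trans (le_max_left _ _)⟩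

/-- Over a short time less than half of the budget is spent. The number `b / 4` will serve as the
margin `r` in `ae_supergradient_bounds`. -/
theorem IsCtrl.exists_residual_ge (hc : IsCtrl b c) (hb : 0 < b) :
    ∃ δ, 0 < δ ∧ δ ≤ 1 ∧ ∀ ε, 0 < ε → ε < δ → 2 * (b / 4) ≤ b - ∫ u in (0 : ℝ)..ε, c u := by
  have h := hc.continuousOn_integral 0 self_mem_Ici
  have h0 : (fun s => ∫ u in (0 : ℝ)..s, c u) 0 < b / 2 := by simpa using hb
  obtain ⟨δ, hδ, hball⟩ := Metric.mem_nhdsWithin_iff.1 (h.eventually (gt_mem_nhds h0))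
  refine ⟨min δ 1, lt_min hδ one_pos, min_le_right _ _, fun ε hε hεδ => ?_⟩
  have := hball (a := ε) ⟨by
    rw [Metric.mem_ball, Real.dist_eq, sub_zero, abs_of_pos hε]
    exact hεδ.trans_le (min_le_left _ _), hε.le⟩
  simp only [mem_ofPred_eq] at this
  linarith

theorem exists_of_ae_Ioc {p : ℝ → Prop} {ε : ℝ} (hε : 0 < ε) (h : ∀ᵐ s, s ∈ Ioc 0 ε → p s) :
    ∃ s ∈ Ioc 0 ε, p s := by
  by_contra hcon
  push Not at hcon
  have : volume (Ioc 0 ε) = 0 := by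
    rw [measure_eq_zero_iff_ae_notMem]
    filter_upwards [h] with s hs hs' using hcon s hs' (hs hs')
  rw [Real.volume_Ioc, ENNReal.ofReal_eq_zero] at this
  linarith

/-- Both supergradients are compared with the marginal utility `U'(c_s)` of the same optimal rate at
one common time `s ≤ ε`; the discrepancy disappears as `ε → 0`. -/
theorem supergradient_le (hU : IsUtility U K γ) (hg : IsRunning β g) (hb : 0 < b) {q q' : ℝ}
    (hq : IsSupergradient (val U β g) b q) (hq' : IsSupergradient (val U β g) b q') : q ≤ q' := by
  obtain ⟨c, hc, hopt⟩ := exists_optimal hU hg hb.le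
  obtain ⟨D, hD0, hD⟩ := hg.exists_le_on_Icc 1 b
  obtain ⟨δ, hδ, hδ1, hres⟩ := hc.exists_residual_ge hb
  have key : ∀ ε, 0 < ε → ε < δ → q ≤ Real.exp (β * ε) * q' + ε * (D / (b / 4)) := by
    intro ε hε hεδ
    have hDε : ∀ s ∈ Ioc 0 ε, g s b ≤ D := fun s hs => hD s ⟨hs.1.le, by linarith [hs.2]⟩
    have h1 := ae_supergradient_bounds hU hg hc hopt (by positivity) (hres ε hε hεδ) hε.le hDε hq
    have h2 := ae_supergradient_bounds hU hg hc hopt (by positivity) (hres ε hε hεδ) hε.le hDε hq'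
    obtain ⟨s, -, ⟨-, -, h3⟩, -, h4, -⟩ := exists_of_ae_Ioc hε (by
      filter_upwards [h1, h2] with s a1 a2 hs using And.intro (a1 hs) (a2 hs))
    refine h3.trans (add_le_add ?_ le_rfl)
    have h5 := mul_le_mul_of_nonneg_left h4 (Real.exp_nonneg (β * ε))
    rwa [← mul_assoc, ← Real.exp_add, show β * ε + -β * ε = 0 by ring, Real.exp_zero, one_mul] at h5
  have hlim : Tendsto (fun ε => Real.exp (β * ε) * q' + ε * (D / (b / 4))) (𝓝[>] 0)
      (𝓝 (Real.exp (β * 0) * q' + 0 * (D / (b / 4)))) :=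
    ((by fun_prop : Continuous fun ε => Real.exp (β * ε) * q' + ε * (D / (b / 4))).tendsto 0).mono_left
      nhdsWithin_le_nhds
  rw [mul_zero, Real.exp_zero, one_mul, zero_mul, add_zero] at hlim
  refine ge_of_tendsto hlim ?_
  filter_upwards [Ioo_mem_nhdsGT hδ] with ε hε using key ε hε.1 hε.2

/-- By concavity both one-sided derivatives are supergradients, so uniqueness of the supergradient
makes them equal. The signs are reversed because the argument runs through the convex function
`-val`. -/
theorem val_differentiableAt (hU : IsUtility U K γ) (hg : IsRunning β g) (hb : 0 < b) :
    DifferentiableAt ℝ (val U β g) b := by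
  have hconc := val_concaveOn hU hg
  have hconv : ConvexOn ℝ (Ici 0) (-val U β g) := hconc.neg
  have hint : b ∈ interior (Ici (0 : ℝ)) := by rw [interior_Ici]; exact hb
  have hR := hconv.hasDerivWithinAt_rightDeriv_of_mem_interior hint
  have hL := hconv.hasDerivWithinAt_leftDeriv_of_mem_interior hint
  have hLR := hconv.leftDeriv_le_rightDeriv_of_mem_interior hint
  set r := derivWithin (-val U β g) (Ioi b) b
  set l := derivWithin (-val U β g) (Iio b) b
  have hRs : ∀ y, b < y → r * (y - b) ≤ -val U β g y + val U β g b := fun y hy => by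
    have := hconv.le_slope_of_hasDerivWithinAt_Ioi (mem_Ici.2 hb.le)
      (mem_Ici.2 (hb.le.trans hy.le)) hy hR
    rw [slope_def_field, le_div_iff₀ (by linarith)] at this
    simpa using this
  have hLs : ∀ y, 0 ≤ y → y < b → -val U β g b + val U β g y ≤ l * (b - y) := fun y hy0 hy => by
    have := hconv.slope_le_of_hasDerivWithinAt_Iio (mem_Ici.2 hy0) (mem_Ici.2 hb.le) hy hL
    rw [slope_def_field, div_le_iff₀ (by linarith)] at this
    simpa using this
  have hsup : ∀ q, l ≤ q → q ≤ r → IsSupergradient (val U β g) b (-q) := by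
    intro q hlq hqr y hy0
    rcases lt_trichotomy y b with h | h | h
    · have := hLs y hy0 h
      nlinarith
    · simp [h]
    · have := hRs y h
      nlinarith
  have heq : l = r := by
    have := supergradient_le hU hg hb (hsup l le_rfl hLR) (hsup r hLR le_rfl)
    linarith
  rw [heq] at hL
  have h : HasDerivAt (-val U β g) r b := by
    rw [hasDerivWithinAt_Iio_iff_Iic] at hL
    rw [hasDerivWithinAt_Ioi_iff_Ici] at hR
    have := hL.union hR
    rwa [Iic_union_Ici, hasDerivWithinAt_univ] at this
  simpa using h.differentiableAt.neg

theorem isSupergradient_deriv (hU : IsUtility U K γ) (hg : IsRunning β g) (hb : 0 < b) :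
    IsSupergradient (val U β g) b (deriv (val U β g) b) := by
  have hconc := val_concaveOn hU hg
  have hd := (val_differentiableAt hU hg hb).hasDerivAt
  intro y hy
  rcases lt_trichotomy y b with h | h | h
  · have := hconc.le_slope_of_hasDerivAt (mem_Ici.2 hy) (mem_Ici.2 hb.le) h hd
    rw [slope_def_field, le_div_iff₀ (by linarith)] at this
    linarith
  · simp [h]
  · have := hconc.slope_le_of_hasDerivAt (mem_Ici.2 hb.le) (mem_Ici.2 hy) h hd
    rw [slope_def_field, div_le_iff₀ (by linarith)] at this
    linarith

theorem val_deriv_anti (hU : IsUtility U K γ) (hg : IsRunning β g) {x y : ℝ} (hx : 0 < x)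
    (hxy : x ≤ y) : deriv (val U β g) y ≤ deriv (val U β g) x := by
  rcases eq_or_lt_of_le hxy with rfl | h
  · exact le_rfl
  have h1 := isSupergradient_deriv hU hg hx y (hx.le.trans hxy)
  have h2 := isSupergradient_deriv hU hg (hx.trans h) x hx.le
  by_contra hcon
  nlinarith [not_le.1 hcon]

/-- A quantitative lower bound for the marginal value. -/
theorem val_deriv_ge (hU : IsUtility U K γ) (hg : IsRunning β g) (hb : 0 < b) :
    Real.exp (-β) * deriv U (3 * b) ≤ deriv (val U β g) b := by
  obtain ⟨c, hc, hopt⟩ := exists_optimal hU hg hb.le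
  -- A rate above `2 * b` on almost all of `(0, 1]` would spend more than `b`, so this set has
  -- positive measure. Adding `b` per unit of time on it raises the reference level from `2 * b` to
  -- `3 * b`, which is where `U'` is evaluated.
  set E := Ioc 0 1 ∩ c ⁻¹' Iic (2 * b) with hE
  have hEm : MeasurableSet E := measurableSet_Ioc.inter (hc.measurable measurableSet_Iic)
  have h0 : volume E ≠ 0 := by
    intro h0
    have h1 : ∀ᵐ s, s ∈ Ioc (0 : ℝ) 1 → 2 * b ≤ c s := by
      filter_upwards [measure_eq_zero_iff_ae_notMem.1 h0] with s hs h1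
      by_contra hcon
      exact hs ⟨h1, (not_le.1 hcon).le⟩
    have h2 : ∫ _ in Ioc (0 : ℝ) 1, 2 * b ≤ ∫ s in Ioc (0 : ℝ) 1, c s :=
      setIntegral_mono_on_ae (integrableOn_const measure_Ioc_lt_top.ne)
        (hc.integrable.mono_set Ioc_subset_Ioi_self) measurableSet_Ioc h1
    have h3 := hc.integral_le zero_le_one
    rw [intervalIntegral.integral_of_le zero_le_one] at h3
    rw [setIntegral_const, Real.volume_real_Ioc_of_le zero_le_one] at h2
    simp only [sub_zero, one_smul] at h2
    linarith
  have hpos : 0 < volume.real E := ENNReal.toReal_pos h0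
    ((measure_mono inter_subset_left).trans_lt measure_Ioc_lt_top).ne
  have hh : 0 ≤ volume.real E * b := mul_nonneg hpos.le hb.le
  have h1 := val_add_ge hU hg hc hopt hEm inter_subset_left hpos hh fun s hs => hs.2
  have h2 := isSupergradient_deriv hU hg hb (b + volume.real E * b) (by linarith)
  have h3 := hU.deriv_le_slope (x := 2 * b) (y := 2 * b + b) (by linarith) (by linarith)
  rw [mul_div_cancel_left₀ _ hpos.ne', mul_one] at h1
  rw [show 2 * b + b = 3 * b by ring] at h1 h3
  rw [show 3 * b - 2 * b = b by ring] at h3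
  have h4 : volume.real E * (Real.exp (-β) * (deriv U (3 * b) * b)) ≤
      deriv (val U β g) b * (volume.real E * b) := by
    refine le_trans ?_ (h1.trans (by rw [add_sub_cancel_left] at h2; linarith))
    gcongr
  refine le_of_mul_le_mul_right (le_trans (le_of_eq ?_) h4) (mul_pos hpos hb)
  ring

theorem val_deriv_pos (hU : IsUtility U K γ) (hg : IsRunning β g) (hb : 0 < b) :
    0 < deriv (val U β g) b :=
  (mul_pos (Real.exp_pos _) (hU.deriv_pos (by linarith))).trans_le (val_deriv_ge hU hg hb)

theorem tendsto_val_deriv (hU : IsUtility U K γ) (hg : IsRunning β g) :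
    Tendsto (deriv (val U β g)) (𝓝[>] 0) atTop := by
  have h3 : Tendsto (fun b : ℝ => 3 * b) (𝓝[>] 0) (𝓝[>] 0) := by
    refine tendsto_nhdsWithin_iff.2 ⟨?_, ?_⟩
    · have := ((continuous_const_mul (3 : ℝ)).tendsto 0).mono_left (nhdsWithin_le_nhds (s := Ioi 0))
      simpa using this
    · filter_upwards [self_mem_nhdsWithin] with b hb
      have : (0 : ℝ) < b := hb
      simpa using this
  refine tendsto_atTop_mono' _ ?_ ((hU.inada_zero.comp h3).const_mul_atTop (Real.exp_pos (-β)))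
  filter_upwards [self_mem_nhdsWithin] with b hb using val_deriv_ge hU hg hb

end Differentiability

/-! ### Continuous families of deterministic problems. -/

section Family

variable {Θ : Type*} [TopologicalSpace Θ]

/-- A continuous family of reward functions `G θ s y`. -/
structure IsReward (β : ℝ) (G : Θ → ℝ → ℝ → ℝ) : Prop where
  cont : Continuous fun q : Θ × ℝ × ℝ => G q.1 q.2.1 q.2.2
  nonneg : ∀ θ s y, 0 ≤ G θ s y
  mono : ∀ θ s, Monotone (G θ s)
  concave : ∀ θ s, ConcaveOn ℝ (Ici 0) (G θ s)
  bound : ∃ r, 0 ≤ r ∧ r < β ∧ ∀ θ₀ R, ∃ B, 0 ≤ B ∧ ∀ᶠ θ in 𝓝 θ₀, ∀ s y, y ≤ R →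
    G θ s y ≤ B * Real.exp (r * |s|)

variable {U : ℝ → ℝ} {K γ β : ℝ} {G : Θ → ℝ → ℝ → ℝ}

theorem IsReward.running (hG : IsReward β G) (θ : Θ) (t : ℝ) : IsRunning β fun s => G θ (t + s) := by
  refine ⟨hG.cont.comp (f := fun q : ℝ × ℝ => (θ, t + q.1, q.2)) (by fun_prop),
    fun s => hG.nonneg _ _, fun s => hG.mono _ _, fun s => hG.concave _ _, ?_⟩
  obtain ⟨r, h0, h1, h⟩ := hG.bound
  refine ⟨r, h0, h1, fun R => ?_⟩
  obtain ⟨B, hB0, hB⟩ := h θ R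
  refine ⟨B * Real.exp (r * |t|), by positivity, fun s y hs hy => ?_⟩
  refine (hB.self_of_nhds (t + s) y hy).trans ?_
  rw [mul_assoc, ← Real.exp_add, ← mul_add]
  gcongr
  exact (abs_add_le t s).trans (by rw [abs_of_nonneg hs])

/-- The value of the problem started at time `t` with budget `b`. -/
noncomputable def famVal (U : ℝ → ℝ) (β : ℝ) (G : Θ → ℝ → ℝ → ℝ) (θ : Θ) (t b : ℝ) : ℝ :=
  val U β (fun s => G θ (t + s)) b

/-- The budgets need not converge: they stay in a compact interval and their differences vanish,
which is all that is known of residual budgets along varying optimal rates. Convergent subsequences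
then suffice. -/
theorem tendsto_sub_of_continuous [FirstCountableTopology Θ] {F : Θ × ℝ → ℝ} (hF : Continuous F)
    {R : ℝ} {p p' : ℕ → Θ} {θ : Θ} (hp : Tendsto p atTop (𝓝 θ)) (hp' : Tendsto p' atTop (𝓝 θ))
    {y y' : ℕ → ℝ} (hy : ∀ n, y n ∈ Icc 0 R) (hyy : Tendsto (fun n => y n - y' n) atTop (𝓝 0)) :
    Tendsto (fun n => F (p n, y n) - F (p' n, y' n)) atTop (𝓝 0) := by
  refine tendsto_of_subseq_tendsto fun ns hns => ?_
  obtain ⟨a, -, φ, hφ, hlim⟩ := isCompact_Icc.tendsto_subseq fun n => hy (ns n)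
  refine ⟨φ, ?_⟩
  have hnφ := hns.comp hφ.tendsto_atTop
  have h2 : Tendsto (fun n => y' (ns (φ n))) atTop (𝓝 a) := by
    have := hlim.sub (hyy.comp hnφ)
    simpa using this
  have h3 := ((hF.tendsto (θ, a)).comp ((hp.comp hnφ).prodMk_nhds hlim)).sub
    ((hF.tendsto (θ, a)).comp ((hp'.comp hnφ).prodMk_nhds h2))
  simpa using h3

/-- The growth rate `r < β` of the reward is uniform in the parameter and the constant is locally
uniform, so one integrable majorant serves the whole sequence. Used twice with exchanged roles, this
one-sided bound gives joint continuity. -/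
theorem famVal_seq_le [FirstCountableTopology Θ] (hU : IsUtility U K γ) (hG : IsReward β G)
    {p p' : ℕ → Θ} {θ : Θ} (hp : Tendsto p atTop (𝓝 θ)) (hp' : Tendsto p' atTop (𝓝 θ))
    {t t' : ℕ → ℝ} {t₀ : ℝ} (ht : Tendsto t atTop (𝓝 t₀)) (ht' : Tendsto t' atTop (𝓝 t₀))
    {b b' : ℕ → ℝ} {b₀ : ℝ} (hb : Tendsto b atTop (𝓝 b₀)) (hb' : Tendsto b' atTop (𝓝 b₀))
    (hb0 : ∀ n, 0 ≤ b n) (hb0' : ∀ n, 0 ≤ b' n) {ε : ℝ} (hε : 0 < ε) :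
    ∀ᶠ n in atTop, famVal U β G (p n) (t n) (b n) ≤ famVal U β G (p' n) (t' n) (b' n) + ε := by
  obtain ⟨R1, hR1⟩ := hb.bddAbove_range
  obtain ⟨R2, hR2⟩ := hb'.bddAbove_range
  obtain ⟨r, hr0, hrβ, h⟩ := hG.bound
  have hβ : 0 < β := hr0.trans_lt hrβ
  obtain ⟨B, hB0, hB⟩ := h θ (max R1 R2)
  have hdom : ∀ {p : ℕ → Θ} {t : ℕ → ℝ}, Tendsto p atTop (𝓝 θ) → Tendsto t atTop (𝓝 t₀) →
      ∀ᶠ n in atTop, ∀ s y, 0 ≤ s → y ≤ max R1 R2 → ‖Real.exp (-β * s) * G (p n) (t n + s) y‖ ≤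
        B * Real.exp (r * (|t₀| + 1)) * Real.exp (-(β - r) * s) := by
    intro p t hp ht
    filter_upwards [hp.eventually hB, ht.abs.eventually (gt_mem_nhds (lt_add_one |t₀|))]
      with n hn hn' s y hs hy
    rw [Real.norm_of_nonneg (mul_nonneg (Real.exp_nonneg _) (hG.nonneg _ _ _))]
    have h1 : |t n + s| ≤ |t₀| + 1 + s := (abs_add_le _ _).trans (by
      rw [abs_of_nonneg hs]; linarith)
    calc Real.exp (-β * s) * G (p n) (t n + s) y ≤
          Real.exp (-β * s) * (B * Real.exp (r * |t n + s|)) := by gcongr; exact hn _ _ hy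
      _ ≤ Real.exp (-β * s) * (B * Real.exp (r * (|t₀| + 1 + s))) := by gcongr
      _ = B * (Real.exp (-β * s) * Real.exp (r * (|t₀| + 1 + s))) := by ring
      _ = _ := by
        rw [mul_assoc, ← Real.exp_add, ← Real.exp_add]; ring_nf
  refine eventually_val_le hU hβ (R := max R1 R2) (fun n => hG.running _ _)
    (fun n => hG.running _ _) (fun n => ⟨hb0 n, (hR1 ⟨n, rfl⟩).trans (le_max_left _ _)⟩)
    (fun n => ⟨hb0' n, (hR2 ⟨n, rfl⟩).trans (le_max_right _ _)⟩) (by simpa using hb.sub hb')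
    ((integrableOn_exp_neg_mul (by linarith : 0 < β - r)).const_mul _) (hdom hp ht) (hdom hp' ht')
    ?_ hε
  intro s _ y y' hy _ hyy
  have hF : Continuous fun q : (Θ × ℝ) × ℝ => G q.1.1 q.1.2 q.2 :=
    hG.cont.comp (f := fun q : (Θ × ℝ) × ℝ => (q.1.1, q.1.2, q.2)) (by fun_prop)
  exact tendsto_sub_of_continuous hF (p := fun n => (p n, t n + s)) (p' := fun n => (p' n, t' n + s))
    (hp.prodMk_nhds (ht.add_const s)) (hp'.prodMk_nhds (ht'.add_const s)) hy hyy

/-- The value is jointly continuous. -/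
theorem continuous_famVal [FirstCountableTopology Θ] (hU : IsUtility U K γ) (hG : IsReward β G) :
    Continuous fun q : Θ × ℝ × ℝ => famVal U β G q.1 q.2.1 (max q.2.2 0) := by
  rw [continuous_iff_continuousAt]
  intro q
  refine tendsto_of_seq_tendsto fun u hu => ?_
  have h1 : Tendsto (fun n => (u n).1) atTop (𝓝 q.1) := (continuous_fst.tendsto q).comp hu
  have h2 : Tendsto (fun n => (u n).2.1) atTop (𝓝 q.2.1) :=
    ((continuous_fst.comp continuous_snd).tendsto q).comp hu
  have h3 : Tendsto (fun n => max (u n).2.2 0) atTop (𝓝 (max q.2.2 0)) :=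
    (((continuous_snd.comp continuous_snd).max continuous_const).tendsto q).comp hu
  rw [Metric.tendsto_atTop']
  intro ε hε
  obtain ⟨N, hN⟩ := eventually_atTop.1 ((famVal_seq_le hU hG h1 (tendsto_const_nhds (x := q.1)) h2
    (tendsto_const_nhds (x := q.2.1)) h3 (tendsto_const_nhds (x := max q.2.2 0))
    (fun n => le_max_right _ _) (fun n => le_max_right _ _) (half_pos hε)).and
    (famVal_seq_le hU hG (tendsto_const_nhds (x := q.1)) h1 (tendsto_const_nhds (x := q.2.1)) h2
    (tendsto_const_nhds (x := max q.2.2 0)) h3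
    (fun n => le_max_right _ _) (fun n => le_max_right _ _) (half_pos hε)))
  refine ⟨N, fun n hn => ?_⟩
  obtain ⟨h4, h5⟩ := hN n hn.le
  rw [Real.dist_eq, abs_lt]
  simp only [Function.comp_apply]
  constructor <;> linarith

end Family

end IlliquidConsumption


/-! ### The feedback rate and the optimal path. -/

namespace IlliquidConsumption

section Feedback

variable {Θ : Type*} [TopologicalSpace Θ] {U : ℝ → ℝ} {K γ β : ℝ} {G : Θ → ℝ → ℝ → ℝ}

/-- The feedback consumption rate, as a function of the residual budget. -/
noncomputable def fbRate {Θ : Type*} (U : ℝ → ℝ) (β : ℝ) (G : Θ → ℝ → ℝ → ℝ) (θ : Θ) (t b : ℝ) : ℝ :=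
  open Classical in
  if 0 < b then Function.invFunOn (deriv U) (Ioi 0) (deriv (famVal U β G θ t) b) else 0

theorem famVal_le_add_deriv (hU : IsUtility U K γ) (hG : IsReward β G) {θ : Θ} {t b h : ℝ}
    (hb : 0 < b) (hh : 0 ≤ b + h) :
    famVal U β G θ t (b + h) ≤ famVal U β G θ t b + deriv (famVal U β G θ t) b * h := by
  have h3 := isSupergradient_deriv hU (hG.running θ t) hb (b + h) hh
  rwa [add_sub_cancel_left] at h3

theorem famVal_deriv_pos (hU : IsUtility U K γ) (hG : IsReward β G) {θ : Θ} {t b : ℝ} (hb : 0 < b) :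
    0 < deriv (famVal U β G θ t) b :=
  val_deriv_pos hU (hG.running θ t) hb

omit [TopologicalSpace Θ] in
theorem fbRate_of_pos {θ : Θ} {t b : ℝ} (hb : 0 < b) : fbRate U β G θ t b =
    Function.invFunOn (deriv U) (Ioi 0) (deriv (famVal U β G θ t) b) := if_pos hb

omit [TopologicalSpace Θ] in
theorem fbRate_of_nonpos {θ : Θ} {t b : ℝ} (hb : b ≤ 0) : fbRate U β G θ t b = 0 :=
  if_neg (not_lt.2 hb)

theorem fbRate_nonneg (hU : IsUtility U K γ) (hG : IsReward β G) (θ : Θ) (t b : ℝ) :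
    0 ≤ fbRate U β G θ t b := by
  rcases le_or_gt b 0 with h | h
  · rw [fbRate_of_nonpos h]
  · rw [fbRate_of_pos h]; exact (hU.inv_pos (famVal_deriv_pos hU hG h)).le

/-- The marginal value decreases in the budget by concavity, and `(U')⁻¹` is decreasing. This
monotonicity replaces a Lipschitz condition in the uniqueness and continuity arguments for the
feedback equation. -/
theorem fbRate_mono (hU : IsUtility U K γ) (hG : IsReward β G) (θ : Θ) (t : ℝ) :
    Monotone (fbRate U β G θ t) := by
  intro x y hxy
  rcases le_or_gt x 0 with h | h
  · rw [fbRate_of_nonpos h]; exact fbRate_nonneg hU hG θ t y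
  · rw [fbRate_of_pos h, fbRate_of_pos (h.trans_le hxy)]
    exact hU.inv_anti (famVal_deriv_pos hU hG (h.trans_le hxy))
      (val_deriv_anti hU (hG.running θ t) h hxy)

/-- A difference quotient with fixed step `h` is continuous in all parameters, and by concavity it
bounds the derivative from one side, depending on the sign of `h`. Differentiability at the limit
point makes the two bounds meet. -/
theorem continuousAt_famVal_deriv [FirstCountableTopology Θ] (hU : IsUtility U K γ)
    (hG : IsReward β G) {q : Θ × ℝ × ℝ} (hq : 0 < q.2.2) :
    ContinuousAt (fun q : Θ × ℝ × ℝ => deriv (famVal U β G q.1 q.2.1) q.2.2) q := by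
  have hd := (val_differentiableAt hU (hG.running q.1 q.2.1) hq).hasDerivAt
  have hpos : ∀ᶠ p : Θ × ℝ × ℝ in 𝓝 q, 0 < p.2.2 :=
    ((continuous_snd.comp continuous_snd).tendsto q).eventually (lt_mem_nhds hq)
  have hc := continuous_famVal hU hG
  have hcont : ∀ h : ℝ, Tendsto (fun p : Θ × ℝ × ℝ => famVal U β G p.1 p.2.1 (max (p.2.2 + h) 0))
      (𝓝 q) (𝓝 (famVal U β G q.1 q.2.1 (max (q.2.2 + h) 0))) := fun h =>
    (hc.comp (f := fun p : Θ × ℝ × ℝ => (p.1, p.2.1, p.2.2 + h)) (by fun_prop)).tendsto q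
  have hcont0 : Tendsto (fun p : Θ × ℝ × ℝ => famVal U β G p.1 p.2.1 (max p.2.2 0))
      (𝓝 q) (𝓝 (famVal U β G q.1 q.2.1 (max q.2.2 0))) := hc.tendsto q
  rw [ContinuousAt, tendsto_order]
  constructor
  · intro a ha
    have h1 := hd.tendsto_slope_zero_right
    obtain ⟨h, hh, h0⟩ := ((h1.eventually (lt_mem_nhds ha)).and self_mem_nhdsWithin).exists
    have h0' : (0 : ℝ) < h := h0
    rw [smul_eq_mul, inv_mul_eq_div, lt_div_iff₀ h0'] at hh
    have h2 := (hcont h).sub hcont0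
    rw [max_eq_left (by linarith : 0 ≤ q.2.2 + h), max_eq_left hq.le] at h2
    filter_upwards [h2.eventually (lt_mem_nhds hh), hpos] with p hp hp0
    rw [max_eq_left (by linarith : 0 ≤ p.2.2 + h), max_eq_left hp0.le] at hp
    have h3 := famVal_le_add_deriv hU hG (θ := p.1) (t := p.2.1) hp0 (h := h) (by linarith)
    have h4 : a * h < deriv (famVal U β G p.1 p.2.1) p.2.2 * h := by linarith
    exact lt_of_mul_lt_mul_right h4 h0'.le
  · intro a ha
    have h1 := hd.tendsto_slope_zero_left
    obtain ⟨h, hh, h0⟩ := ((h1.eventually (gt_mem_nhds ha)).and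
      (Ioo_mem_nhdsLT (show -q.2.2 < 0 by linarith))).exists
    have hneg : h < 0 := h0.2
    have hq' : 0 < q.2.2 + h := by linarith [h0.1]
    rw [smul_eq_mul, inv_mul_eq_div, div_lt_iff_of_neg hneg] at hh
    have h2 := (hcont h).sub hcont0
    rw [max_eq_left hq'.le, max_eq_left hq.le] at h2
    have hpos' : ∀ᶠ p : Θ × ℝ × ℝ in 𝓝 q, 0 < p.2.2 + h :=
      (((continuous_snd.comp continuous_snd).add continuous_const).tendsto q).eventually
        (lt_mem_nhds hq')
    filter_upwards [h2.eventually (lt_mem_nhds hh), hpos, hpos'] with p hp hp0 hp1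
    rw [max_eq_left hp1.le, max_eq_left hp0.le] at hp
    have h3 := famVal_le_add_deriv hU hG (θ := p.1) (t := p.2.1) hp0 (h := h) hp1.le
    have h4 : a * h < deriv (famVal U β G p.1 p.2.1) p.2.2 * h := by linarith
    by_contra hcon
    nlinarith [not_lt.1 hcon]

theorem tendsto_famVal_deriv [FirstCountableTopology Θ] (hU : IsUtility U K γ)
    (hG : IsReward β G) {θ : Θ} {t : ℕ → ℝ} {t' : ℝ} {b : ℕ → ℝ} {b' : ℝ}
    (ht : Tendsto t atTop (𝓝 t')) (hb : Tendsto b atTop (𝓝 b')) (hb' : 0 < b') :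
    Tendsto (fun n => deriv (famVal U β G θ (t n)) (b n)) atTop
      (𝓝 (deriv (famVal U β G θ t') b')) := by
  have h1 : Tendsto (fun q : Θ × ℝ × ℝ => deriv (famVal U β G q.1 q.2.1) q.2.2) (𝓝 (θ, t', b'))
      (𝓝 (deriv (famVal U β G θ t') b')) :=
    continuousAt_famVal_deriv hU hG (q := (θ, t', b')) hb'
  have h2 : Tendsto (fun n => ((θ, t n, b n) : Θ × ℝ × ℝ)) atTop (𝓝 (θ, t', b')) :=
    tendsto_const_nhds.prodMk_nhds (ht.prodMk_nhds hb)
  refine (h1.comp h2).congr fun n => ?_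
  rw [Function.comp_apply]

/-- The feedback rate is jointly continuous. -/
theorem continuous_fbRate [FirstCountableTopology Θ] (hU : IsUtility U K γ) (hG : IsReward β G) :
    Continuous fun q : Θ × ℝ × ℝ => fbRate U β G q.1 q.2.1 q.2.2 := by
  rw [continuous_iff_continuousAt]
  intro q
  have hsnd : Continuous fun p : Θ × ℝ × ℝ => p.2.2 := continuous_snd.comp continuous_snd
  rcases lt_or_ge 0 q.2.2 with h | h
  · have h1 := ContinuousAt.comp (f := fun p : Θ × ℝ × ℝ => deriv (famVal U β G p.1 p.2.1) p.2.2)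
      (x := q) (hU.continuousAt_inv (famVal_deriv_pos hU hG h)) (continuousAt_famVal_deriv hU hG h)
    refine h1.congr ?_
    filter_upwards [(hsnd.tendsto q).eventually (lt_mem_nhds h)] with p hp
    exact (fbRate_of_pos hp).symm
  · rw [ContinuousAt, fbRate_of_nonpos h, tendsto_order]
    refine ⟨fun a ha => Eventually.of_forall fun p => ha.trans_le (fbRate_nonneg hU hG _ _ _),
      fun ε hε => ?_⟩
    -- Near zero budget the marginal value is at least `exp (-β) * U' (3 * b)`, uniformly in the
    -- parameters, so the rate falls below any `ε`.
    have h3 : Tendsto (fun b : ℝ => Real.exp (-β) * deriv U b) (𝓝[>] 0) atTop :=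
      hU.inada_zero.const_mul_atTop (Real.exp_pos _)
    obtain ⟨δ, hδ, hball⟩ := mem_nhdsGT_iff_exists_Ioo_subset.1
      (h3.eventually (eventually_ge_atTop (deriv U (ε / 2))))
    have hδ' : (0 : ℝ) < δ := hδ
    filter_upwards [(hsnd.tendsto q).eventually (gt_mem_nhds (show q.2.2 < δ / 3 by linarith))]
      with p hp
    rcases le_or_gt p.2.2 0 with h0 | h0
    · rwa [fbRate_of_nonpos h0]
    · rw [fbRate_of_pos h0]
      have h4 : deriv U (ε / 2) ≤ Real.exp (-β) * deriv U (3 * p.2.2) :=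
        hball ⟨by linarith, by linarith⟩
      have h5 := h4.trans (val_deriv_ge hU (hG.running p.1 p.2.1) h0)
      exact (hU.inv_le_of_deriv_le (half_pos hε) h5).trans_lt (by linarith)

theorem ae_comp_add_left {p : ℝ → Prop} (s : ℝ) (h : ∀ᵐ u, p (s + u)) : ∀ᵐ v, p v := by
  have := (measurePreserving_add_left volume (-s)).quasiMeasurePreserving.ae h
  simpa using this

/-- An optimal rate is given by the feedback map almost everywhere. -/
theorem ae_eq_fbRate [FirstCountableTopology Θ] (hU : IsUtility U K γ) (hG : IsReward β G)
    {θ : Θ} {t b : ℝ} {c : ℝ → ℝ} (hc : IsCtrl b c)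
    (hopt : payoff U β (fun s => G θ (t + s)) b c = famVal U β G θ t b) :
    ∀ᵐ u ∂volume.restrict (Ioi (0 : ℝ)),
      c u = fbRate U β G θ (t + u) (b - ∫ v in (0 : ℝ)..u, c v) := by
  set Y : ℝ → ℝ := fun u => b - ∫ v in (0 : ℝ)..u, c v with hY
  have hg := hG.running θ t
  have hYc : ContinuousOn Y (Ici 0) := continuousOn_const.sub hc.continuousOn_integral
  have hYanti : ∀ {x y : ℝ}, 0 ≤ x → x ≤ y → Y y ≤ Y x := fun hx hxy => by
    have := hc.monotoneOn_integral (mem_Ici.2 hx) (mem_Ici.2 (hx.trans hxy)) hxy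
    simp only [hY]; linarith
  have hY0 : ∀ {x : ℝ}, 0 ≤ x → 0 ≤ Y x := fun hx => sub_nonneg.2 (hc.integral_le hx)
  choose D hD0 hD using fun T => hg.exists_le_on_Icc T b
  -- The supergradient squeeze is applied to the tail starting at `s`, on the window `(s, s']`. The
  -- later time `T`, with budget still positive, makes the error constant independent of the window.
  have hbounds : ∀ s s' T : ℚ, (0 : ℝ) ≤ s → (s : ℝ) < s' → (s' : ℝ) ≤ T → 0 < Y T →
      ∀ᵐ u, u ∈ Ioc (s : ℝ) s' → 0 < c u ∧
        Real.exp (-β * (s' - s)) * deriv U (c u) ≤ deriv (famVal U β G θ (t + s)) (Y s) ∧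
        deriv (famVal U β G θ (t + s)) (Y s) ≤ deriv U (c u) + (s' - s) * (D T / (Y T / 2)) := by
    intro s s' T hs hss hsT hYT
    have htail := payoff_tail_eq_val hU hg hc hopt hs
    have hct := hc.tail hs
    have hres : 2 * (Y T / 2) ≤ b - (∫ u in (0 : ℝ)..s, c u) -
        ∫ u in (0 : ℝ)..(s' - s : ℝ), c (s + u) := by
      have e := hc.integral_add hs (sub_nonneg.2 hss.le)
      rw [add_sub_cancel] at e
      have := hYanti (hs.trans hss.le) hsT
      simp only [hY] at this ⊢
      linarith
    have hYs : 0 < Y s := hYT.trans_le (hYanti hs (hss.le.trans hsT))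
    have hfam : val U β (fun u => G θ (t + (s + u))) = famVal U β G θ (t + s) := by
      unfold famVal
      simp only [add_assoc]
    have hsup := isSupergradient_deriv hU (hg.shift hs) hYs
    have h1 := ae_supergradient_bounds hU (hg.shift hs) hct htail (half_pos hYT) hres
      (sub_nonneg.2 hss.le) (D := D T) (fun u hu => (hg.mono _ (by
        linarith [hc.integral_nonneg hs])).trans (hD T _ ⟨by linarith [hu.1], by
          linarith [hu.2]⟩)) hsup
    rw [hfam] at h1
    refine ae_comp_add_left (s : ℝ) ?_
    filter_upwards [h1] with u hu hu'
    exact hu ⟨by linarith [hu'.1], by linarith [hu'.2]⟩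
  have hall : ∀ᵐ u, ∀ s s' T : ℚ, (0 : ℝ) ≤ s → (s : ℝ) < s' → (s' : ℝ) ≤ T → 0 < Y T →
      u ∈ Ioc (s : ℝ) s' → 0 < c u ∧
        Real.exp (-β * (s' - s)) * deriv U (c u) ≤ deriv (famVal U β G θ (t + s)) (Y s) ∧
        deriv (famVal U β G θ (t + s)) (Y s) ≤ deriv U (c u) + (s' - s) * (D T / (Y T / 2)) := by
    simp only [ae_all_iff]
    exact hbounds
  -- Once the budget is exhausted the remaining rate is nonnegative with zero integral, hence zero
  -- almost everywhere.
  have hzero : ∀ᵐ u, ∀ T : ℚ, (0 : ℝ) ≤ T → Y T = 0 → (T : ℝ) < u → c u = 0 := by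
    simp only [ae_all_iff]
    intro T hT hYT
    have hct := hc.tail hT
    have h1 : ∫ u in Ioi (0 : ℝ), c (T + u) = 0 :=
      le_antisymm (hct.total_le.trans (le_of_eq hYT)) (integral_nonneg fun u => hct.nonneg u)
    have h2 := (integral_eq_zero_iff_of_nonneg (fun u => hct.nonneg u) hct.integrable).1 h1
    refine ae_comp_add_left (T : ℝ) ?_
    filter_upwards [(ae_restrict_iff' measurableSet_Ioi).1 h2] with u hu hu'
    exact hu (mem_Ioi.2 (by linarith))
  -- The rational times only control what happens strictly after exhaustion; the first exhaustion
  -- time itself is at most one point.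
  have hnull : ∀ᵐ u, u ∉ {u : ℝ | 0 < u ∧ Y u = 0 ∧ ∀ T : ℚ, (0 : ℝ) ≤ T → (T : ℝ) < u → Y T ≠ 0} := by
    refine measure_eq_zero_iff_ae_notMem.1 (Set.Subsingleton.measure_zero ?_ _)
    have aux : ∀ u v : ℝ, (0 < u ∧ Y u = 0) → (∀ T : ℚ, (0 : ℝ) ≤ T → (T : ℝ) < v → Y T ≠ 0) →
        ¬ u < v := by
      rintro u v ⟨hu0, hu⟩ hv huv
      obtain ⟨T, hT1, hT2⟩ := exists_rat_btwn huv
      exact hv T (hu0.trans hT1).le hT2 (le_antisymm ((hYanti hu0.le hT1.le).trans hu.le)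
        (hY0 (hu0.trans hT1).le))
    rintro u ⟨hu0, hu, hu'⟩ v ⟨hv0, hv, hv'⟩
    exact le_antisymm (not_lt.1 (aux v u ⟨hv0, hv⟩ hu')) (not_lt.1 (aux u v ⟨hu0, hu⟩ hv'))
  rw [ae_restrict_iff' measurableSet_Ioi]
  filter_upwards [hall, hzero, hnull] with u h1 h2 h3 hu
  have hu0 : (0 : ℝ) < u := hu
  change c u = fbRate U β G θ (t + u) (Y u)
  rcases eq_or_lt_of_le (hY0 hu0.le) with hYu | hYu
  · rw [← hYu, fbRate_of_nonpos le_rfl]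
    by_contra hcu
    exact h3 ⟨hu0, hYu.symm, fun T hT hTu hYT => hcu (h2 T hT hYT hTu)⟩
  · have hev : ∀ᶠ x in 𝓝[>] u, 0 < Y x := by
      have := (hYc u hu0.le).eventually (lt_mem_nhds hYu)
      exact nhdsWithin_mono u (fun x hx => hu0.le.trans (le_of_lt hx)) this
    obtain ⟨T', hT'u, hT'⟩ := (mem_nhdsGT_iff_exists_Ioo_subset.1 hev)
    have hT'u' : u < T' := hT'u
    obtain ⟨T, hT1, hT2⟩ := exists_rat_btwn hT'u'
    have hYT : 0 < Y T := hT' ⟨hT1, hT2⟩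
    -- Windows with rational endpoints shrink to `u`: the discount tends to 1, the error to 0, and
    -- the marginal value at the left endpoint converges by continuity.
    obtain ⟨a, ha_mono, ha_lt, ha_lim⟩ := Real.exists_seq_rat_strictMono_tendsto u
    obtain ⟨d, hd_anti, hd_gt, hd_lim⟩ := Real.exists_seq_rat_strictAnti_tendsto u
    have hev2 : ∀ᶠ n in atTop, 0 < c u ∧
        Real.exp (-β * (d n - a n)) * deriv U (c u) ≤ deriv (famVal U β G θ (t + a n)) (Y (a n)) ∧
        deriv (famVal U β G θ (t + a n)) (Y (a n)) ≤
          deriv U (c u) + (d n - a n) * (D T / (Y T / 2)) := by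
      filter_upwards [ha_lim.eventually (lt_mem_nhds hu0), hd_lim.eventually (gt_mem_nhds hT1)]
        with n hn1 hn2
      exact h1 (a n) (d n) T hn1.le ((ha_lt n).trans (hd_gt n)) hn2.le hYT ⟨ha_lt n, (hd_gt n).le⟩
    have hcu : 0 < c u := hev2.exists.choose_spec.1
    have hqlim : Tendsto (fun n => deriv (famVal U β G θ (t + a n)) (Y (a n))) atTop
        (𝓝 (deriv (famVal U β G θ (t + u)) (Y u))) := by
      have hYa : Tendsto (fun n => Y (a n)) atTop (𝓝 (Y u)) :=
        ((hYc u hu0.le).continuousAt (Ici_mem_nhds hu0)).tendsto.comp ha_lim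
      exact tendsto_famVal_deriv hU hG (ha_lim.const_add t) hYa hYu
    have hda : Tendsto (fun n => ((d n : ℝ) - a n)) atTop (𝓝 0) := by
      simpa using hd_lim.sub ha_lim
    have hl : Tendsto (fun n => Real.exp (-β * (d n - a n)) * deriv U (c u)) atTop
        (𝓝 (deriv U (c u))) := by
      have := ((Real.continuous_exp.tendsto _).comp (hda.const_mul (-β))).mul_const (deriv U (c u))
      simpa using this
    have hr : Tendsto (fun n => deriv U (c u) + (d n - a n) * (D T / (Y T / 2))) atTop
        (𝓝 (deriv U (c u))) := by
      simpa using (hda.mul_const (D T / (Y T / 2))).const_add (deriv U (c u))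
    have heq : deriv (famVal U β G θ (t + u)) (Y u) = deriv U (c u) :=
      le_antisymm (le_of_tendsto_of_tendsto hqlim hr (hev2.mono fun n hn => hn.2.2))
        (le_of_tendsto_of_tendsto hl hqlim (hev2.mono fun n hn => hn.2.1))
    rw [fbRate_of_pos hYu, heq, hU.inv_deriv hcu]

/-- Existence of an optimal path driven by the feedback map. -/
theorem exists_fbPath [FirstCountableTopology Θ] (hU : IsUtility U K γ) (hG : IsReward β G)
    (θ : Θ) (b : ℝ) : ∃ Y : ℝ → ℝ, 0 ≤ b → Y 0 = b ∧ Continuous Y ∧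
      (∀ s, HasDerivAt Y (-fbRate U β G θ s (Y s)) s ∨ s < 0) ∧
      (∀ s, 0 ≤ s → 0 ≤ Y s) ∧ IsCtrl b (fun s => fbRate U β G θ s (Y s)) ∧
      (∀ s, 0 ≤ s → b - ∫ u in (0 : ℝ)..s, fbRate U β G θ u (Y u) = Y s) ∧
      payoff U β (G θ) b (fun s => fbRate U β G θ s (Y s)) = famVal U β G θ 0 b := by
  rcases lt_or_ge b 0 with hb | hb
  -- The path is chosen for every real `b` so that it can be named by a total function; for negative
  -- `b` it carries no content.
  · exact ⟨0, fun h => absurd h (not_le.2 hb)⟩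
  obtain ⟨c, hc, hopt⟩ := exists_optimal hU (hG.running θ 0) hb
  have hae := ae_eq_fbRate hU hG hc hopt
  set Y₀ : ℝ → ℝ := fun s => b - ∫ v in (0 : ℝ)..(max s 0), c v with hY₀
  have hY₀c : Continuous Y₀ := continuous_const.sub
    (hc.continuousOn_integral.comp_continuous (continuous_id.max continuous_const)
      fun s => mem_Ici.2 (le_max_right _ _))
  -- The optimal rate agrees almost everywhere with this continuous function. Integrating the latter
  -- instead makes the path differentiable at every time, not merely at almost every time.
  set F : ℝ → ℝ := fun s => fbRate U β G θ s (Y₀ s) with hF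
  have hFc : Continuous F := (continuous_fbRate hU hG).comp
    (f := fun s => (θ, s, Y₀ s)) (by fun_prop)
  have hcF : c =ᵐ[volume.restrict (Ioi 0)] F := by
    filter_upwards [hae, ae_restrict_mem measurableSet_Ioi] with s hs hs0
    rw [hs]
    simp only [hF, hY₀, zero_add, max_eq_left (mem_Ioi.1 hs0).le]
  set Y : ℝ → ℝ := fun s => b - ∫ v in (0 : ℝ)..s, F v with hY
  have hYY : ∀ s, 0 ≤ s → Y s = Y₀ s := fun s hs => by
    simp only [hY, hY₀, max_eq_left hs, integral_congr_of_ae_Ioi hcF hs]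
  have hFY : ∀ s, 0 ≤ s → F s = fbRate U β G θ s (Y s) := fun s hs => by rw [hYY s hs]
  have hYd : ∀ s, HasDerivAt Y (-F s) s := fun s => by
    simpa using (hFc.integral_hasStrictDerivAt 0 s).hasDerivAt.const_sub b
  have hYc : Continuous Y := continuous_iff_continuousAt.2 fun s => (hYd s).continuousAt
  have hcY : c =ᵐ[volume.restrict (Ioi 0)] fun s => fbRate U β G θ s (Y s) := by
    filter_upwards [hcF, ae_restrict_mem measurableSet_Ioi] with s hs hs0
    rw [hs, hFY s (le_of_lt hs0)]
  refine ⟨Y, fun _ => ⟨by simp [hY], hYc, fun s => ?_, fun s hs => ?_, ⟨?_, fun s => fbRate_nonneg hU hG _ _ _,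
    hc.integrable.congr hcY, (integral_congr_ae hcY).symm.le.trans hc.total_le⟩, fun s hs => ?_, ?_⟩⟩
  · rcases lt_or_ge s 0 with h | h
    · exact Or.inr h
    · rw [← hFY s h]; exact Or.inl (hYd s)
  · rw [hYY s hs]; simp only [hY₀, max_eq_left hs]; exact sub_nonneg.2 (hc.integral_le hs)
  · exact ((continuous_fbRate hU hG).comp (f := fun s => (θ, s, Y s)) (by fun_prop)).measurable
  · rw [← integral_congr_of_ae_Ioi hcY hs, integral_congr_of_ae_Ioi hcF hs]
  · rw [← payoff_congr_ae hcY]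
    simp only [zero_add] at hopt
    rw [hopt, famVal]
    simp only [zero_add]

/-- Uniqueness for decreasing feedback equations. -/
theorem eqOn_of_feedback {f : ℝ → ℝ → ℝ} (hf : ∀ s, Monotone (f s)) {t₀ t₁ : ℝ} {Y Y' : ℝ → ℝ}
    (h0 : Y t₀ = Y' t₀) (hY : ContinuousOn Y (Icc t₀ t₁)) (hY' : ContinuousOn Y' (Icc t₀ t₁))
    (hd : ∀ s ∈ Ioc t₀ t₁, HasDerivWithinAt Y (-f s (Y s)) (Icc t₀ t₁) s)
    (hd' : ∀ s ∈ Ioc t₀ t₁, HasDerivWithinAt Y' (-f s (Y' s)) (Icc t₀ t₁) s) :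
    EqOn Y Y' (Icc t₀ t₁) := by
  -- The squared distance of two solutions is nonincreasing, since the larger solution also consumes
  -- at least as fast.
  have hder : ∀ s ∈ interior (Icc t₀ t₁), HasDerivAt (fun s => (Y s - Y' s) ^ 2)
      (2 * (Y s - Y' s) * (-f s (Y s) - -f s (Y' s))) s := by
    intro s hs
    rw [interior_Icc] at hs
    have hn := Icc_mem_nhds hs.1 hs.2
    have h1 := ((hd s ⟨hs.1, hs.2.le⟩).hasDerivAt hn).sub ((hd' s ⟨hs.1, hs.2.le⟩).hasDerivAt hn)
    simpa using h1.fun_pow 2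
  have hanti : AntitoneOn (fun s => (Y s - Y' s) ^ 2) (Icc t₀ t₁) := by
    refine antitoneOn_of_deriv_nonpos (convex_Icc _ _) ((hY.sub hY').pow 2)
      (fun s hs => (hder s hs).differentiableAt.differentiableWithinAt) fun s hs => ?_
    rw [(hder s hs).deriv]
    rcases le_total (Y s) (Y' s) with h | h
    · nlinarith [hf s h]
    · nlinarith [hf s h]
  intro s hs
  have h1 := hanti (left_mem_Icc.2 (hs.1.trans hs.2)) hs hs.1
  simp only [h0, sub_self] at h1
  nlinarith [sq_nonneg (Y s - Y' s), pow_eq_zero_iff (two_ne_zero) |>.1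
    (le_antisymm (by simpa using h1) (sq_nonneg (Y s - Y' s)))]

/-- The flow of the feedback equation. -/
noncomputable def fbFlow [FirstCountableTopology Θ] (hU : IsUtility U K γ) (hG : IsReward β G)
    (θ : Θ) (b : ℝ) : ℝ → ℝ :=
  (exists_fbPath hU hG θ b).choose

/-! ### Dependence of the feedback flow on its data. -/

section Flow

variable [FirstCountableTopology Θ] (hU : IsUtility U K γ) (hG : IsReward β G) (θ : Θ) {b : ℝ}

theorem fbFlow_zero (hb : 0 ≤ b) : fbFlow hU hG θ b 0 = b :=
  ((exists_fbPath hU hG θ b).choose_spec hb).1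

theorem continuous_fbFlow (hb : 0 ≤ b) : Continuous (fbFlow hU hG θ b) :=
  ((exists_fbPath hU hG θ b).choose_spec hb).2.1

theorem hasDerivAt_fbFlow (hb : 0 ≤ b) {s : ℝ} (hs : 0 ≤ s) : HasDerivAt (fbFlow hU hG θ b)
    (-fbRate U β G θ s (fbFlow hU hG θ b s)) s :=
  (((exists_fbPath hU hG θ b).choose_spec hb).2.2.1 s).resolve_right (not_lt.2 hs)

theorem fbFlow_nonneg (hb : 0 ≤ b) {s : ℝ} (hs : 0 ≤ s) : 0 ≤ fbFlow hU hG θ b s :=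
  ((exists_fbPath hU hG θ b).choose_spec hb).2.2.2.1 s hs

theorem isCtrl_fbFlow (hb : 0 ≤ b) :
    IsCtrl b fun s => fbRate U β G θ s (fbFlow hU hG θ b s) :=
  ((exists_fbPath hU hG θ b).choose_spec hb).2.2.2.2.1

theorem integral_fbFlow (hb : 0 ≤ b) {s : ℝ} (hs : 0 ≤ s) :
    b - ∫ u in (0 : ℝ)..s, fbRate U β G θ u (fbFlow hU hG θ b u) = fbFlow hU hG θ b s :=
  ((exists_fbPath hU hG θ b).choose_spec hb).2.2.2.2.2.1 s hs

theorem payoff_fbFlow (hb : 0 ≤ b) :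
    payoff U β (G θ) b (fun s => fbRate U β G θ s (fbFlow hU hG θ b s)) = famVal U β G θ 0 b :=
  ((exists_fbPath hU hG θ b).choose_spec hb).2.2.2.2.2.2

/-- Barrier argument with the line `|b - b'| + M * s`. When the difference touches it, the first
path is the higher one and, by monotonicity, consumes at least `fbRate θ` of the second path, so the
difference grows more slowly than `M`. Only the rates along the second path need to be compared. -/
theorem fbFlow_sub_le {θ θ' : Θ} {b b' T M : ℝ} (hb : 0 ≤ b) (hb' : 0 ≤ b') (hT : 0 ≤ T)
    (h1 : ∀ s ∈ Icc 0 T, fbRate U β G θ' s (fbFlow hU hG θ' b' s) <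
      fbRate U β G θ s (fbFlow hU hG θ' b' s) + M) (hM : 0 ≤ M) :
    fbFlow hU hG θ b T - fbFlow hU hG θ' b' T ≤ |b - b'| + M * T := by
  refine image_le_of_deriv_right_lt_deriv_boundary
    (f := fun s => fbFlow hU hG θ b s - fbFlow hU hG θ' b' s)
    (f' := fun s => -fbRate U β G θ s (fbFlow hU hG θ b s) -
      -fbRate U β G θ' s (fbFlow hU hG θ' b' s)) (B := fun s => |b - b'| + M * s)
    (B' := fun _ => M) (a := 0) (b := T)
    ((continuous_fbFlow hU hG θ hb).sub (continuous_fbFlow hU hG θ' hb')).continuousOn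
    (fun s hs => ((hasDerivAt_fbFlow hU hG θ hb hs.1).sub
      (hasDerivAt_fbFlow hU hG θ' hb' hs.1)).hasDerivWithinAt) ?_ (fun s => ?_) (fun s hs he => ?_)
    (right_mem_Icc.2 hT)
  · simp only [fbFlow_zero hU hG _ hb, fbFlow_zero hU hG _ hb', mul_zero, add_zero]
    exact le_abs_self _
  · simpa using ((hasDerivAt_id s).const_mul M).const_add (|b - b'|)
  · have h2 : fbFlow hU hG θ' b' s ≤ fbFlow hU hG θ b s := by
      have : 0 ≤ |b - b'| + M * s := add_nonneg (abs_nonneg _) (mul_nonneg hM hs.1)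
      linarith
    have h3 := fbRate_mono hU hG θ s h2
    have h4 := h1 s ⟨hs.1, hs.2.le⟩
    linarith

theorem fbFlow_sub_le' {θ θ' : Θ} {b b' T M : ℝ} (hb : 0 ≤ b) (hb' : 0 ≤ b') (hT : 0 ≤ T)
    (h1 : ∀ s ∈ Icc 0 T, fbRate U β G θ s (fbFlow hU hG θ' b' s) <
      fbRate U β G θ' s (fbFlow hU hG θ' b' s) + M) (hM : 0 ≤ M) :
    fbFlow hU hG θ' b' T - fbFlow hU hG θ b T ≤ |b - b'| + M * T := by
  refine image_le_of_deriv_right_lt_deriv_boundary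
    (f := fun s => fbFlow hU hG θ' b' s - fbFlow hU hG θ b s)
    (f' := fun s => -fbRate U β G θ' s (fbFlow hU hG θ' b' s) -
      -fbRate U β G θ s (fbFlow hU hG θ b s)) (B := fun s => |b - b'| + M * s)
    (B' := fun _ => M) (a := 0) (b := T)
    ((continuous_fbFlow hU hG θ' hb').sub (continuous_fbFlow hU hG θ hb)).continuousOn
    (fun s hs => ((hasDerivAt_fbFlow hU hG θ' hb' hs.1).sub
      (hasDerivAt_fbFlow hU hG θ hb hs.1)).hasDerivWithinAt) ?_ (fun s => ?_) (fun s hs he => ?_)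
    (right_mem_Icc.2 hT)
  · simp only [fbFlow_zero hU hG _ hb, fbFlow_zero hU hG _ hb', mul_zero, add_zero]
    rw [abs_sub_comm]
    exact le_abs_self _
  · simpa using ((hasDerivAt_id s).const_mul M).const_add (|b - b'|)
  · have h2 : fbFlow hU hG θ b s ≤ fbFlow hU hG θ' b' s := by
      have : 0 ≤ |b - b'| + M * s := add_nonneg (abs_nonneg _) (mul_nonneg hM hs.1)
      linarith
    have h3 := fbRate_mono hU hG θ s h2
    have h4 := h1 s ⟨hs.1, hs.2.le⟩
    linarith

/-- The flow depends continuously on the parameter and the initial budget. -/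
theorem continuous_fbFlow_param {T : ℝ} (hT : 0 ≤ T) :
    Continuous fun q : Θ × ℝ => fbFlow hU hG q.1 (max q.2 0) T := by
  rw [continuous_iff_continuousAt]
  rintro ⟨θ', b₀⟩
  set b' := max b₀ 0 with hb'
  have hb0 : 0 ≤ b' := le_max_right _ _
  rw [ContinuousAt, Metric.tendsto_nhds]
  intro ε hε
  set M := ε / (2 * (T + 1)) with hM
  have hM0 : 0 < M := by positivity
  have hMT : M * T < ε / 2 := by
    rw [hM, div_mul_eq_mul_div, div_lt_iff₀ (by positivity)]
    nlinarith
  have hF : Continuous fun q : Θ × ℝ => fbRate U β G q.1 q.2 (fbFlow hU hG θ' b' q.2) :=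
    (continuous_fbRate hU hG).comp (f := fun q : Θ × ℝ => (q.1, q.2, fbFlow hU hG θ' b' q.2))
      (continuous_fst.prodMk (continuous_snd.prodMk
        ((continuous_fbFlow hU hG θ' hb0).comp continuous_snd)))
  -- Along the fixed limiting path the time interval is compact, so joint continuity of the rate is
  -- uniform in time.
  have hev : ∀ᶠ θ in 𝓝 θ', ∀ s ∈ Icc 0 T,
      |fbRate U β G θ s (fbFlow hU hG θ' b' s) - fbRate U β G θ' s (fbFlow hU hG θ' b' s)| < M := by
    refine isCompact_Icc.eventually_forall_of_forall_eventually fun s _ => ?_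
    have h1 : Continuous fun q : Θ × ℝ => |fbRate U β G q.1 q.2 (fbFlow hU hG θ' b' q.2) -
        fbRate U β G θ' q.2 (fbFlow hU hG θ' b' q.2)| :=
      (hF.sub (hF.comp (f := fun q : Θ × ℝ => (θ', q.2)) (by fun_prop))).abs
    exact (h1.tendsto (θ', s)).eventually (gt_mem_nhds (by simpa using hM0))
  have hevb : ∀ᶠ x : ℝ in 𝓝 b₀, |max x 0 - b'| < ε / 2 := by
    have h1 : Continuous fun x : ℝ => |max x 0 - b'| := by fun_prop
    exact (h1.tendsto b₀).eventually (gt_mem_nhds (by simpa [hb'] using hε))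
  rw [nhds_prod_eq]
  filter_upwards [hev.prod_mk hevb] with q hq
  obtain ⟨hq1, hq2⟩ := hq
  have a1 := fbFlow_sub_le hU hG (θ := q.1) (θ' := θ') (b := max q.2 0) (b' := b')
    (le_max_right _ _) hb0 hT (M := M) (fun s hs => by linarith [(abs_lt.1 (hq1 s hs)).1]) hM0.le
  have a2 := fbFlow_sub_le' hU hG (θ := q.1) (θ' := θ') (b := max q.2 0) (b' := b')
    (le_max_right _ _) hb0 hT (M := M) (fun s hs => by linarith [(abs_lt.1 (hq1 s hs)).2]) hM0.le
  rw [Real.dist_eq, abs_lt]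
  constructor <;> linarith

end Flow

end Feedback

end IlliquidConsumption


/-! ### Measurable maximisers and candidate value functions. -/

namespace IlliquidConsumption

/-- A continuous function on a compact rectangle has a measurable selection of maximisers. -/
theorem exists_measurable_argmax {F : ℝ → ℝ → ℝ} (hF : Continuous fun q : ℝ × ℝ => F q.1 q.2)
    {lo hi : ℝ} (hlh : lo ≤ hi) : ∃ π : ℝ → ℝ, Measurable π ∧
      ∀ x, π x ∈ Icc lo hi ∧ ∀ r ∈ Icc lo hi, F x r ≤ F x (π x) := by
  have hFx : ∀ x, Continuous (F x) := fun x => hF.comp (f := fun r => (x, r)) (by fun_prop)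
  set S : ℝ → Set ℝ := fun x => {r | r ∈ Icc lo hi ∧ ∀ r' ∈ Icc lo hi, F x r' ≤ F x r} with hS
  have hSne : ∀ x, (S x).Nonempty := fun x => by
    obtain ⟨r, hr, hmax⟩ := isCompact_Icc.exists_isMaxOn (nonempty_Icc.2 hlh) (hFx x).continuousOn
    exact ⟨r, hr, fun r' hr' => hmax hr'⟩
  have hSc : ∀ x, IsClosed (S x) := fun x => by
    have : S x = Icc lo hi ∩ ⋂ r' ∈ Icc lo hi, {r | F x r' ≤ F x r} := by
      ext r
      simp only [hS, mem_ofPred_eq, mem_inter_iff, mem_iInter]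
    rw [this]
    exact isClosed_Icc.inter (isClosed_biInter fun r' _ => isClosed_le continuous_const (hFx x))
  have hSb : ∀ x, BddBelow (S x) := fun x => ⟨lo, fun r hr => hr.1.1⟩
  have hmem : ∀ x, sInf (S x) ∈ S x := fun x => (hSc x).csInf_mem (hSne x) (hSb x)
  refine ⟨fun x => sInf (S x), measurable_of_Iic fun r => ?_, fun x => hmem x⟩
  -- The selection is the smallest maximiser. It is at most `r` exactly when the part of the
  -- interval up to `r` already attains the maximum, which is a closed condition because both maxima
  -- are continuous in `x`.
  have hset : (fun x => sInf (S x)) ⁻¹' Iic r =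
      {x | lo ≤ r ∧ sSup (F x '' Icc lo hi) ≤ sSup (F x '' Icc lo (min r hi))} := by
    ext x
    have hbdd : ∀ s, BddAbove (F x '' Icc lo s) := fun s =>
      isCompact_Icc.bddAbove_image (hFx x).continuousOn
    have hne := (nonempty_Icc.2 hlh).image (F x)
    simp only [mem_preimage, mem_Iic, mem_ofPred_eq]
    constructor
    · intro h
      have h1 := hmem x
      refine ⟨h1.1.1.trans h, csSup_le hne ?_⟩
      rintro _ ⟨r', hr', rfl⟩
      exact (h1.2 r' hr').trans (le_csSup (hbdd _) ⟨_, ⟨h1.1.1, le_min h h1.1.2⟩, rfl⟩)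
    · rintro ⟨hr, h⟩
      obtain ⟨y, hy, hmax⟩ := isCompact_Icc.exists_isMaxOn (nonempty_Icc.2 (le_min hr hlh))
        (hFx x).continuousOn
      refine (csInf_le (hSb x) ⟨⟨hy.1, hy.2.trans (min_le_right _ _)⟩, fun r' hr' => ?_⟩).trans
        (hy.2.trans (min_le_left _ _))
      refine (le_csSup (hbdd _) ⟨r', hr', rfl⟩).trans (h.trans (csSup_le
        ((nonempty_Icc.2 (le_min hr hlh)).image _) ?_))
      rintro _ ⟨z, hz, rfl⟩
      exact hmax hz
  rw [hset]
  by_cases hr : lo ≤ r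
  · simp only [hr, true_and]
    exact (isClosed_le (isCompact_Icc.continuous_sSup hF)
      (isCompact_Icc.continuous_sSup hF)).measurableSet
  · simp only [hr, false_and]
    exact MeasurableSet.empty

/-- Candidate value functions of the wealth. -/
structure IsWealthFn (γ K : ℝ) (w : ℝ → ℝ) : Prop where
  mono : Monotone w
  eq_zero : ∀ y, y < 0 → w y = 0
  concave : ConcaveOn ℝ (Ici 0) w
  le : ∀ y, 0 ≤ y → w y ≤ K * y ^ γ

namespace IsWealthFn

variable {γ K : ℝ} {w : ℝ → ℝ}

theorem nonneg (hw : IsWealthFn γ K w) (y : ℝ) : 0 ≤ w y := by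
  rcases lt_or_ge y 0 with h | h
  · exact (hw.eq_zero y h).ge
  · rw [← hw.eq_zero (-1) (by norm_num)]; exact hw.mono (by linarith)

/-- Concavity on the segment from 0, where `w` is nonnegative, is used with the weights `x / (x +
h)` and `h / (x + h)`, which sum to 1. -/
theorem add_le (hw : IsWealthFn γ K w) {x h : ℝ} (hx : 0 ≤ x) (hh : 0 ≤ h) :
    w (x + h) ≤ w x + w h := by
  rcases (add_nonneg hx hh).eq_or_lt with h0 | h0
  · have hx0 : x = 0 := by linarith
    have hh0 : h = 0 := by linarith
    subst hx0 hh0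
    simpa using hw.nonneg 0
  have h1 : x / (x + h) + h / (x + h) = 1 := by field_simp
  have e : ∀ u v : ℝ, 0 ≤ u → 0 ≤ v → u + v = 1 → u * w (x + h) ≤ w (u * (x + h)) := by
    intro u v hu hv huv
    have := hw.concave.2 (mem_Ici.2 h0.le) (mem_Ici.2 le_rfl) hu hv huv
    simp only [smul_eq_mul, mul_zero, add_zero] at this
    linarith [mul_nonneg hv (hw.nonneg 0)]
  have hx1 := e _ _ (div_nonneg hx h0.le) (div_nonneg hh h0.le) h1
  have hh1 := e _ _ (div_nonneg hh h0.le) (div_nonneg hx h0.le) (by linarith)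
  rw [div_mul_cancel₀ _ h0.ne'] at hx1 hh1
  calc w (x + h) = (x / (x + h) + h / (x + h)) * w (x + h) := by rw [h1, one_mul]
    _ ≤ _ := by linarith

/-- By subadditivity an increment of `w` is at most `w` of the increment, so the growth bound is
also a Hölder modulus. Crossing 0 is harmless because `w` vanishes on the negative axis and the
growth bound forces `w 0 = 0`. -/
theorem abs_sub_le (hK : 0 ≤ K) (hγ : 0 < γ) (hw : IsWealthFn γ K w) (x y : ℝ) :
    |w x - w y| ≤ K * |x - y| ^ γ := by
  wlog hxy : y ≤ x generalizing x y
  · rw [abs_sub_comm, abs_sub_comm x]; exact this y x (le_of_not_ge hxy)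
  rw [abs_of_nonneg (sub_nonneg.2 (hw.mono hxy)), abs_of_nonneg (sub_nonneg.2 hxy)]
  rcases lt_or_ge x 0 with hx | hx
  · rw [hw.eq_zero x hx, hw.eq_zero y (hxy.trans_lt hx), sub_zero]
    exact mul_nonneg hK (Real.rpow_nonneg (sub_nonneg.2 hxy) _)
  rcases lt_or_ge y 0 with hy | hy
  · rw [hw.eq_zero y hy, sub_zero]
    exact (hw.le x hx).trans (mul_le_mul_of_nonneg_left
      (Real.rpow_le_rpow hx (by linarith) hγ.le) hK)
  · have := hw.add_le hy (sub_nonneg.2 hxy)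
    rw [add_sub_cancel] at this
    linarith [hw.le (x - y) (sub_nonneg.2 hxy)]

theorem continuous (hK : 0 ≤ K) (hγ : 0 < γ) (hw : IsWealthFn γ K w) : Continuous w := by
  rw [continuous_iff_continuousAt]
  intro x
  rw [ContinuousAt, tendsto_iff_norm_sub_tendsto_zero]
  have h1 : Tendsto (fun y => K * |y - x| ^ γ) (𝓝 x) (𝓝 (K * |x - x| ^ γ)) :=
    (((continuous_id.sub continuous_const).abs.rpow_const fun _ => Or.inr hγ.le).const_mul
      K).tendsto x
  simp only [sub_self, abs_zero, Real.zero_rpow hγ.ne', mul_zero] at h1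
  exact squeeze_zero (fun _ => norm_nonneg _) (fun y => hw.abs_sub_le hK hγ y x) h1

theorem le_linear (hK : 0 ≤ K) (hγ : γ ∈ Ioo (0 : ℝ) 1) (hw : IsWealthFn γ K w) {y u m : ℝ}
    (hm : 0 < m) (hyu : y ≤ u) (hu : 0 ≤ u) : w y ≤ K * (m ^ γ * (1 + u / m)) :=
  (hw.mono hyu).trans ((hw.le u hu).trans (mul_le_mul_of_nonneg_left
    (rpow_le_mul_one_add_div hu hm hγ.1.le hγ.2.le) hK))

end IsWealthFn

/-! ### The return support, the threshold `l` and the feasible investments. -/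

namespace Market

variable {Ω : Type*} [mΩ : MeasurableSpace Ω] {μ : Measure Ω} {M : Market Ω} {k b γ K₁ : ℝ}

theorem UtilityAssumption.isUtility (hu : M.UtilityAssumption k b γ K₁) : IsUtility M.U K₁ γ :=
  ⟨hu.strictMono, hu.strictConcave, hu.contDiff, hu.zero, hu.inada_zero, hu.inada_top, hu.γ_mem,
    hu.K₁_pos, hu.growth⟩

/-- The law of the return, extended to all times. -/
noncomputable def retLaw (M : Market Ω) (s : ℝ) : Measure ℝ := M.p (max s 0)

theorem retLaw_of_nonneg (M : Market Ω) {s : ℝ} (hs : 0 ≤ s) : M.retLaw s = M.p s := by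
  rw [retLaw, max_eq_left hs]

theorem mul_zlow_le_l (a : ℝ) : a * M.zlow ≤ M.l a := by
  unfold l; split_ifs
  · exact le_rfl
  · exact le_max_left _ _

theorem neg_mul_zbar_le_l (h : M.zbar ≠ ⊤) (a : ℝ) : -a * M.zbar.toReal ≤ M.l a := by
  unfold l; rw [if_neg h]; exact le_max_right _ _

theorem continuous_l (M : Market Ω) : Continuous M.l := by
  unfold l
  by_cases ht : M.zbar = ⊤
  · simp only [ht, if_true]; fun_prop
  · simp only [ht, if_false]; fun_prop

theorem l_convex {a a' η η' : ℝ} (hη : 0 ≤ η) (hη' : 0 ≤ η') :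
    M.l (η * a + η' * a') ≤ η * M.l a + η' * M.l a' := by
  have h1 := mul_le_mul_of_nonneg_left (mul_zlow_le_l (M := M) a) hη
  have h2 := mul_le_mul_of_nonneg_left (mul_zlow_le_l (M := M) a') hη'
  by_cases ht : M.zbar = ⊤
  · unfold l at *; simp only [ht, if_true] at *; linarith
  · have h3 := mul_le_mul_of_nonneg_left (neg_mul_zbar_le_l ht a) hη
    have h4 := mul_le_mul_of_nonneg_left (neg_mul_zbar_le_l ht a') hη'
    rw [l, if_neg ht]
    exact max_le (by linarith) (by linarith)

theorem investSet_convex {a a' η η' : ℝ} (ha : a ∈ M.investSet) (ha' : a' ∈ M.investSet)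
    (hη : 0 ≤ η) (hη' : 0 ≤ η') : η * a + η' * a' ∈ M.investSet := fun ht =>
  add_nonneg (mul_nonneg hη (ha ht)) (mul_nonneg hη' (ha' ht))

theorem zero_mem_investSet : (0 : ℝ) ∈ M.investSet := fun _ => le_rfl

theorem l_zero : M.l 0 = 0 := by unfold l; simp

namespace ReturnAssumption

theorem isProb_retLaw (hr : M.ReturnAssumption μ k b) (s : ℝ) : IsProbabilityMeasure (M.retLaw s) :=
  hr.isProb _ (le_max_right _ _)

theorem integrable_id (hr : M.ReturnAssumption μ k b) (s : ℝ) :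
    Integrable (fun z : ℝ => z) (M.retLaw s) := hr.integrable _ (le_max_right _ _)

/-- A measure on the line is carried by its support. In the interval case the support is convex with
nonempty interior, hence contained in the closure of that interior. -/
theorem ae_mem (hr : M.ReturnAssumption μ k b) (s : ℝ) :
    ∀ᵐ z ∂M.retLaw s, -M.zlow ≤ z ∧ (z : EReal) ≤ M.zbar := by
  have hsub : (M.retLaw s).support ⊆ {z : ℝ | -M.zlow ≤ z ∧ (z : EReal) ≤ M.zbar} := by
    rcases hr.support (max s 0) (le_max_right _ _) with ⟨h1, h2⟩ | ⟨h0, -, h1, h2⟩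
    · have hne : (interior (M.p (max s 0)).support).Nonempty := by
        rw [h2]; exact ⟨0, by simpa using hr.zlow_mem.1, by simpa using hr.zbar_pos⟩
      have h3 := (convex_iff_ordConnected.2 h1).closure_interior_eq_closure_of_nonempty_interior hne
      refine subset_closure.trans (h3.symm.subset.trans (closure_minimal ?_ ?_))
      · rw [h2]; exact fun z hz => ⟨hz.1.le, hz.2.le⟩
      · exact (isClosed_le continuous_const continuous_id).inter
          (isClosed_le continuous_coe_real_ereal continuous_const)
    · intro z hz
      refine ⟨h1.2 hz, ?_⟩
      rw [← EReal.coe_toReal h0 (ne_bot_of_gt hr.zbar_pos)]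
      exact EReal.coe_le_coe_iff.2 (h2.2 hz)
  exact mem_of_superset Measure.support_mem_ae hsub

theorem zbar_toReal_pos (hr : M.ReturnAssumption μ k b) (h : M.zbar ≠ ⊤) : 0 < M.zbar.toReal :=
  EReal.toReal_pos hr.zbar_pos h

theorem zlow_pos (hr : M.ReturnAssumption μ k b) : 0 < M.zlow := hr.zlow_mem.1

theorem abs_le (hr : M.ReturnAssumption μ k b) {z : ℝ} (hz : -M.zlow ≤ z) : |z| ≤ 1 + (1 + z) := by
  rw [_root_.abs_le]; constructor <;> linarith [hr.zlow_mem.2]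

theorem integral_one_add_le (hr : M.ReturnAssumption μ k b) (s : ℝ) :
    ∫ z, (1 + z) ∂M.retLaw s ≤ k * Real.exp (b * max s 0) := hr.mean_le _ (le_max_right _ _)

theorem integral_one_add (hr : M.ReturnAssumption μ k b) (s : ℝ) :
    ∫ z, (1 + z) ∂M.retLaw s = 1 + ∫ z, z ∂M.retLaw s := by
  have := hr.isProb_retLaw s
  rw [integral_add (integrable_const 1) (hr.integrable_id s)]
  simp

theorem integral_abs_le (hr : M.ReturnAssumption μ k b) (s : ℝ) :
    ∫ z, |z| ∂M.retLaw s ≤ 1 + k * Real.exp (b * max s 0) := by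
  have := hr.isProb_retLaw s
  have h2 : Integrable (fun z : ℝ => 1 + z) (M.retLaw s) :=
    (integrable_const 1).add (hr.integrable_id s)
  have h1 : ∫ z, |z| ∂M.retLaw s ≤ ∫ z, (1 + (1 + z)) ∂M.retLaw s :=
    integral_mono_ae (hr.integrable_id s).abs ((integrable_const 1).add h2)
      ((hr.ae_mem s).mono fun z hz => hr.abs_le hz.1)
  rw [integral_add (integrable_const 1) h2] at h1
  simp only [integral_const, probReal_univ, smul_eq_mul, mul_one] at h1
  linarith [hr.integral_one_add_le s]

/-- If `y + a z ≥ 0` almost surely, then `a` is an admissible investment for the wealth `y`. -/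
theorem of_ae_nonneg (hr : M.ReturnAssumption μ k b) {s y a : ℝ}
    (h : ∀ᵐ z ∂M.retLaw s, 0 ≤ y + a * z) : a ∈ M.investSet ∧ M.l a ≤ y := by
  have hsub : (M.retLaw s).support ⊆ {z | 0 ≤ y + a * z} := Measure.support_subset_of_isClosed
    (isClosed_le continuous_const (by fun_prop)) h
  -- An affine function nonnegative on the support is nonnegative at both finite ends, by evaluation
  -- when the support is finite and by a limit when it is an interval. An unbounded support forces a
  -- nonnegative slope.
  have key : 0 ≤ y + a * (-M.zlow) ∧ (M.zbar = ⊤ → 0 ≤ a) ∧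
      (M.zbar ≠ ⊤ → 0 ≤ y + a * M.zbar.toReal) := by
    rcases hr.support (max s 0) (le_max_right _ _) with ⟨h1, h2⟩ | ⟨h0, -, h1, h2⟩
    · have h3 : ∀ z : ℝ, -M.zlow < z → (z : EReal) < M.zbar → 0 ≤ y + a * z := fun z hz hz' =>
        hsub (interior_subset (s := (M.p (max s 0)).support) (h2 ▸ ⟨hz, hz'⟩))
      have hl := hr.zlow_pos
      refine ⟨?_, fun ht => ?_, fun ht => ?_⟩
      · have hc : ContinuousWithinAt (fun z : ℝ => y + a * z) (Ioi (-M.zlow)) (-M.zlow) := by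
          fun_prop
        refine ge_of_tendsto hc.tendsto ?_
        filter_upwards [Ioo_mem_nhdsGT (show -M.zlow < 0 by linarith)] with z hz
        exact h3 z hz.1 (lt_trans (EReal.coe_neg'.2 hz.2) hr.zbar_pos)
      · by_contra hneg
        have hneg' : a < 0 := not_le.1 hneg
        -- At this return the wealth would be `y - |y| - 1`, which is negative.
        have h4 := h3 ((|y| + 1) / (-a)) (by
          have : 0 ≤ (|y| + 1) / (-a) := div_nonneg (by positivity) (by linarith)
          linarith) (ht ▸ EReal.coe_lt_top _)
        have : a * ((|y| + 1) / (-a)) = -(|y| + 1) := by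
          rw [mul_div_assoc', div_neg, mul_div_cancel_left₀ _ hneg'.ne]
        rw [this] at h4
        linarith [le_abs_self y]
      · have hzp := hr.zbar_toReal_pos ht
        have hc : ContinuousWithinAt (fun z : ℝ => y + a * z) (Iio M.zbar.toReal) M.zbar.toReal := by
          fun_prop
        refine ge_of_tendsto hc.tendsto ?_
        filter_upwards [Ioo_mem_nhdsLT hzp] with z hz
        refine h3 z (by linarith [hz.1]) ?_
        rw [← EReal.coe_toReal ht (ne_bot_of_gt hr.zbar_pos)]
        exact EReal.coe_lt_coe_iff.2 hz.2
    · exact ⟨hsub h1.1, fun ht => absurd ht h0, fun _ => hsub h2.1⟩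
  refine ⟨key.2.1, ?_⟩
  unfold l
  split_ifs with ht
  · linarith [key.1]
  · exact max_le (by linarith [key.1]) (by linarith [key.2.2 ht])

/-- The level `l(a)` is the wealth needed to survive the worst return, which is `-zlow` for a long
position and `zbar` for a short one; short positions are excluded when `zbar` is infinite. -/
theorem l_add_mul_nonneg (hr : M.ReturnAssumption μ k b) {a z : ℝ} (ha : a ∈ M.investSet)
    (h1 : -M.zlow ≤ z) (h2 : (z : EReal) ≤ M.zbar) : 0 ≤ M.l a + a * z := by
  rcases le_or_gt 0 a with h | h
  · nlinarith [mul_zlow_le_l (M := M) a]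
  · have ht : M.zbar ≠ ⊤ := fun ht => absurd (ha ht) (not_le.2 h)
    rw [← EReal.coe_toReal ht (ne_bot_of_gt hr.zbar_pos), EReal.coe_le_coe_iff] at h2
    nlinarith [neg_mul_zbar_le_l ht a]

theorem l_nonneg (hr : M.ReturnAssumption μ k b) {a : ℝ} (ha : a ∈ M.investSet) : 0 ≤ M.l a := by
  simpa using hr.l_add_mul_nonneg ha (z := 0) (by linarith [hr.zlow_pos]) hr.zbar_pos.le

theorem mem_investInterval_iff (hr : M.ReturnAssumption μ k b) {x a : ℝ} :
    a ∈ M.investInterval x ↔ a ∈ M.investSet ∧ M.l a ≤ x := by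
  unfold investInterval investSet l
  have hz := hr.zlow_pos
  by_cases ht : M.zbar = ⊤
  · simp only [ht, if_true, mem_Icc, le_div_iff₀ hz, mem_ofPred_eq, true_imp_iff]
  · have hp := hr.zbar_toReal_pos ht
    simp only [ht, if_false, mem_Icc, le_div_iff₀ hz, div_le_iff₀ hp, mem_ofPred_eq,
      false_imp_iff, true_and, max_le_iff]
    constructor
    · rintro ⟨h1, h2⟩; exact ⟨h2, by linarith⟩
    · rintro ⟨h1, h2⟩; exact ⟨by linarith, h1⟩

end ReturnAssumption

end Market

end IlliquidConsumption


/-! ### The continuation reward generated by a value function. -/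

namespace IlliquidConsumption

namespace Market

variable {Ω : Type*} [mΩ : MeasurableSpace Ω] {μ : Measure Ω} {M : Market Ω} {k b γ K₁ : ℝ}

/-- The expected continuation reward when the return is realised at time `s`, for the residual
budget `y` above the level `l(a)`. -/
noncomputable def reward (M : Market Ω) (w : ℝ → ℝ) (a : M.investSet) (s y : ℝ) : ℝ :=
  M.lam * ∫ z, w (M.l a + y + a * z) ∂M.retLaw s

/-- This is the condition on the discount rate, rearranged to say that the factor `contr` is below
1. -/
theorem ReturnAssumption.beta_gt (hr : M.ReturnAssumption μ k b) (hu : M.UtilityAssumption k b γ K₁) :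
    M.lam * (k / M.zlow) ^ γ < M.rho + M.lam - b * γ := by
  rw [Real.div_rpow hr.k_nonneg hr.zlow_pos.le]
  linarith [hu.rho_gt, mul_sub M.lam (k ^ γ / M.zlow ^ γ) 1]

theorem ReturnAssumption.bγ_lt (hr : M.ReturnAssumption μ k b) (hu : M.UtilityAssumption k b γ K₁) :
    b * γ < M.rho + M.lam := by
  have h := hr.beta_gt hu
  have : 0 ≤ M.lam * (k / M.zlow) ^ γ := mul_nonneg hr.lam_pos.le
    (Real.rpow_nonneg (div_nonneg hr.k_nonneg hr.zlow_pos.le) _)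
  linarith

/-- The contraction factor of the dynamic programming operator. -/
noncomputable def contr (M : Market Ω) (k b γ : ℝ) : ℝ :=
  M.lam * (k / M.zlow) ^ γ / (M.rho + M.lam - b * γ)

section Wealth

variable {K : ℝ} {w : ℝ → ℝ} (hr : M.ReturnAssumption μ k b) (hu : M.UtilityAssumption k b γ K₁)
include hr hu

theorem contr_nonneg : 0 ≤ M.contr k b γ :=
  div_nonneg (mul_nonneg hr.lam_pos.le
    (Real.rpow_nonneg (div_nonneg hr.k_nonneg hr.zlow_pos.le) _)) (by linarith [hr.bγ_lt hu])

theorem contr_lt_one : M.contr k b γ < 1 :=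
  (div_lt_one (by linarith [hr.bγ_lt hu])).2 (hr.beta_gt hu)

theorem beta_pos : 0 < M.rho + M.lam := add_pos hu.rho_pos hr.lam_pos

variable (hw : IsWealthFn γ K w) (hK : 0 ≤ K)
include hw hK

omit hr in
theorem wealthFn_affine_le (x a z : ℝ) :
    w (x + a * z) ≤ K * (1 + |x| + |a|) * (1 + |z|) := by
  have h1 : x + a * z ≤ |x| + |a| * |z| := by
    rw [← abs_mul]; exact add_le_add (le_abs_self _) (le_abs_self _)
  have h2 := hw.le_linear hK hu.γ_mem one_pos h1 (by positivity)
  rw [Real.one_rpow, one_mul, div_one] at h2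
  rw [mul_assoc]
  refine h2.trans (mul_le_mul_of_nonneg_left ?_ hK)
  nlinarith [abs_nonneg x, abs_nonneg a, abs_nonneg z, mul_nonneg (abs_nonneg x) (abs_nonneg z)]

theorem integrable_wealthFn (x a s : ℝ) :
    Integrable (fun z => w (x + a * z)) (M.retLaw s) := by
  have hP := hr.isProb_retLaw s
  refine Integrable.mono' (((integrable_const 1).add (hr.integrable_id s).abs).const_mul
    (K * (1 + |x| + |a|))) ((hw.continuous hK hu.γ_mem.1).measurable.comp
    (by fun_prop)).aestronglyMeasurable (Eventually.of_forall fun z => ?_)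
  rw [Real.norm_of_nonneg (hw.nonneg _)]
  exact wealthFn_affine_le hu hw hK x a z

theorem tendsto_integral_wealthFn (x a s₀ : ℝ) :
    Tendsto (fun s => ∫ z, w (x + a * z) ∂M.retLaw s) (𝓝 s₀)
      (𝓝 (∫ z, w (x + a * z) ∂M.retLaw s₀)) := by
  have h1 := hr.continuity (fun z => w (x + a * z)) ((hw.continuous hK hu.γ_mem.1).measurable.comp
    (by fun_prop)) ⟨K * (1 + |x| + |a|), fun z => by
      rw [abs_of_nonneg (hw.nonneg _)]; exact wealthFn_affine_le hu hw hK x a z⟩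
    (max s₀ 0) (le_max_right _ _)
  have h2 : Tendsto (fun s : ℝ => max s 0) (𝓝 s₀) (𝓝[Ici 0] (max s₀ 0)) :=
    tendsto_nhdsWithin_iff.2 ⟨(by fun_prop : Continuous fun s : ℝ => max s 0).tendsto s₀,
      Eventually.of_forall fun s => mem_Ici.2 (le_max_right _ _)⟩
  exact h1.comp h2

omit hu hK in
theorem reward_nonneg (a : M.investSet) (s y : ℝ) : 0 ≤ M.reward w a s y :=
  mul_nonneg hr.lam_pos.le (integral_nonneg fun _ => hw.nonneg _)

/-- The Hölder modulus of `w` together with `(1 + |z|) ^ γ ≤ 1 + |z|` gives an estimate locally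
uniform in time. Joint continuity then reduces to continuity in time for fixed investment and
budget. -/
theorem reward_sub_le (a a' : M.investSet) (s y y' : ℝ) :
    |M.reward w a s y - M.reward w a' s y'| ≤ M.lam * (K *
      (max |M.l a + y - (M.l a' + y')| |(a : ℝ) - a'| ^ γ * (2 + k * Real.exp (b * max s 0)))) := by
  have hP := hr.isProb_retLaw s
  set D := max |M.l a + y - (M.l a' + y')| |(a : ℝ) - a'| with hD
  have hD0 : 0 ≤ D := (abs_nonneg _).trans (le_max_left _ _)
  rw [reward, reward, ← mul_sub, abs_mul, abs_of_pos hr.lam_pos]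
  refine mul_le_mul_of_nonneg_left ?_ hr.lam_pos.le
  rw [← integral_sub (integrable_wealthFn hr hu hw hK _ _ _) (integrable_wealthFn hr hu hw hK _ _ _)]
  have h1 : ∀ z, |w (M.l a + y + a * z) - w (M.l a' + y' + a' * z)| ≤ K * (D ^ γ * (1 + |z|)) := by
    intro z
    refine (hw.abs_sub_le hK hu.γ_mem.1 _ _).trans (mul_le_mul_of_nonneg_left ?_ hK)
    have h2 : |M.l a + y + a * z - (M.l a' + y' + a' * z)| ≤ D * (1 + |z|) := by
      have e : M.l a + y + a * z - (M.l a' + y' + a' * z) =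
        (M.l a + y - (M.l a' + y')) + ((a : ℝ) - a') * z := by ring
      rw [e]
      refine (abs_add_le _ _).trans ?_
      rw [abs_mul]
      have := mul_le_mul_of_nonneg_right (le_max_right |M.l a + y - (M.l a' + y')| |(a : ℝ) - a'|)
        (abs_nonneg z)
      linarith [le_max_left |M.l a + y - (M.l a' + y')| |(a : ℝ) - a'|]
    refine (Real.rpow_le_rpow (abs_nonneg _) h2 hu.γ_mem.1.le).trans ?_
    have hz : (1 : ℝ) ≤ 1 + |z| := by linarith [abs_nonneg z]
    rw [Real.mul_rpow hD0 (by linarith)]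
    refine mul_le_mul_of_nonneg_left ?_ (Real.rpow_nonneg hD0 _)
    exact (Real.rpow_le_rpow_of_exponent_le hz hu.γ_mem.2.le).trans (Real.rpow_one _).le
  have hint : Integrable (fun z : ℝ => K * (D ^ γ * (1 + |z|))) (M.retLaw s) :=
    ((((integrable_const 1).add (hr.integrable_id s).abs).const_mul _).const_mul _)
  rw [← Real.norm_eq_abs]
  refine (norm_integral_le_of_norm_le hint (Eventually.of_forall fun z => by
    rw [Real.norm_eq_abs]; exact h1 z)).trans ?_
  rw [integral_const_mul, integral_const_mul]
  refine mul_le_mul_of_nonneg_left (mul_le_mul_of_nonneg_left ?_ (Real.rpow_nonneg hD0 _)) hK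
  rw [integral_add (integrable_const 1) (hr.integrable_id s).abs]
  simp only [integral_const, probReal_univ, smul_eq_mul, mul_one]
  linarith [hr.integral_abs_le s]

theorem continuous_reward :
    Continuous fun q : M.investSet × ℝ × ℝ => M.reward w q.1 q.2.1 q.2.2 := by
  rw [continuous_iff_continuousAt]
  rintro ⟨a₀, s₀, y₀⟩
  rw [ContinuousAt, tendsto_iff_norm_sub_tendsto_zero]
  have hl := continuous_l M
  have hc1 : Continuous fun q : M.investSet × ℝ × ℝ => M.lam * (K *
      (max |M.l q.1 + q.2.2 - (M.l a₀ + y₀)| |(q.1 : ℝ) - a₀| ^ γ *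
        (2 + k * Real.exp (b * max q.2.1 0)))) := by
    refine continuous_const.mul (continuous_const.mul (Continuous.mul ?_ (by fun_prop)))
    refine Continuous.rpow_const ?_ fun _ => Or.inr hu.γ_mem.1.le
    have : Continuous fun q : M.investSet × ℝ × ℝ => M.l q.1 := hl.comp (by fun_prop)
    fun_prop
  have h1 := hc1.tendsto (a₀, s₀, y₀)
  simp only [sub_self, abs_zero, max_self, Real.zero_rpow hu.γ_mem.1.ne', zero_mul, mul_zero] at h1
  have h2 : Tendsto (fun q : M.investSet × ℝ × ℝ =>
      |M.reward w a₀ q.2.1 y₀ - M.reward w a₀ s₀ y₀|) (𝓝 (a₀, s₀, y₀)) (𝓝 0) := by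
    have h3 := (tendsto_integral_wealthFn hr hu hw hK (M.l a₀ + y₀) a₀ s₀).const_mul M.lam
    have h4 := (tendsto_iff_norm_sub_tendsto_zero.1 h3).comp
      ((by fun_prop : Continuous fun q : M.investSet × ℝ × ℝ => q.2.1).tendsto (a₀, s₀, y₀))
    exact h4
  refine squeeze_zero (fun _ => norm_nonneg _) (fun q => ?_) (by simpa using h1.add h2)
  have h5 := reward_sub_le hr hu hw hK q.1 a₀ q.2.1 q.2.2 y₀
  rw [Real.norm_eq_abs]
  refine (abs_sub_le _ (M.reward w a₀ q.2.1 y₀) _).trans (add_le_add h5 le_rfl)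

theorem reward_mono (a : M.investSet) (s : ℝ) : Monotone (M.reward w a s) := fun y y' h =>
  mul_le_mul_of_nonneg_left (integral_mono (integrable_wealthFn hr hu hw hK _ _ _)
    (integrable_wealthFn hr hu hw hK _ _ _) fun z => hw.mono (by linarith)) hr.lam_pos.le

/-- Joint concavity of the continuation reward in the investment and the budget. -/
theorem reward_concave (a a' a'' : M.investSet) (s : ℝ) {y y' y'' η η' : ℝ} (hy : 0 ≤ y)
    (hy' : 0 ≤ y') (hη : 0 ≤ η) (hη' : 0 ≤ η') (h1 : η + η' = 1)
    (ha : (a'' : ℝ) = η * a + η' * a')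
    (hle : η * (M.l a + y) + η' * (M.l a' + y') ≤ M.l a'' + y'') :
    η * M.reward w a s y + η' * M.reward w a' s y' ≤ M.reward w a'' s y'' := by
  have hi := integrable_wealthFn hr hu hw hK
  have h : ∫ z, (η * w (M.l a + y + a * z) + η' * w (M.l a' + y' + a' * z)) ∂M.retLaw s ≤
      ∫ z, w (M.l a'' + y'' + a'' * z) ∂M.retLaw s := by
    refine integral_mono_ae (((hi _ _ _).const_mul _).add ((hi _ _ _).const_mul _)) (hi _ _ _) ?_
    -- Concavity of `w` holds only on the half line, but for returns in the allowed range both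
    -- wealths are nonnegative.
    filter_upwards [hr.ae_mem s] with z hz
    have e1 := hr.l_add_mul_nonneg a.2 hz.1 hz.2
    have e2 := hr.l_add_mul_nonneg a'.2 hz.1 hz.2
    refine (hw.concave.2 (mem_Ici.2 (by linarith)) (mem_Ici.2 (by linarith)) hη hη' h1).trans
      (hw.mono ?_)
    simp only [smul_eq_mul]
    have e3 : (a'' : ℝ) * z = η * (a * z) + η' * (a' * z) := by rw [ha]; ring
    linarith
  rw [integral_add ((hi _ _ _).const_mul _) ((hi _ _ _).const_mul _), integral_const_mul,
    integral_const_mul] at h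
  have := mul_le_mul_of_nonneg_left h hr.lam_pos.le
  simp only [reward]
  linarith

/-- The scale in the linear bound is `exp (b * |s|)`, the growth of the mean return. The reward then
grows at rate `b * γ`, which is below the discount `ρ + λ`, instead of at rate `b`. -/
theorem reward_bound (a₀ : M.investSet) (R : ℝ) : ∃ B, 0 ≤ B ∧ ∀ᶠ a in 𝓝 a₀, ∀ s y, y ≤ R →
    M.reward w a s y ≤ B * Real.exp (b * γ * |s|) := by
  set C := (M.l a₀ + 1) + |R| + (|(a₀ : ℝ)| + 1) with hC
  have hl0 := hr.l_nonneg a₀.2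
  have hC0 : 0 ≤ C := by positivity
  have hk := hr.k_nonneg
  refine ⟨M.lam * (K * (1 + C * (2 + k))), by have := hr.lam_pos; positivity, ?_⟩
  have hev1 : ∀ᶠ a : M.investSet in 𝓝 a₀, M.l a < M.l a₀ + 1 :=
    (((continuous_l M).comp continuous_subtype_val).tendsto a₀).eventually
      (gt_mem_nhds (by simp))
  have hev2 : ∀ᶠ a : M.investSet in 𝓝 a₀, |(a : ℝ)| < |(a₀ : ℝ)| + 1 :=
    (continuous_subtype_val.abs.tendsto a₀).eventually (gt_mem_nhds (by simp))
  filter_upwards [hev1, hev2] with a ha1 ha2 s y hy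
  have hP := hr.isProb_retLaw s
  set m := Real.exp (b * |s|) with hm
  have hm1 : 1 ≤ m := Real.one_le_exp (mul_nonneg hr.b_nonneg (abs_nonneg _))
  have hm0 : 0 < m := Real.exp_pos _
  have hmγ : m ^ γ = Real.exp (b * γ * |s|) := by rw [hm, ← Real.exp_mul]; ring_nf
  have hmγ0 : 0 ≤ m ^ γ := Real.rpow_nonneg hm0.le _
  rw [reward, mul_assoc]
  refine mul_le_mul_of_nonneg_left ?_ hr.lam_pos.le
  have h1 : ∀ z, w (M.l a + y + a * z) ≤ K * (m ^ γ * (1 + C * (1 + |z|) / m)) := fun z => by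
    refine hw.le_linear hK hu.γ_mem hm0 ?_ (by positivity)
    have e1 : (a : ℝ) * z ≤ |(a : ℝ)| * |z| := by rw [← abs_mul]; exact le_abs_self _
    have e2 : |(a : ℝ)| * |z| ≤ C * |z| := mul_le_mul_of_nonneg_right
      (by linarith [abs_nonneg R]) (abs_nonneg z)
    linarith [le_abs_self R, abs_nonneg (a₀ : ℝ)]
  have hi1 : Integrable (fun z : ℝ => 1 + |z|) (M.retLaw s) :=
    (integrable_const 1).add (hr.integrable_id s).abs
  have hi2 : Integrable (fun z : ℝ => C * (1 + |z|) / m) (M.retLaw s) :=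
    (hi1.const_mul C).div_const m
  have hint : Integrable (fun z : ℝ => K * (m ^ γ * (1 + C * (1 + |z|) / m))) (M.retLaw s) :=
    (((integrable_const 1).add hi2).const_mul _).const_mul _
  refine (integral_mono (integrable_wealthFn hr hu hw hK _ _ _) hint h1).trans ?_
  rw [integral_const_mul, integral_const_mul, integral_add (integrable_const 1) hi2,
    integral_div, integral_const_mul, integral_add (integrable_const 1) (hr.integrable_id s).abs,
    ← hmγ, mul_assoc K, mul_comm (1 + C * (2 + k))]
  simp only [integral_const, probReal_univ, smul_eq_mul, mul_one]
  refine mul_le_mul_of_nonneg_left (mul_le_mul_of_nonneg_left ?_ hmγ0) hK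
  rw [mul_div_assoc]
  refine add_le_add le_rfl (mul_le_mul_of_nonneg_left ?_ hC0)
  rw [div_le_iff₀ hm0]
  have h3 := hr.integral_abs_le s
  have h4 : Real.exp (b * max s 0) ≤ m := Real.exp_le_exp.2
    (mul_le_mul_of_nonneg_left (max_le (le_abs_self _) (abs_nonneg _)) hr.b_nonneg)
  have h5 := mul_le_mul_of_nonneg_left h4 hk
  linarith

theorem isReward : IsReward (M.rho + M.lam) (M.reward w) :=
  ⟨continuous_reward hr hu hw hK, reward_nonneg hr hw, reward_mono hr hu hw hK,
    fun a s => ⟨convex_Ici 0, fun y hy y' hy' η η' hη hη' h1 => by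
      simp only [smul_eq_mul]
      refine reward_concave hr hu hw hK a a a s hy hy' hη hη' h1 ?_ (le_of_eq ?_)
      · rw [← add_mul, h1, one_mul]
      · linear_combination (M.l a) * h1⟩,
    ⟨b * γ, mul_nonneg hr.b_nonneg hu.γ_mem.1.le, hr.bγ_lt hu, reward_bound hr hu hw hK⟩⟩

/-- Jensen's inequality moves the power γ outside the mean. Since `a ≤ x / zlow`, and `x ≤ x / zlow`
because `zlow ≤ 1`, the mean wealth is at most `x / zlow` times the mean of `1 + z`. The resulting
constant `(k / zlow) ^ γ` is the one in the contraction factor. -/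
theorem reward_le (a : M.investSet) {s y x : ℝ} (hs : 0 ≤ s) (hy : 0 ≤ y) (hx : M.l a + y ≤ x) :
    M.reward w a s y ≤ M.lam * (K * ((k / M.zlow) ^ γ * x ^ γ)) * Real.exp (b * γ * s) := by
  have hP := hr.isProb_retLaw s
  have hl0 := hr.l_nonneg a.2
  have hz0 := hr.zlow_pos
  have hx0 : 0 ≤ x := by linarith
  have hnn : ∀ᵐ z ∂M.retLaw s, 0 ≤ M.l a + y + a * z := by
    filter_upwards [hr.ae_mem s] with z hz
    linarith [hr.l_add_mul_nonneg a.2 hz.1 hz.2]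
  have haff : Integrable (fun z : ℝ => M.l a + y + a * z) (M.retLaw s) :=
    (integrable_const _).add ((hr.integrable_id s).const_mul _)
  have hpow : Integrable (fun z : ℝ => (M.l a + y + a * z) ^ γ) (M.retLaw s) := by
    refine Integrable.mono' ((integrable_const 1).add haff)
      ((by fun_prop : Measurable fun z : ℝ => M.l a + y + a * z).pow_const γ).aestronglyMeasurable ?_
    filter_upwards [hnn] with z hz
    rw [Real.norm_of_nonneg (Real.rpow_nonneg hz _)]
    simpa using rpow_le_mul_one_add_div hz one_pos hu.γ_mem.1.le hu.γ_mem.2.le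
  have hJ : ∫ z, (M.l a + y + a * z) ^ γ ∂M.retLaw s ≤
      (∫ z, (M.l a + y + a * z) ∂M.retLaw s) ^ γ :=
    (Real.concaveOn_rpow hu.γ_mem.1.le hu.γ_mem.2.le).le_map_integral
      (continuousOn_id.rpow_const fun _ _ => Or.inr hu.γ_mem.1.le) isClosed_Ici hnn haff hpow
  have hmean : ∫ z, (M.l a + y + a * z) ∂M.retLaw s ≤ k / M.zlow * x * Real.exp (b * s) := by
    rw [integral_add (integrable_const _) ((hr.integrable_id s).const_mul _), integral_const_mul]
    simp only [integral_const, probReal_univ, smul_eq_mul, one_mul]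
    have h1 := hr.integral_one_add_le s
    rw [hr.integral_one_add s, max_eq_left hs] at h1
    have h2 : 0 ≤ ∫ z, z ∂M.retLaw s := hr.mean_nonneg _ (le_max_right _ _)
    have h3 : (a : ℝ) ≤ x / M.zlow := by
      rw [le_div_iff₀ hz0]; linarith [mul_zlow_le_l (M := M) a]
    have h4 : x ≤ x / M.zlow := by
      rw [le_div_iff₀ hz0]; nlinarith [hr.zlow_mem.2]
    calc M.l a + y + a * ∫ z, z ∂M.retLaw s ≤ x / M.zlow + x / M.zlow * ∫ z, z ∂M.retLaw s :=
          add_le_add (hx.trans h4) (mul_le_mul_of_nonneg_right h3 h2)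
      _ = x / M.zlow * (1 + ∫ z, z ∂M.retLaw s) := by ring
      _ ≤ x / M.zlow * (k * Real.exp (b * s)) :=
          mul_le_mul_of_nonneg_left h1 (div_nonneg hx0 hz0.le)
      _ = _ := by ring
  have hmean0 : 0 ≤ ∫ z, (M.l a + y + a * z) ∂M.retLaw s := integral_nonneg_of_ae hnn
  have hfin := hJ.trans (Real.rpow_le_rpow hmean0 hmean hu.γ_mem.1.le)
  have hkz := div_nonneg hr.k_nonneg hz0.le
  rw [Real.mul_rpow (mul_nonneg hkz hx0) (Real.exp_pos _).le, Real.mul_rpow hkz hx0,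
    ← Real.exp_mul] at hfin
  rw [reward, mul_assoc, mul_assoc K]
  refine mul_le_mul_of_nonneg_left ?_ hr.lam_pos.le
  have h6 : ∫ z, w (M.l a + y + a * z) ∂M.retLaw s ≤
      ∫ z, K * (M.l a + y + a * z) ^ γ ∂M.retLaw s :=
    integral_mono_ae (integrable_wealthFn hr hu hw hK _ _ _) (hpow.const_mul K)
      (hnn.mono fun z hz => hw.le _ hz)
  rw [integral_const_mul] at h6
  refine h6.trans (mul_le_mul_of_nonneg_left ?_ hK)
  rw [show b * γ * s = b * s * γ by ring]
  exact hfin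

end Wealth

end Market

end IlliquidConsumption


/-! ### The dynamic programming operator. -/

namespace IlliquidConsumption

namespace Market

variable {Ω : Type*} [mΩ : MeasurableSpace Ω] {μ : Measure Ω} {M : Market Ω} {k b γ K₁ : ℝ}

theorem investSet_mul {r a : ℝ} (hr : 0 ≤ r) (ha : a ∈ M.investSet) : r * a ∈ M.investSet :=
  fun h => mul_nonneg hr (ha h)

theorem l_mul {r : ℝ} (hr : 0 ≤ r) (a : ℝ) : M.l (r * a) = r * M.l a := by
  unfold l
  split_ifs
  · ring
  · rw [mul_max_of_nonneg _ _ hr]; ring_nf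

theorem ReturnAssumption.eq_zero_of_l_le (hr : M.ReturnAssumption μ k b) {a : ℝ}
    (ha : a ∈ M.investSet) (h : M.l a ≤ 0) : a = 0 := by
  have h1 := (mul_zlow_le_l (M := M) a).trans h
  have h2 : a ≤ 0 := by
    by_contra hc
    exact absurd h1 (not_le.2 (mul_pos (not_le.1 hc) hr.zlow_pos))
  refine le_antisymm h2 ?_
  by_cases ht : M.zbar = ⊤
  · exact ha ht
  · have h3 := (neg_mul_zbar_le_l ht a).trans h
    nlinarith [hr.zbar_toReal_pos ht]

/-- The value of the auxiliary problem with continuation value `w`, for the residual budget `y`. -/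
noncomputable def aux (M : Market Ω) (w : ℝ → ℝ) (a : M.investSet) (t y : ℝ) : ℝ :=
  famVal M.U (M.rho + M.lam) (M.reward w) a t y

/-- The dynamic programming operator. -/
noncomputable def step (M : Market Ω) (w : ℝ → ℝ) (x : ℝ) : ℝ :=
  sSup ((fun a : M.investSet => M.aux w a 0 (x - M.l a)) '' {a | M.l a ≤ x})

section Step

variable {K : ℝ} {w : ℝ → ℝ} (hr : M.ReturnAssumption μ k b) (hu : M.UtilityAssumption k b γ K₁)
  (hw : IsWealthFn γ K w) (hK : 0 ≤ K)
include hr hu hw hK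

theorem running (a : M.investSet) (t : ℝ) :
    IsRunning (M.rho + M.lam) fun s => M.reward w a (t + s) :=
  (isReward hr hu hw hK).running a t

/-- A measurable choice of an optimal investment. -/
theorem exists_measurable_invest : ∃ α : ℝ → M.investSet, Measurable α ∧ ∀ x, 0 ≤ x →
    M.l (α x) ≤ x ∧ ∀ a : M.investSet, M.l a ≤ x →
      M.aux w a 0 (x - M.l a) ≤ M.aux w (α x) 0 (x - M.l (α x)) := by
  -- Since `l` is positively homogeneous, an investment feasible for wealth `x` is `x` times one
  -- feasible for unit wealth. The maximisation over an interval moving with `x` thus becomes one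
  -- over a fixed compact interval.
  set lo : ℝ := open Classical in if M.zbar = ⊤ then 0 else -1 / M.zbar.toReal with hlo
  have hI : ∀ π : ℝ, π ∈ Icc lo (1 / M.zlow) ↔ π ∈ M.investSet ∧ M.l π ≤ 1 := fun π =>
    hr.mem_investInterval_iff (x := 1)
  have h0 : (0 : ℝ) ∈ Icc lo (1 / M.zlow) := (hI 0).2 ⟨zero_mem_investSet, by
    rw [l_zero]; exact zero_le_one⟩
  have hlh : lo ≤ 1 / M.zlow := h0.1.trans h0.2
  set A : ℝ × ℝ → M.investSet := fun q => ⟨max q.1 0 * projIcc lo _ hlh q.2,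
    investSet_mul (le_max_right _ _) ((hI _).1 (projIcc lo _ hlh q.2).2).1⟩ with hA
  have hAc : Continuous A := Continuous.subtype_mk ((continuous_fst.max continuous_const).mul
    (continuous_subtype_val.comp (continuous_projIcc.comp continuous_snd))) _
  have hF : Continuous fun q : ℝ × ℝ => M.aux w (A q) 0 (max (max q.1 0 - M.l (A q)) 0) :=
    (continuous_famVal hu.isUtility (isReward hr hu hw hK)).comp
      (f := fun q : ℝ × ℝ => (A q, (0 : ℝ), max q.1 0 - M.l (A q)))
      (hAc.prodMk (continuous_const.prodMk ((continuous_fst.max continuous_const).sub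
        ((continuous_l M).comp (continuous_subtype_val.comp hAc)))))
  obtain ⟨π, hπ, hmax⟩ := exists_measurable_argmax
    (F := fun x r => M.aux w (A (x, r)) 0 (max (max x 0 - M.l (A (x, r))) 0)) hF hlh
  have hlA : ∀ x r, 0 ≤ x → M.l (A (x, r)) ≤ x := fun x r hx => by
    have h := ((hI _).1 (projIcc lo _ hlh r).2).2
    simp only [hA, max_eq_left hx]
    rw [l_mul hx]
    exact mul_le_of_le_one_right hx h
  refine ⟨fun x => A (x, π x), hAc.measurable.comp (measurable_id.prodMk hπ), fun x hx =>
    ⟨hlA x _ hx, fun a ha => ?_⟩⟩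
  obtain ⟨r, hr1, hr2⟩ : ∃ r ∈ Icc lo (1 / M.zlow), A (x, r) = a := by
    -- With zero wealth the only feasible investment is 0, which is `x` times anything; for positive
    -- wealth one divides by `x`.
    rcases hx.eq_or_lt with h | h
    · refine ⟨0, h0, Subtype.ext ?_⟩
      simp only [hA, ← h, max_self, zero_mul]
      exact (hr.eq_zero_of_l_le a.2 (h ▸ ha)).symm
    · have hmem : (a : ℝ) / x ∈ Icc lo (1 / M.zlow) := by
        rw [hI, div_eq_inv_mul]
        refine ⟨investSet_mul (inv_nonneg.2 hx) a.2, ?_⟩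
        rw [l_mul (inv_nonneg.2 hx), inv_mul_le_iff₀ h, mul_one]
        exact ha
      refine ⟨_, hmem, Subtype.ext ?_⟩
      simp only [hA, max_eq_left hx, projIcc_of_mem hlh hmem]
      field_simp
  have h2 := (hmax x).2 r hr1
  simp only [hr2, max_eq_left hx] at h2
  rwa [max_eq_left (sub_nonneg.2 ha), max_eq_left (sub_nonneg.2 (hlA x _ hx))] at h2

theorem aux_le_step {x : ℝ} {a : M.investSet} (ha : M.l a ≤ x) :
    M.aux w a 0 (x - M.l a) ≤ M.step w x := by
  have hx : 0 ≤ x := (hr.l_nonneg a.2).trans ha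
  obtain ⟨α, -, hα⟩ := exists_measurable_invest hr hu hw hK
  refine le_csSup ⟨M.aux w (α x) 0 (x - M.l (α x)), ?_⟩ ⟨a, ha, rfl⟩
  rintro _ ⟨a', ha', rfl⟩
  exact (hα x hx).2 a' ha'

theorem step_eq_of_max {x : ℝ} {a : M.investSet} (ha : M.l a ≤ x) (hmax : ∀ a' : M.investSet,
    M.l a' ≤ x → M.aux w a' 0 (x - M.l a') ≤ M.aux w a 0 (x - M.l a)) :
    M.step w x = M.aux w a 0 (x - M.l a) := by
  refine le_antisymm (csSup_le ⟨_, a, ha, rfl⟩ ?_) (aux_le_step hr hu hw hK ha)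
  rintro _ ⟨a', ha', rfl⟩
  exact hmax a' ha'

theorem exists_step_eq {x : ℝ} (hx : 0 ≤ x) : ∃ a : M.investSet, ∃ c, M.l a ≤ x ∧
    IsCtrl (x - M.l a) c ∧
    M.step w x = payoff M.U (M.rho + M.lam) (M.reward w a) (x - M.l a) c := by
  obtain ⟨α, -, hα⟩ := exists_measurable_invest hr hu hw hK
  obtain ⟨c, hc, hcv⟩ := exists_optimal hu.isUtility (running hr hu hw hK (α x) 0)
    (sub_nonneg.2 (hα x hx).1)
  refine ⟨α x, c, (hα x hx).1, hc, ?_⟩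
  rw [step_eq_of_max hr hu hw hK (hα x hx).1 (hα x hx).2, aux, famVal, ← hcv]
  simp only [zero_add]

theorem running_zero (a : M.investSet) : IsRunning (M.rho + M.lam) (M.reward w a) := by
  simpa only [zero_add] using running hr hu hw hK a 0

theorem payoff_le_step {x : ℝ} {a : M.investSet} (ha : M.l a ≤ x) {c : ℝ → ℝ}
    (hc : IsCtrl (x - M.l a) c) :
    payoff M.U (M.rho + M.lam) (M.reward w a) (x - M.l a) c ≤ M.step w x := by
  refine le_trans ?_ (aux_le_step hr hu hw hK ha)
  have := payoff_le_val hu.isUtility (running hr hu hw hK a 0) hc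
  simpa only [zero_add, aux, famVal] using this

/-- The reward grows at rate `b * γ`, so discounting it at `ρ + λ` leaves the integral `1 / (ρ + λ -
b γ)`, the denominator of `contr`. -/
theorem integral_reward_le {x : ℝ} {a : M.investSet} {c : ℝ → ℝ}
    (hc : IsCtrl (x - M.l a) c) :
    ∫ s in Ioi (0 : ℝ), Real.exp (-(M.rho + M.lam) * s) *
      M.reward w a s (x - M.l a - ∫ u in (0 : ℝ)..s, c u) ≤ M.contr k b γ * K * x ^ γ := by
  have hβ := hr.bγ_lt hu
  set C := M.lam * (K * ((k / M.zlow) ^ γ * x ^ γ)) with hC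
  have hpos : 0 < M.rho + M.lam - b * γ := by linarith
  have h1 : ∫ s in Ioi (0 : ℝ), C * Real.exp (-(M.rho + M.lam - b * γ) * s) =
      M.contr k b γ * K * x ^ γ := by
    rw [integral_const_mul, integral_exp_neg_mul hpos, contr, hC]
    ring
  rw [← h1]
  refine setIntegral_mono_on ((running_zero hr hu hw hK a).integrableOn hc _)
    ((integrableOn_exp_neg_mul hpos).const_mul C) measurableSet_Ioi fun s hs => ?_
  have hs' : (0 : ℝ) ≤ s := le_of_lt hs
  have h2 := reward_le hr hu hw hK a hs' (sub_nonneg.2 (hc.integral_le hs')) (x := x)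
    (by linarith [hc.integral_nonneg hs'])
  refine (mul_le_mul_of_nonneg_left h2 (Real.exp_nonneg _)).trans (le_of_eq ?_)
  rw [← hC, mul_comm, mul_assoc, ← Real.exp_add]
  ring_nf

theorem step_le {x : ℝ} (hx : 0 ≤ x) :
    M.step w x ≤ (K₁ * (1 / (M.rho + M.lam) + 1) + M.contr k b γ * K) * x ^ γ := by
  obtain ⟨a, c, ha, hc, e⟩ := exists_step_eq hr hu hw hK hx
  rw [e, payoff_eq_add hu.isUtility (running_zero hr hu hw hK a) hc, add_mul]
  refine add_le_add ((hu.isUtility.integral_le (beta_pos hr hu) hc).trans ?_)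
    (integral_reward_le hr hu hw hK hc)
  have := beta_pos hr hu
  have := hu.K₁_pos
  refine mul_le_mul_of_nonneg_left (Real.rpow_le_rpow hc.nonneg_budget ?_ hu.γ_mem.1.le)
    (by positivity)
  linarith [hr.l_nonneg a.2]

/-- The reward is concave jointly in investment and residual wealth, and `l` is convex. Hence mixing
two optimal pairs of investment and rate gives an admissible pair for the mixed wealth with at least
the mixed payoff. -/
theorem step_concave : ConcaveOn ℝ (Ici 0) (M.step w) := by
  refine ⟨convex_Ici 0, fun x hx x' hx' η η' hη hη' h1 => ?_⟩
  obtain ⟨a, c, ha, hc, e⟩ := exists_step_eq hr hu hw hK hx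
  obtain ⟨a', c', ha', hc', e'⟩ := exists_step_eq hr hu hw hK hx'
  simp only [smul_eq_mul]
  rw [e, e']
  set a'' : M.investSet := ⟨η * a + η' * a', investSet_convex a.2 a'.2 hη hη'⟩ with ha''
  have hl : M.l a'' ≤ η * M.l a + η' * M.l a' := l_convex hη hη'
  have hb : η * (x - M.l a) + η' * (x' - M.l a') ≤ η * x + η' * x' - M.l a'' := by linarith
  have hle : M.l a'' ≤ η * x + η' * x' := by
    linarith [mul_le_mul_of_nonneg_left ha hη, mul_le_mul_of_nonneg_left ha' hη']
  refine le_trans ?_ (payoff_le_step hr hu hw hK hle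
    (((hc.smul_mem hη).add_mem (hc'.smul_mem hη')).mono hb))
  refine payoff_concave_of hu.isUtility (running_zero hr hu hw hK _) (running_zero hr hu hw hK _)
    (running_zero hr hu hw hK _) hc hc' hη hη' h1 hb fun s y y' hy hy' => ?_
  refine reward_concave hr hu hw hK a a' a'' s hy hy' hη hη' h1 rfl (le_of_eq ?_)
  ring

theorem isWealthFn_step : IsWealthFn γ
    (K₁ * (1 / (M.rho + M.lam) + 1) + M.contr k b γ * K) (M.step w) := by
  have hneg : ∀ y, y < 0 → M.step w y = 0 := fun y hy => by
    have : {a : M.investSet | M.l a ≤ y} = ∅ := eq_empty_of_forall_notMem fun a ha =>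
      absurd ((hr.l_nonneg a.2).trans ha) (not_le.2 hy)
    rw [step, this, image_empty, Real.sSup_empty]
  refine ⟨fun x x' hxx => ?_, hneg, step_concave hr hu hw hK, fun x hx => step_le hr hu hw hK hx⟩
  rcases lt_or_ge x 0 with hx | hx
  · rw [hneg x hx]
    refine Real.sSup_nonneg ?_
    rintro _ ⟨a, -, rfl⟩
    exact val_nonneg hu.isUtility (running hr hu hw hK a 0)
  · obtain ⟨a, c, ha, hc, e⟩ := exists_step_eq hr hu hw hK hx
    rw [e]
    exact (payoff_mono_budget hu.isUtility (running_zero hr hu hw hK a) hc (by linarith)).trans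
      (payoff_le_step hr hu hw hK (ha.trans hxx) (hc.mono (by linarith)))

theorem step_mono {w' : ℝ → ℝ} (hw' : IsWealthFn γ K w') (h : ∀ y, w y ≤ w' y) (x : ℝ) :
    M.step w x ≤ M.step w' x := by
  rcases lt_or_ge x 0 with hx | hx
  · rw [(isWealthFn_step hr hu hw hK).eq_zero x hx, (isWealthFn_step hr hu hw' hK).eq_zero x hx]
  · obtain ⟨a, c, ha, hc, e⟩ := exists_step_eq hr hu hw hK hx
    rw [e]
    refine le_trans ?_ (payoff_le_step hr hu hw' hK ha hc)
    refine setIntegral_mono_on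
      (integrableOn_payoff hu.isUtility (running_zero hr hu hw hK a) hc _)
      (integrableOn_payoff hu.isUtility (running_zero hr hu hw' hK a) hc _)
      measurableSet_Ioi fun s _ => ?_
    gcongr
    exact mul_le_mul_of_nonneg_left (integral_mono (integrable_wealthFn hr hu hw hK _ _ _)
      (integrable_wealthFn hr hu hw' hK _ _ _) fun z => h _) hr.lam_pos.le

/-- The approximations lie below `w`, so the integrands for `w` itself serve as majorants, both in
the return and in time. -/
theorem tendsto_payoff {wn : ℕ → ℝ → ℝ} (hwn : ∀ n, IsWealthFn γ K (wn n))
    (hle : ∀ n y, wn n y ≤ w y) (hlim : ∀ y, Tendsto (fun n => wn n y) atTop (𝓝 (w y)))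
    {a : M.investSet} {x : ℝ} {c : ℝ → ℝ} (hc : IsCtrl x c) :
    Tendsto (fun n => payoff M.U (M.rho + M.lam) (M.reward (wn n) a) x c) atTop
      (𝓝 (payoff M.U (M.rho + M.lam) (M.reward w a) x c)) := by
  refine tendsto_integral_of_dominated_convergence _
    (fun n => (integrableOn_payoff hu.isUtility (running_zero hr hu (hwn n) hK a) hc
      x).aestronglyMeasurable)
    (integrableOn_payoff hu.isUtility (running_zero hr hu hw hK a) hc x)
    (fun n => Eventually.of_forall fun s => ?_) (Eventually.of_forall fun s => ?_)
  · have h1 := reward_nonneg hr (hwn n) a s (x - ∫ u in (0 : ℝ)..s, c u)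
    have h2 := hu.isUtility.nonneg (hc.nonneg s)
    rw [Real.norm_of_nonneg (mul_nonneg (Real.exp_nonneg _) (add_nonneg h2 h1))]
    gcongr
    exact mul_le_mul_of_nonneg_left (integral_mono (integrable_wealthFn hr hu (hwn n) hK _ _ _)
      (integrable_wealthFn hr hu hw hK _ _ _) fun z => hle n _) hr.lam_pos.le
  · refine Tendsto.const_mul _ (Tendsto.const_add _ (Tendsto.const_mul _ ?_))
    exact tendsto_integral_of_dominated_convergence _
      (fun n => (integrable_wealthFn hr hu (hwn n) hK _ _ _).aestronglyMeasurable)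
      (integrable_wealthFn hr hu hw hK _ _ _)
      (fun n => Eventually.of_forall fun z => by
        rw [Real.norm_of_nonneg ((hwn n).nonneg _)]; exact hle n _)
      (Eventually.of_forall fun z => hlim _)

end Step

/-! ### The least fixed point. -/

/-- The growth constant of the value function. -/
noncomputable def growthConst (M : Market Ω) (k b γ K₁ : ℝ) : ℝ :=
  K₁ * (1 / (M.rho + M.lam) + 1) / (1 - M.contr k b γ)

/-- The least fixed point of the dynamic programming operator. -/
noncomputable def fixedPt (M : Market Ω) (x : ℝ) : ℝ := ⨆ n : ℕ, (M.step)^[n] 0 x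

section FixedPt

variable (hr : M.ReturnAssumption μ k b) (hu : M.UtilityAssumption k b γ K₁)
include hr hu

theorem growthConst_nonneg : 0 ≤ M.growthConst k b γ K₁ := by
  have := beta_pos hr hu
  have := hu.K₁_pos
  exact div_nonneg (by positivity) (by linarith [contr_lt_one hr hu])

/-- The growth constant is the fixed point of the affine map by which `step` transforms growth
constants, so all iterates obey the same bound. -/
theorem growthConst_eq : K₁ * (1 / (M.rho + M.lam) + 1) +
    M.contr k b γ * M.growthConst k b γ K₁ = M.growthConst k b γ K₁ := by
  have : 1 - M.contr k b γ ≠ 0 := by linarith [contr_lt_one hr hu]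
  unfold growthConst
  field_simp
  ring

theorem isWealthFn_iterate (n : ℕ) :
    IsWealthFn γ (M.growthConst k b γ K₁) ((M.step)^[n] 0) := by
  induction n with
  | zero => exact ⟨fun _ _ _ => le_rfl, fun _ _ => rfl, concaveOn_const 0 (convex_Ici 0),
      fun y hy => mul_nonneg (growthConst_nonneg hr hu) (Real.rpow_nonneg hy _)⟩
  | succ n ih =>
    rw [Function.iterate_succ_apply', ← growthConst_eq hr hu]
    rw [← growthConst_eq hr hu] at ih
    have := isWealthFn_step hr hu ih (by
      rw [growthConst_eq hr hu]; exact growthConst_nonneg hr hu)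
    rwa [growthConst_eq hr hu] at this

theorem monotone_iterate (x : ℝ) : Monotone fun n => (M.step)^[n] 0 x := by
  have h : ∀ n x, (M.step)^[n] 0 x ≤ (M.step)^[n + 1] 0 x := by
    intro n
    induction n with
    | zero => exact fun x => (isWealthFn_iterate hr hu 1).nonneg x
    | succ n ih =>
      intro x
      rw [Function.iterate_succ_apply', Function.iterate_succ_apply' _ (n + 1)]
      exact step_mono hr hu (isWealthFn_iterate hr hu n) (growthConst_nonneg hr hu)
        (isWealthFn_iterate hr hu (n + 1)) ih x
  exact monotone_nat_of_le_succ fun n => h n x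

theorem bddAbove_iterate (x : ℝ) : BddAbove (range fun n => (M.step)^[n] 0 x) := by
  refine ⟨M.growthConst k b γ K₁ * (max x 0) ^ γ, ?_⟩
  rintro _ ⟨n, rfl⟩
  exact ((isWealthFn_iterate hr hu n).mono (le_max_left x 0)).trans
    ((isWealthFn_iterate hr hu n).le _ (le_max_right _ _))

theorem tendsto_iterate (x : ℝ) :
    Tendsto (fun n => (M.step)^[n] 0 x) atTop (𝓝 (M.fixedPt x)) :=
  tendsto_atTop_ciSup (monotone_iterate hr hu x) (bddAbove_iterate hr hu x)

theorem iterate_le_fixedPt (n : ℕ) (x : ℝ) : (M.step)^[n] 0 x ≤ M.fixedPt x :=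
  le_ciSup (bddAbove_iterate hr hu x) n

theorem isWealthFn_fixedPt : IsWealthFn γ (M.growthConst k b γ K₁) M.fixedPt := by
  have hi := isWealthFn_iterate hr hu
  have hl := tendsto_iterate hr hu
  refine ⟨fun x y h => le_of_tendsto_of_tendsto' (hl x) (hl y) fun n => (hi n).mono h,
    fun y hy => tendsto_nhds_unique (hl y) (by simp only [(hi _).eq_zero y hy, tendsto_const_nhds]),
    ⟨convex_Ici 0, fun x hx y hy η η' hη hη' h1 => ?_⟩, fun y hy =>
    le_of_tendsto' (hl y) fun n => (hi n).le y hy⟩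
  exact le_of_tendsto_of_tendsto' (((hl x).const_smul η).add ((hl y).const_smul η')) (hl _)
    fun n => (hi n).concave.2 hx hy hη hη' h1

/-- One inequality is monotonicity of the operator. For the other, an optimal pair for the limit
function is held fixed and its payoff is the limit of its payoffs against the iterates, each of
which is below the next iterate. -/
theorem step_fixedPt (x : ℝ) : M.step M.fixedPt x = M.fixedPt x := by
  have hK := growthConst_nonneg hr hu
  have hW := isWealthFn_fixedPt hr hu
  refine le_antisymm ?_ (le_of_tendsto' ((tendsto_iterate hr hu x).comp (tendsto_add_atTop_nat 1))
    fun n => ?_)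
  · rcases lt_or_ge x 0 with hx | hx
    · rw [(isWealthFn_step hr hu hW hK).eq_zero x hx, hW.eq_zero x hx]
    obtain ⟨a, c, ha, hc, e⟩ := exists_step_eq hr hu hW hK hx
    rw [e]
    refine le_of_tendsto' (tendsto_payoff hr hu hW hK (isWealthFn_iterate hr hu)
      (iterate_le_fixedPt hr hu) (tendsto_iterate hr hu) hc) fun n => ?_
    refine (payoff_le_step hr hu (isWealthFn_iterate hr hu n) hK ha hc).trans ?_
    have h := iterate_le_fixedPt hr hu (n + 1) x
    rwa [Function.iterate_succ_apply'] at h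
  · rw [Function.comp_apply, Function.iterate_succ_apply']
    exact step_mono hr hu (isWealthFn_iterate hr hu n) hK hW (iterate_le_fixedPt hr hu n) x

end FixedPt

end Market

end IlliquidConsumption


/-! ### The joint law of the past, the waiting time and the return. -/

namespace IlliquidConsumption

theorem measurable_exponentialPDF (r : ℝ) : Measurable (exponentialPDF r) :=
  (measurable_exponentialPDFReal r).ennreal_ofReal

theorem lintegral_expMeasure {r : ℝ} {f : ℝ → ℝ≥0∞} (hf : Measurable f) :
    ∫⁻ s, f s ∂expMeasure r = ∫⁻ s in Ioi (0 : ℝ), ENNReal.ofReal (r * Real.exp (-r * s)) * f s := by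
  have h0 : expMeasure r = volume.withDensity (exponentialPDF r) := rfl
  rw [h0, lintegral_withDensity_eq_lintegral_mul _ (measurable_exponentialPDF r) hf, ← lintegral_indicator measurableSet_Ioi]
  refine lintegral_congr_ae ?_
  have hne : ∀ᵐ s : ℝ, s ≠ 0 := by simp [ae_iff]
  filter_upwards [hne] with s hs
  rcases lt_or_gt_of_ne hs with h | h
  · rw [indicator_of_notMem (by simpa using h.le), Pi.mul_apply, exponentialPDF_of_neg h, zero_mul]
  · rw [indicator_of_mem (mem_Ioi.2 h), Pi.mul_apply, exponentialPDF_of_nonneg h.le]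
    ring_nf

/-- The exponential density is positive on the half line. This is how a constraint at one random
date becomes a constraint at Lebesgue-almost every time. -/
theorem ae_volume_of_ae_expMeasure {r : ℝ} (hr : 0 < r) {P : ℝ → Prop}
    (h : ∀ᵐ s ∂expMeasure r, P s) : ∀ᵐ s ∂volume.restrict (Ioi (0 : ℝ)), P s := by
  have h0 : expMeasure r = volume.withDensity (exponentialPDF r) := rfl
  rw [h0, ae_withDensity_iff (measurable_exponentialPDF r)] at h
  rw [ae_restrict_iff' measurableSet_Ioi]
  filter_upwards [h] with s hs hs0
  have : 0 < exponentialPDFReal r s := exponentialPDFReal_pos hr hs0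
  exact hs (ENNReal.ofReal_pos.2 this).ne'

theorem measureReal_inter_of_condExp {Ω : Type*} {m m₀ : MeasurableSpace Ω} {μ : Measure Ω}
    [IsProbabilityMeasure μ] (hm : m ≤ m₀) {A D : Set Ω} (hA : MeasurableSet[m] A)
    (hD : MeasurableSet D) {f : Ω → ℝ} (hf : μ[D.indicator (fun _ => (1 : ℝ)) | m] =ᵐ[μ] f) :
    μ.real (A ∩ D) = ∫ ω in A, f ω ∂μ := by
  rw [← setIntegral_congr_ae (hm _ hA) (hf.mono fun ω h _ => h),
    setIntegral_condExp hm ((integrable_const 1).indicator hD) hA, setIntegral_indicator hD]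
  simp

namespace Market

variable {Ω : Type*} [mΩ : MeasurableSpace Ω] {μ : Measure Ω} {M : Market Ω} {k b γ K₁ : ℝ}

theorem hist_le (M : Market Ω) (n : ℕ) : M.hist n ≤ mΩ := by
  refine iSup_le fun i => iSup_le fun _ => sup_le ?_ ?_
  · exact (M.measurable_τ i).comap_le
  · exact (M.measurable_Z i).comap_le

theorem measurable_τ_hist (M : Market Ω) {i n : ℕ} (h : i ≤ n) : Measurable[M.hist n] (M.τ i) :=
  Measurable.mono (comap_measurable (M.τ i))
    (le_sup_left.trans (le_iSup₂_of_le (f := fun i (_ : i ≤ n) =>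
      (MeasurableSpace.comap (M.τ i) inferInstance ⊔ MeasurableSpace.comap (M.Z i) inferInstance))
      i h le_rfl)) le_rfl

theorem measurable_Z_hist (M : Market Ω) {i n : ℕ} (h : i ≤ n) : Measurable[M.hist n] (M.Z i) :=
  Measurable.mono (comap_measurable (M.Z i))
    (le_sup_right.trans (le_iSup₂_of_le (f := fun i (_ : i ≤ n) =>
      (MeasurableSpace.comap (M.τ i) inferInstance ⊔ MeasurableSpace.comap (M.Z i) inferInstance))
      i h le_rfl)) le_rfl

theorem hist_mono (M : Market Ω) {m n : ℕ} (h : m ≤ n) : M.hist m ≤ M.hist n :=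
  iSup₂_le fun i hi => le_iSup₂_of_le (f := fun i (_ : i ≤ n) =>
    (MeasurableSpace.comap (M.τ i) inferInstance ⊔ MeasurableSpace.comap (M.Z i) inferInstance))
    i (hi.trans h) le_rfl

theorem wait_pos (M : Market Ω) (n : ℕ) (ω : Ω) : 0 < M.wait n ω :=
  sub_pos.2 (NNReal.coe_lt_coe.2 (M.τ_strictMono ω (Nat.lt_succ_self n)))

theorem measurable_wait_hist (M : Market Ω) (n : ℕ) : Measurable[M.hist (n + 1)] (M.wait n) :=
  Measurable.sub (measurable_coe_nnreal_real.comp (M.measurable_τ_hist le_rfl))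
    (measurable_coe_nnreal_real.comp (M.measurable_τ_hist n.le_succ))

theorem measurable_wait (M : Market Ω) (n : ℕ) : Measurable (M.wait n) :=
  (M.measurable_wait_hist n).mono (M.hist_le _) le_rfl

/-- The continuity assumption covers indicators of Borel sets, so the mass of each set is even
continuous in time. -/
theorem ReturnAssumption.measurable_retLaw (hr : M.ReturnAssumption μ k b) :
    Measurable M.retLaw := by
  refine Measure.measurable_of_measurable_coe _ fun B hB => ?_
  have hc : Continuous fun s => (M.retLaw s).real B := by
    rw [continuous_iff_continuousAt]
    intro s₀
    have h1 := hr.continuity (B.indicator 1) (measurable_one.indicator hB) ⟨1, fun z => by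
      rw [one_mul]
      have h3 : |B.indicator (1 : ℝ → ℝ) z| ≤ 1 := by
        by_cases h : z ∈ B <;> simp [h]
      linarith [abs_nonneg z]⟩ (max s₀ 0) (le_max_right _ _)
    have h2 : Tendsto (fun s : ℝ => max s 0) (𝓝 s₀) (𝓝[Ici 0] (max s₀ 0)) :=
      tendsto_nhdsWithin_iff.2 ⟨(by fun_prop : Continuous fun s : ℝ => max s 0).tendsto s₀,
        Eventually.of_forall fun s => mem_Ici.2 (le_max_right _ _)⟩
    have h4 := h1.comp h2
    simp only [integral_indicator_one hB] at h4
    exact h4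
  have e : (fun s => M.retLaw s B) = fun s => ENNReal.ofReal ((M.retLaw s).real B) := by
    funext s
    have := hr.isProb_retLaw s
    exact (ofReal_measureReal (μ := M.retLaw s) (s := B)).symm
  rw [e]
  exact hc.measurable.ennreal_ofReal

/-- The law of the return as a kernel in the waiting time. -/
noncomputable def retKernel (hr : M.ReturnAssumption μ k b) : Kernel ℝ ℝ :=
  ⟨M.retLaw, hr.measurable_retLaw⟩

instance (hr : M.ReturnAssumption μ k b) : IsMarkovKernel (retKernel hr) :=
  ⟨fun s => hr.isProb_retLaw s⟩

/-- Conditioning on past and waiting time replaces the return by its law given the waiting time;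
independence then separates the past from the waiting time. -/
theorem ReturnAssumption.lintegral_return (hr : M.ReturnAssumption μ k b) [IsProbabilityMeasure μ]
    (n : ℕ) {A B C : Set _} (hA : MeasurableSet[M.hist n] A) (hB : MeasurableSet B)
    (hC : MeasurableSet C) : μ (A ∩ (M.wait n ⁻¹' B ∩ M.Z (n + 1) ⁻¹' C)) =
      μ A * ∫⁻ s in B, M.retLaw s C ∂expMeasure M.lam := by
  have hm' : M.hist n ⊔ MeasurableSpace.comap (M.wait n) inferInstance ≤ mΩ :=
    sup_le (M.hist_le n) (M.measurable_wait n).comap_le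
  have hκ : Measurable fun s => M.retLaw s C :=
    (Measure.measurable_coe hC).comp hr.measurable_retLaw
  have hA' := M.hist_le n _ hA
  have h1 := measureReal_inter_of_condExp hm' (MeasurableSet.inter
    ((le_sup_left : M.hist n ≤ _) _ hA)
    ((le_sup_right : MeasurableSpace.comap (M.wait n) inferInstance ≤ _) _ ⟨B, hB, rfl⟩))
    (M.measurable_Z (n + 1) hC) (hr.return_law n C hC)
  have h2 : μ (A ∩ M.wait n ⁻¹' B ∩ M.Z (n + 1) ⁻¹' C) =
      ∫⁻ ω in A ∩ M.wait n ⁻¹' B, M.retLaw (M.wait n ω) C ∂μ := by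
    rw [← ofReal_measureReal, h1, ofReal_integral_eq_lintegral_ofReal]
    · refine lintegral_congr fun ω => ?_
      have := hr.isProb_retLaw (M.wait n ω)
      rw [← M.retLaw_of_nonneg (M.wait_pos n ω).le, ofReal_measureReal]
    · refine Integrable.mono' (integrable_const 1) ?_ (Eventually.of_forall fun ω => ?_)
      · simp only [← fun ω => M.retLaw_of_nonneg (M.wait_pos n ω).le]
        exact ((hκ.comp (M.measurable_wait n)).ennreal_toReal).aestronglyMeasurable
      · have := hr.isProb _ (M.wait_pos n ω).le
        rw [Real.norm_of_nonneg measureReal_nonneg]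
        exact measureReal_le_one
    · exact Eventually.of_forall fun ω => measureReal_nonneg
  rw [← inter_assoc, h2, ← lintegral_indicator (hA'.inter (M.measurable_wait n hB))]
  have h3 : (A ∩ M.wait n ⁻¹' B).indicator (fun ω => M.retLaw (M.wait n ω) C) =
      fun ω => A.indicator (fun _ => (1 : ℝ≥0∞)) ω *
        (B.indicator fun s => M.retLaw s C) (M.wait n ω) := by
    funext ω
    by_cases h : ω ∈ A <;> by_cases h' : M.wait n ω ∈ B <;> simp [h, h']
  have h4 : Measurable[MeasurableSpace.comap (M.wait n) inferInstance]
      fun ω => (B.indicator fun s => M.retLaw s C) (M.wait n ω) :=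
    (hκ.indicator hB).comp (comap_measurable _)
  simp only [h3]
  rw [lintegral_mul_eq_lintegral_mul_lintegral_of_independent_measurableSpace (M.hist_le n)
    (M.measurable_wait n).comap_le (hr.wait_indep n) (measurable_const.indicator hA)
    h4, lintegral_indicator_const hA', one_mul,
    ← lintegral_map (hκ.indicator hB) (M.measurable_wait n), hr.wait_law n,
    lintegral_indicator hB]

/-- The joint law of the past, the waiting time and the return. -/
theorem ReturnAssumption.lintegral_next (hr : M.ReturnAssumption μ k b) [IsProbabilityMeasure μ]
    (n : ℕ) {E : Type*} [MeasurableSpace E] {V : Ω → E} (hV : Measurable[M.hist n] V)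
    {F : E → ℝ → ℝ → ℝ≥0∞} (hF : Measurable fun q : E × ℝ × ℝ => F q.1 q.2.1 q.2.2) :
    ∫⁻ ω, F (V ω) (M.wait n ω) (M.Z (n + 1) ω) ∂μ =
      ∫⁻ ω, ∫⁻ s, ∫⁻ z, F (V ω) s z ∂M.retLaw s ∂expMeasure M.lam ∂μ := by
  have hV' : Measurable V := hV.mono (M.hist_le n) le_rfl
  have := isProbabilityMeasure_expMeasure hr.lam_pos
  have := Measure.isProbabilityMeasure_map (μ := μ) hV'.aemeasurable
  have hmeas : Measurable fun ω => (V ω, M.wait n ω, M.Z (n + 1) ω) :=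
    hV'.prodMk ((M.measurable_wait n).prodMk (M.measurable_Z _))
  have := Measure.isProbabilityMeasure_map (μ := μ) hmeas.aemeasurable
  have hlaw : μ.map (fun ω => (V ω, M.wait n ω, M.Z (n + 1) ω)) =
      (μ.map V).prod (expMeasure M.lam ⊗ₘ retKernel hr) := by
    refine Measure.ext_prod₃ fun {S B C} hS hB hC => ?_
    rw [Measure.map_apply hmeas (hS.prod (hB.prod hC)), Measure.prod_prod,
      Measure.compProd_apply_prod hB hC, Measure.map_apply hV' hS]
    exact hr.lintegral_return n (hV hS) hB hC
  have h1 := lintegral_map (μ := μ) hF hmeas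
  simp only at h1
  rw [← h1, hlaw, lintegral_prod _ hF.aemeasurable]
  rw [lintegral_map]
  · refine lintegral_congr fun ω => ?_
    have h2 : Measurable fun q : ℝ × ℝ => F (V ω) q.1 q.2 :=
      hF.comp (f := fun q : ℝ × ℝ => (V ω, q.1, q.2)) (by fun_prop)
    exact Measure.lintegral_compProd h2
  · exact hF.lintegral_prod_right'
  · exact hV'

/-- The joint law is applied to the indicator of the failure of `P`: a nonnegative integral vanishes
exactly when the integrand does almost everywhere, level by level. -/
theorem ReturnAssumption.ae_next (hr : M.ReturnAssumption μ k b) [IsProbabilityMeasure μ]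
    (n : ℕ) {E : Type*} [MeasurableSpace E] {V : Ω → E} (hV : Measurable[M.hist n] V)
    {P : E → ℝ → ℝ → Prop} (hP : MeasurableSet {q : E × ℝ × ℝ | P q.1 q.2.1 q.2.2}) :
    (∀ᵐ ω ∂μ, P (V ω) (M.wait n ω) (M.Z (n + 1) ω)) ↔
      ∀ᵐ ω ∂μ, ∀ᵐ s ∂expMeasure M.lam, ∀ᵐ z ∂M.retLaw s, P (V ω) s z := by
  classical
  set F : E → ℝ → ℝ → ℝ≥0∞ := fun v s z => if P v s z then 0 else 1 with hF
  have hFm : Measurable fun q : E × ℝ × ℝ => F q.1 q.2.1 q.2.2 :=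
    Measurable.ite hP measurable_const measurable_const
  have h := hr.lintegral_next n hV hFm
  have := isProbabilityMeasure_expMeasure hr.lam_pos
  have hV' : Measurable V := hV.mono (M.hist_le n) le_rfl
  have hF0 : ∀ v s z, F v s z = 0 ↔ P v s z := fun v s z => by simp [hF]
  have hm1 : Measurable fun q : E × ℝ => ∫⁻ z, F q.1 q.2 z ∂M.retLaw q.2 :=
    Measurable.lintegral_kernel_prod_right' (κ := (retKernel hr).comap Prod.snd measurable_snd)
      (f := fun q : (E × ℝ) × ℝ => F q.1.1 q.1.2 q.2)
      (hFm.comp (f := fun q : (E × ℝ) × ℝ => (q.1.1, q.1.2, q.2)) (by fun_prop))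
  have hm2 : Measurable fun v : E => ∫⁻ s, ∫⁻ z, F v s z ∂M.retLaw s ∂expMeasure M.lam :=
    hm1.lintegral_prod_right'
  have e1 : (∫⁻ ω, F (V ω) (M.wait n ω) (M.Z (n + 1) ω) ∂μ = 0) ↔
      ∀ᵐ ω ∂μ, P (V ω) (M.wait n ω) (M.Z (n + 1) ω) := by
    have hm3 : Measurable fun ω => F (V ω) (M.wait n ω) (M.Z (n + 1) ω) := hFm.comp (hV'.prodMk
      ((M.measurable_wait n).prodMk (M.measurable_Z (n + 1))))
    rw [lintegral_eq_zero_iff hm3]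
    exact eventually_congr (Eventually.of_forall fun ω => hF0 _ _ _)
  have hm4 : Measurable fun ω => ∫⁻ s, ∫⁻ z, F (V ω) s z ∂M.retLaw s ∂expMeasure M.lam :=
    hm2.comp hV'
  rw [← e1, h, lintegral_eq_zero_iff hm4]
  refine eventually_congr (Eventually.of_forall fun ω => ?_)
  simp only [Pi.zero_apply]
  have hm5 : Measurable fun s => ∫⁻ z, F (V ω) s z ∂M.retLaw s := hm1.comp measurable_prodMk_left
  rw [lintegral_eq_zero_iff hm5]
  refine eventually_congr (Eventually.of_forall fun s => ?_)
  simp only [Pi.zero_apply]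
  have hm6 : Measurable fun z => F (V ω) s z :=
    hFm.comp (f := fun z => (V ω, s, z)) (by fun_prop)
  rw [lintegral_eq_zero_iff hm6]
  exact eventually_congr (Eventually.of_forall fun z => hF0 _ _ _)

end Market

end IlliquidConsumption


/-! ### Structure of predictable processes between trading dates. -/

namespace IlliquidConsumption

namespace Market

variable {Ω : Type*} [mΩ : MeasurableSpace Ω] {μ : Measure Ω} {M : Market Ω}

/-- The sample space with the information available at the `n`-th trading date. -/
def Past (_ : Market Ω) (_ : ℕ) : Type _ := Ω

noncomputable instance (n : ℕ) : MeasurableSpace (M.Past n) := M.hist n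

/-- The identity, as a map to the space of past observations. -/
def toPast (M : Market Ω) (n : ℕ) (ω : Ω) : M.Past n := ω

/-- The identity, as a map from the space of past observations. -/
def ofPast (M : Market Ω) (n : ℕ) (ω : M.Past n) : Ω := ω

theorem ofPast_toPast (n : ℕ) (ω : Ω) : M.ofPast n (M.toPast n ω) = ω := rfl

theorem measurable_toPast (n : ℕ) : Measurable[M.hist n] (M.toPast n) := fun _ h => h

theorem measurable_comp_ofPast {E : Type*} [MeasurableSpace E] {n : ℕ} {f : Ω → E}
    (hf : Measurable[M.hist n] f) : Measurable fun h => f (M.ofPast n h) := hf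

/-- Times and scenarios with the predictable `σ`-algebra. -/
def PredSpace (_ : Market Ω) : Type _ := ℝ≥0 × Ω

noncomputable instance : MeasurableSpace M.PredSpace := M.obs.predictable

/-- The point of the predictable space at a given time and scenario. -/
def predMk (M : Market Ω) (t : ℝ≥0) (ω : Ω) : M.PredSpace := (t, ω)

/-- The time of a point of the predictable space. -/
def PredSpace.time (q : M.PredSpace) : ℝ≥0 := Prod.fst q

/-- The scenario of a point of the predictable space. -/
def PredSpace.scen (q : M.PredSpace) : Ω := Prod.snd q

@[simp] theorem time_predMk (t : ℝ≥0) (ω : Ω) : (M.predMk t ω).time = t := rfl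

@[simp] theorem scen_predMk (t : ℝ≥0) (ω : Ω) : (M.predMk t ω).scen = ω := rfl

theorem measurable_pred {c : ℝ≥0 → Ω → ℝ} (hc : IsStronglyPredictable M.obs c) :
    Measurable fun q : M.PredSpace => c q.time q.scen := StronglyMeasurable.measurable hc

theorem isStronglyPredictable_of_measurable {f : M.PredSpace → ℝ} (hf : Measurable f) :
    IsStronglyPredictable M.obs fun t ω => f (M.predMk t ω) := hf.stronglyMeasurable

theorem measurableSet_pred_Ioi {s : ℝ≥0} {A : Set Ω} (hA : MeasurableSet[M.obs s] A) :
    MeasurableSet {q : M.PredSpace | s < q.time ∧ q.scen ∈ A} :=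
  measurableSet_predictable_Ioi_prod hA

/-- Strictly before the date `n + 1`, a generating event with index above `n` has not occurred,
while one with index at most `n` belongs to the past; the property passes to complements and
countable unions. -/
theorem exists_hist_of_obs (n : ℕ) {s : ℝ≥0} {A : Set Ω} (hA : MeasurableSet[M.obs s] A) :
    ∃ Q : Set (M.Past n), MeasurableSet Q ∧ ∀ ω, s < M.τ (n + 1) ω → (ω ∈ A ↔ M.toPast n ω ∈ Q) := by
  induction A, hA using MeasurableSpace.generateFrom_induction with
  | hC A hA _ =>
    obtain ⟨j, s', B, hs', hB, rfl⟩ := hA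
    rcases le_or_gt j n with hj | hj
    · refine ⟨{h | M.τ j (M.ofPast n h) ≤ s' ∧ M.Z j (M.ofPast n h) ∈ B}, ?_, fun ω _ => Iff.rfl⟩
      exact (measurable_comp_ofPast (M.measurable_τ_hist hj) measurableSet_Iic).inter
        (measurable_comp_ofPast (M.measurable_Z_hist hj) hB)
    · refine ⟨∅, MeasurableSet.empty, fun ω hω => ?_⟩
      simp only [mem_empty_iff_false, iff_false]
      rintro ⟨h1, -⟩
      exact absurd (((M.τ_strictMono ω).monotone (Nat.succ_le_of_lt hj)).trans (h1.trans hs'))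
        (not_le.2 hω)
  | empty => exact ⟨∅, MeasurableSet.empty, fun _ _ => Iff.rfl⟩
  | compl A _ ih =>
    obtain ⟨Q, hQ, h⟩ := ih
    exact ⟨Qᶜ, hQ.compl, fun ω hω => not_congr (h ω hω)⟩
  | iUnion A _ ih =>
    choose Q hQ h using ih
    refine ⟨⋃ i, Q i, MeasurableSet.iUnion hQ, fun ω hω => ?_⟩
    simp only [mem_iUnion]
    exact exists_congr fun i => h i ω hω

/-- Up to the next trading date, a predictable process only depends on the past observations. -/
theorem exists_past_of_predictable (n : ℕ) {c : ℝ≥0 → Ω → ℝ} (hc : IsStronglyPredictable M.obs c) :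
    ∃ C : ℝ≥0 × M.Past n → ℝ, Measurable C ∧
      ∀ t ω, t ≤ M.τ (n + 1) ω → c t ω = C (t, M.toPast n ω) := by
  set T : Type _ := {q : M.PredSpace // q.time ≤ M.τ (n + 1) q.scen} with hT
  set φ : T → ℝ≥0 × M.Past n := fun q => (q.1.time, M.toPast n q.1.scen) with hφ
  -- It suffices to treat predictable rectangles. In `(s, ∞) × A` the event `A` is known at `s`,
  -- strictly before the current time; hence the period can include its right endpoint `τ (n + 1)`.
  have hle : MeasurableSpace.comap (Subtype.val : T → M.PredSpace) inferInstance ≤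
      MeasurableSpace.comap φ inferInstance := by
    rw [MeasurableSpace.comap_le_iff_le_map]
    refine MeasurableSpace.generateFrom_le ?_
    rintro G (⟨A, hA, rfl⟩ | ⟨s, A, hA, rfl⟩)
    · obtain ⟨Q, hQ, h⟩ := exists_hist_of_obs n hA
      refine ⟨{⊥} ×ˢ Q, (measurableSet_singleton _).prod hQ, ?_⟩
      ext ⟨q, hq⟩
      refine and_congr_right fun ht => (h q.scen ?_).symm
      have h0 := M.τ_strictMono q.scen (Nat.succ_pos n)
      exact lt_of_le_of_lt bot_le h0
    · obtain ⟨Q, hQ, h⟩ := exists_hist_of_obs n hA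
      refine ⟨Ioi s ×ˢ Q, measurableSet_Ioi.prod hQ, ?_⟩
      ext ⟨q, hq⟩
      exact and_congr_right fun ht => (h q.scen (lt_of_lt_of_le (mem_Ioi.1 ht) hq)).symm
  have hcT : Measurable[MeasurableSpace.comap φ inferInstance]
      (fun q : T => c q.1.time q.1.scen) :=
    ((measurable_pred hc).comp (comap_measurable (Subtype.val : T → M.PredSpace))).mono hle le_rfl
  obtain ⟨C, hC, e⟩ := hcT.exists_eq_measurable_comp
  exact ⟨C, hC, fun t ω h => congrFun e ⟨M.predMk t ω, h⟩⟩

/-- Between `τ n` and a later time there is a rational, so the set is a countable union of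
predictable rectangles built from `A ∩ {τ n ≤ r}`. -/
theorem measurableSet_after (n : ℕ) {A : Set Ω}
    (hA : MeasurableSet[(M.isStoppingTime_τ n).measurableSpace] A) :
    MeasurableSet {q : M.PredSpace | M.τ n q.scen < q.time ∧ q.scen ∈ A} := by
  have e : {q : M.PredSpace | M.τ n q.scen < q.time ∧ q.scen ∈ A} = ⋃ r : ℚ,
      {q : M.PredSpace | Real.toNNReal r < q.time ∧
        q.scen ∈ A ∩ {ω | ((M.τ n ω : ℝ≥0) : WithTop ℝ≥0) ≤ Real.toNNReal r}} := by
    ext q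
    simp only [mem_ofPred_eq, mem_iUnion, mem_inter_iff, WithTop.coe_le_coe]
    constructor
    · rintro ⟨h1, h2⟩
      obtain ⟨r, -, hr1, hr2⟩ := (NNReal.lt_iff_exists_rat_btwn _ _).1 h1
      exact ⟨r, hr2, h2, hr1.le⟩
    · rintro ⟨r, hr, h2, hr1⟩
      exact ⟨hr1.trans_lt hr, h2⟩
  rw [e]
  exact MeasurableSet.iUnion fun r => measurableSet_pred_Ioi (hA.2 _)

/-- For `A` in the stopped σ-algebra, the indicator of `A` after `τ n` is a predictable process,
hence a function of time and past up to the next date. Its values at `τ n + 1 / (m + 1)` for large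
`m` recover `A`. -/
theorem stopped_le_hist (n : ℕ) : (M.isStoppingTime_τ n).measurableSpace ≤ M.hist n := by
  intro A hA
  classical
  have hPm : Measurable ({q : M.PredSpace | M.τ n q.scen < q.time ∧ q.scen ∈ A}.indicator
      (1 : M.PredSpace → ℝ)) := measurable_one.indicator (measurableSet_after n hA)
  obtain ⟨C, hC, h⟩ := exists_past_of_predictable n (isStronglyPredictable_of_measurable hPm)
  have hτ : Measurable fun h : M.Past n => M.τ n (M.ofPast n h) :=
    measurable_comp_ofPast (M.measurable_τ_hist le_rfl)
  have hset : MeasurableSet {h : M.Past n | ∃ N : ℕ, ∀ m : ℕ, N ≤ m →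
      C (M.τ n (M.ofPast n h) + 1 / ((m : ℝ≥0) + 1), h) = 1} := by
    have : {h : M.Past n | ∃ N : ℕ, ∀ m : ℕ, N ≤ m →
          C (M.τ n (M.ofPast n h) + 1 / ((m : ℝ≥0) + 1), h) = 1} =
        ⋃ N : ℕ, ⋂ m : ℕ, ⋂ _ : N ≤ m,
          {h : M.Past n | C (M.τ n (M.ofPast n h) + 1 / ((m : ℝ≥0) + 1), h) = 1} := by
      ext ω; simp
    rw [this]
    refine MeasurableSet.iUnion fun N => MeasurableSet.iInter fun m => MeasurableSet.iInter fun _ => ?_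
    exact (hC.comp ((hτ.add_const _).prodMk measurable_id)) (measurableSet_singleton (1 : ℝ))
  have hA' : A = M.toPast n ⁻¹' {h : M.Past n | ∃ N : ℕ, ∀ m : ℕ, N ≤ m →
      C (M.τ n (M.ofPast n h) + 1 / ((m : ℝ≥0) + 1), h) = 1} := by
    ext ω
    have hlt := M.τ_strictMono ω (Nat.lt_succ_self n)
    have hlim : Tendsto (fun m : ℕ => M.τ n ω + 1 / ((m : ℝ≥0) + 1)) atTop (𝓝 (M.τ n ω + 0)) :=
      tendsto_one_div_add_atTop_nhds_zero_nat.const_add _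
    rw [add_zero] at hlim
    obtain ⟨N₀, hN₀⟩ := eventually_atTop.1 (hlim.eventually (gt_mem_nhds hlt))
    have key : ∀ m, N₀ ≤ m →
        (C (M.τ n ω + 1 / ((m : ℝ≥0) + 1), M.toPast n ω) = 1 ↔ ω ∈ A) := by
      intro m hm
      have h2 : M.τ n ω < M.τ n ω + 1 / ((m : ℝ≥0) + 1) := lt_add_of_pos_right _ (by positivity)
      rw [← h _ ω (hN₀ m hm).le, indicator_apply]
      simp
    simp only [mem_preimage, mem_ofPred_eq, ofPast_toPast]
    constructor
    · exact fun hω => ⟨N₀, fun m hm => (key m hm).2 hω⟩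
    · rintro ⟨N, hN⟩
      exact (key _ (le_max_right N N₀)).1 (hN _ (le_max_left _ _))
  rw [hA']
  exact measurable_toPast n hset

/-- Earlier dates satisfy `τ i ≤ τ n`, so whatever they generate is already observed at any time by
which `τ n` has occurred. This makes a choice based on the past a legitimate investment. -/
theorem hist_le_stopped (n : ℕ) : M.hist n ≤ (M.isStoppingTime_τ n).measurableSpace := by
  have hgen : ∀ (k : ℕ) (s : ℝ≥0) (B : Set ℝ), MeasurableSet B →
      MeasurableSet[M.obs s] {ω | M.τ k ω ≤ s ∧ M.Z k ω ∈ B} := fun k s B hB =>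
    MeasurableSpace.measurableSet_generateFrom ⟨k, s, B, le_rfl, hB, rfl⟩
  have hτ : ∀ (k : ℕ) (s : ℝ≥0), MeasurableSet[M.obs s] {ω | M.τ k ω ≤ s} := fun k s => by
    simpa using hgen k s univ MeasurableSet.univ
  refine iSup_le fun i => iSup_le fun hi => sup_le ?_ ?_
  · refine Measurable.comap_le (m₁ := (M.isStoppingTime_τ n).measurableSpace)
      (measurable_of_Iic fun u => ⟨le_iSup (fun t => (M.obs t : MeasurableSpace Ω)) u _ (hτ i u),
        fun t => ?_⟩)
    have e : M.τ i ⁻¹' Iic u ∩ {ω | ((M.τ n ω : ℝ≥0) : WithTop ℝ≥0) ≤ t} =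
        {ω | M.τ i ω ≤ min u t} ∩ {ω | M.τ n ω ≤ t} := by
      ext ω
      simp only [mem_inter_iff, mem_preimage, mem_Iic, mem_ofPred_eq, WithTop.coe_le_coe, le_min_iff]
      exact ⟨fun ⟨h1, h2⟩ => ⟨⟨h1, ((M.τ_strictMono ω).monotone hi).trans h2⟩, h2⟩,
        fun ⟨h1, h2⟩ => ⟨h1.1, h2⟩⟩
    rw [e]
    exact MeasurableSet.inter (M.obs.mono (min_le_right u t) _ (hτ i _)) (hτ n t)
  · refine Measurable.comap_le (m₁ := (M.isStoppingTime_τ n).measurableSpace) fun B hB => ⟨?_,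
      fun t => ?_⟩
    · have e : M.Z i ⁻¹' B = ⋃ r : ℕ, {ω | M.τ i ω ≤ (r : ℝ≥0) ∧ M.Z i ω ∈ B} := by
        ext ω
        simp only [mem_preimage, mem_iUnion, mem_ofPred_eq]
        exact ⟨fun h => ⟨_, (exists_nat_ge (M.τ i ω)).choose_spec, h⟩, fun ⟨_, h⟩ => h.2⟩
      rw [e]
      exact MeasurableSet.iUnion fun r =>
        le_iSup (fun t => (M.obs t : MeasurableSpace Ω)) (r : ℝ≥0) _ (hgen i r B hB)
    · have e : M.Z i ⁻¹' B ∩ {ω | ((M.τ n ω : ℝ≥0) : WithTop ℝ≥0) ≤ t} =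
          {ω | M.τ i ω ≤ t ∧ M.Z i ω ∈ B} ∩ {ω | M.τ n ω ≤ t} := by
        ext ω
        simp only [mem_inter_iff, mem_preimage, mem_ofPred_eq, WithTop.coe_le_coe]
        exact ⟨fun ⟨h1, h2⟩ => ⟨⟨((M.τ_strictMono ω).monotone hi).trans h2, h1⟩, h2⟩,
          fun ⟨h1, h2⟩ => ⟨h1.2, h2⟩⟩
      rw [e]
      exact MeasurableSet.inter (hgen i t B hB) (hτ n t)

theorem measurableSet_lt_pred (n : ℕ) :
    MeasurableSet {q : M.PredSpace | M.τ n q.scen < q.time} := by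
  simpa using measurableSet_after (M := M) n (A := univ) MeasurableSet.univ

theorem measurable_time : Measurable fun q : M.PredSpace => q.time :=
  measurable_of_Ioi fun s => by
    have h := measurableSet_pred_Ioi (M := M) (s := s) (A := univ) MeasurableSet.univ
    simp only [mem_univ, and_true] at h
    exact h

theorem measurable_scen_after (n : ℕ) : Measurable
    fun q : {q : M.PredSpace | M.τ n q.scen < q.time} => M.toPast n q.1.scen := by
  intro A hA
  have h := measurableSet_after n (hist_le_stopped n _ (measurable_toPast n hA))
  refine ⟨{q : M.PredSpace | M.τ n q.scen < q.time ∧ q.scen ∈ M.toPast n ⁻¹' A}, h, ?_⟩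
  ext q
  exact ⟨fun h => h.2, fun h => ⟨q.2, h⟩⟩

theorem measurable_after (n : ℕ) {C : ℝ≥0 × M.Past n → ℝ} (hC : Measurable C) :
    Measurable fun q : M.PredSpace =>
      if M.τ n q.scen < q.time then C (q.time, M.toPast n q.scen) else 0 := by
  refine measurable_of_restrict_of_restrict_compl (measurableSet_lt_pred n) ?_ ?_
  · have hφ : Measurable fun q : {q : M.PredSpace | M.τ n q.scen < q.time} =>
        ((q.1.time, M.toPast n q.1.scen) : ℝ≥0 × M.Past n) :=
      (measurable_time.comp measurable_subtype_coe).prodMk (measurable_scen_after n)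
    have e : ({q : M.PredSpace | M.τ n q.scen < q.time}.domRestrict fun q : M.PredSpace =>
        if M.τ n q.scen < q.time then C (q.time, M.toPast n q.scen) else 0) =
        fun q => C (q.1.time, M.toPast n q.1.scen) := funext fun q => if_pos q.2
    rw [e]
    exact hC.comp hφ
  · have e : ({q : M.PredSpace | M.τ n q.scen < q.time}ᶜ.domRestrict fun q : M.PredSpace =>
        if M.τ n q.scen < q.time then C (q.time, M.toPast n q.scen) else 0) =
        fun _ => 0 := funext fun q => if_neg q.2
    rw [e]
    exact measurable_const

/-- Predictable processes can be pieced together from the trading periods. -/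
theorem exists_predictable (C : ∀ n, ℝ≥0 × M.Past n → ℝ) (hC : ∀ n, Measurable (C n))
    (hC0 : ∀ n q, 0 ≤ C n q) : ∃ c : ℝ≥0 → Ω → ℝ, IsStronglyPredictable M.obs c ∧
      (∀ t ω, 0 ≤ c t ω) ∧ ∀ n t ω, M.τ n ω < t → t ≤ M.τ (n + 1) ω →
        c t ω = C n (t, M.toPast n ω) := by
  set T : ℕ → Set M.PredSpace := fun n =>
    {q | M.τ n q.scen < q.time} \ {q | M.τ (n + 1) q.scen < q.time} with hT
  have hTm : ∀ n, MeasurableSet (T n) := fun n =>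
    (measurableSet_lt_pred n).diff (measurableSet_lt_pred (n + 1))
  have huniq : ∀ i j q, q ∈ T i → q ∈ T j → ¬ i < j := fun i j q hi hj hij =>
    hi.2 (lt_of_le_of_lt ((M.τ_strictMono q.scen).monotone (Nat.succ_le_of_lt hij)) hj.1)
  obtain ⟨f, hf, hfe⟩ := exists_measurable_piecewise T hTm
    (fun n (q : M.PredSpace) =>
      if M.τ n q.scen < q.time then C n (q.time, M.toPast n q.scen) else 0)
    (fun n => measurable_after n (hC n)) (fun i j hij q hq => by
      rcases lt_or_gt_of_ne hij with h | h
      · exact absurd h (huniq i j q hq.1 hq.2)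
      · exact absurd h (huniq j i q hq.2 hq.1))
  -- The glued function is prescribed only on the trading periods; truncation secures its sign
  -- elsewhere, at time 0 and beyond all dates.
  refine ⟨fun t ω => max (f (M.predMk t ω)) 0,
    isStronglyPredictable_of_measurable (hf.max measurable_const),
    fun t ω => le_max_right _ _, fun n t ω h1 h2 => ?_⟩
  have h3 : f (M.predMk t ω) = C n (t, M.toPast n ω) :=
    (hfe n (show M.predMk t ω ∈ T n from ⟨h1, not_lt.2 h2⟩)).trans (if_pos h1)
  change max (f (M.predMk t ω)) 0 = _
  rw [h3, max_eq_left (hC0 _ _)]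

end Market

end IlliquidConsumption


/-! ### One trading period as a deterministic payoff. -/

namespace IlliquidConsumption

theorem lintegral_exp_tail {r : ℝ} (hr : 0 < r) (u : ℝ) :
    ∫⁻ s in Ici u, ENNReal.ofReal (r * Real.exp (-r * s)) = ENNReal.ofReal (Real.exp (-r * u)) := by
  have hint : IntegrableOn (fun s => r * Real.exp (-r * s)) (Ioi u) :=
    (exp_neg_integrableOn_Ioi u hr).const_mul r
  rw [setLIntegral_congr Ioi_ae_eq_Ici.symm, ← ofReal_integral_eq_lintegral_ofReal hint
    (Eventually.of_forall fun s => by positivity), integral_const_mul,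
    integral_exp_mul_Ioi (by linarith) u]
  congr 1
  field_simp

/-- Discounting with an independent exponential clock. -/
theorem lintegral_exp_clock {r : ℝ} (hr : 0 < r) {f : ℝ → ℝ≥0∞} (hf : Measurable f) :
    ∫⁻ s in Ioi (0 : ℝ), ENNReal.ofReal (r * Real.exp (-r * s)) * ∫⁻ u in Ioc 0 s, f u =
      ∫⁻ u in Ioi (0 : ℝ), ENNReal.ofReal (Real.exp (-r * u)) * f u := by
  set e : ℝ → ℝ≥0∞ := fun s => ENNReal.ofReal (r * Real.exp (-r * s)) with he
  have hem : Measurable e := by fun_prop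
  set H : ℝ → ℝ → ℝ≥0∞ := fun s u => (Ici u).indicator e s * f u with hH
  have hHm : Measurable (Function.uncurry H) := by
    have h1 : Measurable fun q : ℝ × ℝ => ({q : ℝ × ℝ | q.2 ≤ q.1}.indicator (fun q => e q.1)) q :=
      (hem.comp measurable_fst).indicator (measurableSet_le measurable_snd measurable_fst)
    have h2 : Function.uncurry H = fun q : ℝ × ℝ =>
        ({q : ℝ × ℝ | q.2 ≤ q.1}.indicator (fun q => e q.1)) q * f q.2 := by
      funext ⟨s, u⟩
      by_cases h : u ≤ s <;> simp [hH, Function.uncurry, h]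
    rw [h2]
    exact h1.mul (hf.comp measurable_snd)
  have h1 : ∀ s ∈ Ioi (0 : ℝ), e s * ∫⁻ u in Ioc 0 s, f u = ∫⁻ u in Ioi (0 : ℝ), H s u := by
    intro s hs
    rw [← lintegral_const_mul _ hf, ← lintegral_indicator measurableSet_Ioc,
      ← lintegral_indicator measurableSet_Ioi]
    refine lintegral_congr fun u => ?_
    by_cases h0 : 0 < u <;> by_cases h : u ≤ s <;> simp [hH, h0, h]
  rw [setLIntegral_congr_fun measurableSet_Ioi h1, lintegral_lintegral_swap hHm.aemeasurable]
  refine setLIntegral_congr_fun measurableSet_Ioi fun u hu => ?_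
  have hu0 : (0 : ℝ) < u := hu
  simp only [hH]
  rw [lintegral_mul_const _ (hem.indicator measurableSet_Ici), setLIntegral_indicator
    measurableSet_Ici, ← lintegral_exp_tail hr u]
  congr 3
  exact inter_eq_left.2 fun s hs => hu0.trans_le hs

namespace Market

variable {Ω : Type*} [mΩ : MeasurableSpace Ω] {μ : Measure Ω} {M : Market Ω} {k b γ K₁ : ℝ}

/-- The discounted utility of a consumption rate on `(0, s]`. -/
noncomputable def periodGain (M : Market Ω) (d : ℝ → ℝ) (s : ℝ) : ℝ≥0∞ :=
  ∫⁻ u in Ioc 0 s, ENNReal.ofReal (Real.exp (-M.rho * u) * M.U (d u))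

/-- The expected utility until the next trading date plus the discounted continuation value. -/
noncomputable def oneStep (M : Market Ω) (w : ℝ → ℝ) (ξ a : ℝ) (d : ℝ → ℝ) : ℝ≥0∞ :=
  ∫⁻ s, ∫⁻ z, (M.periodGain d s +
    ENNReal.ofReal (Real.exp (-M.rho * s) * w (ξ - (∫ u in Ioc 0 s, d u) + a * z)))
      ∂M.retLaw s ∂expMeasure M.lam

section Measurability

variable {E : Type*} [MeasurableSpace E] {d : E → ℝ → ℝ} (hd : Measurable (Function.uncurry d))
include hd

theorem measurable_periodGain (hu : M.UtilityAssumption k b γ K₁) (hd0 : ∀ h u, 0 ≤ d h u) :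
    Measurable fun q : E × ℝ => M.periodGain (d q.1) q.2 := by
  have hUm : Measurable fun q : E × ℝ => ENNReal.ofReal (Real.exp (-M.rho * q.2) *
      M.U (max (d q.1 q.2) 0)) :=
    ((by fun_prop : Measurable fun q : E × ℝ => Real.exp (-M.rho * q.2)).mul
      (hu.isUtility.continuous_comp_max.measurable.comp hd)).ennreal_ofReal
  have h1 : (fun q : E × ℝ => M.periodGain (d q.1) q.2) = fun q => ∫⁻ u,
      {r : (E × ℝ) × ℝ | 0 < r.2 ∧ r.2 ≤ r.1.2}.indicator (fun r =>
        ENNReal.ofReal (Real.exp (-M.rho * r.2) * M.U (max (d r.1.1 r.2) 0))) (q, u) := by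
    funext q
    rw [periodGain, ← lintegral_indicator measurableSet_Ioc]
    refine lintegral_congr fun u => ?_
    simp [indicator_apply, max_eq_left (hd0 _ _)]
  rw [h1]
  refine Measurable.lintegral_prod_right' ?_
  exact (hUm.comp ((measurable_fst.comp measurable_fst).prodMk measurable_snd)).indicator
    ((measurableSet_lt measurable_const measurable_snd).inter
      (measurableSet_le measurable_snd (measurable_snd.comp measurable_fst)))

theorem measurable_periodConsumption :
    Measurable fun q : E × ℝ => ∫ u in Ioc 0 q.2, d q.1 u := by
  have h1 : (fun q : E × ℝ => ∫ u in Ioc 0 q.2, d q.1 u) = fun q => ∫ u,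
      {r : (E × ℝ) × ℝ | 0 < r.2 ∧ r.2 ≤ r.1.2}.indicator (fun r => d r.1.1 r.2) (q, u) := by
    funext q
    rw [← integral_indicator measurableSet_Ioc]
    refine integral_congr_ae (Eventually.of_forall fun u => ?_)
    simp [indicator_apply]
  rw [h1]
  have h2 : Measurable ({r : (E × ℝ) × ℝ | 0 < r.2 ∧ r.2 ≤ r.1.2}.indicator
      fun r => d r.1.1 r.2) :=
    (hd.comp ((measurable_fst.comp measurable_fst).prodMk measurable_snd)).indicator
      ((measurableSet_lt measurable_const measurable_snd).inter
        (measurableSet_le measurable_snd (measurable_snd.comp measurable_fst)))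
  exact (h2.stronglyMeasurable.integral_prod_right' (ν := volume)).measurable

theorem measurable_oneStep_integrand (hu : M.UtilityAssumption k b γ K₁)
    (hd0 : ∀ h u, 0 ≤ d h u) {w : ℝ → ℝ} (hw : Measurable w) {ξ a : E → ℝ} (hξ : Measurable ξ)
    (ha : Measurable a) : Measurable fun q : E × ℝ × ℝ => M.periodGain (d q.1) q.2.1 +
      ENNReal.ofReal (Real.exp (-M.rho * q.2.1) *
        w (ξ q.1 - (∫ u in Ioc 0 q.2.1, d q.1 u) + a q.1 * q.2.2)) := by
  have h0 : Measurable fun q : E × ℝ × ℝ => (q.1, q.2.1) := by fun_prop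
  have h1 := (measurable_periodGain hd hu hd0).comp h0
  have h2 := (measurable_periodConsumption hd).comp h0
  refine h1.add (((by fun_prop : Measurable fun q : E × ℝ × ℝ => Real.exp (-M.rho * q.2.1)).mul
    (hw.comp (Measurable.add ((hξ.comp measurable_fst).sub h2)
      ((ha.comp measurable_fst).mul (by fun_prop))))).ennreal_ofReal)

end Measurability

section OneStep

variable {K : ℝ} {w : ℝ → ℝ} (hr : M.ReturnAssumption μ k b) (hu : M.UtilityAssumption k b γ K₁)
  (hw : IsWealthFn γ K w) (hK : 0 ≤ K)
include hr hu hw hK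

/-- By Fubini, utility collected until an exponential clock rings is utility discounted additionally
by `exp (-λ u)`. The density `λ exp (-λ s)` of the clock turns the continuation value into the
running reward, with the same total discount `ρ + λ`. -/
theorem oneStep_eq {ξ : ℝ} (a : M.investSet) {d : ℝ → ℝ} (hd : IsCtrl (ξ - M.l a) d) :
    M.oneStep w ξ a d =
      ENNReal.ofReal (payoff M.U (M.rho + M.lam) (M.reward w a) (ξ - M.l a) d) := by
  have hrun := running_zero hr hu hw hK a
  have hU := hu.isUtility
  have hI : ∀ s, 0 < s → ∫ u in Ioc 0 s, d u = ∫ u in (0 : ℝ)..s, d u := fun s hs =>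
    (intervalIntegral.integral_of_le hs.le).symm
  have hUm : Measurable fun u => ENNReal.ofReal (Real.exp (-M.rho * u) * M.U (d u)) :=
    ((by fun_prop : Measurable fun u : ℝ => Real.exp (-M.rho * u)).mul
      (hU.measurable_comp hd.measurable hd.nonneg)).ennreal_ofReal
  set R : ℝ → ℝ := fun s => Real.exp (-(M.rho + M.lam) * s) *
    M.reward w a s (ξ - M.l a - ∫ u in (0 : ℝ)..s, d u) with hR
  have hRint : IntegrableOn R (Ioi 0) := hrun.integrableOn hd _
  have hR0 : ∀ s, 0 ≤ R s := fun s => mul_nonneg (Real.exp_nonneg _) (hrun.nonneg _ _)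
  have hRm : AEMeasurable (fun s => ENNReal.ofReal (R s)) (volume.restrict (Ioi 0)) :=
    hRint.aestronglyMeasurable.aemeasurable.ennreal_ofReal
  have hinner : ∀ s, 0 < s → ENNReal.ofReal (M.lam * Real.exp (-M.lam * s)) * (∫⁻ z, (M.periodGain d s +
      ENNReal.ofReal (Real.exp (-M.rho * s) * w (ξ - (∫ u in Ioc 0 s, d u) + a * z)))
        ∂M.retLaw s) = ENNReal.ofReal (M.lam * Real.exp (-M.lam * s)) * M.periodGain d s +
          ENNReal.ofReal (R s) := by
    intro s hs
    have hP := hr.isProb_retLaw s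
    have hi := integrable_wealthFn hr hu hw hK (ξ - ∫ u in Ioc 0 s, d u) a s
    rw [lintegral_add_left measurable_const, ← ofReal_integral_eq_lintegral_ofReal (hi.const_mul _)
      (Eventually.of_forall fun z => mul_nonneg (Real.exp_nonneg _) (hw.nonneg _)),
      lintegral_const, measure_univ, mul_one, mul_add, ← ENNReal.ofReal_mul
        (mul_nonneg hr.lam_pos.le (Real.exp_nonneg _)), integral_const_mul]
    congr 2
    simp only [hR, reward, hI s hs]
    rw [show -(M.rho + M.lam) * s = -M.lam * s + -M.rho * s by ring, Real.exp_add]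
    have e : ∀ z, M.l a + (ξ - M.l a - ∫ u in (0 : ℝ)..s, d u) + a * z =
      ξ - (∫ u in (0 : ℝ)..s, d u) + a * z := fun z => by ring
    simp only [e]
    ring
  have hm := measurable_oneStep_integrand (E := Unit) (d := fun _ => d) (ξ := fun _ => ξ)
    (a := fun _ => (a : ℝ)) (hd.measurable.comp measurable_snd) hu (fun _ => hd.nonneg)
    (hw.continuous hK hu.γ_mem.1).measurable measurable_const measurable_const
  have hm1 : Measurable fun s => ∫⁻ z, (M.periodGain d s + ENNReal.ofReal
      (Real.exp (-M.rho * s) * w (ξ - (∫ u in Ioc 0 s, d u) + a * z))) ∂M.retLaw s :=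
    Measurable.lintegral_kernel_prod_right' (κ := retKernel hr)
      (f := fun q : ℝ × ℝ => M.periodGain d q.1 + ENNReal.ofReal
        (Real.exp (-M.rho * q.1) * w (ξ - (∫ u in Ioc 0 q.1, d u) + a * q.2)))
      (hm.comp (f := fun q : ℝ × ℝ => ((), q.1, q.2)) (by fun_prop))
  rw [oneStep, lintegral_expMeasure hm1, setLIntegral_congr_fun measurableSet_Ioi
    (fun s hs => hinner s hs), lintegral_add_right' _ hRm, show (∫⁻ s in Ioi (0 : ℝ),
      ENNReal.ofReal (M.lam * Real.exp (-M.lam * s)) * M.periodGain d s) = _ from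
      lintegral_exp_clock hr.lam_pos hUm,
    payoff_eq_add hU hrun hd, ENNReal.ofReal_add
      (setIntegral_nonneg measurableSet_Ioi fun s _ => mul_nonneg (Real.exp_nonneg _)
        (hU.nonneg (hd.nonneg s))) (setIntegral_nonneg measurableSet_Ioi fun s _ => hR0 s),
    ofReal_integral_eq_lintegral_ofReal (hU.integrableOn (beta_pos hr hu) hd)
      (Eventually.of_forall fun s => mul_nonneg (Real.exp_nonneg _) (hU.nonneg (hd.nonneg s))),
    ofReal_integral_eq_lintegral_ofReal hRint (Eventually.of_forall hR0)]
  · congr 1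
    refine lintegral_congr fun s => ?_
    rw [← ENNReal.ofReal_mul (Real.exp_nonneg _), ← mul_assoc, ← Real.exp_add]
    congr 4
    ring

/-- Conditional expectation of the utility and the continuation value given the past. -/
theorem lintegral_oneStep [IsProbabilityMeasure μ] (n : ℕ) {ξ a : M.Past n → ℝ}
    (hξ : Measurable ξ) (ha : Measurable a) {d : M.Past n → ℝ → ℝ}
    (hd : Measurable (Function.uncurry d)) (hd0 : ∀ h u, 0 ≤ d h u) :
    ∫⁻ ω, ENNReal.ofReal (Real.exp (-M.rho * M.τ n ω)) *
      (M.periodGain (d (M.toPast n ω)) (M.wait n ω) + ENNReal.ofReal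
        (Real.exp (-M.rho * M.wait n ω) * w (ξ (M.toPast n ω) -
          (∫ u in Ioc 0 (M.wait n ω), d (M.toPast n ω) u) + a (M.toPast n ω) * M.Z (n + 1) ω))) ∂μ =
    ∫⁻ ω, ENNReal.ofReal (Real.exp (-M.rho * M.τ n ω)) *
      M.oneStep w (ξ (M.toPast n ω)) (a (M.toPast n ω)) (d (M.toPast n ω)) ∂μ := by
  have hm := measurable_oneStep_integrand hd hu hd0 (hw.continuous hK hu.γ_mem.1).measurable hξ ha
  have hτ : Measurable fun h : M.Past n => (M.τ n (M.ofPast n h) : ℝ) :=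
    measurable_coe_nnreal_real.comp (measurable_comp_ofPast (M.measurable_τ_hist le_rfl))
  have hT : Measurable fun h : M.Past n =>
      ENNReal.ofReal (Real.exp (-M.rho * M.τ n (M.ofPast n h))) := by fun_prop
  refine (hr.lintegral_next n (measurable_toPast n) (F := fun h s z =>
    ENNReal.ofReal (Real.exp (-M.rho * M.τ n (M.ofPast n h))) * (M.periodGain (d h) s +
      ENNReal.ofReal (Real.exp (-M.rho * s) * w (ξ h - (∫ u in Ioc 0 s, d h u) + a h * z))))
    ((hT.comp measurable_fst).mul hm)).trans (lintegral_congr fun ω => ?_)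
  simp only [ofPast_toPast, oneStep]
  have hm1 : ∀ s, Measurable fun z => M.periodGain (d (M.toPast n ω)) s + ENNReal.ofReal
      (Real.exp (-M.rho * s) * w (ξ (M.toPast n ω) -
        (∫ u in Ioc 0 s, d (M.toPast n ω) u) + a (M.toPast n ω) * z)) := fun s =>
    hm.comp (f := fun z : ℝ => (M.toPast n ω, s, z)) (by fun_prop)
  have hm2 : Measurable fun s => ∫⁻ z, (M.periodGain (d (M.toPast n ω)) s + ENNReal.ofReal
      (Real.exp (-M.rho * s) * w (ξ (M.toPast n ω) -
        (∫ u in Ioc 0 s, d (M.toPast n ω) u) + a (M.toPast n ω) * z))) ∂M.retLaw s :=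
    Measurable.lintegral_kernel_prod_right' (κ := retKernel hr)
      (f := fun q : ℝ × ℝ => M.periodGain (d (M.toPast n ω)) q.1 + ENNReal.ofReal
        (Real.exp (-M.rho * q.1) * w (ξ (M.toPast n ω) -
          (∫ u in Ioc 0 q.1, d (M.toPast n ω) u) + a (M.toPast n ω) * q.2)))
      (hm.comp (f := fun q : ℝ × ℝ => (M.toPast n ω, q.1, q.2)) (by fun_prop))
  rw [← lintegral_const_mul _ hm2]
  exact lintegral_congr fun s => lintegral_const_mul _ (hm1 s)

end OneStep

end Market

end IlliquidConsumption


/-! ### Decomposition of gain and consumption by trading periods. -/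

namespace IlliquidConsumption

theorem setLIntegral_Ioc_add (f : ℝ → ℝ≥0∞) (a s : ℝ) :
    ∫⁻ t in Ioc a (a + s), f t = ∫⁻ u in Ioc 0 s, f (a + u) := by
  rw [← lintegral_indicator measurableSet_Ioc, ← lintegral_indicator measurableSet_Ioc,
    ← lintegral_add_left_eq_self _ a]
  refine lintegral_congr fun u => ?_
  simp [indicator_apply]

theorem setIntegral_Ioc_add (f : ℝ → ℝ) (a s : ℝ) :
    ∫ t in Ioc a (a + s), f t = ∫ u in Ioc 0 s, f (a + u) := by
  rw [← integral_indicator measurableSet_Ioc, ← integral_indicator measurableSet_Ioc,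
    ← integral_add_left_eq_self _ a]
  refine integral_congr_ae (Eventually.of_forall fun u => ?_)
  simp [indicator_apply]

namespace Market

variable {Ω : Type*} [mΩ : MeasurableSpace Ω] {μ : Measure Ω} {M : Market Ω} {k b γ K₁ : ℝ}

theorem τ_add_wait (n : ℕ) (ω : Ω) : (M.τ n ω : ℝ) + M.wait n ω = M.τ (n + 1) ω := by
  rw [wait]; ring

/-- The consumption rate after the `n`-th trading date, for a rate given in terms of the past. -/
noncomputable def periodRate (M : Market Ω) (n : ℕ) (C : ℝ≥0 × M.Past n → ℝ) (h : M.Past n)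
    (u : ℝ) : ℝ := C (Real.toNNReal (M.τ n (M.ofPast n h) + u), h)

theorem measurable_periodRate (n : ℕ) {C : ℝ≥0 × M.Past n → ℝ} (hC : Measurable C) :
    Measurable (Function.uncurry (M.periodRate n C)) := by
  have hτ : Measurable fun h : M.Past n => (M.τ n (M.ofPast n h) : ℝ) :=
    measurable_coe_nnreal_real.comp (measurable_comp_ofPast (M.measurable_τ_hist le_rfl))
  exact hC.comp ((measurable_real_toNNReal.comp ((hτ.comp measurable_fst).add
    measurable_snd)).prodMk measurable_fst)

/-- The discounted utility up to the `n`-th trading date. -/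
noncomputable def gainUpTo (M : Market Ω) (c : ℝ≥0 → Ω → ℝ) (n : ℕ) (ω : Ω) : ℝ≥0∞ :=
  ∫⁻ t in Ioc (0 : ℝ) (M.τ n ω), ENNReal.ofReal (Real.exp (-M.rho * t) * M.U (c t.toNNReal ω))

section Period

variable {c : ℝ≥0 → Ω → ℝ} {C : ∀ n, ℝ≥0 × M.Past n → ℝ}
  (hcC : ∀ n t ω, M.τ n ω < t → t ≤ M.τ (n + 1) ω → c t ω = C n (t, M.toPast n ω))
include hcC

theorem eq_periodRate {n : ℕ} {ω : Ω} {u : ℝ} (hu : u ∈ Ioc 0 (M.wait n ω)) :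
    c (Real.toNNReal (M.τ n ω + u)) ω = M.periodRate n (C n) (M.toPast n ω) u := by
  have h0 : 0 ≤ (M.τ n ω : ℝ) + u := add_nonneg (M.τ n ω).2 hu.1.le
  refine hcC n _ ω ?_ ?_
  · rw [← NNReal.coe_lt_coe, Real.coe_toNNReal _ h0]; linarith [hu.1]
  · rw [← NNReal.coe_le_coe, Real.coe_toNNReal _ h0, ← τ_add_wait]; linarith [hu.2]

theorem lintegral_period (n : ℕ) (ω : Ω) : ∫⁻ t in Ioc (M.τ n ω : ℝ) (M.τ (n + 1) ω),
      ENNReal.ofReal (Real.exp (-M.rho * t) * M.U (c t.toNNReal ω)) =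
    ENNReal.ofReal (Real.exp (-M.rho * M.τ n ω)) *
      M.periodGain (M.periodRate n (C n) (M.toPast n ω)) (M.wait n ω) := by
  rw [← τ_add_wait, setLIntegral_Ioc_add, periodGain, ← lintegral_const_mul' _ _ ENNReal.ofReal_ne_top]
  refine setLIntegral_congr_fun measurableSet_Ioc fun u hu => ?_
  rw [eq_periodRate hcC hu, ← ENNReal.ofReal_mul (Real.exp_nonneg _), ← mul_assoc, ← Real.exp_add]
  congr 3
  ring_nf

theorem integral_period (n : ℕ) (ω : Ω) :
    ∫ t in Ioc (M.τ n ω : ℝ) (M.τ (n + 1) ω), c t.toNNReal ω =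
      ∫ u in Ioc 0 (M.wait n ω), M.periodRate n (C n) (M.toPast n ω) u := by
  rw [← τ_add_wait, setIntegral_Ioc_add]
  exact setIntegral_congr_fun measurableSet_Ioc fun u hu => eq_periodRate hcC hu

theorem lintegral_period_ofReal (n : ℕ) (ω : Ω) :
    ∫⁻ t in Ioc (M.τ n ω : ℝ) (M.τ (n + 1) ω), ENNReal.ofReal (c t.toNNReal ω) =
      ∫⁻ u in Ioc 0 (M.wait n ω), ENNReal.ofReal (M.periodRate n (C n) (M.toPast n ω) u) := by
  rw [← τ_add_wait, setLIntegral_Ioc_add]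
  exact setLIntegral_congr_fun measurableSet_Ioc fun u hu => by
    simp only [eq_periodRate hcC hu]

omit hcC in
theorem gainUpTo_zero (ω : Ω) : M.gainUpTo c 0 ω = 0 := by
  simp [gainUpTo, M.τ_zero]

theorem gainUpTo_succ (n : ℕ) (ω : Ω) : M.gainUpTo c (n + 1) ω = M.gainUpTo c n ω +
    ENNReal.ofReal (Real.exp (-M.rho * M.τ n ω)) *
      M.periodGain (M.periodRate n (C n) (M.toPast n ω)) (M.wait n ω) := by
  have h1 : (0 : ℝ) ≤ M.τ n ω := (M.τ n ω).2
  have h2 : (M.τ n ω : ℝ) ≤ M.τ (n + 1) ω := by linarith [M.wait_pos n ω, M.τ_add_wait n ω]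
  rw [← lintegral_period hcC, gainUpTo, ← Ioc_union_Ioc_eq_Ioc h1 h2,
    lintegral_union measurableSet_Ioc (Ioc_disjoint_Ioc_of_le le_rfl)]
  rfl

variable (hC : ∀ n, Measurable (C n)) (hC0 : ∀ n q, 0 ≤ C n q)
  (hr : M.ReturnAssumption μ k b) (hu : M.UtilityAssumption k b γ K₁)
include hC hC0 hr hu

omit hr in
theorem measurable_gainUpTo (n : ℕ) : Measurable (M.gainUpTo c n) := by
  induction n with
  | zero => simp only [funext (gainUpTo_zero (M := M) (c := c))]; exact measurable_const
  | succ n ih =>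
    simp only [funext (gainUpTo_succ hcC n)]
    have h1 : Measurable fun ω => M.periodGain (M.periodRate n (C n) (M.toPast n ω)) (M.wait n ω) :=
      (measurable_periodGain (measurable_periodRate n (hC n)) hu (fun _ _ => hC0 n _)).comp
        (((measurable_toPast n).mono (M.hist_le n) le_rfl).prodMk (M.measurable_wait n))
    have h2 : Measurable fun ω => (M.τ n ω : ℝ) := measurable_coe_nnreal_real.comp (M.measurable_τ n)
    exact ih.add (Measurable.mul (by fun_prop) h1)

/-- Dynamic programming over one trading period. -/
theorem lintegral_gainUpTo_succ [IsProbabilityMeasure μ] {K : ℝ} {w : ℝ → ℝ}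
    (hw : IsWealthFn γ K w) (hK : 0 ≤ K) (n : ℕ) {ξ a : M.Past n → ℝ} (hξ : Measurable ξ)
    (ha : Measurable a) {X' : Ω → ℝ} (hX' : ∀ᵐ ω ∂μ, w (X' ω) = w (ξ (M.toPast n ω) -
      (∫ u in Ioc 0 (M.wait n ω), M.periodRate n (C n) (M.toPast n ω) u) +
        a (M.toPast n ω) * M.Z (n + 1) ω)) :
    (∫⁻ ω, M.gainUpTo c (n + 1) ω ∂μ) +
        ∫⁻ ω, ENNReal.ofReal (Real.exp (-M.rho * M.τ (n + 1) ω) * w (X' ω)) ∂μ =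
      (∫⁻ ω, M.gainUpTo c n ω ∂μ) + ∫⁻ ω, ENNReal.ofReal (Real.exp (-M.rho * M.τ n ω)) *
        M.oneStep w (ξ (M.toPast n ω)) (a (M.toPast n ω))
          (M.periodRate n (C n) (M.toPast n ω)) ∂μ := by
  have hg := measurable_gainUpTo hcC hC hC0 hu
  rw [← lintegral_oneStep hr hu hw hK n hξ ha (measurable_periodRate n (hC n)) (fun _ _ => hC0 n _),
    ← lintegral_add_left (hg (n + 1)), ← lintegral_add_left (hg n)]
  refine lintegral_congr_ae ?_
  filter_upwards [hX'] with ω hω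
  rw [gainUpTo_succ hcC, hω, add_assoc, mul_add, ← ENNReal.ofReal_mul (Real.exp_nonneg _),
    ← mul_assoc, ← Real.exp_add, ← τ_add_wait]
  congr 5
  ring

end Period

section Dates

variable (hr : M.ReturnAssumption μ k b) (hu : M.UtilityAssumption k b γ K₁)
  [IsProbabilityMeasure μ]
include hr hu

/-- Each waiting time, independent of the past, contributes its Laplace transform `λ / (ρ + λ)`.
This is below 1, which drives the dates to infinity. -/
theorem lintegral_exp_τ (n : ℕ) : ∫⁻ ω, ENNReal.ofReal (Real.exp (-M.rho * M.τ n ω)) ∂μ =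
    ENNReal.ofReal (M.lam / (M.rho + M.lam)) ^ n := by
  have hβ := beta_pos hr hu
  induction n with
  | zero => simp [M.τ_zero]
  | succ n ih =>
    have hτ : Measurable fun h : M.Past n => (M.τ n (M.ofPast n h) : ℝ) :=
      measurable_coe_nnreal_real.comp (measurable_comp_ofPast (M.measurable_τ_hist le_rfl))
    have h1 := hr.lintegral_next n (measurable_toPast n) (F := fun h s _ =>
      ENNReal.ofReal (Real.exp (-M.rho * M.τ n (M.ofPast n h))) *
        ENNReal.ofReal (Real.exp (-M.rho * s)))
      (Measurable.mul (((hτ.comp measurable_fst).const_mul _).exp.ennreal_ofReal) (by fun_prop))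
    have h2 : ∫⁻ s, ENNReal.ofReal (Real.exp (-M.rho * s)) ∂expMeasure M.lam =
        ENNReal.ofReal (M.lam / (M.rho + M.lam)) := by
      rw [lintegral_expMeasure (by fun_prop)]
      have h3 := ofReal_integral_eq_lintegral_ofReal ((integrableOn_exp_neg_mul hβ).const_mul M.lam)
        (Eventually.of_forall fun s => mul_nonneg hr.lam_pos.le (Real.exp_nonneg _))
      rw [integral_const_mul, integral_exp_neg_mul hβ, mul_one_div] at h3
      rw [h3]
      refine lintegral_congr fun s => ?_
      rw [← ENNReal.ofReal_mul (mul_nonneg hr.lam_pos.le (Real.exp_nonneg _)), mul_assoc,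
        ← Real.exp_add]
      congr 3
      ring
    have h4 : ∀ ω, ∫⁻ s, ∫⁻ _z, ENNReal.ofReal (Real.exp (-M.rho * M.τ n ω)) *
        ENNReal.ofReal (Real.exp (-M.rho * s)) ∂M.retLaw s ∂expMeasure M.lam =
        ENNReal.ofReal (Real.exp (-M.rho * M.τ n ω)) *
          ENNReal.ofReal (M.lam / (M.rho + M.lam)) := by
      intro ω
      rw [← h2, ← lintegral_const_mul _ (by fun_prop)]
      refine lintegral_congr fun s => ?_
      have := hr.isProb_retLaw s
      simp
    simp only [ofPast_toPast, h4] at h1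
    rw [lintegral_mul_const' _ _ ENNReal.ofReal_ne_top, ih, ← pow_succ] at h1
    rw [← h1]
    refine lintegral_congr fun ω => ?_
    rw [← ENNReal.ofReal_mul (Real.exp_nonneg _), ← Real.exp_add, ← τ_add_wait]
    congr 2
    ring

/-- The trading dates almost surely tend to infinity. -/
theorem tendsto_τ : ∀ᵐ ω ∂μ, Tendsto (fun n => (M.τ n ω : ℝ)) atTop atTop := by
  have hβ := beta_pos hr hu
  have hm : ∀ n, Measurable fun ω => ENNReal.ofReal (Real.exp (-M.rho * M.τ n ω)) := fun n => by
    have h2 : Measurable fun ω => (M.τ n ω : ℝ) := measurable_coe_nnreal_real.comp (M.measurable_τ n)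
    fun_prop
  have hq : ENNReal.ofReal (M.lam / (M.rho + M.lam)) < 1 := by
    rw [ENNReal.ofReal_lt_one, div_lt_one hβ]; linarith [hu.rho_pos]
  -- The infimum of the discount factors has expectation below every power of a number less than 1,
  -- so it vanishes almost surely.
  have h1 : ∫⁻ ω, ⨅ n, ENNReal.ofReal (Real.exp (-M.rho * M.τ n ω)) ∂μ = 0 := by
    refine le_antisymm (ge_of_tendsto' (ENNReal.tendsto_pow_atTop_nhds_zero_of_lt_one hq)
      fun n => ?_) zero_le
    rw [← lintegral_exp_τ hr hu n]
    exact lintegral_mono fun ω => iInf_le _ n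
  rw [lintegral_eq_zero_iff (Measurable.iInf hm)] at h1
  filter_upwards [h1] with ω hω
  refine tendsto_atTop_atTop_of_monotone (fun i j hij => NNReal.coe_le_coe.2
    ((M.τ_strictMono ω).monotone hij)) fun B => ?_
  have hpos : 0 < ENNReal.ofReal (Real.exp (-M.rho * B)) := ENNReal.ofReal_pos.2 (Real.exp_pos _)
  rw [← show (⨅ n, ENNReal.ofReal (Real.exp (-M.rho * M.τ n ω))) = 0 from hω, iInf_lt_iff] at hpos
  obtain ⟨n, hn⟩ := hpos
  refine ⟨n, ?_⟩
  have h3 := (ENNReal.ofReal_lt_ofReal_iff (Real.exp_pos _)).1 hn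
  rw [Real.exp_lt_exp] at h3
  nlinarith [hu.rho_pos]

/-- Almost surely the dates exhaust the half line, so this is monotone convergence. -/
theorem gain_eq_iSup {c : ℝ≥0 → Ω → ℝ} (hm : ∀ n, Measurable (M.gainUpTo c n)) :
    M.gain μ c = ⨆ n, ∫⁻ ω, M.gainUpTo c n ω ∂μ := by
  have hmono : ∀ ω, Monotone fun n => M.gainUpTo c n ω := fun ω i j hij =>
    lintegral_mono_set (Ioc_subset_Ioc_right (NNReal.coe_le_coe.2 ((M.τ_strictMono ω).monotone hij)))
  rw [← lintegral_iSup hm fun i j hij ω => hmono ω hij, gain]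
  refine lintegral_congr_ae ?_
  filter_upwards [tendsto_τ hr hu] with ω hω
  have hU : Ioi (0 : ℝ) = ⋃ n, Ioc (0 : ℝ) (M.τ n ω) := by
    ext t
    simp only [mem_Ioi, mem_iUnion, mem_Ioc]
    exact ⟨fun h => (hω.eventually_ge_atTop t).exists.imp fun n hn => ⟨h, hn⟩, fun ⟨n, h⟩ => h.1⟩
  rw [hU, setLIntegral_iUnion_of_directed]
  · rfl
  · exact directed_of_isDirected_le fun i j hij =>
      Ioc_subset_Ioc_right (NNReal.coe_le_coe.2 ((M.τ_strictMono ω).monotone hij))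

end Dates

end Market

end IlliquidConsumption


/-! ### The upper bound for admissible policies. -/

namespace IlliquidConsumption

theorem measurable_lintegral_Ioc {E : Type*} [MeasurableSpace E] {f : E → ℝ → ℝ≥0∞}
    (hf : Measurable (Function.uncurry f)) :
    Measurable fun q : E × ℝ => ∫⁻ u in Ioc 0 q.2, f q.1 u := by
  have h1 : (fun q : E × ℝ => ∫⁻ u in Ioc 0 q.2, f q.1 u) = fun q => ∫⁻ u,
      {r : (E × ℝ) × ℝ | 0 < r.2 ∧ r.2 ≤ r.1.2}.indicator (fun r => f r.1.1 r.2) (q, u) := by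
    funext q
    rw [← lintegral_indicator measurableSet_Ioc]
    exact lintegral_congr fun u => by simp [indicator_apply]
  rw [h1]
  refine Measurable.lintegral_prod_right' ?_
  exact (hf.comp ((measurable_fst.comp measurable_fst).prodMk measurable_snd)).indicator
    ((measurableSet_lt measurable_const measurable_snd).inter
      (measurableSet_le measurable_snd (measurable_snd.comp measurable_fst)))

theorem integrableOn_of_lintegral_ofReal {d : ℝ → ℝ} (hd : Measurable d) (h0 : ∀ u, 0 ≤ d u)
    {s : Set ℝ} (h : ∫⁻ u in s, ENNReal.ofReal (d u) < ⊤) : IntegrableOn d s :=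
  ⟨hd.aestronglyMeasurable, (hasFiniteIntegral_iff_ofReal (Eventually.of_forall h0)).2 h⟩

/-- Cumulative consumption is nondecreasing, so its bound at arbitrarily late good times holds at
all times and for the total. -/
theorem isCtrl_of_ae {d : ℝ → ℝ} {B : ℝ} (hd : Measurable d) (h0 : ∀ u, 0 ≤ d u)
    (h : ∀ᵐ s ∂volume.restrict (Ioi (0 : ℝ)),
      ∫⁻ u in Ioc 0 s, ENNReal.ofReal (d u) < ⊤ ∧ ∫ u in Ioc 0 s, d u ≤ B) : IsCtrl B d := by
  have hex : ∀ T : ℝ, ∃ s, T < s ∧ 0 < s ∧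
      ∫⁻ u in Ioc 0 s, ENNReal.ofReal (d u) < ⊤ ∧ ∫ u in Ioc 0 s, d u ≤ B := by
    intro T
    have h1 : ∀ᵐ s ∂volume.restrict (Ioi (max T 0)),
        ∫⁻ u in Ioc 0 s, ENNReal.ofReal (d u) < ⊤ ∧ ∫ u in Ioc 0 s, d u ≤ B :=
      ae_restrict_of_ae_restrict_of_subset (Ioi_subset_Ioi (le_max_right _ _)) h
    have hne : NeBot (ae (volume.restrict (Ioi (max T 0)))) := by
      rw [ae_neBot, Ne, Measure.restrict_eq_zero]; simp
    obtain ⟨s, hs, hs'⟩ := (h1.and (ae_restrict_mem measurableSet_Ioi)).exists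
    exact ⟨s, (le_max_left _ _).trans_lt hs', (le_max_right _ _).trans_lt hs', hs⟩
  have hB : 0 ≤ B := by
    obtain ⟨s, -, -, -, hs⟩ := hex 0
    exact (setIntegral_nonneg measurableSet_Ioc fun u _ => h0 u).trans hs
  have hT : ∀ n : ℕ, ∫⁻ u in Ioc (0 : ℝ) n, ENNReal.ofReal (d u) ≤ ENNReal.ofReal B := by
    intro n
    obtain ⟨s, h1, -, h2, h3⟩ := hex n
    refine (lintegral_mono_set (Ioc_subset_Ioc_right h1.le)).trans ?_
    rw [← ofReal_integral_eq_lintegral_ofReal (integrableOn_of_lintegral_ofReal hd h0 h2)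
      (Eventually.of_forall h0)]
    exact ENNReal.ofReal_le_ofReal h3
  have hU : Ioi (0 : ℝ) = ⋃ n : ℕ, Ioc (0 : ℝ) n := by
    ext t
    simp only [mem_Ioi, mem_iUnion, mem_Ioc]
    exact ⟨fun h => (exists_nat_ge t).imp fun n hn => ⟨h, hn⟩, fun ⟨n, h⟩ => h.1⟩
  have htot : ∫⁻ u in Ioi (0 : ℝ), ENNReal.ofReal (d u) ≤ ENNReal.ofReal B := by
    rw [hU, setLIntegral_iUnion_of_directed]
    · exact iSup_le hT
    · exact directed_of_isDirected_le fun i j hij => Ioc_subset_Ioc_right (Nat.cast_le.2 hij)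
  have hint : IntegrableOn d (Ioi 0) :=
    integrableOn_of_lintegral_ofReal hd h0 (htot.trans_lt ENNReal.ofReal_lt_top)
  refine ⟨hd, h0, hint, ?_⟩
  rw [← ofReal_integral_eq_lintegral_ofReal hint (Eventually.of_forall h0)] at htot
  exact (ENNReal.ofReal_le_ofReal_iff hB).1 htot

namespace Market

variable {Ω : Type*} [mΩ : MeasurableSpace Ω] {μ : Measure Ω} {M : Market Ω} {k b γ K₁ : ℝ}

section Wealth

variable {c : ℝ≥0 → Ω → ℝ} {C : ∀ n, ℝ≥0 × M.Past n → ℝ}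
  (hcC : ∀ n t ω, M.τ n ω < t → t ≤ M.τ (n + 1) ω → c t ω = C n (t, M.toPast n ω))
include hcC

theorem wealth_succ {x : ℝ} {α : ℕ → Ω → ℝ} {n : ℕ} {ω : Ω}
    (hi : IntervalIntegrable (fun t : ℝ => c t.toNNReal ω) volume 0 (M.τ (n + 1) ω)) :
    M.wealth x α c (n + 1) ω = M.wealth x α c n ω -
      (∫ u in Ioc 0 (M.wait n ω), M.periodRate n (C n) (M.toPast n ω) u) +
        α (n + 1) ω * M.Z (n + 1) ω := by
  have h1 : (0 : ℝ) ≤ M.τ n ω := (M.τ n ω).2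
  have h2 : (M.τ n ω : ℝ) ≤ M.τ (n + 1) ω := by linarith [M.wait_pos n ω, M.τ_add_wait n ω]
  have hi1 : IntervalIntegrable (fun t : ℝ => c t.toNNReal ω) volume 0 (M.τ n ω) :=
    hi.mono_set (by rw [uIcc_of_le h1, uIcc_of_le (h1.trans h2)]; exact Icc_subset_Icc_right h2)
  have hi2 : IntervalIntegrable (fun t : ℝ => c t.toNNReal ω) volume (M.τ n ω) (M.τ (n + 1) ω) :=
    hi.mono_set (by rw [uIcc_of_le h2, uIcc_of_le (h1.trans h2)]; exact Icc_subset_Icc_left h1)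
  rw [wealth, wealth, ← intervalIntegral.integral_add_adjacent_intervals hi1 hi2,
    intervalIntegral.integral_of_le h2, integral_period hcC, Finset.sum_Icc_succ_top (by omega)]
  ring

omit hcC in
theorem wealth_zero (x : ℝ) (α : ℕ → Ω → ℝ) (ω : Ω) : M.wealth x α c 0 ω = x := by
  simp [wealth, M.τ_zero]

end Wealth

section UpperBound

variable (hr : M.ReturnAssumption μ k b) (hu : M.UtilityAssumption k b γ K₁)
  [IsProbabilityMeasure μ]
include hr hu

omit hu in
/-- Nonnegativity of the wealth at the next date constrains the investment and the consumption. -/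
theorem ae_isCtrl (n : ℕ) {ξ a : M.Past n → ℝ} (hξ : Measurable ξ) (ha : Measurable a)
    {d : M.Past n → ℝ → ℝ} (hd : Measurable (Function.uncurry d)) (hd0 : ∀ h u, 0 ≤ d h u)
    (h : ∀ᵐ ω ∂μ, ∫⁻ u in Ioc 0 (M.wait n ω), ENNReal.ofReal (d (M.toPast n ω) u) < ⊤ ∧
      0 ≤ ξ (M.toPast n ω) - (∫ u in Ioc 0 (M.wait n ω), d (M.toPast n ω) u) +
        a (M.toPast n ω) * M.Z (n + 1) ω) :
    ∀ᵐ ω ∂μ, a (M.toPast n ω) ∈ M.investSet ∧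
      IsCtrl (ξ (M.toPast n ω) - M.l (a (M.toPast n ω))) (d (M.toPast n ω)) := by
  have hm : MeasurableSet {q : M.Past n × ℝ × ℝ |
      ∫⁻ u in Ioc 0 q.2.1, ENNReal.ofReal (d q.1 u) < ⊤ ∧
        0 ≤ ξ q.1 - (∫ u in Ioc 0 q.2.1, d q.1 u) + a q.1 * q.2.2} := by
    have h0 : Measurable fun q : M.Past n × ℝ × ℝ => (q.1, q.2.1) := by fun_prop
    have h1 := (measurable_lintegral_Ioc (f := fun h u => ENNReal.ofReal (d h u))
      hd.ennreal_ofReal).comp h0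
    have h2 := (measurable_periodConsumption hd).comp h0
    exact (measurableSet_lt h1 measurable_const).inter (measurableSet_le measurable_const
      (Measurable.add ((hξ.comp measurable_fst).sub h2) ((ha.comp measurable_fst).mul (by fun_prop))))
  have h1 := (hr.ae_next n (measurable_toPast n) (P := fun h s z =>
    ∫⁻ u in Ioc 0 s, ENNReal.ofReal (d h u) < ⊤ ∧ 0 ≤ ξ h - (∫ u in Ioc 0 s, d h u) + a h * z)
    hm).1 h
  filter_upwards [h1] with ω hω
  -- For a fixed past and a fixed waiting time, nonnegative wealth for almost every return means
  -- that the wealth before the return is at least `l(a)`, with `a` allowed.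
  have h2 : ∀ᵐ s ∂expMeasure M.lam, a (M.toPast n ω) ∈ M.investSet ∧
      ∫⁻ u in Ioc 0 s, ENNReal.ofReal (d (M.toPast n ω) u) < ⊤ ∧
        ∫ u in Ioc 0 s, d (M.toPast n ω) u ≤ ξ (M.toPast n ω) - M.l (a (M.toPast n ω)) := by
    filter_upwards [hω] with s hs
    have := hr.isProb_retLaw s
    obtain ⟨h3, h4⟩ := hr.of_ae_nonneg (hs.mono fun z hz => hz.2)
    obtain ⟨z, hz⟩ := hs.exists
    exact ⟨h3, hz.1, by linarith⟩
  have := isProbabilityMeasure_expMeasure hr.lam_pos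
  refine ⟨h2.exists.choose_spec.1, isCtrl_of_ae (hd.comp measurable_prodMk_left) (hd0 _) ?_⟩
  exact (ae_volume_of_ae_expMeasure hr.lam_pos h2).mono fun s hs => hs.2

/-- Verification inequality: the expected gain up to the n-th date plus the expected discounted
`fixedPt` of the wealth there does not increase with `n`, since a single period yields at most `step
fixedPt = fixedPt`. It starts at `fixedPt x`. -/
theorem gain_le {x : ℝ} (hx : 0 ≤ x) {α : ℕ → Ω → ℝ} {c : ℝ≥0 → Ω → ℝ}
    (hadm : M.Admissible μ x α c) : M.gain μ c ≤ ENNReal.ofReal (M.fixedPt x) := by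
  have hK := growthConst_nonneg hr hu
  have hW := isWealthFn_fixedPt hr hu
  choose C₀ hC₀ hcC₀ using fun n => exists_past_of_predictable n hadm.isPolicy.predictable_c
  -- The representing function is uncontrolled beyond the next date; truncating it at 0 makes it a
  -- genuine rate on the whole half line without changing it on the period.
  set C : ∀ n, ℝ≥0 × M.Past n → ℝ := fun n q => max (C₀ n q) 0 with hCdef
  have hC : ∀ n, Measurable (C n) := fun n => (hC₀ n).max measurable_const
  have hC0 : ∀ n q, 0 ≤ C n q := fun n q => le_max_right _ _
  have hcC : ∀ n t ω, M.τ n ω < t → t ≤ M.τ (n + 1) ω → c t ω = C n (t, M.toPast n ω) :=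
    fun n t ω _ h => by
      simp only [hCdef]
      rw [← hcC₀ n t ω h, max_eq_left (hadm.isPolicy.nonneg_c t ω)]
  have hα : ∀ n, Measurable[M.hist n] (α (n + 1)) := fun n =>
    (hadm.isPolicy.measurable_α n).mono (stopped_le_hist n) le_rfl
  -- A version of the wealth defined by recursion from the past. It is measurable with respect to
  -- the past for every scenario and equals the wealth almost surely, namely where consumption is
  -- integrable up to each date.
  let X : ℕ → Ω → ℝ := fun n => Nat.rec (fun _ => x) (fun n Xn ω => Xn ω -
    (∫ u in Ioc 0 (M.wait n ω), M.periodRate n (C n) (M.toPast n ω) u) +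
      α (n + 1) ω * M.Z (n + 1) ω) n
  have hX0 : ∀ ω, X 0 ω = x := fun _ => rfl
  have hXs : ∀ n ω, X (n + 1) ω = X n ω -
    (∫ u in Ioc 0 (M.wait n ω), M.periodRate n (C n) (M.toPast n ω) u) +
      α (n + 1) ω * M.Z (n + 1) ω := fun _ _ => rfl
  have hXm : ∀ n, Measurable[M.hist n] (X n) := by
    intro n
    induction n with
    | zero => exact measurable_const
    | succ n ih =>
      have hle := M.hist_mono n.le_succ
      have h1 : Measurable[M.hist (n + 1)] fun ω =>
          ∫ u in Ioc 0 (M.wait n ω), M.periodRate n (C n) (M.toPast n ω) u :=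
        (measurable_periodConsumption (measurable_periodRate n (hC n))).comp
          (((measurable_toPast n).mono hle le_rfl).prodMk (M.measurable_wait_hist n))
      exact Measurable.add ((ih.mono hle le_rfl).sub h1)
        (((hα n).mono hle le_rfl).mul (M.measurable_Z_hist le_rfl))
  have hadm' : ∀ᵐ ω ∂μ, ∀ n, IntervalIntegrable (fun t : ℝ => c t.toNNReal ω) volume 0 (M.τ n ω) ∧
      0 ≤ M.wealth x α c n ω := by
    rw [ae_all_iff]
    intro n
    rcases n.eq_zero_or_pos with rfl | hn
    · exact Eventually.of_forall fun ω => by simp [M.τ_zero, wealth, hx]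
    · exact hadm.nonneg_wealth n hn
  have hwX : ∀ᵐ ω ∂μ, ∀ n, M.wealth x α c n ω = X n ω := by
    filter_upwards [hadm'] with ω hω n
    induction n with
    | zero => rw [hX0, wealth_zero]
    | succ n ih => rw [wealth_succ hcC (hω (n + 1)).1, ih, hXs]
  have hstep : ∀ n, ∀ᵐ ω ∂μ, M.oneStep M.fixedPt (X n ω) (α (n + 1) ω)
      (M.periodRate n (C n) (M.toPast n ω)) ≤ ENNReal.ofReal (M.fixedPt (X n ω)) := by
    intro n
    have h1 := ae_isCtrl hr n (ξ := fun h => X n (M.ofPast n h))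
      (a := fun h => α (n + 1) (M.ofPast n h)) (measurable_comp_ofPast (hXm n))
      (measurable_comp_ofPast (hα n)) (measurable_periodRate n (hC n)) (fun _ _ => hC0 n _) (by
        filter_upwards [hadm', hwX] with ω hω hωX
        simp only [ofPast_toPast]
        refine ⟨?_, (hXs n ω).subst (motive := fun y => 0 ≤ y) (hωX (n + 1) ▸ (hω (n + 1)).2)⟩
        have h1 : (0 : ℝ) ≤ M.τ n ω := (M.τ n ω).2
        have h2 : (M.τ n ω : ℝ) ≤ M.τ (n + 1) ω := by
          linarith [M.wait_pos n ω, M.τ_add_wait n ω]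
        rw [← lintegral_period_ofReal hcC]
        have h3 : IntegrableOn (fun t : ℝ => c t.toNNReal ω)
            (Ioc (M.τ n ω : ℝ) (M.τ (n + 1) ω)) :=
          ((intervalIntegrable_iff_integrableOn_Ioc_of_le (h1.trans h2)).1 (hω (n + 1)).1).mono_set
            (Ioc_subset_Ioc_left h1)
        exact (hasFiniteIntegral_iff_ofReal (Eventually.of_forall fun t =>
          hadm.isPolicy.nonneg_c _ ω)).1 h3.2)
    filter_upwards [h1] with ω ⟨ha, hc⟩
    simp only [ofPast_toPast] at ha hc
    have h2 := oneStep_eq hr hu hW hK ⟨_, ha⟩ hc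
    rw [h2, ← step_fixedPt hr hu (X n ω)]
    refine ENNReal.ofReal_le_ofReal (payoff_le_step hr hu hW hK ?_ hc)
    exact sub_nonneg.1 hc.nonneg_budget
  have hbound : ∀ n, (∫⁻ ω, M.gainUpTo c n ω ∂μ) +
      ∫⁻ ω, ENNReal.ofReal (Real.exp (-M.rho * M.τ n ω) * M.fixedPt (X n ω)) ∂μ ≤
        ENNReal.ofReal (M.fixedPt x) := by
    intro n
    induction n with
    | zero => simp [gainUpTo_zero, M.τ_zero, hX0]
    | succ n ih =>
      rw [lintegral_gainUpTo_succ hcC hC hC0 hr hu hW hK n (ξ := fun h => X n (M.ofPast n h))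
        (a := fun h => α (n + 1) (M.ofPast n h)) (measurable_comp_ofPast (hXm n))
        (measurable_comp_ofPast (hα n)) (X' := X (n + 1))
        (Eventually.of_forall fun ω => by simp only [ofPast_toPast, hXs])]
      refine le_trans (add_le_add le_rfl (lintegral_mono_ae ?_)) ih
      filter_upwards [hstep n] with ω hω
      rw [ENNReal.ofReal_mul (Real.exp_nonneg _)]
      gcongr
      exact hω
  rw [gain_eq_iSup hr hu (measurable_gainUpTo hcC hC hC0 hu)]
  exact iSup_le fun n => le_self_add.trans (hbound n)

end UpperBound

end Market

end IlliquidConsumption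


/-! ### The candidate optimal policy. -/

namespace IlliquidConsumption

/-- The power function serves as a Lyapunov function: inserted as continuation value into the
one-period identity, it controls the wealth at late dates. -/
theorem isWealthFn_rpow {γ : ℝ} (hγ : γ ∈ Ioo (0 : ℝ) 1) :
    IsWealthFn γ 1 fun y => (max y 0) ^ γ := by
  refine ⟨fun x y h => Real.rpow_le_rpow (le_max_right _ _) (max_le_max_right 0 h) hγ.1.le,
    fun y hy => by rw [max_eq_right hy.le, Real.zero_rpow hγ.1.ne'], ?_, fun y hy => by
      rw [max_eq_left hy, one_mul]⟩
  exact (Real.concaveOn_rpow hγ.1.le hγ.2.le).congr fun y hy => by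
    simp only; rw [max_eq_left hy]

/-- With zero continuation value the one-period identity measures only the utility of the period. -/
theorem isWealthFn_zero (γ : ℝ) : IsWealthFn γ 0 0 :=
  ⟨fun _ _ _ => le_rfl, fun _ _ => rfl, concaveOn_const 0 (convex_Ici 0),
    fun y _ => by simp⟩

/-- The feedback flow is measurable in the parameter, the initial budget and the time. -/
theorem measurable_fbFlow {Θ : Type*} [TopologicalSpace Θ] [SecondCountableTopology Θ]
    [MeasurableSpace Θ] [OpensMeasurableSpace Θ] {U : ℝ → ℝ} {K γ β : ℝ} {G : Θ → ℝ → ℝ → ℝ}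
    (hU : IsUtility U K γ) (hG : IsReward β G) :
    Measurable fun q : ℝ × Θ × ℝ => fbFlow hU hG q.2.1 (max q.2.2 0) (max q.1 0) :=
  measurable_uncurry_of_continuous_of_measurable
    (u := fun (s : ℝ) (q : Θ × ℝ) => fbFlow hU hG q.1 (max q.2 0) (max s 0))
    (fun q => (continuous_fbFlow hU hG q.1 (le_max_right q.2 0)).comp (by fun_prop))
    (fun s => (continuous_fbFlow_param hU hG (le_max_right s 0)).measurable)

namespace Market

variable {Ω : Type*} [mΩ : MeasurableSpace Ω] {μ : Measure Ω} {M : Market Ω} {k b γ K₁ : ℝ}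

/-- Subtracting the utility of the period, which is `oneStep 0`, leaves the discounted power of the
next wealth, and this is smaller than the present power by the factor `contr`. -/
theorem oneStep_le_add (hr : M.ReturnAssumption μ k b) (hu : M.UtilityAssumption k b γ K₁)
    {ξ : ℝ} (hξ : 0 ≤ ξ) (a : M.investSet) {d : ℝ → ℝ} (hd : IsCtrl (ξ - M.l a) d) :
    M.oneStep (fun y => (max y 0) ^ γ) ξ a d ≤
      M.oneStep 0 ξ a d + ENNReal.ofReal (M.contr k b γ) * ENNReal.ofReal ((max ξ 0) ^ γ) := by
  have hw := isWealthFn_rpow hu.γ_mem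
  have h0 := isWealthFn_zero γ
  rw [oneStep_eq hr hu hw zero_le_one a hd, oneStep_eq hr hu h0 le_rfl a hd,
    payoff_eq_add hu.isUtility (running_zero hr hu hw zero_le_one a) hd,
    payoff_eq_add hu.isUtility (running_zero hr hu h0 le_rfl a) hd,
    ← ENNReal.ofReal_mul (contr_nonneg hr hu), max_eq_left hξ]
  have h1 := integral_reward_le hr hu hw zero_le_one hd
  rw [mul_one] at h1
  have h2 : ∀ s y, M.reward 0 a s y = 0 := fun s y => by simp [reward]
  simp only [h2, mul_zero, integral_zero, add_zero]
  exact (ENNReal.ofReal_le_ofReal (add_le_add le_rfl h1)).trans ENNReal.ofReal_add_le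

theorem ae_Z_mem (hr : M.ReturnAssumption μ k b) [IsProbabilityMeasure μ] :
    ∀ᵐ ω ∂μ, ∀ n, -M.zlow ≤ M.Z (n + 1) ω ∧ (M.Z (n + 1) ω : EReal) ≤ M.zbar := by
  rw [ae_all_iff]
  intro n
  have h2 : Measurable fun q : M.Past n × ℝ × ℝ => q.2.2 := measurable_snd.comp measurable_snd
  have hm : MeasurableSet {q : M.Past n × ℝ × ℝ | -M.zlow ≤ q.2.2 ∧ (q.2.2 : EReal) ≤ M.zbar} :=
    (measurableSet_le measurable_const h2).inter
      (measurableSet_le (measurable_coe_real_ereal.comp h2) measurable_const)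
  exact (hr.ae_next n (measurable_toPast n)
    (P := fun _ _ z => -M.zlow ≤ z ∧ (z : EReal) ≤ M.zbar) hm).2
    (Eventually.of_forall fun ω => Eventually.of_forall fun s => hr.ae_mem s)

section Optimal

variable (hr : M.ReturnAssumption μ k b) (hu : M.UtilityAssumption k b γ K₁)

/-- The residual budget at time `s` after a trading date, under the optimal consumption. -/
noncomputable def optFlow (hr : M.ReturnAssumption μ k b) (hu : M.UtilityAssumption k b γ K₁)
    (a : M.investSet) (y s : ℝ) : ℝ :=
  fbFlow hu.isUtility (isReward hr hu (isWealthFn_fixedPt hr hu) (growthConst_nonneg hr hu)) a y s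

/-- The optimal consumption rate as a function of time and residual budget. -/
noncomputable def optRate (M : Market Ω) (a : M.investSet) (s y : ℝ) : ℝ :=
  fbRate M.U (M.rho + M.lam) (M.reward M.fixedPt) a s y

/-- The optimal wealth at the trading dates for an investment rule `A`. -/
noncomputable def optWealth (hr : M.ReturnAssumption μ k b) (hu : M.UtilityAssumption k b γ K₁)
    (A : ℝ → M.investSet) (x : ℝ) : ℕ → Ω → ℝ
  | 0, _ => x
  -- The truncations keep the recursion meaningful for every scenario and every rule `A`; they are
  -- inactive for a feasible rule when the returns lie in their range.
  | n + 1, ω => max 0 (M.l (A (optWealth hr hu A x n ω)) +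
      optFlow hr hu (A (optWealth hr hu A x n ω)) (max (optWealth hr hu A x n ω -
        M.l (A (optWealth hr hu A x n ω))) 0) (max (M.wait n ω) 0) +
      A (optWealth hr hu A x n ω) * M.Z (n + 1) ω)

/-- The optimal consumption rate at time `t` in terms of the past. -/
noncomputable def optPast (hr : M.ReturnAssumption μ k b) (hu : M.UtilityAssumption k b γ K₁)
    (A : ℝ → M.investSet) (x : ℝ) (n : ℕ) (q : ℝ≥0 × M.Past n) : ℝ :=
  M.optRate (A (optWealth hr hu A x n (M.ofPast n q.2))) (max (q.1 - M.τ n (M.ofPast n q.2)) 0)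
    (optFlow hr hu (A (optWealth hr hu A x n (M.ofPast n q.2)))
      (max (optWealth hr hu A x n (M.ofPast n q.2) -
        M.l (A (optWealth hr hu A x n (M.ofPast n q.2)))) 0)
      (max (q.1 - M.τ n (M.ofPast n q.2)) 0))

variable {A : ℝ → M.investSet} {x : ℝ}

theorem isCtrl_optFlow (a : M.investSet) {y : ℝ} (hy : 0 ≤ y) :
    IsCtrl y fun s => M.optRate a s (optFlow hr hu a y s) :=
  isCtrl_fbFlow hu.isUtility
    (isReward hr hu (isWealthFn_fixedPt hr hu) (growthConst_nonneg hr hu)) a hy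

theorem integral_optFlow (a : M.investSet) {y s : ℝ} (hy : 0 ≤ y) (hs : 0 ≤ s) :
    y - ∫ u in (0 : ℝ)..s, M.optRate a u (optFlow hr hu a y u) = optFlow hr hu a y s :=
  integral_fbFlow hu.isUtility
    (isReward hr hu (isWealthFn_fixedPt hr hu) (growthConst_nonneg hr hu)) a hy hs

theorem optFlow_nonneg (a : M.investSet) {y s : ℝ} (hy : 0 ≤ y) (hs : 0 ≤ s) :
    0 ≤ optFlow hr hu a y s :=
  fbFlow_nonneg hu.isUtility
    (isReward hr hu (isWealthFn_fixedPt hr hu) (growthConst_nonneg hr hu)) a hy hs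

theorem payoff_optFlow (a : M.investSet) {y : ℝ} (hy : 0 ≤ y) :
    payoff M.U (M.rho + M.lam) (M.reward M.fixedPt a) y
      (fun s => M.optRate a s (optFlow hr hu a y s)) = M.aux M.fixedPt a 0 y :=
  payoff_fbFlow hu.isUtility
    (isReward hr hu (isWealthFn_fixedPt hr hu) (growthConst_nonneg hr hu)) a hy

theorem optWealth_nonneg (hx : 0 ≤ x) (n : ℕ) (ω : Ω) : 0 ≤ optWealth hr hu A x n ω := by
  cases n with
  | zero => exact hx
  | succ n => exact le_max_left _ _

theorem measurable_optFlow : Measurable fun q : ℝ × M.investSet × ℝ =>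
    optFlow hr hu q.2.1 (max q.2.2 0) (max q.1 0) :=
  measurable_fbFlow hu.isUtility
    (isReward hr hu (isWealthFn_fixedPt hr hu) (growthConst_nonneg hr hu))

theorem measurable_optWealth (hA : Measurable A) (n : ℕ) :
    Measurable[M.hist n] (optWealth hr hu A x n) := by
  induction n with
  | zero => exact measurable_const
  | succ n ih =>
    have hX : Measurable[M.hist (n + 1)] (optWealth hr hu A x n) :=
      ih.mono (M.hist_mono n.le_succ) le_rfl
    have hl : Measurable fun y => M.l (A y) :=
      (continuous_l M).measurable.comp (measurable_subtype_coe.comp hA)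
    have hf : Measurable fun q : ℝ × ℝ × ℝ => max 0 (M.l (A q.1) + optFlow hr hu (A q.1)
        (max (q.1 - M.l (A q.1)) 0) (max q.2.1 0) + A q.1 * q.2.2) := by
      have h0 : Measurable fun q : ℝ × ℝ × ℝ => (q.2.1, A q.1, q.1 - M.l (A q.1)) :=
        (measurable_fst.comp measurable_snd).prodMk
          ((hA.comp measurable_fst).prodMk (measurable_fst.sub (hl.comp measurable_fst)))
      have h1 := (measurable_optFlow hr hu).comp h0
      exact measurable_const.max (Measurable.add ((hl.comp measurable_fst).add h1)
        ((measurable_subtype_coe.comp (hA.comp measurable_fst)).mul (by fun_prop)))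
    exact hf.comp (hX.prodMk ((M.measurable_wait_hist n).prodMk (M.measurable_Z_hist le_rfl)))

theorem measurable_optPast (hA : Measurable A) (n : ℕ) : Measurable (optPast hr hu A x n) := by
  have hU := hu.isUtility
  have hG := isReward hr hu (isWealthFn_fixedPt hr hu) (growthConst_nonneg hr hu)
  have hτ : Measurable fun h : M.Past n => (M.τ n (M.ofPast n h) : ℝ) :=
    measurable_coe_nnreal_real.comp (measurable_comp_ofPast (M.measurable_τ_hist le_rfl))
  have hX : Measurable fun h : M.Past n => optWealth hr hu A x n (M.ofPast n h) :=
    measurable_comp_ofPast (measurable_optWealth hr hu hA n)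
  have hl : Measurable fun y => M.l (A y) :=
    (continuous_l M).measurable.comp (measurable_subtype_coe.comp hA)
  have hs : Measurable fun q : ℝ≥0 × M.Past n => (q.1 : ℝ) - M.τ n (M.ofPast n q.2) :=
    (measurable_coe_nnreal_real.comp measurable_fst).sub (hτ.comp measurable_snd)
  have ha : Measurable fun q : ℝ≥0 × M.Past n => A (optWealth hr hu A x n (M.ofPast n q.2)) :=
    hA.comp (hX.comp measurable_snd)
  have hf := (measurable_optFlow hr hu).comp (hs.prodMk (ha.prodMk
    ((hX.comp measurable_snd).sub (hl.comp (hX.comp measurable_snd)))))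
  exact (continuous_fbRate hU hG).measurable.comp (ha.prodMk
    ((hs.max measurable_const).prodMk hf))

theorem optPast_nonneg (n : ℕ) (q : ℝ≥0 × M.Past n) : 0 ≤ optPast hr hu A x n q :=
  fbRate_nonneg hu.isUtility
    (isReward hr hu (isWealthFn_fixedPt hr hu) (growthConst_nonneg hr hu)) _ _ _

theorem periodRate_optPast (n : ℕ) (ω : Ω) {u : ℝ} (h : 0 ≤ u) :
    M.periodRate n (optPast hr hu A x n) (M.toPast n ω) u =
      M.optRate (A (optWealth hr hu A x n ω)) u (optFlow hr hu (A (optWealth hr hu A x n ω))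
        (max (optWealth hr hu A x n ω - M.l (A (optWealth hr hu A x n ω))) 0) u) := by
  have h1 : 0 ≤ (M.τ n ω : ℝ) + u := add_nonneg (M.τ n ω).2 h
  simp only [periodRate, optPast, ofPast_toPast, Real.coe_toNNReal _ h1, add_sub_cancel_left,
    max_eq_left h]

variable (hAl : ∀ x, 0 ≤ x → M.l (A x) ≤ x) (hx : 0 ≤ x)
include hAl hx

theorem isCtrl_optPast (hA : Measurable A) (n : ℕ) (ω : Ω) :
    IsCtrl (optWealth hr hu A x n ω - M.l (A (optWealth hr hu A x n ω)))
      (M.periodRate n (optPast hr hu A x n) (M.toPast n ω)) := by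
  have hb := sub_nonneg.2 (hAl _ (optWealth_nonneg hr hu (A := A) hx n ω))
  have h1 := isCtrl_optFlow hr hu (A (optWealth hr hu A x n ω)) hb
  have h2 : EqOn (fun s => M.optRate (A (optWealth hr hu A x n ω)) s
      (optFlow hr hu (A (optWealth hr hu A x n ω))
        (optWealth hr hu A x n ω - M.l (A (optWealth hr hu A x n ω))) s))
      (M.periodRate n (optPast hr hu A x n) (M.toPast n ω)) (Ioi 0) := fun s hs => by
    rw [periodRate_optPast hr hu n ω (le_of_lt hs), max_eq_left hb]
  have hm := measurable_periodRate n (measurable_optPast hr hu hA n (x := x))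
  have hm' : Measurable (M.periodRate n (optPast hr hu A x n) (M.toPast n ω)) :=
    hm.of_uncurry_left
  have h0 : ∀ s, 0 ≤ M.periodRate n (optPast hr hu A x n) (M.toPast n ω) s := fun s => by
    rw [periodRate]; exact optPast_nonneg hr hu n _
  refine ⟨hm', h0, h1.integrable.congr_fun h2 measurableSet_Ioi, ?_⟩
  rw [← setIntegral_congr_fun measurableSet_Ioi h2]
  exact h1.total_le

theorem setIntegral_optPast (n : ℕ) (ω : Ω) {s : ℝ} (hs : 0 ≤ s) :
    optWealth hr hu A x n ω - ∫ u in Ioc 0 s, M.periodRate n (optPast hr hu A x n) (M.toPast n ω) u =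
      M.l (A (optWealth hr hu A x n ω)) + optFlow hr hu (A (optWealth hr hu A x n ω))
        (max (optWealth hr hu A x n ω - M.l (A (optWealth hr hu A x n ω))) 0) s := by
  have hb := sub_nonneg.2 (hAl _ (optWealth_nonneg hr hu (A := A) hx n ω))
  have h1 := integral_optFlow hr hu (A (optWealth hr hu A x n ω)) hb hs
  rw [setIntegral_congr_fun measurableSet_Ioc fun u hu' =>
    periodRate_optPast hr hu n ω (le_of_lt hu'.1), max_eq_left hb,
    ← intervalIntegral.integral_of_le hs]
  linarith

theorem optWealth_succ (n : ℕ) {ω : Ω} (hZ : -M.zlow ≤ M.Z (n + 1) ω)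
    (hZ' : (M.Z (n + 1) ω : EReal) ≤ M.zbar) :
    optWealth hr hu A x (n + 1) ω = optWealth hr hu A x n ω -
      (∫ u in Ioc 0 (M.wait n ω), M.periodRate n (optPast hr hu A x n) (M.toPast n ω) u) +
        A (optWealth hr hu A x n ω) * M.Z (n + 1) ω := by
  have hw := (M.wait_pos n ω).le
  rw [setIntegral_optPast hr hu hAl hx n ω hw]
  have h3 := optFlow_nonneg hr hu (A (optWealth hr hu A x n ω))
    (le_max_right (optWealth hr hu A x n ω - M.l (A (optWealth hr hu A x n ω))) 0) hw
  have h2 := hr.l_add_mul_nonneg (A (optWealth hr hu A x n ω)).2 hZ hZ'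
  rw [optWealth, max_eq_left hw, max_eq_right (by linarith)]

/-- Both inequalities in the upper bound become equalities: the investment attains the maximum in
`step` and the rate follows the optimal path of the deterministic problem. -/
theorem oneStep_optPast (hA : Measurable A) (hmax : ∀ x, 0 ≤ x → ∀ a : M.investSet, M.l a ≤ x →
      M.aux M.fixedPt a 0 (x - M.l a) ≤ M.aux M.fixedPt (A x) 0 (x - M.l (A x))) (n : ℕ) (ω : Ω) :
    M.oneStep M.fixedPt (optWealth hr hu A x n ω) (A (optWealth hr hu A x n ω))
      (M.periodRate n (optPast hr hu A x n) (M.toPast n ω)) =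
      ENNReal.ofReal (M.fixedPt (optWealth hr hu A x n ω)) := by
  have hK := growthConst_nonneg hr hu
  have hW := isWealthFn_fixedPt hr hu
  have hX := optWealth_nonneg hr hu (A := A) hx n ω
  have hb := sub_nonneg.2 (hAl _ hX)
  rw [oneStep_eq hr hu hW hK _ (isCtrl_optPast hr hu hAl hx hA n ω),
    ← step_fixedPt hr hu (optWealth hr hu A x n ω),
    step_eq_of_max hr hu hW hK (hAl _ hX) (hmax _ hX)]
  congr 1
  rw [← payoff_optFlow hr hu _ hb]
  refine payoff_congr_ae ((ae_restrict_mem measurableSet_Ioi).mono fun s hs => ?_)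
  rw [periodRate_optPast hr hu n ω (le_of_lt hs), max_eq_left hb]

end Optimal

end Market

end IlliquidConsumption


/-! ### Optimality of the candidate policy. -/

namespace IlliquidConsumption

namespace Market

variable {Ω : Type*} [mΩ : MeasurableSpace Ω] {μ : Measure Ω} {M : Market Ω} {k b γ K₁ : ℝ}

section Period

variable {c : ℝ≥0 → Ω → ℝ} {C : ∀ n, ℝ≥0 × M.Past n → ℝ}
  (hcC : ∀ n t ω, M.τ n ω < t → t ≤ M.τ (n + 1) ω → c t ω = C n (t, M.toPast n ω))
include hcC

theorem intervalIntegrable_of_periodRate {ω : Ω}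
    (h : ∀ n, IntegrableOn (M.periodRate n (C n) (M.toPast n ω)) (Ioi 0)) (n : ℕ) :
    IntervalIntegrable (fun t : ℝ => c t.toNNReal ω) volume 0 (M.τ n ω) := by
  induction n with
  | zero => simp [M.τ_zero]
  | succ n ih =>
    refine ih.trans ?_
    have hw := (M.wait_pos n ω).le
    have h1 : IntervalIntegrable (M.periodRate n (C n) (M.toPast n ω)) volume 0 (M.wait n ω) :=
      (intervalIntegrable_iff_integrableOn_Ioc_of_le hw).2 ((h n).mono_set Ioc_subset_Ioi_self)
    have h2 := h1.comp_sub_right (M.τ n ω : ℝ)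
    rw [zero_add, add_comm, τ_add_wait] at h2
    have h3 : (M.τ n ω : ℝ) ≤ M.τ (n + 1) ω := by linarith [M.τ_add_wait n ω]
    rw [intervalIntegrable_iff_integrableOn_Ioc_of_le h3] at h2 ⊢
    refine h2.congr_fun (fun t ht => ?_) measurableSet_Ioc
    have h4 := eq_periodRate hcC (n := n) (ω := ω) (u := t - M.τ n ω)
      ⟨by linarith [ht.1], by linarith [ht.2, M.τ_add_wait n ω]⟩
    rw [add_sub_cancel] at h4
    exact h4.symm

end Period

section Optimal

variable (hr : M.ReturnAssumption μ k b) (hu : M.UtilityAssumption k b γ K₁)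
  [IsProbabilityMeasure μ] {A : ℝ → M.investSet} {x : ℝ} {c : ℝ≥0 → Ω → ℝ}
  (hA : Measurable A) (hAl : ∀ x, 0 ≤ x → M.l (A x) ≤ x) (hx : 0 ≤ x)
  (hcC : ∀ n t ω, M.τ n ω < t → t ≤ M.τ (n + 1) ω →
    c t ω = optPast hr hu A x n (t, M.toPast n ω))
include hA hAl hx hcC

theorem wealth_eq_optWealth {α : ℕ → Ω → ℝ}
    (hα : ∀ n ω, α (n + 1) ω = A (optWealth hr hu A x n ω)) :
    ∀ᵐ ω ∂μ, ∀ n, M.wealth x α c n ω = optWealth hr hu A x n ω := by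
  filter_upwards [ae_Z_mem hr] with ω hω n
  induction n with
  | zero => rw [wealth_zero]; rfl
  | succ n ih =>
    rw [wealth_succ hcC (intervalIntegrable_of_periodRate hcC
      (fun n => (isCtrl_optPast hr hu hAl hx hA n ω).integrable) (n + 1)), ih,
      optWealth_succ hr hu hAl hx n (hω n).1 (hω n).2, hα]

omit hA hcC in
theorem ae_optWealth_succ (n : ℕ) : ∀ᵐ ω ∂μ, optWealth hr hu A x (n + 1) ω =
    optWealth hr hu A x n (M.ofPast n (M.toPast n ω)) -
      (∫ u in Ioc 0 (M.wait n ω), M.periodRate n (optPast hr hu A x n) (M.toPast n ω) u) +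
        A (optWealth hr hu A x n (M.ofPast n (M.toPast n ω))) * M.Z (n + 1) ω := by
  filter_upwards [ae_Z_mem hr] with ω hω
  exact optWealth_succ hr hu hAl hx n (hω n).1 (hω n).2

/-- The discounted value of the final wealth of the first `n` periods decreases geometrically. -/
theorem lintegral_rpow_optWealth_le (hfin : M.gain μ c ≠ ⊤) (n : ℕ) :
    ∫⁻ ω, ENNReal.ofReal (Real.exp (-M.rho * M.τ n ω) *
      (max (optWealth hr hu A x n ω) 0) ^ γ) ∂μ ≤
        ENNReal.ofReal (M.contr k b γ) ^ n * ENNReal.ofReal ((max x 0) ^ γ) := by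
  have hC : ∀ n, Measurable (optPast hr hu A x n) := measurable_optPast hr hu hA
  have hC0 : ∀ n q, 0 ≤ optPast hr hu A x n q := optPast_nonneg hr hu
  induction n with
  | zero => simp [M.τ_zero, optWealth]
  | succ n ih =>
    have hξ := measurable_comp_ofPast (measurable_optWealth hr hu (x := x) hA n)
    have ha : Measurable fun h : M.Past n => (A (optWealth hr hu A x n (M.ofPast n h)) : ℝ) :=
      measurable_subtype_coe.comp (hA.comp hξ)
    have hs := ae_optWealth_succ hr hu hAl hx n
    -- The one-period identity is used twice, with the power function and with zero as continuation
    -- value. The expected gain is common to both and finite, so it can be cancelled, leaving the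
    -- recursion for the power alone.
    have e1 := lintegral_gainUpTo_succ hcC hC hC0 hr hu (isWealthFn_rpow hu.γ_mem) zero_le_one n
      hξ ha (X' := optWealth hr hu A x (n + 1)) (hs.mono fun ω h => by rw [← h])
    have e2 := lintegral_gainUpTo_succ hcC hC hC0 hr hu (isWealthFn_zero γ) le_rfl n
      hξ ha (X' := optWealth hr hu A x (n + 1)) (Eventually.of_forall fun _ => rfl)
    simp only [Pi.zero_apply, mul_zero, ENNReal.ofReal_zero, lintegral_zero, add_zero] at e2
    have hgm := measurable_gainUpTo hcC hC hC0 hu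
    have hgfin : ∫⁻ ω, M.gainUpTo c (n + 1) ω ∂μ ≠ ⊤ := by
      refine ne_top_of_le_ne_top hfin ?_
      rw [gain_eq_iSup hr hu hgm]
      exact le_iSup (fun n => ∫⁻ ω, M.gainUpTo c n ω ∂μ) (n + 1)
    have hm : Measurable fun ω => ENNReal.ofReal (Real.exp (-M.rho * M.τ n ω) *
        (max (optWealth hr hu A x n ω) 0) ^ γ) := by
      have h1 : Measurable fun ω => (M.τ n ω : ℝ) :=
        measurable_coe_nnreal_real.comp (M.measurable_τ n)
      have h2 : Measurable (optWealth hr hu A x n) :=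
        (measurable_optWealth hr hu hA n).mono (M.hist_le n) le_rfl
      exact ((h1.const_mul _).exp.mul ((h2.max measurable_const).pow_const γ)).ennreal_ofReal
    have h1 : ∫⁻ ω, ENNReal.ofReal (Real.exp (-M.rho * M.τ n ω)) *
        M.oneStep (fun y => (max y 0) ^ γ) (optWealth hr hu A x n ω)
          (A (optWealth hr hu A x n ω)) (M.periodRate n (optPast hr hu A x n) (M.toPast n ω)) ∂μ ≤
        ∫⁻ ω, (ENNReal.ofReal (Real.exp (-M.rho * M.τ n ω)) *
          M.oneStep 0 (optWealth hr hu A x n ω)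
          (A (optWealth hr hu A x n ω)) (M.periodRate n (optPast hr hu A x n) (M.toPast n ω)) +
          ENNReal.ofReal (M.contr k b γ) * ENNReal.ofReal (Real.exp (-M.rho * M.τ n ω) *
            (max (optWealth hr hu A x n ω) 0) ^ γ)) ∂μ := by
      refine lintegral_mono fun ω => ?_
      refine (mul_le_mul_right (oneStep_le_add hr hu (optWealth_nonneg hr hu hx n ω) _
        (isCtrl_optPast hr hu hAl hx hA n ω)) _).trans (le_of_eq ?_)
      rw [mul_add, ENNReal.ofReal_mul (Real.exp_nonneg _)]
      ring
    rw [lintegral_add_right _ (hm.const_mul _), lintegral_const_mul _ hm] at h1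
    have h2 : (∫⁻ ω, M.gainUpTo c (n + 1) ω ∂μ) + ∫⁻ ω, ENNReal.ofReal
        (Real.exp (-M.rho * M.τ (n + 1) ω) * (max (optWealth hr hu A x (n + 1) ω) 0) ^ γ) ∂μ ≤
        (∫⁻ ω, M.gainUpTo c (n + 1) ω ∂μ) + ENNReal.ofReal (M.contr k b γ) *
          ∫⁻ ω, ENNReal.ofReal (Real.exp (-M.rho * M.τ n ω) *
            (max (optWealth hr hu A x n ω) 0) ^ γ) ∂μ := by
      rw [e1, e2, add_assoc]
      exact add_le_add le_rfl h1
    refine ((ENNReal.add_le_add_iff_left hgfin).1 h2).trans ?_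
    rw [pow_succ', mul_assoc]
    exact mul_le_mul_right ih _

/-- The verification inequality is an equality at every date, and the remainder is at most the
growth constant times `contr ^ n * x ^ γ`, which tends to 0. The bound `hle` also supplies the
finiteness needed to control the remainder. -/
theorem gain_optPast (hmax : ∀ x, 0 ≤ x → ∀ a : M.investSet, M.l a ≤ x →
      M.aux M.fixedPt a 0 (x - M.l a) ≤ M.aux M.fixedPt (A x) 0 (x - M.l (A x)))
    (hle : M.gain μ c ≤ ENNReal.ofReal (M.fixedPt x)) :
    M.gain μ c = ENNReal.ofReal (M.fixedPt x) := by
  have hK := growthConst_nonneg hr hu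
  have hW := isWealthFn_fixedPt hr hu
  have hC : ∀ n, Measurable (optPast hr hu A x n) := measurable_optPast hr hu hA
  have hC0 : ∀ n q, 0 ≤ optPast hr hu A x n q := optPast_nonneg hr hu
  have hfin : M.gain μ c ≠ ⊤ := ne_top_of_le_ne_top ENNReal.ofReal_ne_top hle
  set R : ℕ → ℝ≥0∞ := fun n => ∫⁻ ω, ENNReal.ofReal (Real.exp (-M.rho * M.τ n ω) *
    M.fixedPt (optWealth hr hu A x n ω)) ∂μ with hR
  have heq : ∀ n, (∫⁻ ω, M.gainUpTo c n ω ∂μ) + R n = ENNReal.ofReal (M.fixedPt x) := by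
    intro n
    induction n with
    | zero => simp [gainUpTo_zero, M.τ_zero, hR, optWealth]
    | succ n ih =>
      have hξ := measurable_comp_ofPast (measurable_optWealth hr hu (x := x) hA n)
      have ha : Measurable fun h : M.Past n => (A (optWealth hr hu A x n (M.ofPast n h)) : ℝ) :=
        measurable_subtype_coe.comp (hA.comp hξ)
      have e1 := lintegral_gainUpTo_succ hcC hC hC0 hr hu hW hK n hξ ha
        (X' := optWealth hr hu A x (n + 1))
        ((ae_optWealth_succ hr hu hAl hx n).mono fun ω h => by rw [← h])
      rw [← ih]
      refine e1.trans (congrArg _ (lintegral_congr fun ω => ?_))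
      rw [ofPast_toPast, oneStep_optPast hr hu hAl hx hA hmax n ω,
        ENNReal.ofReal_mul (Real.exp_nonneg _)]
  have hRle : ∀ n, R n ≤ ENNReal.ofReal (M.growthConst k b γ K₁) *
      (ENNReal.ofReal (M.contr k b γ) ^ n * ENNReal.ofReal ((max x 0) ^ γ)) := by
    intro n
    refine le_trans ?_ (mul_le_mul_right
      (lintegral_rpow_optWealth_le hr hu hA hAl hx hcC hfin n) _)
    rw [← lintegral_const_mul' _ _ ENNReal.ofReal_ne_top]
    refine lintegral_mono fun ω => ?_
    rw [← ENNReal.ofReal_mul hK]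
    refine ENNReal.ofReal_le_ofReal ?_
    have hX := optWealth_nonneg hr hu (A := A) hx n ω
    have h1 := mul_le_mul_of_nonneg_left (hW.le _ hX) (Real.exp_nonneg (-M.rho * M.τ n ω))
    rw [max_eq_left hX]
    linarith
  have hlim : Tendsto R atTop (𝓝 0) := by
    have hq : ENNReal.ofReal (M.contr k b γ) < 1 := ENNReal.ofReal_lt_one.2 (contr_lt_one hr hu)
    have h1 := ENNReal.Tendsto.mul_const (b := ENNReal.ofReal ((max x 0) ^ γ))
      (ENNReal.tendsto_pow_atTop_nhds_zero_of_lt_one hq) (Or.inr ENNReal.ofReal_ne_top)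
    have h2 := ENNReal.Tendsto.const_mul (a := ENNReal.ofReal (M.growthConst k b γ K₁)) h1
      (Or.inr ENNReal.ofReal_ne_top)
    rw [zero_mul, mul_zero] at h2
    exact tendsto_of_tendsto_of_tendsto_of_le_of_le tendsto_const_nhds h2 (fun n => zero_le) hRle
  refine le_antisymm hle ?_
  have h3 : Tendsto (fun n => M.gain μ c + R n) atTop (𝓝 (M.gain μ c)) := by
    simpa using tendsto_const_nhds.add hlim
  refine ge_of_tendsto' h3 fun n => ?_
  rw [← heq n, gain_eq_iSup hr hu (measurable_gainUpTo hcC hC hC0 hu)]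
  exact add_le_add (le_iSup (fun n => ∫⁻ ω, M.gainUpTo c n ω ∂μ) n) le_rfl

end Optimal

/-- There is an optimal policy, of feedback form, with value given by the fixed point. -/
theorem exists_optimal_policy (hr : M.ReturnAssumption μ k b) (hu : M.UtilityAssumption k b γ K₁)
    [IsProbabilityMeasure μ] {x : ℝ} (hx : 0 ≤ x) :
    ∃ (α : ℕ → Ω → ℝ) (c : ℝ≥0 → Ω → ℝ), M.Admissible μ x α c ∧
      M.gain μ c = ENNReal.ofReal (M.fixedPt x) ∧
      ∀ᵐ ω ∂μ, ∀ n, ∃ a : M.investSet, α (n + 1) ω = a ∧ M.l a ≤ M.wealth x α c n ω ∧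
        (∀ a' : M.investSet, M.l a' ≤ M.wealth x α c n ω →
          M.aux M.fixedPt a' 0 (M.wealth x α c n ω - M.l a') ≤
            M.aux M.fixedPt a 0 (M.wealth x α c n ω - M.l a)) ∧
        ∀ t : ℝ≥0, M.τ n ω < t → t ≤ M.τ (n + 1) ω →
          c t ω = M.optRate a (t - M.τ n ω)
            (optFlow hr hu a (M.wealth x α c n ω - M.l a) (t - M.τ n ω)) := by
  obtain ⟨A, hA, hAx⟩ := exists_measurable_invest hr hu (isWealthFn_fixedPt hr hu)
    (growthConst_nonneg hr hu)
  have hAl : ∀ x, 0 ≤ x → M.l (A x) ≤ x := fun x hx => (hAx x hx).1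
  have hmax := fun x hx => (hAx x hx).2
  obtain ⟨c, hc, hc0, hcC⟩ := exists_predictable (optPast hr hu A x)
    (measurable_optPast hr hu hA) (optPast_nonneg hr hu)
  set α : ℕ → Ω → ℝ := fun n => Nat.casesOn n (fun _ => 0)
    (fun n ω => A (optWealth hr hu A x n ω)) with hα
  have hαs : ∀ n ω, α (n + 1) ω = A (optWealth hr hu A x n ω) := fun _ _ => rfl
  have hw := wealth_eq_optWealth hr hu hA hAl hx hcC hαs
  have hadm : M.Admissible μ x α c := by
    refine ⟨⟨fun n => ?_, hc, hc0⟩, fun n _ => ?_⟩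
    · exact (measurable_subtype_coe.comp (hA.comp (measurable_optWealth hr hu hA n))).mono
        (hist_le_stopped n) le_rfl
    · filter_upwards [hw] with ω hω
      refine ⟨intervalIntegrable_of_periodRate hcC
        (fun n => (isCtrl_optPast hr hu hAl hx hA n ω).integrable) n, ?_⟩
      rw [hω]
      exact optWealth_nonneg hr hu hx n ω
  refine ⟨α, c, hadm, gain_optPast hr hu hA hAl hx hcC hmax (gain_le hr hu hx hadm), ?_⟩
  filter_upwards [hw] with ω hω n
  have hX := optWealth_nonneg hr hu (A := A) hx n ω
  rw [hω n]
  refine ⟨A (optWealth hr hu A x n ω), hαs n ω, hAl _ hX, hmax _ hX, fun t h1 h2 => ?_⟩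
  have h3 : (0 : ℝ) ≤ t - M.τ n ω := sub_nonneg.2 (NNReal.coe_le_coe.2 h1.le)
  rw [hcC n t ω h1 h2]
  simp only [optPast, ofPast_toPast, max_eq_left h3, max_eq_left (sub_nonneg.2 (hAl _ hX))]

theorem value_eq (hr : M.ReturnAssumption μ k b) (hu : M.UtilityAssumption k b γ K₁)
    [IsProbabilityMeasure μ] {x : ℝ} (hx : 0 ≤ x) :
    M.value μ x = ENNReal.ofReal (M.fixedPt x) := by
  refine le_antisymm (iSup_le fun α => iSup_le fun c => iSup_le fun h => gain_le hr hu hx h) ?_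
  obtain ⟨α, c, h, hg, -⟩ := exists_optimal_policy hr hu hx
  rw [← hg]
  exact le_iSup_of_le α (le_iSup_of_le c (le_iSup_of_le h le_rfl))

end Market

end IlliquidConsumption


/-! ### Identification of `v̂` and `ĉ`, and the feedback description. -/

namespace IlliquidConsumption

theorem setLIntegral_Ioi_add (f : ℝ → ℝ≥0∞) (t : ℝ) :
    ∫⁻ s in Ioi t, f s = ∫⁻ u in Ioi 0, f (t + u) := by
  rw [← lintegral_indicator measurableSet_Ioi, ← lintegral_indicator measurableSet_Ioi,
    ← lintegral_add_left_eq_self _ t]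
  exact lintegral_congr fun u => by simp [indicator_apply]

namespace Market

variable {Ω : Type*} [mΩ : MeasurableSpace Ω] {μ : Measure Ω} {M : Market Ω} {k b γ K₁ : ℝ}
  (hr : M.ReturnAssumption μ k b) (hu : M.UtilityAssumption k b γ K₁) [IsProbabilityMeasure μ]
include hr hu

/-- The value function and the fixed point are known to agree only for nonnegative wealth, and above
the threshold `l(a)` almost every return leaves the wealth nonnegative. -/
theorem g_eq (a : M.investSet) {t y : ℝ} (ht : 0 ≤ t) (hy : M.l a ≤ y) :
    M.g μ t y a = ENNReal.ofReal (M.reward M.fixedPt a t (y - M.l a)) := by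
  have hK := growthConst_nonneg hr hu
  have hW := isWealthFn_fixedPt hr hu
  rw [g, ← M.retLaw_of_nonneg ht, reward, ENNReal.ofReal_mul hr.lam_pos.le]
  simp only [add_sub_cancel]
  rw [ofReal_integral_eq_lintegral_ofReal (integrable_wealthFn hr hu hW hK y a t)
    (Eventually.of_forall fun z => hW.nonneg _)]
  congr 1
  refine lintegral_congr_ae ?_
  filter_upwards [hr.ae_mem t] with z hz
  refine value_eq hr hu ?_
  linarith [hr.l_add_mul_nonneg a.2 hz.1 hz.2]

theorem lintegral_eq_payoff (a : M.investSet) {t x : ℝ} (ht : 0 ≤ t) {c d : ℝ → ℝ}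
    (hd : IsCtrl (x - M.l a) d) (hcd : ∀ u, 0 < u → c (t + u) = d u) :
    ∫⁻ s in Ioi t, ENNReal.ofReal (Real.exp (-(M.rho + M.lam) * (s - t))) *
      (ENNReal.ofReal (M.U (c s)) + M.g μ s (x - ∫ u in t..s, c u) a) =
    ENNReal.ofReal (payoff M.U (M.rho + M.lam) (fun s => M.reward M.fixedPt a (t + s))
      (x - M.l a) d) := by
  have hK := growthConst_nonneg hr hu
  have hW := isWealthFn_fixedPt hr hu
  have hrun := running hr hu hW hK a t
  rw [payoff, ofReal_integral_eq_lintegral_ofReal (integrableOn_payoff hu.isUtility hrun hd _)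
    (Eventually.of_forall fun s => mul_nonneg (Real.exp_nonneg _)
      (add_nonneg (hu.isUtility.nonneg (hd.nonneg s)) (hrun.nonneg _ _))), setLIntegral_Ioi_add]
  refine setLIntegral_congr_fun measurableSet_Ioi fun u hu0 => ?_
  have hu0' : 0 < u := hu0
  have h1 : ∫ v in t..(t + u), c v = ∫ v in (0 : ℝ)..u, d v := by
    rw [intervalIntegral.integral_of_le (by linarith), intervalIntegral.integral_of_le hu0'.le,
      setIntegral_Ioc_add]
    exact setIntegral_congr_fun measurableSet_Ioc fun v hv => hcd v hv.1
  have h2 := hd.integral_le hu0'.le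
  rw [ENNReal.ofReal_mul (Real.exp_nonneg _), ENNReal.ofReal_add
    (hu.isUtility.nonneg (hd.nonneg u)) (hrun.nonneg _ _), h1, hcd u hu0', add_sub_cancel_left,
    g_eq hr hu a (by linarith) (by linarith)]
  congr 4
  ring

theorem vHatENN_eq (a : M.investSet) {t x : ℝ} (ht : 0 ≤ t) (hx : M.l a ≤ x) :
    M.vHatENN μ t x a = ENNReal.ofReal (M.aux M.fixedPt a t (x - M.l a)) := by
  have hK := growthConst_nonneg hr hu
  have hW := isWealthFn_fixedPt hr hu
  have hrun := running hr hu hW hK a t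
  refine le_antisymm (iSup₂_le fun c ⟨hm, h0, hc⟩ => ?_) ?_
  -- A competing rate is constrained only after `t` and on finite horizons. Truncation disposes of
  -- its values before `t`, and the uniform bound on finite horizons passes to the total budget.
  · have hd : IsCtrl (x - M.l a) fun u => max (c (t + u)) 0 := by
      refine isCtrl_of_ae ((hm.comp (measurable_const_add t)).max measurable_const)
        (fun u => le_max_right _ _) ((ae_restrict_mem measurableSet_Ioi).mono fun s hs => ?_)
      have hs0 : (0 : ℝ) < s := hs
      obtain ⟨h1, h2⟩ := hc (t + s) (by linarith)
      have h3 : EqOn (fun u => max (c (t + u)) 0) (fun u => c (t + u)) (Ioc 0 s) := fun u hu' =>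
        max_eq_left (h0 _ (by linarith [hu'.1]))
      constructor
      · rw [← setLIntegral_Ioc_add (fun u => ENNReal.ofReal (max (c u) 0))]
        rw [intervalIntegrable_iff_integrableOn_Ioc_of_le (by linarith)] at h1
        exact (hasFiniteIntegral_iff_ofReal
          (Eventually.of_forall fun u => le_max_right _ _)).1 h1.pos_part.2
      · rw [setIntegral_congr_fun measurableSet_Ioc h3, ← setIntegral_Ioc_add c,
          ← intervalIntegral.integral_of_le (by linarith)]
        exact h2
    rw [lintegral_eq_payoff hr hu a ht hd fun u hu' => (max_eq_left (h0 _ (by linarith))).symm]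
    exact ENNReal.ofReal_le_ofReal (payoff_le_val hu.isUtility hrun hd)
  · obtain ⟨d, hd, hopt⟩ := exists_optimal hu.isUtility hrun (sub_nonneg.2 hx)
    rw [aux, famVal, ← hopt, ← lintegral_eq_payoff hr hu a ht (c := fun s => d (s - t)) hd
      fun u _ => by simp]
    refine le_iSup₂_of_le (fun s => d (s - t)) ⟨hd.measurable.comp (measurable_id.sub_const t),
      fun s _ => hd.nonneg _, fun s hs => ⟨?_, ?_⟩⟩ le_rfl
    · have h1 : IntervalIntegrable d volume 0 (s - t) :=
        (intervalIntegrable_iff_integrableOn_Ioc_of_le (sub_nonneg.2 hs)).2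
          (hd.integrable.mono_set Ioc_subset_Ioi_self)
      have h2 := h1.comp_sub_right t
      rwa [zero_add, sub_add_cancel] at h2
    · rw [intervalIntegral.integral_comp_sub_right, sub_self]
      exact hd.integral_le (sub_nonneg.2 hs)

theorem vHat_eq (a : M.investSet) {t x : ℝ} (ht : 0 ≤ t) (hx : M.l a ≤ x) :
    M.vHat μ t x a = M.aux M.fixedPt a t (x - M.l a) := by
  rw [vHat, vHatENN_eq hr hu a ht hx, ENNReal.toReal_ofReal]
  exact val_nonneg hu.isUtility
    (running hr hu (isWealthFn_fixedPt hr hu) (growthConst_nonneg hr hu) a t)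

theorem hasDerivAt_vHat (a : M.investSet) {t x : ℝ} (ht : 0 ≤ t) (hx : M.l a < x) :
    HasDerivAt (fun y => M.vHat μ t y a) (deriv (M.aux M.fixedPt a t) (x - M.l a)) x := by
  have h1 := (val_differentiableAt hu.isUtility
    (running hr hu (isWealthFn_fixedPt hr hu) (growthConst_nonneg hr hu) a t)
    (sub_pos.2 hx)).hasDerivAt.comp_sub_const x (M.l a)
  refine h1.congr_of_eventuallyEq ?_
  filter_upwards [lt_mem_nhds hx] with y hy
  exact vHat_eq hr hu a ht hy.le

theorem cHat_eq (a : M.investSet) {t x : ℝ} (ht : 0 ≤ t) :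
    M.cHat μ t x a = M.optRate a t (x - M.l a) := by
  rw [cHat, optRate]
  split_ifs with h
  · rw [fbRate_of_pos (sub_pos.2 h), (hasDerivAt_vHat hr hu a ht h).deriv, invMarginal]
    rfl
  · rw [fbRate_of_nonpos (sub_nonpos.2 (not_lt.1 h))]

theorem tendsto_deriv_vHat (a : M.investSet) {t : ℝ} (ht : 0 ≤ t) :
    Tendsto (deriv fun y => M.vHat μ t y a) (𝓝[>] (M.l a)) atTop := by
  have h1 := tendsto_val_deriv hu.isUtility
    (running hr hu (isWealthFn_fixedPt hr hu) (growthConst_nonneg hr hu) a t)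
  have h2 : Tendsto (fun x => x - M.l a) (𝓝[>] (M.l a)) (𝓝[>] 0) := by
    refine tendsto_nhdsWithin_iff.2 ⟨?_, ?_⟩
    · have := ((continuous_sub_right (M.l a)).tendsto (M.l a)).mono_left
        (nhdsWithin_le_nhds (s := Ioi (M.l a)))
      simpa using this
    · filter_upwards [self_mem_nhdsWithin] with x hx
      exact sub_pos.2 (mem_Ioi.1 hx)
  refine (h1.comp h2).congr' ?_
  filter_upwards [self_mem_nhdsWithin] with x hx
  exact (hasDerivAt_vHat hr hu a ht hx).deriv.symm

theorem solvesFeedback_optFlow (a : M.investSet) {t₀ t₁ x : ℝ} (hx : M.l a ≤ x) :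
    M.SolvesFeedback μ t₀ t₁ x a fun s => M.l a + optFlow hr hu a (x - M.l a) (s - t₀) := by
  have hG := isReward hr hu (isWealthFn_fixedPt hr hu) (growthConst_nonneg hr hu)
  have hb := sub_nonneg.2 hx
  refine ⟨?_, ?_, fun s hs => ?_⟩
  · simp only [sub_self]
    rw [optFlow, fbFlow_zero hu.isUtility hG a hb, add_sub_cancel]
  · exact (continuous_const.add ((continuous_fbFlow hu.isUtility hG a hb).comp
      (continuous_sub_right t₀))).continuousOn
  · have hs0 : 0 ≤ s - t₀ := sub_nonneg.2 hs.1.le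
    rw [cHat_eq hr hu a hs0, add_sub_cancel_left]
    exact (((hasDerivAt_fbFlow hu.isUtility hG a hb hs0).comp_sub_const s t₀).const_add
      (M.l a)).hasDerivWithinAt

theorem eqOn_of_solvesFeedback (a : M.investSet) {t₀ t₁ x : ℝ} {Y Y' : ℝ → ℝ}
    (hY : M.SolvesFeedback μ t₀ t₁ x a Y) (hY' : M.SolvesFeedback μ t₀ t₁ x a Y') :
    EqOn Y Y' (Icc t₀ t₁) := by
  have hG := isReward hr hu (isWealthFn_fixedPt hr hu) (growthConst_nonneg hr hu)
  have h : ∀ {Z : ℝ → ℝ}, M.SolvesFeedback μ t₀ t₁ x a Z → ∀ s ∈ Ioc t₀ t₁,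
      HasDerivWithinAt Z (-M.optRate a (s - t₀) (Z s - M.l a)) (Icc t₀ t₁) s := fun hZ s hs => by
    rw [← cHat_eq hr hu a (sub_nonneg.2 hs.1.le)]
    exact hZ.hasDeriv s hs
  exact eqOn_of_feedback (f := fun s y => M.optRate a (s - t₀) (y - M.l a))
    (fun s y y' hy => fbRate_mono hu.isUtility hG a _ (sub_le_sub_right hy _))
    (hY.initial.trans hY'.initial.symm) hY.continuousOn hY'.continuousOn (h hY) (h hY')

theorem exists_feedback_policy {x : ℝ} (hx : 0 ≤ x) :
    ∃ (α : ℕ → Ω → ℝ) (c : ℝ≥0 → Ω → ℝ) (Y : ℕ → Ω → ℝ → ℝ),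
      M.Admissible μ x α c ∧ M.gain μ c = M.value μ x ∧
      ∀ᵐ ω ∂μ, ∀ n : ℕ,
        (α (n + 1) ω ∈ M.investInterval (M.wealth x α c n ω) ∧
          IsMaxOn (fun a => M.vHat μ 0 (M.wealth x α c n ω) a)
            (M.investInterval (M.wealth x α c n ω)) (α (n + 1) ω)) ∧
        (M.SolvesFeedback μ (M.τ n ω) (M.τ (n + 1) ω) (M.wealth x α c n ω) (α (n + 1) ω)
            (Y n ω) ∧
          ∀ Y' : ℝ → ℝ, M.SolvesFeedback μ (M.τ n ω) (M.τ (n + 1) ω) (M.wealth x α c n ω)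
            (α (n + 1) ω) Y' → EqOn Y' (Y n ω) (Icc (M.τ n ω : ℝ) (M.τ (n + 1) ω))) ∧
        ∀ t : ℝ≥0, M.τ n ω < t → t ≤ M.τ (n + 1) ω →
          c t ω = M.cHat μ ((t : ℝ) - M.τ n ω) (Y n ω t) (α (n + 1) ω) := by
  classical
  obtain ⟨α, c, hadm, hgain, hω⟩ := exists_optimal_policy hr hu hx
  -- The path is the threshold plus the residual budget along the optimal flow. The case distinction
  -- only makes the formula total: almost surely the investment is allowed.
  refine ⟨α, c, fun n ω s => M.l (α (n + 1) ω) + if h : α (n + 1) ω ∈ M.investSet then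
    optFlow hr hu ⟨α (n + 1) ω, h⟩ (M.wealth x α c n ω - M.l (α (n + 1) ω)) (s - M.τ n ω) else 0,
    hadm, hgain.trans (value_eq hr hu hx).symm, ?_⟩
  filter_upwards [hω] with ω hω n
  obtain ⟨⟨a, ha⟩, hα, hle, hmax, hc⟩ := hω n
  rw [hα]
  simp only [ha, dif_pos]
  have hsol := solvesFeedback_optFlow hr hu ⟨a, ha⟩ (t₀ := M.τ n ω) (t₁ := M.τ (n + 1) ω) hle
  refine ⟨⟨hr.mem_investInterval_iff.2 ⟨ha, hle⟩, fun a' ha' => ?_⟩, ⟨hsol,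
    fun Y' hY' => eqOn_of_solvesFeedback hr hu ⟨a, ha⟩ hY' hsol⟩, fun t h1 h2 => ?_⟩
  · obtain ⟨h3, h4⟩ := hr.mem_investInterval_iff.1 ha'
    have h5 := vHat_eq hr hu ⟨a', h3⟩ le_rfl h4
    have h6 := vHat_eq hr hu ⟨a, ha⟩ le_rfl hle
    simp only [mem_ofPred_eq]
    rw [h5, h6]
    exact hmax ⟨a', h3⟩ h4
  · have h3 : (0 : ℝ) ≤ t - M.τ n ω := sub_nonneg.2 (NNReal.coe_le_coe.2 h1.le)
    have h4 := cHat_eq hr hu ⟨a, ha⟩ h3 (x := M.l a + optFlow hr hu ⟨a, ha⟩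
      (M.wealth x α c n ω - M.l a) (t - M.τ n ω))
    rw [hc t h1 h2]
    refine Eq.trans ?_ h4.symm
    rw [add_sub_cancel_left]

end Market

end IlliquidConsumption

/-! ### The main theorem. -/

theorem mainTheorem5 {Ω : Type*} [MeasurableSpace Ω] (μ : Measure Ω) [IsProbabilityMeasure μ]
    (M : IlliquidConsumption.Market Ω) (k b γ K₁ : ℝ)
    (hret : M.ReturnAssumption μ k b) (hutil : M.UtilityAssumption k b γ K₁)
    (hsemi : M.SemiconcavityAssumption) :
    (∀ x, 0 ≤ x → M.value μ x ≠ ⊤) ∧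
    (∀ t a x, 0 ≤ t → a ∈ M.investSet → M.l a ≤ x → M.vHatENN μ t x a ≠ ⊤) ∧
    (∀ t a, 0 ≤ t → a ∈ M.investSet →
      (∀ x, M.l a < x → DifferentiableAt ℝ (fun y => M.vHat μ t y a) x ∧
        0 < deriv (fun y => M.vHat μ t y a) x) ∧
      Tendsto (deriv fun y => M.vHat μ t y a) (𝓝[>] (M.l a)) atTop) ∧
    ∀ x, 0 ≤ x →
      ∃ (α : ℕ → Ω → ℝ) (c : ℝ≥0 → Ω → ℝ) (Y : ℕ → Ω → ℝ → ℝ),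
        M.Admissible μ x α c ∧ M.gain μ c = M.value μ x ∧
        ∀ᵐ ω ∂μ, ∀ n : ℕ,
          (α (n + 1) ω ∈ M.investInterval (M.wealth x α c n ω) ∧
            IsMaxOn (fun a => M.vHat μ 0 (M.wealth x α c n ω) a)
              (M.investInterval (M.wealth x α c n ω)) (α (n + 1) ω)) ∧
          (M.SolvesFeedback μ (M.τ n ω) (M.τ (n + 1) ω) (M.wealth x α c n ω) (α (n + 1) ω)
              (Y n ω) ∧
            ∀ Y' : ℝ → ℝ, M.SolvesFeedback μ (M.τ n ω) (M.τ (n + 1) ω) (M.wealth x α c n ω)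
              (α (n + 1) ω) Y' → EqOn Y' (Y n ω) (Icc (M.τ n ω : ℝ) (M.τ (n + 1) ω))) ∧
          ∀ t : ℝ≥0, M.τ n ω < t → t ≤ M.τ (n + 1) ω →
            c t ω = M.cHat μ ((t : ℝ) - M.τ n ω) (Y n ω t) (α (n + 1) ω) := by
  refine ⟨fun x hx => ?_, fun t a x ht ha hx => ?_, fun t a ht ha => ⟨fun x hx => ?_, ?_⟩,
    fun x hx => IlliquidConsumption.Market.exists_feedback_policy hret hutil hx⟩
  · rw [IlliquidConsumption.Market.value_eq hret hutil hx]
    exact ENNReal.ofReal_ne_top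
  · rw [IlliquidConsumption.Market.vHatENN_eq hret hutil ⟨a, ha⟩ ht hx]
    exact ENNReal.ofReal_ne_top
  · have h := IlliquidConsumption.Market.hasDerivAt_vHat hret hutil ⟨a, ha⟩ ht hx
    refine ⟨h.differentiableAt, ?_⟩
    rw [h.deriv]
    exact IlliquidConsumption.famVal_deriv_pos hutil.isUtility
      (IlliquidConsumption.Market.isReward hret hutil
        (IlliquidConsumption.Market.isWealthFn_fixedPt hret hutil)
        (IlliquidConsumption.Market.growthConst_nonneg hret hutil)) (sub_pos.2 hx)
  · exact IlliquidConsumption.Market.tendsto_deriv_vHat hret hutil ⟨a, ha⟩ ht
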